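/- Let $a<b$ and let $\lambda=\{\lambda_m\}_{m\ge1}$ be a nested sequence of partitions of $[a,b]$ with $\bigcup_m\lambda_m$ dense in $[a,b]$. A function $f:[a,b]\to\mathbb R$ is regulated if it has one-sided limits $f(t-)$, $t\in(a,b]$, and $f(t+)$, $t\in[a,b)$; put $\Delta^-f(t)=f(t)-f(t-)$, $\Delta^+f(t)=f(t+)-f(t)$. For $u<v$ in $[a,b]$ and $\lambda_m=\{t_0^m<\dots<t_{n(m)}^m\}$ put $x_i^m=(t_i^m\wedge v)\vee u$. *Brackets.* For regulated $f_1,f_2$, the pair $(f_1,f_2)$ has the quadratic $\lambda$-covariation if there is a regulated function $B=[f_1,f_2]_\lambda$ on $[a,b]$ with $B(a)=0$, $B(v)-B(u)=\lim_m\sum_i(f_1(x_i^m)-f_1(x_{i-1}^m))(f_2(x_i^m)-f_2(x_{i-1}^m))$ for all $a\le u<v\le b$, and $\Delta^{\pm}B=\Delta^{\pm}f_1\,\Delta^{\pm}f_2$. Write $f\in Q_\lambda$ if $(f,f)$ has this property, $[f]_\lambda=[f,f]_\lambda$ and $[f]^c_\lambda(t)=[f]_\lambda(t)-\sum_{(a,t]}(\Delta^-f)^2-\sum_{[a,t)}(\Delta^+f)^2$.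 The vector function $(f_1,f_2)$ has the quadratic $\lambda$-variation if every pair $(f_k,f_l)$, $k,l\in\{1,2\}$, has the quadratic $\lambda$-covariation. *Classes.* $\mathcal W_p$ is the class of functions on $[a,b]$ of bounded $p$-variation; $\mathrm{dual}(\mathcal W_1)$ is the class of regulated functions and, for $p>1$, $\mathrm{dual}(\mathcal W_p)=\bigcup\{\mathcal W_q: q>0,\ 1/p+1/q>1\}$. For $1\le p<2$, a regulated function $f$ is $(\lambda,p)$-decomposable if $f=C+g+h$ with a constant $C$ and regulated $g\in Q_\lambda\cap\mathrm{dual}(\mathcal W_p)$, $h\in\mathcal W_p$, $g(a)=h(a)=0$. Let $D^{+}_{\lambda,p}(f)$ (resp. $D^{-}_{\lambda,p}(f)$) be the set of all such pairs $(g,h)$ for which all points of $(a,b)$ where $\Delta^+g\ne0$ or $\Delta^+h\neq 0$ (resp. $\Delta^-g\ne0$ or $\Delta^-h\neq0$) belong to $\bigcup_m\lambda_m$. *Integrals.* $(RRS)$ denotes the refinement Riemann–Stieltjes integral. For regulated $g,f$ and $u<v$ in $[a,b]$, let $g_-^{(u)}(x)=g(x-)$ for $x\in(u,v]$, $g_-^{(u)}(u)=g(u)$,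 and $g_+^{(v)}(x)=g(x+)$ for $x\in[u,v)$, $g_+^{(v)}(v)=g(v)$, and similarly for $f$. The Left and Right Young integrals are $$(LY)\!\int_u^v\! g\,df=(RRS)\!\int_u^v\! g_-^{(u)}\,df_+^{(v)}+(g\Delta^+f)(u)+\sum_{(u,v)}\Delta^-g\,\Delta^+f,$$ $$(RY)\!\int_u^v\! g\,df=(RRS)\!\int_u^v\! g_+^{(v)}\,df_-^{(u)}-\sum_{(u,v)}\Delta^+g\,\Delta^-f+(g\Delta^-f)(v),$$ provided the $(RRS)$ integral exists and the sum converges unconditionally; both are $0$ if $u=v$. For vector functions $\mathbf F=(F_k)$, $\mathbf f=(f_k)$ with regulated components, $(LC)\int\langle\mathbf F,d_\lambda\mathbf f\rangle$ is defined on $[a,b]$ if there is a regulated $\Phi$ with $\Phi(a)=0$, $\Phi(v)-\Phi(u)=\lim_m\sum_k\sum_iF_k(x_{i-1}^m)(f_k(x_i^m)-f_k(x_{i-1}^m))$ for $a\le u<v\le b$, $\Delta^-\Phi(v)=\sum_kF_k(v-)\Delta^-f_k(v)$ and $\Delta^+\Phi(u)=\sum_kF_k(u)\Delta^+f_k(u)$;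 then $(LC)\int_u^v\langle\mathbf F,d_\lambda\mathbf f\rangle=\Phi(v)-\Phi(u)$. The integral $(RC)\int\langle\mathbf F,d_\lambda\mathbf f\rangle$ is defined in the same way with $F_k(x_i^m)$, $F_k(v)$, $F_k(u+)$ in place of $F_k(x_{i-1}^m)$, $F_k(v-)$, $F_k(u)$. *Doléans exponentials.* For $f\in Q_\lambda$, $\mathcal E_{\lambda,a}(f;a)=1$, $\mathcal E_{\lambda,b}(f;b)=1$ and $$\mathcal E_{\lambda,a}(f;x)=\exp\{f(x)-f(a)-\tfrac12[f]^c_\lambda(x)\}\prod_{[a,x]}(1+\Delta f)e^{-\Delta f},\quad x\in(a,b],$$ $$\mathcal E_{\lambda,b}(f;x)=\exp\{f(b)-f(x)-\tfrac12[f]^c_\lambda(b)+\tfrac12[f]^c_\lambda(x)\}\prod_{[x,b]}(1+\Delta f)e^{-\Delta f},\quad x\in[a,b),$$ where $\prod_{[u,v]}$ is the limit as $\delta\downarrow0$ of the finite products of the factors for the left jumps of $f$ at points of $(u,v]$ and the right jumps at points of $[u,v)$ exceeding $\delta$ in absolute value. *Equations.* A function $F\in\mathrm{dual}(\mathcal W_p)\cap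 Q_\lambda$ with $F(a)=1$ is a solution of the augmented forward linear Left $\lambda$-integral equation $d_\lambda^{\to}F=F\,d_\lambda^{\to}f$ if (a) for all $(g,h)\in D^+_{\lambda,p}(f)$ and $\psi\in\mathrm{dual}(\mathcal W_p)$, $(LC)\int\langle(\psi,-\psi F),d_\lambda(F,g)\rangle$ is defined on $[a,b]$ and $(LC)\int_a^y\langle(\psi,-\psi F),d_\lambda(F,g)\rangle=(LY)\int_a^y\psi F\,dh$ for $a\le y\le b$; and (b) $(F,f)$ has the quadratic $\lambda$-variation and, for $a\le y\le b$, $[F]_\lambda(y)=(LY)\int_a^yF^2\,d[f]_\lambda$, $[F,f]_\lambda(y)=[f,F]_\lambda(y)=(LY)\int_a^yF\,d[f]_\lambda$ and $[f]_\lambda(y)=(LY)\int_a^y1\,d[f]_\lambda$. A function $G\in\mathrm{dual}(\mathcal W_p)\cap Q_\lambda$ with $G(b)=1$ is a solution of the augmented backward linear Right $\lambda$-integral equation $d_\lambda^{\gets}G=G\,d_\lambda^{\gets}f$ if (a) for all $(g,h)\in D^-_{\lambda,p}(f)$ and $\psi\in\mathrm{dual}(\mathcal W_p)$, $(RC)\int\langle(\psi,\psi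 G),d_\lambda(G,g)\rangle$ is defined on $[a,b]$ and $(RC)\int_y^b\langle(\psi,\psi G),d_\lambda(G,g)\rangle=-(RY)\int_y^b\psi G\,dh$ for $a\le y\le b$; and (b) $(G,f)$ has the quadratic $\lambda$-variation and, for $a\le y\le b$, $[G]_\lambda(y)=(RY)\int_a^yG^2\,d[f]_\lambda$, $[G,f]_\lambda(y)=[f,G]_\lambda(y)=(RY)\int_a^y(-G)\,d[f]_\lambda$ and $[f]_\lambda(y)=(RY)\int_a^y1\,d[f]_\lambda$. **Theorem.** Let $1\le p<2$ and let $f$ be $(\lambda,p)$-decomposable on $[a,b]$. 1. If $D^+_{\lambda,p}(f)\ne\emptyset$, then $f\in Q_\lambda$, the sums and products over jumps in $\mathcal E_{\lambda,a}(f)$ converge absolutely, and $\mathcal E_{\lambda,a}(f)$ is the unique solution, in the class $\mathrm{dual}(\mathcal W_p)\cap Q_\lambda$, of the augmented forward linear Left $\lambda$-integral equation. 2. If $D^-_{\lambda,p}(f)\ne\emptyset$, then $f\in Q_\lambda$, the sums and products over jumps in $\mathcal E_{\lambda,b}(f)$ converge absolutely, and $\mathcal E_{\lambda,b}(f)$ is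 the unique solution, in the class $\mathrm{dual}(\mathcal W_p)\cap Q_\lambda$, of the augmented backward linear Right $\lambda$-integral equation. -/

import Mathlib

open Set Filter Topology

noncomputable section

/-! Functions on `[a,b]` are represented by functions `ℝ → ℝ`; every notion below looks only at
their values on `[a,b]`. -/

/-- A partition `a = x₀ < x₁ < ⋯ < xₙ = b` of `[a,b]`. Values `pt i` with `i > n` are irrelevant. -/
structure IntervalPartition (a b : ℝ) where
  n : ℕ
  pt : ℕ → ℝ
  pt_zero : pt 0 = a
  pt_last : pt n = b
  pt_lt : ∀ i, i < n → pt i < pt (i + 1)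

namespace IntervalPartition

variable {a b : ℝ}

/-- The set of points of a partition. -/
def points (κ : IntervalPartition a b) : Set ℝ := {x | ∃ i, i ≤ κ.n ∧ κ.pt i = x}

/-- The `i`-th point `(xᵢ ∧ v) ∨ u` of the partition of `[u,v]` induced by `κ`
(repetitions contribute nothing to the sums below). -/
def trace (κ : IntervalPartition a b) (u v : ℝ) (i : ℕ) : ℝ := max (min (κ.pt i) v) u

/-- Left Cauchy sum of `φ` with respect to `g` over the trace of `κ` on `[u,v]`. -/
def leftCauchySum (κ : IntervalPartition a b) (u v : ℝ) (φ g : ℝ → ℝ) : ℝ :=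
  ∑ i ∈ Finset.range κ.n,
    φ (κ.trace u v i) * (g (κ.trace u v (i + 1)) - g (κ.trace u v i))

/-- Right Cauchy sum of `φ` with respect to `g` over the trace of `κ` on `[u,v]`. -/
def rightCauchySum (κ : IntervalPartition a b) (u v : ℝ) (φ g : ℝ → ℝ) : ℝ :=
  ∑ i ∈ Finset.range κ.n,
    φ (κ.trace u v (i + 1)) * (g (κ.trace u v (i + 1)) - g (κ.trace u v i))

/-- Sum of products of increments of `f₁` and `f₂` over the trace of `κ` on `[u,v]`. -/
def covariationSum (κ : IntervalPartition a b) (u v : ℝ) (f₁ f₂ : ℝ → ℝ) : ℝ :=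
  ∑ i ∈ Finset.range κ.n,
    (f₁ (κ.trace u v (i + 1)) - f₁ (κ.trace u v i)) *
      (f₂ (κ.trace u v (i + 1)) - f₂ (κ.trace u v i))

/-- The `p`-variation sum `∑ |f(xᵢ) - f(xᵢ₋₁)|^p`. -/
def pVariationSum (κ : IntervalPartition a b) (p : ℝ) (f : ℝ → ℝ) : ℝ :=
  ∑ i ∈ Finset.range κ.n, |f (κ.pt (i + 1)) - f (κ.pt i)| ^ p

end IntervalPartition

/-- The class `Λ[a,b]`: nested sequences of partitions of `[a,b]` with dense union. -/
structure NestedPartitions (a b : ℝ) where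
  part : ℕ → IntervalPartition a b
  nested : ∀ m, (part m).points ⊆ (part (m + 1)).points
  dense : Icc a b ⊆ closure (⋃ m, (part m).points)

/-- The set of all points of the partitions of the sequence. -/
def NestedPartitions.allPoints {a b : ℝ} (lam : NestedPartitions a b) : Set ℝ :=
  ⋃ m, (lam.part m).points

/-- `f` is regulated on `[a,b]`: left limits exist on `(a,b]`, right limits exist on `[a,b)`. -/
def IsRegulated (a b : ℝ) (f : ℝ → ℝ) : Prop :=
  (∀ t ∈ Ioc a b, ∃ l, Tendsto f (𝓝[<] t) (𝓝 l)) ∧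
  (∀ t ∈ Ico a b, ∃ l, Tendsto f (𝓝[>] t) (𝓝 l))

/-- The left jump `f(t) - f(t-)`. -/
def leftJump (f : ℝ → ℝ) (t : ℝ) : ℝ := f t - Function.leftLim f t

/-- The right jump `f(t+) - f(t)`. -/
def rightJump (f : ℝ → ℝ) (t : ℝ) : ℝ := Function.rightLim f t - f t

/-- The class `𝒲_p[a,b]` of functions with bounded `p`-variation. -/
def BoundedPVariation (a b p : ℝ) (f : ℝ → ℝ) : Prop :=
  ∃ K : ℝ, ∀ κ : IntervalPartition a b, κ.pVariationSum p f ≤ K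

/-- The class `dual(𝒲_p)[a,b]`, `p ≥ 1`: the regulated functions if `p = 1`, and the union of the
classes `𝒲_q[a,b]` with `1/p + 1/q > 1` if `p > 1`. -/
def MemDualW (a b p : ℝ) (f : ℝ → ℝ) : Prop :=
  (p = 1 ∧ IsRegulated a b f) ∨
  (1 < p ∧ ∃ q : ℝ, 0 < q ∧ 1 < 1 / p + 1 / q ∧ BoundedPVariation a b q f)

section Brackets

variable {a b : ℝ} (lam : NestedPartitions a b)

/-- `B` is the bracket function `[f₁,f₂]_λ` on `[a,b]`. -/
def IsBracket (f₁ f₂ B : ℝ → ℝ) : Prop :=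
  IsRegulated a b f₁ ∧ IsRegulated a b f₂ ∧ IsRegulated a b B ∧ B a = 0 ∧
  (∀ s t, a ≤ s → s < t → t ≤ b →
    Tendsto (fun m => (lam.part m).covariationSum s t f₁ f₂) atTop (𝓝 (B t - B s))) ∧
  (∀ t ∈ Ioc a b, leftJump B t = leftJump f₁ t * leftJump f₂ t) ∧
  (∀ s ∈ Ico a b, rightJump B s = rightJump f₁ s * rightJump f₂ s)

/-- `(f₁,f₂)` has the quadratic `λ`-covariation on `[a,b]`. -/
def HasQuadraticCovariation (f₁ f₂ : ℝ → ℝ) : Prop := ∃ B, IsBracket lam f₁ f₂ B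

/-- `f ∈ Q_λ[a,b]`: `f` has the quadratic `λ`-variation on `[a,b]`. -/
def HasQuadraticVariation (f : ℝ → ℝ) : Prop := HasQuadraticCovariation lam f f

/-- The vector function `(f₁,…,f_d)` has the quadratic `λ`-variation on `[a,b]`. -/
def HasVectorQuadraticVariation {d : ℕ} (f : Fin d → ℝ → ℝ) : Prop :=
  ∀ k l, HasQuadraticCovariation lam (f k) (f l)

open Classical in
/-- The bracket function `[f₁,f₂]_λ` (unique on `[a,b]` when it exists; `0` otherwise). -/
def bracket (f₁ f₂ : ℝ → ℝ) : ℝ → ℝ :=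
  if h : ∃ B, IsBracket lam f₁ f₂ B then h.choose else 0

/-- The continuous part `[f]_λ^c` of the bracket function `[f]_λ = [f,f]_λ`. -/
def bracketCont (f : ℝ → ℝ) (t : ℝ) : ℝ :=
  bracket lam f f t - ∑' x : Ioc a t, (leftJump f x) ^ 2 - ∑' x : Ico a t, (rightJump f x) ^ 2

end Brackets

section Integrals

/-- The refinement Riemann–Stieltjes integral of `f` with respect to `g` over `[a,b]` exists and
equals `J`. -/
def HasRRSIntegral (f g : ℝ → ℝ) (a b J : ℝ) : Prop :=
  ∀ ε > 0, ∃ κ₀ : IntervalPartition a b, ∀ κ : IntervalPartition a b, κ₀.points ⊆ κ.points →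
    ∀ y : ℕ → ℝ, (∀ i < κ.n, y i ∈ Icc (κ.pt i) (κ.pt (i + 1))) →
      |∑ i ∈ Finset.range κ.n, f (y i) * (g (κ.pt (i + 1)) - g (κ.pt i)) - J| < ε

open Classical in
/-- `f_-^{(a)}`: left limits, and the value `f(a)` at `a`. -/
def leftModification (a : ℝ) (f : ℝ → ℝ) (x : ℝ) : ℝ :=
  if x = a then f a else Function.leftLim f x

open Classical in
/-- `f_+^{(b)}`: right limits, and the value `f(b)` at `b`. -/
def rightModification (b : ℝ) (f : ℝ → ℝ) (x : ℝ) : ℝ :=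
  if x = b then f b else Function.rightLim f x

/-- The Left Young integral of `g` with respect to `f` over `[a,b]` exists and equals `I`. -/
def HasLYIntegral (g f : ℝ → ℝ) (a b I : ℝ) : Prop :=
  (a = b ∧ I = 0) ∨
  (a < b ∧ IsRegulated a b g ∧ IsRegulated a b f ∧ ∃ J S : ℝ,
    HasRRSIntegral (leftModification a g) (rightModification b f) a b J ∧
    HasSum (fun x : Ioo a b => leftJump g x * rightJump f x) S ∧
    I = J + g a * rightJump f a + S)

/-- The Right Young integral of `g` with respect to `f` over `[a,b]` exists and equals `I`. -/
def HasRYIntegral (g f : ℝ → ℝ) (a b I : ℝ) : Prop :=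
  (a = b ∧ I = 0) ∨
  (a < b ∧ IsRegulated a b g ∧ IsRegulated a b f ∧ ∃ J S : ℝ,
    HasRRSIntegral (rightModification b g) (leftModification a f) a b J ∧
    HasSum (fun x : Ioo a b => rightJump g x * leftJump f x) S ∧
    I = J - S + g b * leftJump f b)

variable {a b : ℝ} (lam : NestedPartitions a b) {d : ℕ}

/-- The Left Cauchy `λ`-integral of the vector function `φ` with respect to the vector function `f`
is defined on `[a,b]`, and `Φ` is its indefinite integral: its value over `[u,v]` is
`Φ(v) - Φ(u)`. -/
def IsLCIntegral (φ f : Fin d → ℝ → ℝ) (Φ : ℝ → ℝ) : Prop :=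
  (∀ k, IsRegulated a b (f k) ∧
    ∀ t ∈ Ioc a b, leftJump (f k) t ≠ 0 → ∃ l, Tendsto (φ k) (𝓝[<] t) (𝓝 l)) ∧
  IsRegulated a b Φ ∧ Φ a = 0 ∧
  (∀ u v, a ≤ u → u < v → v ≤ b →
    Tendsto (fun m => ∑ k, (lam.part m).leftCauchySum u v (φ k) (f k)) atTop
      (𝓝 (Φ v - Φ u))) ∧
  (∀ v ∈ Ioc a b, leftJump Φ v = ∑ k, Function.leftLim (φ k) v * leftJump (f k) v) ∧
  (∀ u ∈ Ico a b, rightJump Φ u = ∑ k, φ k u * rightJump (f k) u)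

/-- The Right Cauchy `λ`-integral of the vector function `φ` with respect to the vector function `f`
is defined on `[a,b]`, and `Ψ` is its indefinite integral: its value over `[u,v]` is
`Ψ(v) - Ψ(u)`. -/
def IsRCIntegral (φ f : Fin d → ℝ → ℝ) (Ψ : ℝ → ℝ) : Prop :=
  (∀ k, IsRegulated a b (f k) ∧
    ∀ t ∈ Ico a b, rightJump (f k) t ≠ 0 → ∃ l, Tendsto (φ k) (𝓝[>] t) (𝓝 l)) ∧
  IsRegulated a b Ψ ∧ Ψ a = 0 ∧
  (∀ u v, a ≤ u → u < v → v ≤ b →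
    Tendsto (fun m => ∑ k, (lam.part m).rightCauchySum u v (φ k) (f k)) atTop
      (𝓝 (Ψ v - Ψ u))) ∧
  (∀ v ∈ Ioc a b, leftJump Ψ v = ∑ k, φ k v * leftJump (f k) v) ∧
  (∀ u ∈ Ico a b, rightJump Ψ u = ∑ k, Function.rightLim (φ k) u * rightJump (f k) u)

end Integrals

section Decomposable

variable {a b : ℝ} (lam : NestedPartitions a b) (p : ℝ) (f : ℝ → ℝ)

/-- The set `D_{λ,p}(f)` of `(λ,p)`-dual pairs `(g,h)` which `(λ,p)`-decompose `f`. -/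
def dualPairs : Set ((ℝ → ℝ) × (ℝ → ℝ)) :=
  {gh | IsRegulated a b gh.1 ∧ IsRegulated a b gh.2 ∧
    HasQuadraticVariation lam gh.1 ∧ MemDualW a b p gh.1 ∧ BoundedPVariation a b p gh.2 ∧
    gh.1 a = 0 ∧ gh.2 a = 0 ∧ ∃ C : ℝ, ∀ t ∈ Icc a b, f t = C + gh.1 t + gh.2 t}

/-- The regulated function `f` is `(λ,p)`-decomposable on `[a,b]`. -/
def IsDecomposable : Prop := IsRegulated a b f ∧ (dualPairs lam p f).Nonempty

/-- `D⁺_{λ,p}(f)`: the right discontinuity points of `g` and `h` in `(a,b)` are accessible. -/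
def dualPairsPlus : Set ((ℝ → ℝ) × (ℝ → ℝ)) :=
  {gh | gh ∈ dualPairs lam p f ∧
    ∀ t ∈ Ioo a b, rightJump gh.1 t ≠ 0 ∨ rightJump gh.2 t ≠ 0 → t ∈ lam.allPoints}

/-- `D⁻_{λ,p}(f)`: the left discontinuity points of `g` and `h` in `(a,b)` are accessible. -/
def dualPairsMinus : Set ((ℝ → ℝ) × (ℝ → ℝ)) :=
  {gh | gh ∈ dualPairs lam p f ∧
    ∀ t ∈ Ioo a b, leftJump gh.1 t ≠ 0 ∨ leftJump gh.2 t ≠ 0 → t ∈ lam.allPoints}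

end Decomposable

section Doleans

/-- `(1 + x) e^{-x}`. -/
def jumpFactor (x : ℝ) : ℝ := (1 + x) * Real.exp (-x)

/-- The finite product of `(1 + Δf) e^{-Δf}` over the left and right jumps of `f` on `[u,v]` that
exceed `δ` in absolute value. -/
def truncatedJumpProduct (f : ℝ → ℝ) (u v δ : ℝ) : ℝ :=
  (∏ᶠ x ∈ {x | x ∈ Ioc u v ∧ δ < |leftJump f x|}, jumpFactor (leftJump f x)) *
  (∏ᶠ x ∈ {x | x ∈ Ico u v ∧ δ < |rightJump f x|}, jumpFactor (rightJump f x))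

/-- `∏_{[u,v]} (1 + Δf) e^{-Δf}`, the limit of the truncated products as `δ ↓ 0`. -/
def jumpProduct (f : ℝ → ℝ) (u v : ℝ) : ℝ :=
  limUnder (𝓝[>] (0 : ℝ)) (truncatedJumpProduct f u v)

variable {a b : ℝ} (lam : NestedPartitions a b) (f : ℝ → ℝ)

/-- Everything that enters the two Doléans exponentials of `f` is defined: `f` has the quadratic
`λ`-variation, the sums of squared jumps are finite, and the products over jumps converge
absolutely, to the limits that define them. -/
def DoleansDefined : Prop :=
  HasQuadraticVariation lam f ∧
  Summable (fun x : Ioc a b => (leftJump f x) ^ 2) ∧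
  Summable (fun x : Ico a b => (rightJump f x) ^ 2) ∧
  Summable (fun x : Ioc a b => |jumpFactor (leftJump f x) - 1|) ∧
  Summable (fun x : Ico a b => |jumpFactor (rightJump f x) - 1|) ∧
  ∀ u v, a ≤ u → u < v → v ≤ b →
    Tendsto (truncatedJumpProduct f u v) (𝓝[>] 0) (𝓝 (jumpProduct f u v))

open Classical in
/-- The forward Doléans exponential `ℰ_{λ,a}(f)`. -/
def doleansForward (x : ℝ) : ℝ :=
  if x = a then 1
  else Real.exp (f x - f a - 1 / 2 * bracketCont lam f x) * jumpProduct f a x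

open Classical in
/-- The backward Doléans exponential `ℰ_{λ,b}(f)`. -/
def doleansBackward (x : ℝ) : ℝ :=
  if x = b then 1
  else Real.exp (f b - f x - 1 / 2 * bracketCont lam f b + 1 / 2 * bracketCont lam f x) *
    jumpProduct f x b

end Doleans

section Equations

variable {a b : ℝ} (lam : NestedPartitions a b) (p : ℝ) (f : ℝ → ℝ)

/-- `F ∈ dual(𝒲_p)[a,b] ∩ Q_λ[a,b]`, with `F(a) = 1`, is a solution of the augmented forward linear
Left `λ`-integral equation `d_λF = F d_λf` on `[a,b]`. -/
structure IsForwardSolution (F : ℝ → ℝ) : Prop where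
  mem_dual : MemDualW a b p F
  mem_Q : HasQuadraticVariation lam F
  initial : F a = 1
  substitution : ∀ g h : ℝ → ℝ, (g, h) ∈ dualPairsPlus lam p f →
    ∀ ψ : ℝ → ℝ, MemDualW a b p ψ →
      ∃ Φ : ℝ → ℝ, IsLCIntegral lam ![ψ, fun x => -(ψ x * F x)] ![F, g] Φ ∧
        ∀ y ∈ Icc a b, HasLYIntegral (fun x => ψ x * F x) h a y (Φ y - Φ a)
  vector_qv : HasVectorQuadraticVariation lam ![F, f]
  bracket_eq : ∀ y ∈ Icc a b,
    HasLYIntegral (fun x => F x ^ 2) (bracket lam f f) a y (bracket lam F F y) ∧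
    HasLYIntegral F (bracket lam f f) a y (bracket lam f F y) ∧
    HasLYIntegral F (bracket lam f f) a y (bracket lam F f y) ∧
    HasLYIntegral (fun _ => 1) (bracket lam f f) a y (bracket lam f f y)

/-- `G ∈ dual(𝒲_p)[a,b] ∩ Q_λ[a,b]`, with `G(b) = 1`, is a solution of the augmented backward linear
Right `λ`-integral equation `d_λG = G d_λf` on `[a,b]`. -/
structure IsBackwardSolution (G : ℝ → ℝ) : Prop where
  mem_dual : MemDualW a b p G
  mem_Q : HasQuadraticVariation lam G
  terminal : G b = 1
  substitution : ∀ g h : ℝ → ℝ, (g, h) ∈ dualPairsMinus lam p f →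
    ∀ ψ : ℝ → ℝ, MemDualW a b p ψ →
      ∃ Ψ : ℝ → ℝ, IsRCIntegral lam ![ψ, fun x => ψ x * G x] ![G, g] Ψ ∧
        ∀ y ∈ Icc a b, HasRYIntegral (fun x => ψ x * G x) h y b (-(Ψ b - Ψ y))
  vector_qv : HasVectorQuadraticVariation lam ![G, f]
  bracket_eq : ∀ y ∈ Icc a b,
    HasRYIntegral (fun x => G x ^ 2) (bracket lam f f) a y (bracket lam G G y) ∧
    HasRYIntegral (fun x => -G x) (bracket lam f f) a y (bracket lam f G y) ∧
    HasRYIntegral (fun x => -G x) (bracket lam f f) a y (bracket lam G f y) ∧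
    HasRYIntegral (fun _ => 1) (bracket lam f f) a y (bracket lam f f y)

end Equations

end

/-! ### One-sided limits and regulated functions -/

section Regulated

variable {a b : ℝ} {f g h : ℝ → ℝ} {t : ℝ}

/-! Write B for the bracket function of f, B^c for its continuous part, and ℰ(s,t) = exp{f(t) - f(s)
- ½(B^c(t) - B^c(s))} ∏_{[s,t]} (1+Δf)e^{-Δf}. The exponent is additive and the product
multiplicative over adjacent intervals, so ℰ(r,s) ℰ(s,t) = ℰ(r,t); the forward exponential is ℰ(a,·)
and the backward one ℰ(·,b). In what follows δf, δB, ... are increments over a partition interval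
[s,t].

Everything rests on the remainder R(s,t) = ℰ(s,t) - 1 - δf. On intervals that avoid a suitable
finite set, Taylor expansion gives R = ½((δf)² - δB) up to a small multiple of (δf)² + δB
(`IsBracket.exists_doleansRem_small`), and the sums of (δf)² - δB vanish in the limit by the
definition of the bracket. At an exceptional point c, R tends to 0 along intervals that shrink to c
from one side. Along intervals with c inside, ℰ tends to (1+Δ⁻f(c))(1+Δ⁺f(c)), so R tends to 0 there
when Δ⁺f(c) = 0. This is why right discontinuities are required to be accessible: they are partition
points from some stage on, hence never inside an interval. It follows that ΣR → 0, that Σ|R| stays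
bounded and that ΣR² → 0; approximation by step functions upgrades this to Σ φ(s)R(s,t) → 0 for
every regulated φ (`IsBracket.tendsto_traceSum_mul_doleansRem`).

The integrals with respect to h are handled by the Love–Young inequality: a function of the dual
class is approximated by step functions uniformly over all Riemann–Stieltjes sums against h
(`MemDualW.exists_pairingBound`). The Left Young integral then exists, and it is also the limit of
Left Cauchy sums when the right jumps of h are accessible (`exists_isYoungPrimitive`). The same
smallness of products of increments gives [g,h] and [h,h] as pure jump sums, whence f has a bracket
(`CrossSmall.isBracket`).

Existence: E = ℰ(a,·) satisfies δE = E(s)(δf + R). Multiplying by ψ(s) and summing, the R-part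
disappears and what remains of f = C + g + h is the Left Young integral of ψE against h. Squaring,
or multiplying by δf, gives the bracket equations, the cross terms being removed by Cauchy–Schwarz.

Uniqueness: for a solution F and fixed y, the substitution rule is tested with H(s) = ℰ(s∧y, y). The
increment of FH over [a,y], expanded over a partition, is a sum of terms that all tend to 0; the
bracket equations enter through Σ(δF - F(s)δf)² → 0. Hence F(y) = F(y)H(y) = F(a)H(a) = ℰ(a,y). No
division occurs, so jumps of f equal to -1, where ℰ vanishes, do no harm.

The backward statement is the forward one for s ↦ r - f(-s) on [-b,-a]: reversal exchanges left and
right jumps, Left and Right integrals, and turns ℰ(s,t) into ℰ(-t,-s). -/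

theorem IsRegulated.tendsto_left (hf : IsRegulated a b f) (ht : t ∈ Ioc a b) :
    Tendsto f (𝓝[<] t) (𝓝 (f t - leftJump f t)) := by
  obtain ⟨l, hl⟩ := hf.1 t ht
  have := tendsto_leftLim_of_tendsto (f := f) (a := t) ⟨l, hl⟩
  simpa [leftJump] using this

theorem IsRegulated.tendsto_right (hf : IsRegulated a b f) (ht : t ∈ Ico a b) :
    Tendsto f (𝓝[>] t) (𝓝 (f t + rightJump f t)) := by
  obtain ⟨l, hl⟩ := hf.2 t ht
  have := tendsto_rightLim_of_tendsto (f := f) (a := t) ⟨l, hl⟩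
  simpa [rightJump] using this

theorem leftLim_eq_sub_leftJump (f : ℝ → ℝ) (t : ℝ) :
    Function.leftLim f t = f t - leftJump f t := by simp [leftJump]

theorem rightLim_eq_add_rightJump (f : ℝ → ℝ) (t : ℝ) :
    Function.rightLim f t = f t + rightJump f t := by simp [rightJump]

theorem leftJump_eq_of_tendsto {j : ℝ} (h : Tendsto f (𝓝[<] t) (𝓝 (f t - j))) :
    leftJump f t = j := by
  have := leftLim_eq_of_tendsto h
  simp [leftJump, this]

theorem rightJump_eq_of_tendsto {j : ℝ} (h : Tendsto f (𝓝[>] t) (𝓝 (f t + j))) :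
    rightJump f t = j := by
  have := rightLim_eq_of_tendsto h
  simp [rightJump, this]

theorem eventuallyEq_nhdsLT (hfg : EqOn f g (Icc a b)) (ht : t ∈ Ioc a b) : f =ᶠ[𝓝[<] t] g :=
  mem_of_superset (Icc_mem_nhdsLT_of_mem ht) hfg

theorem eventuallyEq_nhdsGT (hfg : EqOn f g (Icc a b)) (ht : t ∈ Ico a b) : f =ᶠ[𝓝[>] t] g :=
  mem_of_superset (Icc_mem_nhdsGT_of_mem ht) hfg

theorem IsRegulated.congr (hf : IsRegulated a b f) (hfg : EqOn f g (Icc a b)) :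
    IsRegulated a b g :=
  ⟨fun t ht => (hf.1 t ht).imp fun _ h => h.congr' (eventuallyEq_nhdsLT hfg ht),
    fun t ht => (hf.2 t ht).imp fun _ h => h.congr' (eventuallyEq_nhdsGT hfg ht)⟩

theorem IsRegulated.leftJump_congr (hf : IsRegulated a b f) (hfg : EqOn f g (Icc a b))
    (ht : t ∈ Ioc a b) : leftJump g t = leftJump f t := by
  apply leftJump_eq_of_tendsto
  rw [← hfg ⟨ht.1.le, ht.2⟩]
  exact (hf.tendsto_left ht).congr' (eventuallyEq_nhdsLT hfg ht)

theorem IsRegulated.rightJump_congr (hf : IsRegulated a b f) (hfg : EqOn f g (Icc a b))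
    (ht : t ∈ Ico a b) : rightJump g t = rightJump f t := by
  apply rightJump_eq_of_tendsto
  rw [← hfg ⟨ht.1, ht.2.le⟩]
  exact (hf.tendsto_right ht).congr' (eventuallyEq_nhdsGT hfg ht)

theorem IsRegulated.leftLim_congr (hf : IsRegulated a b f) (hfg : EqOn f g (Icc a b))
    (ht : t ∈ Ioc a b) : Function.leftLim g t = Function.leftLim f t := by
  rw [leftLim_eq_sub_leftJump, leftLim_eq_sub_leftJump, hf.leftJump_congr hfg ht,
    hfg ⟨ht.1.le, ht.2⟩]

theorem IsRegulated.tendsto_leftLim (hf : IsRegulated a b f) (ht : t ∈ Ioc a b) :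
    Tendsto f (𝓝[<] t) (𝓝 (Function.leftLim f t)) := by
  rw [leftLim_eq_sub_leftJump]; exact hf.tendsto_left ht

theorem IsRegulated.tendsto_rightLim (hf : IsRegulated a b f) (ht : t ∈ Ico a b) :
    Tendsto f (𝓝[>] t) (𝓝 (Function.rightLim f t)) := by
  rw [rightLim_eq_add_rightJump]; exact hf.tendsto_right ht

theorem IsRegulated.mono (hf : IsRegulated a b f) {u v : ℝ} (hu : a ≤ u) (hv : v ≤ b) :
    IsRegulated u v f :=
  ⟨fun t ht => hf.1 t ⟨hu.trans_lt ht.1, ht.2.trans hv⟩,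
    fun t ht => hf.2 t ⟨hu.trans ht.1, ht.2.trans_le hv⟩⟩

theorem isRegulated_const (c : ℝ) : IsRegulated a b (fun _ => c) :=
  ⟨fun _ _ => ⟨c, tendsto_const_nhds⟩, fun _ _ => ⟨c, tendsto_const_nhds⟩⟩

theorem IsRegulated.add (hf : IsRegulated a b f) (hg : IsRegulated a b g) :
    IsRegulated a b (f + g) :=
  ⟨fun _ ht => ⟨_, (hf.tendsto_left ht).add (hg.tendsto_left ht)⟩,
    fun _ ht => ⟨_, (hf.tendsto_right ht).add (hg.tendsto_right ht)⟩⟩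

theorem IsRegulated.sub (hf : IsRegulated a b f) (hg : IsRegulated a b g) :
    IsRegulated a b (f - g) :=
  ⟨fun _ ht => ⟨_, (hf.tendsto_left ht).sub (hg.tendsto_left ht)⟩,
    fun _ ht => ⟨_, (hf.tendsto_right ht).sub (hg.tendsto_right ht)⟩⟩

theorem IsRegulated.mul (hf : IsRegulated a b f) (hg : IsRegulated a b g) :
    IsRegulated a b (fun x => f x * g x) :=
  ⟨fun _ ht => ⟨_, (hf.tendsto_left ht).mul (hg.tendsto_left ht)⟩,
    fun _ ht => ⟨_, (hf.tendsto_right ht).mul (hg.tendsto_right ht)⟩⟩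

theorem IsRegulated.smul (hf : IsRegulated a b f) (c : ℝ) : IsRegulated a b (c • f) :=
  ⟨fun _ ht => ⟨_, (hf.tendsto_left ht).const_mul c⟩,
    fun _ ht => ⟨_, (hf.tendsto_right ht).const_mul c⟩⟩

theorem IsRegulated.leftLim_add (hf : IsRegulated a b f) (hg : IsRegulated a b g)
    (ht : t ∈ Ioc a b) :
    Function.leftLim (f + g) t = Function.leftLim f t + Function.leftLim g t :=
  leftLim_eq_of_tendsto ((hf.tendsto_leftLim ht).add (hg.tendsto_leftLim ht))

theorem IsRegulated.rightLim_add (hf : IsRegulated a b f) (hg : IsRegulated a b g)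
    (ht : t ∈ Ico a b) :
    Function.rightLim (f + g) t = Function.rightLim f t + Function.rightLim g t :=
  rightLim_eq_of_tendsto ((hf.tendsto_rightLim ht).add (hg.tendsto_rightLim ht))

theorem IsRegulated.leftLim_sub (hf : IsRegulated a b f) (hg : IsRegulated a b g)
    (ht : t ∈ Ioc a b) :
    Function.leftLim (f - g) t = Function.leftLim f t - Function.leftLim g t :=
  leftLim_eq_of_tendsto ((hf.tendsto_leftLim ht).sub (hg.tendsto_leftLim ht))

theorem IsRegulated.leftLim_smul (hf : IsRegulated a b f) (c : ℝ) (ht : t ∈ Ioc a b) :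
    Function.leftLim (c • f) t = c * Function.leftLim f t :=
  leftLim_eq_of_tendsto ((hf.tendsto_leftLim ht).const_mul c)

theorem IsRegulated.leftLim_mul (hf : IsRegulated a b f) (hg : IsRegulated a b g)
    (ht : t ∈ Ioc a b) :
    Function.leftLim (fun x => f x * g x) t = Function.leftLim f t * Function.leftLim g t :=
  leftLim_eq_of_tendsto ((hf.tendsto_leftLim ht).mul (hg.tendsto_leftLim ht))

theorem IsRegulated.leftJump_add (hf : IsRegulated a b f) (hg : IsRegulated a b g)
    (ht : t ∈ Ioc a b) : leftJump (f + g) t = leftJump f t + leftJump g t := by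
  simp only [leftJump, hf.leftLim_add hg ht, Pi.add_apply]; ring

theorem IsRegulated.rightJump_add (hf : IsRegulated a b f) (hg : IsRegulated a b g)
    (ht : t ∈ Ico a b) : rightJump (f + g) t = rightJump f t + rightJump g t := by
  simp only [rightJump, hf.rightLim_add hg ht, Pi.add_apply]; ring

theorem IsRegulated.leftJump_sub (hf : IsRegulated a b f) (hg : IsRegulated a b g)
    (ht : t ∈ Ioc a b) : leftJump (f - g) t = leftJump f t - leftJump g t := by
  simp only [leftJump, hf.leftLim_sub hg ht, Pi.sub_apply]; ring

theorem IsRegulated.leftJump_smul (hf : IsRegulated a b f) (c : ℝ) (ht : t ∈ Ioc a b) :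
    leftJump (c • f) t = c * leftJump f t := by
  simp only [leftJump, hf.leftLim_smul c ht, Pi.smul_apply, smul_eq_mul]; ring

theorem Monotone.isRegulated (hf : Monotone f) : IsRegulated a b f :=
  ⟨fun t _ => ⟨_, hf.tendsto_leftLim t⟩, fun t _ => ⟨_, hf.tendsto_rightLim t⟩⟩

theorem MonotoneOn.isRegulated (hf : MonotoneOn f (Icc a b)) : IsRegulated a b f := by
  rcases lt_or_ge b a with hab | hab
  · exact ⟨fun t ht => absurd (ht.1.trans_le ht.2) (by simp [hab.le]),
      fun t ht => absurd (ht.1.trans_lt ht.2) (by simp [hab.le])⟩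
  · have : Monotone (IccExtend hab ((Icc a b).domRestrict f)) :=
      Monotone.IccExtend (h := hab) fun x y hxy => hf x.2 y.2 hxy
    exact (this.isRegulated).congr fun x hx => by simp [IccExtend_of_mem hab _ hx, Set.domRestrict]

/-- The increments of `g` and `h` along `l ×ˢ l` tend to zero, so the image of `l` under `F` is a
Cauchy filter and completeness supplies the limit. A function is thus seen to be regulated without
its one-sided limits being known. -/
theorem exists_tendsto_of_dominated {l : Filter ℝ} [l.NeBot] {F : ℝ → ℝ} {S : Set ℝ} {C L L' : ℝ}
    (hg : Tendsto g l (𝓝 L)) (hh : Tendsto h l (𝓝 L')) (hS : S ∈ l)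
    (H : ∀ s ∈ S, ∀ t ∈ S, |F t - F s| ≤ C * (|g t - g s| + |h t - h s|)) :
    ∃ M, Tendsto F l (𝓝 M) := by
  rw [← cauchy_map_iff_exists_tendsto]
  have h1 := (hg.comp tendsto_fst : Tendsto _ (l ×ˢ l) _)
  have h2 := (hg.comp tendsto_snd : Tendsto _ (l ×ˢ l) _)
  have h3 := (hh.comp tendsto_fst : Tendsto _ (l ×ˢ l) _)
  have h4 := (hh.comp tendsto_snd : Tendsto _ (l ×ˢ l) _)
  have h5 := ((h2.sub h1).abs.add (h4.sub h3).abs).const_mul C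
  simp only [sub_self, abs_zero, add_zero, mul_zero] at h5
  refine (cauchy_map_iff).2 ⟨inferInstance, ?_⟩
  rw [Metric.uniformity_eq_comap_nhds_zero, tendsto_comap_iff]
  refine squeeze_zero' (Eventually.of_forall fun _ => dist_nonneg) ?_ h5
  filter_upwards [prod_mem_prod hS hS] with x hx
  rw [Function.comp, Real.dist_eq, abs_sub_comm]
  exact H _ hx.1 _ hx.2

theorem IsRegulated.of_dominated {F : ℝ → ℝ} (hg : IsRegulated a b g) (hh : IsRegulated a b h)
    {C : ℝ} (H : ∀ s ∈ Icc a b, ∀ t ∈ Icc a b, s ≤ t →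
      |F t - F s| ≤ C * (|g t - g s| + |h t - h s|)) : IsRegulated a b F := by
  have H' : ∀ s ∈ Icc a b, ∀ t ∈ Icc a b, |F t - F s| ≤ C * (|g t - g s| + |h t - h s|) := by
    intro s hs t ht
    rcases le_total s t with hst | hst
    · exact H s hs t ht hst
    · have := H t ht s hs hst
      rwa [abs_sub_comm, abs_sub_comm (g s), abs_sub_comm (h s)] at this
  exact ⟨fun t ht => exists_tendsto_of_dominated (hg.tendsto_left ht) (hh.tendsto_left ht)
      (Icc_mem_nhdsLT_of_mem ht) H',
    fun t ht => exists_tendsto_of_dominated (hg.tendsto_right ht) (hh.tendsto_right ht)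
      (Icc_mem_nhdsGT_of_mem ht) H'⟩

theorem IsRegulated.exists_bound (hf : IsRegulated a b f) :
    ∃ M, 0 ≤ M ∧ ∀ t ∈ Icc a b, |f t| ≤ M := by
  -- The compactness induction runs over arbitrary sets, so a bound is asked only on the part of
  -- each set inside `[a,b]`.
  suffices h : ∃ M, ∀ t ∈ Icc a b ∩ Icc a b, |f t| ≤ M by
    obtain ⟨M, hM⟩ := h
    exact ⟨max M 0, le_max_right _ _, fun t ht => (hM t ⟨ht, ht⟩).trans (le_max_left _ _)⟩
  refine isCompact_Icc.induction_on (p := fun s => ∃ M, ∀ t ∈ s ∩ Icc a b, |f t| ≤ M)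
    ⟨0, by simp⟩ ?_ ?_ ?_
  · rintro s t hst ⟨M, hM⟩
    exact ⟨M, fun x hx => hM x ⟨hst hx.1, hx.2⟩⟩
  · rintro s t ⟨M, hM⟩ ⟨M', hM'⟩
    refine ⟨max M M', fun x hx => ?_⟩
    rcases hx.1 with h | h
    · exact (hM x ⟨h, hx.2⟩).trans (le_max_left _ _)
    · exact (hM' x ⟨h, hx.2⟩).trans (le_max_right _ _)
  · intro c hc
    have hl : ∃ M, ∀ᶠ t in 𝓝[<] c, t ∈ Icc a b → |f t| ≤ M := by
      rcases eq_or_lt_of_le hc.1 with rfl | hac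
      · exact ⟨0, eventually_nhdsWithin_of_forall fun t ht h => absurd h.1 (not_le.2 ht)⟩
      · obtain ⟨l, hl⟩ := hf.1 c ⟨hac, hc.2⟩
        refine ⟨|l| + 1, (hl.abs.eventually (gt_mem_nhds (lt_add_one _))).mono fun t ht _ => ht.le⟩
    have hr : ∃ M, ∀ᶠ t in 𝓝[>] c, t ∈ Icc a b → |f t| ≤ M := by
      rcases eq_or_lt_of_le hc.2 with rfl | hcb
      · exact ⟨0, eventually_nhdsWithin_of_forall fun t ht h => absurd h.2 (not_le.2 ht)⟩
      · obtain ⟨l, hl⟩ := hf.2 c ⟨hc.1, hcb⟩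
        refine ⟨|l| + 1, (hl.abs.eventually (gt_mem_nhds (lt_add_one _))).mono fun t ht _ => ht.le⟩
    obtain ⟨M, hM⟩ := hl
    obtain ⟨M', hM'⟩ := hr
    rw [eventually_nhdsWithin_iff] at hM hM'
    refine ⟨_, mem_nhdsWithin_of_mem_nhds (hM.and hM'), max (max M M') |f c|, fun t ht => ?_⟩
    rcases lt_trichotomy t c with h | rfl | h
    · exact (ht.1.1 h ht.2).trans (le_max_of_le_left (le_max_left _ _))
    · exact le_max_right _ _
    · exact (ht.1.2 h ht.2).trans (le_max_of_le_left (le_max_right _ _))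

/-- The two one-sided limits control the two sides separately, and the centre is left out: across
`c` itself the function may jump. -/
theorem IsRegulated.exists_radius_osc (hf : IsRegulated a b f) {ε : ℝ} (hε : 0 < ε) {c : ℝ}
    (hc : c ∈ Icc a b) : ∃ δ > 0,
      (∀ s ∈ Ioo (c - δ) c, ∀ t ∈ Ioo (c - δ) c, s ∈ Icc a b → t ∈ Icc a b → |f t - f s| ≤ ε) ∧
      (∀ s ∈ Ioo c (c + δ), ∀ t ∈ Ioo c (c + δ), s ∈ Icc a b → t ∈ Icc a b → |f t - f s| ≤ ε) := by
  have key : ∀ l : Filter ℝ, (∃ L, Tendsto f l (𝓝 L)) →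
      ∃ S ∈ l, ∀ s ∈ S, ∀ t ∈ S, |f t - f s| ≤ ε := by
    rintro l ⟨L, hL⟩
    refine ⟨_, hL (Metric.ball_mem_nhds L (half_pos hε)), fun s hs t ht => ?_⟩
    have h1 := Metric.mem_ball.1 hs
    have h2 := Metric.mem_ball.1 ht
    rw [Real.dist_eq] at h1 h2
    have := abs_sub_le (f t) L (f s)
    rw [abs_sub_comm L] at this
    linarith
  have hl : ∃ δ > 0, ∀ s ∈ Ioo (c - δ) c, ∀ t ∈ Ioo (c - δ) c, s ∈ Icc a b → t ∈ Icc a b →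
      |f t - f s| ≤ ε := by
    rcases eq_or_lt_of_le hc.1 with rfl | hac
    · exact ⟨1, one_pos, fun s hs t _ h => absurd h.1 (not_le.2 hs.2)⟩
    · obtain ⟨S, hS, h⟩ := key _ (hf.1 c ⟨hac, hc.2⟩)
      obtain ⟨d, hd, hdS⟩ := (mem_nhdsLT_iff_exists_Ioo_subset).1 hS
      refine ⟨c - d, sub_pos.2 hd, fun s hs t ht _ _ => h s (hdS ?_) t (hdS ?_)⟩
      · simpa using hs
      · simpa using ht
  have hr : ∃ δ > 0, ∀ s ∈ Ioo c (c + δ), ∀ t ∈ Ioo c (c + δ), s ∈ Icc a b → t ∈ Icc a b →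
      |f t - f s| ≤ ε := by
    rcases eq_or_lt_of_le hc.2 with rfl | hcb
    · exact ⟨1, one_pos, fun s hs t _ h => absurd h.2 (not_le.2 hs.1)⟩
    · obtain ⟨S, hS, h⟩ := key _ (hf.2 c ⟨hc.1, hcb⟩)
      obtain ⟨d, hd, hdS⟩ := (mem_nhdsGT_iff_exists_Ioo_subset).1 hS
      refine ⟨d - c, sub_pos.2 hd, fun s hs t ht _ _ => h s (hdS ?_) t (hdS ?_)⟩
      · simpa using hs
      · simpa using ht
  obtain ⟨δ, hδ, h⟩ := hl
  obtain ⟨δ', hδ', h'⟩ := hr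
  refine ⟨min δ δ', lt_min hδ hδ', fun s hs t ht => h s ⟨?_, hs.2⟩ t ⟨?_, ht.2⟩,
    fun s hs t ht => h' s ⟨hs.1, ?_⟩ t ⟨ht.1, ?_⟩⟩
  · have := hs.1; have := min_le_left δ δ'; linarith
  · have := ht.1; have := min_le_left δ δ'; linarith
  · have := hs.2; have := min_le_right δ δ'; linarith
  · have := ht.2; have := min_le_right δ δ'; linarith

/-- A regulated function oscillates little on every interval that avoids a suitable finite set. -/
theorem IsRegulated.exists_finset_osc (hf : IsRegulated a b f) {ε : ℝ} (hε : 0 < ε) :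
    ∃ D : Finset ℝ, ∀ s t, a ≤ s → s ≤ t → t ≤ b → (∀ d ∈ D, d ∉ Icc s t) → |f t - f s| ≤ ε := by
  classical
  choose! δ hδ h1 h2 using fun c (hc : c ∈ Icc a b) => hf.exists_radius_osc hε hc
  obtain ⟨T, hT, hcov⟩ := isCompact_Icc.elim_nhds_subcover (fun c => Ioo (c - δ c) (c + δ c))
    fun c hc => Ioo_mem_nhds (by linarith [hδ c hc]) (by linarith [hδ c hc])
  -- The finite set collects the centres and the end points of a finite cover. An interval that
  -- starts in one covering interval and avoids these points cannot leave the half in which it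
  -- starts.
  refine ⟨T ∪ T.image (fun c => c - δ c) ∪ T.image (fun c => c + δ c), fun s t has hst htb hD => ?_⟩
  have hs : s ∈ Icc a b := ⟨has, hst.trans htb⟩
  have ht : t ∈ Icc a b := ⟨has.trans hst, htb⟩
  obtain ⟨c, hc, hsc⟩ := mem_iUnion₂.1 (hcov hs)
  have d1 : c ∉ Icc s t := hD c (by simp [hc])
  have d2 : c + δ c ∉ Icc s t :=
    hD _ (Finset.mem_union_right _ (Finset.mem_image_of_mem _ hc))
  simp only [mem_Icc, not_and, not_le] at d1 d2
  rcases le_or_gt s c with h | h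
  · exact h1 c (hT c hc) s ⟨hsc.1, hst.trans_lt (d1 h)⟩ t ⟨hsc.1.trans_le hst, d1 h⟩ hs ht
  · have := d2 hsc.2.le
    exact h2 c (hT c hc) s ⟨h, hsc.2⟩ t ⟨h.trans_le hst, this⟩ hs ht

end Regulated

/-! ### Step functions -/

section StepFunctions

/-- Linear combinations of indicator functions of right half-lines. -/
def stepSpan : Submodule ℝ (ℝ → ℝ) :=
  Submodule.span ℝ
    (range (fun c : ℝ => (Ici c).indicator fun _ => (1 : ℝ)) ∪
      range (fun c : ℝ => (Ioi c).indicator fun _ => (1 : ℝ)))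

theorem indicator_Ici_mem_stepSpan (c : ℝ) :
    ((Ici c).indicator fun _ => (1 : ℝ)) ∈ stepSpan :=
  Submodule.subset_span (Or.inl ⟨c, rfl⟩)

theorem indicator_Ioi_mem_stepSpan (c : ℝ) :
    ((Ioi c).indicator fun _ => (1 : ℝ)) ∈ stepSpan :=
  Submodule.subset_span (Or.inr ⟨c, rfl⟩)

theorem stepSpan_induction {p : (ℝ → ℝ) → Prop}
    (Ici : ∀ c : ℝ, p ((Set.Ici c).indicator fun _ => 1))
    (Ioi : ∀ c : ℝ, p ((Set.Ioi c).indicator fun _ => 1)) (zero : p 0)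
    (add : ∀ φ ψ, φ ∈ stepSpan → ψ ∈ stepSpan → p φ → p ψ → p (φ + ψ))
    (smul : ∀ (r : ℝ) φ, φ ∈ stepSpan → p φ → p (r • φ)) {σ : ℝ → ℝ} (hσ : σ ∈ stepSpan) : p σ := by
  refine Submodule.span_induction (p := fun φ _ => p φ) ?_ zero add smul hσ
  rintro _ (⟨c, rfl⟩ | ⟨c, rfl⟩)
  exacts [Ici c, Ioi c]

/-- Induction on the largest point `d` of `D`: once the two one-sided jumps of `σ` at `d` are
subtracted as multiples of half-line indicators, the rest is constant across `d`. Vanishing near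
`-∞` is imposed because all elements of the span have this property. -/
theorem mem_stepSpan_of_const (D : Finset ℝ) : ∀ σ : ℝ → ℝ, (∃ z, ∀ t < z, σ t = 0) →
    (∀ s t, s ≤ t → (∀ d ∈ D, d ∉ Icc s t) → σ s = σ t) → σ ∈ stepSpan := by
  induction D using Finset.induction_on_max with
  | empty =>
    rintro σ ⟨z, hz⟩ hσ
    have : σ = 0 := by
      ext t
      rw [Pi.zero_apply, ← hz (min t z - 1) (by linarith [min_le_right t z])]
      exact (hσ _ _ (by linarith [min_le_left t z]) (by simp)).symm
    rw [this]; exact zero_mem _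
  | insert d D hD ih =>
    rintro σ ⟨z, hz⟩ hσ
    -- The point `y` lies between `d` and the remaining points of `D`, so `σ y` is the value of `σ`
    -- immediately to the left of `d`; likewise `σ (d + 1)` is its value immediately to the right.
    obtain ⟨y, hyd, hy⟩ : ∃ y < d, ∀ x ∈ D, x < y := by
      have : ∀ᶠ y in 𝓝[<] d, ∀ x ∈ D, x < y := by
        rw [Finset.eventually_all]
        exact fun x hx => eventually_nhdsWithin_of_eventually_nhds (lt_mem_nhds (hD x hx))
      obtain ⟨y, hy, hyd⟩ := (this.and self_mem_nhdsWithin).exists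
      exact ⟨y, hyd, hy⟩
    have below : ∀ t, (∀ x ∈ D, x < t) → t < d → σ t = σ y := by
      intro t ht htd
      rcases le_total t y with h | h
      · refine hσ t y h fun x hx hxt => ?_
        rcases Finset.mem_insert.1 hx with rfl | hx
        · exact absurd hxt.2 (not_le.2 hyd)
        · exact absurd hxt.1 (not_le.2 (ht x hx))
      · refine (hσ y t h fun x hx hxt => ?_).symm
        rcases Finset.mem_insert.1 hx with rfl | hx
        · exact absurd hxt.2 (not_le.2 htd)
        · exact absurd hxt.1 (not_le.2 (hy x hx))
    have above : ∀ t, d < t → σ t = σ (d + 1) := by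
      intro t ht
      have hav : ∀ s, d < s → ∀ x ∈ insert d D, x < s := by
        intro s hs x hx
        rcases Finset.mem_insert.1 hx with rfl | hx
        · exact hs
        · exact (hD x hx).trans hs
      rcases le_total t (d + 1) with h | h
      · exact hσ t _ h fun x hx hxt => absurd hxt.1 (not_le.2 (hav t ht x hx))
      · exact (hσ _ t h fun x hx hxt => absurd hxt.1 (not_le.2 (hav _ (lt_add_one d) x hx))).symm
    set α := σ d - σ y
    set β := σ (d + 1) - σ d
    have hmem : σ - α • ((Ici d).indicator fun _ => (1 : ℝ)) -
        β • ((Ioi d).indicator fun _ => (1 : ℝ)) ∈ stepSpan := by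
      set σ' := σ - α • ((Ici d).indicator fun _ => (1 : ℝ)) -
        β • ((Ioi d).indicator fun _ => (1 : ℝ)) with hσ'
      have e1 : ∀ t < d, σ' t = σ t := by
        intro t ht
        simp [hσ', indicator, not_le.2 ht, not_lt.2 ht.le]
      have e2 : ∀ t, d ≤ t → σ' t = σ y := by
        intro t ht
        rcases eq_or_lt_of_le ht with rfl | h
        · simp [hσ', indicator, α]
        · simp [hσ', indicator, ht, h, above t h, α, β]
      have e3 : ∀ t, (∀ x ∈ D, x < t) → σ' t = σ y := fun t ht => by
        rcases lt_or_ge t d with h | h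
        · rw [e1 t h, below t ht h]
        · exact e2 t h
      refine ih σ' ⟨min z d, fun t ht => ?_⟩ fun s t hst hav => ?_
      · rw [e1 t (ht.trans_le (min_le_right _ _)), hz t (ht.trans_le (min_le_left _ _))]
      · by_cases h : ∀ x ∈ D, x < s
        · rw [e3 s h, e3 t fun x hx => (h x hx).trans_le hst]
        · push Not at h
          obtain ⟨x, hx, hsx⟩ := h
          have htx : t < x := by
            by_contra hc
            exact hav x hx ⟨hsx, not_lt.1 hc⟩
          have htd := htx.trans (hD x hx)
          rw [e1 s (hst.trans_lt htd), e1 t htd]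
          refine hσ s t hst fun r hr hrt => ?_
          rcases Finset.mem_insert.1 hr with rfl | hr
          · exact absurd hrt.2 (not_le.2 htd)
          · exact hav r hr hrt
    have := add_mem (add_mem hmem (stepSpan.smul_mem β (indicator_Ioi_mem_stepSpan d)))
      (stepSpan.smul_mem α (indicator_Ici_mem_stepSpan d))
    simpa using this

/-- Sampling a function along a monotone map with finitely many values gives a step function. -/
theorem exists_step_sampling {a b : ℝ} (hab : a ≤ b) (D : Finset ℝ) :
    ∃ τ : ℝ → ℝ, MonotoneOn τ (Icc a b) ∧ MapsTo τ (Icc a b) (Icc a b) ∧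
      (∀ t ∈ Icc a b, τ t = t ∨
        ∃ s s', s ≤ s' ∧ Icc s s' ⊆ Icc a b ∧ (∀ d ∈ D, d ∉ Icc s s') ∧
          t ∈ Icc s s' ∧ τ t ∈ Icc s s') ∧
      ∀ φ : ℝ → ℝ, ∃ σ ∈ stepSpan, EqOn σ (φ ∘ τ) (Icc a b) := by
  classical
  -- With the end points added, every other point of `[a,b]` has a neighbour in the finite set on
  -- either side.
  set E : Finset ℝ := insert a (insert b D)
  have haE : a ∈ E := by simp [E]
  have hbE : b ∈ E := by simp [E]
  have hne1 : ∀ t, a < t → (E.filter (· < t)).Nonempty := fun t ht =>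
    ⟨a, Finset.mem_filter.2 ⟨haE, ht⟩⟩
  have hne2 : ∀ t, t < b → (E.filter (t < ·)).Nonempty := fun t ht =>
    ⟨b, Finset.mem_filter.2 ⟨hbE, ht⟩⟩
  have hpred : ∀ t, ∃ l, a < t → l ∈ E ∧ l < t ∧ ∀ d ∈ E, d < t → d ≤ l := by
    intro t
    by_cases ht : a < t
    · have h := (E.filter (· < t)).max'_mem (hne1 t ht)
      rw [Finset.mem_filter] at h
      exact ⟨_, fun _ => ⟨h.1, h.2, fun d hd hdt =>
        Finset.le_max' _ _ (Finset.mem_filter.2 ⟨hd, hdt⟩)⟩⟩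
    · exact ⟨0, fun h => absurd h ht⟩
  have hsucc : ∀ t, ∃ r, t < b → r ∈ E ∧ t < r ∧ ∀ d ∈ E, t < d → r ≤ d := by
    intro t
    by_cases ht : t < b
    · have h := (E.filter (t < ·)).min'_mem (hne2 t ht)
      rw [Finset.mem_filter] at h
      exact ⟨_, fun _ => ⟨h.1, h.2, fun d hd hdt =>
        Finset.min'_le _ _ (Finset.mem_filter.2 ⟨hd, hdt⟩)⟩⟩
    · exact ⟨0, fun h => absurd h ht⟩
  choose L hL using hpred
  choose R hR using hsucc
  -- The points of `E` are fixed, and every other point is sent to the midpoint of its gap.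
  set τ : ℝ → ℝ := fun t => if t ∈ E then t else (L t + R t) / 2 with hτ
  have τmem : ∀ t, t ∈ E → τ t = t := fun t ht => by simp [hτ, ht]
  have τnot : ∀ t, t ∉ E → τ t = (L t + R t) / 2 := fun t ht => by simp [hτ, ht]
  have hint : ∀ t ∈ Icc a b, t ∉ E → a < t ∧ t < b := fun t ht hE =>
    ⟨lt_of_le_of_ne ht.1 (by rintro rfl; exact hE haE),
      lt_of_le_of_ne ht.2 (by rintro rfl; exact hE hbE)⟩
  have hLa : ∀ t, a < t → a ≤ L t := fun t ht => (hL t ht).2.2 a haE ht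
  have hRb : ∀ t, t < b → R t ≤ b := fun t ht => (hR t ht).2.2 b hbE ht
  have τconst : ∀ s t, a < s → s ≤ t → t < b → (∀ d ∈ E, d ∉ Icc s t) → L s = L t ∧ R s = R t := by
    intro s t has hst htb hE
    have hat := has.trans_le hst
    have hsb := hst.trans_lt htb
    refine ⟨le_antisymm ((hL t hat).2.2 _ (hL s has).1 ((hL s has).2.1.trans_le hst)) ?_,
      le_antisymm ((hR s hsb).2.2 _ (hR t htb).1 (hst.trans_lt (hR t htb).2.1)) ?_⟩
    · refine (hL s has).2.2 _ (hL t hat).1 ?_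
      by_contra hc
      exact hE _ (hL t hat).1 ⟨not_lt.1 hc, (hL t hat).2.1.le⟩
    · refine (hR t htb).2.2 _ (hR s hsb).1 ?_
      by_contra hc
      exact hE _ (hR s hsb).1 ⟨(hR s hsb).2.1.le, not_lt.1 hc⟩
  refine ⟨τ, ?_, ?_, ?_, ?_⟩
  · intro s hs t ht hst
    rcases eq_or_lt_of_le hst with rfl | hlt
    · exact le_rfl
    by_cases hsE : s ∈ E <;> by_cases htE : t ∈ E
    · rw [τmem s hsE, τmem t htE]; exact hst
    · obtain ⟨h1, h2⟩ := hint t ht htE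
      rw [τmem s hsE, τnot t htE]
      have := (hL t h1).2.2 s hsE hlt
      have := (hL t h1).2.1
      have := (hR t h2).2.1
      linarith
    · obtain ⟨h1, h2⟩ := hint s hs hsE
      rw [τmem t htE, τnot s hsE]
      have := (hR s h2).2.2 t htE hlt
      have := (hL s h1).2.1
      have := (hR s h2).2.1
      linarith
    · obtain ⟨h1, h2⟩ := hint s hs hsE
      obtain ⟨h3, h4⟩ := hint t ht htE
      rw [τnot s hsE, τnot t htE]
      by_cases h : ∀ d ∈ E, d ∉ Icc s t
      · obtain ⟨e1, e2⟩ := τconst s t h1 hst h4 h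
        rw [e1, e2]
      · push Not at h
        obtain ⟨d, hd, hds⟩ := h
        have hsd : s < d := lt_of_le_of_ne hds.1 (by rintro rfl; exact hsE hd)
        have hdt : d < t := lt_of_le_of_ne hds.2 (by rintro rfl; exact htE hd)
        have := (hR s h2).2.2 d hd hsd
        have := (hL t h3).2.2 d hd hdt
        have := (hL s h1).2.1
        have := (hR t h4).2.1
        linarith
  · intro t ht
    by_cases htE : t ∈ E
    · rwa [τmem t htE]
    · obtain ⟨h1, h2⟩ := hint t ht htE
      rw [τnot t htE]
      have := hLa t h1
      have := hRb t h2
      have := (hL t h1).2.1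
      have := (hR t h2).2.1
      constructor <;> linarith
  · intro t ht
    by_cases htE : t ∈ E
    · exact Or.inl (τmem t htE)
    · right
      obtain ⟨h1, h2⟩ := hint t ht htE
      have l1 := hLa t h1
      have l2 := hRb t h2
      have l3 := (hL t h1).2.1
      have l4 := (hR t h2).2.1
      rw [τnot t htE]
      refine ⟨min t ((L t + R t) / 2), max t ((L t + R t) / 2), min_le_max, ?_, ?_,
        ⟨min_le_left _ _, le_max_left _ _⟩, ⟨min_le_right _ _, le_max_right _ _⟩⟩
      · exact Icc_subset_Icc (le_min ht.1 (by linarith)) (max_le ht.2 (by linarith))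
      · intro d hd hdI
        have hdE : d ∈ E := by simp [E, hd]
        have g1 : L t < d := (lt_min l3 (by linarith)).trans_le hdI.1
        have g2 : d < R t := hdI.2.trans_lt (max_lt l4 (by linarith))
        rcases lt_trichotomy d t with h | rfl | h
        · exact absurd ((hL t h1).2.2 d hdE h) (not_le.2 g1)
        · exact htE hdE
        · exact absurd ((hR t h2).2.2 d hdE h) (not_le.2 g2)
  · intro φ
    -- Extension by zero to the left of `a` and by a constant to the right of `b` puts the sampled
    -- function into `stepSpan`.
    refine ⟨fun t => if t < a then 0 else φ (τ (min t b)), mem_stepSpan_of_const E _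
      ⟨a, fun t ht => by simp [ht]⟩ ?_, fun t ht => by simp [not_lt.2 ht.1, min_eq_left ht.2]⟩
    intro s t hst hE
    rcases lt_or_ge t a with hta | hta
    · simp [hta, hst.trans_lt hta]
    have has : a < s := by
      by_contra hc
      exact hE a haE ⟨not_lt.1 hc, hta⟩
    rw [if_neg (not_lt.2 has.le), if_neg (not_lt.2 hta)]
    rcases lt_or_ge b s with hbs | hbs
    · rw [min_eq_right hbs.le, min_eq_right (hbs.le.trans hst)]
    have htb : t < b := by
      by_contra hc
      exact hE b hbE ⟨hbs, not_lt.1 hc⟩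
    rw [min_eq_left hbs, min_eq_left htb.le]
    obtain ⟨e1, e2⟩ := τconst s t has hst htb hE
    rw [τnot s fun h => hE s h ⟨le_rfl, hst⟩, τnot t fun h => hE t h ⟨hst, le_rfl⟩, e1, e2]

/-- The approximant is a sampling `φ ∘ τ` along a monotone map. Besides uniform closeness this gives
control of its variation: if `F` controls the `q`-variation of `φ`, then `F ∘ τ` controls that of
`σ`, whatever the accuracy `ε`. -/
theorem IsRegulated.exists_step {a b : ℝ} {φ : ℝ → ℝ} (hab : a ≤ b) (hφ : IsRegulated a b φ)
    {ε : ℝ} (hε : 0 < ε) :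
    ∃ τ : ℝ → ℝ, ∃ σ ∈ stepSpan, MonotoneOn τ (Icc a b) ∧ MapsTo τ (Icc a b) (Icc a b) ∧
      EqOn σ (φ ∘ τ) (Icc a b) ∧ ∀ t ∈ Icc a b, |φ t - σ t| ≤ ε := by
  obtain ⟨D, hD⟩ := hφ.exists_finset_osc hε
  obtain ⟨τ, h1, h2, h3, h4⟩ := exists_step_sampling hab D
  obtain ⟨σ, hσ, hστ⟩ := h4 φ
  refine ⟨τ, σ, hσ, h1, h2, hστ, fun t ht => ?_⟩
  rw [hστ ht, Function.comp]
  rcases h3 t ht with h | ⟨s, s', hss, hsub, hav, hts, hτs⟩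
  · rw [h]; simpa using hε.le
  · have key : ∀ x ∈ Icc s s', ∀ y ∈ Icc s s', x ≤ y → |φ y - φ x| ≤ ε := fun x hx y hy hxy =>
      hD x y (hsub hx).1 hxy (hsub hy).2 fun d hd hdx =>
        hav d hd ⟨hx.1.trans hdx.1, hdx.2.trans hy.2⟩
    rcases le_total t (τ t) with h | h
    · rw [abs_sub_comm]; exact key t hts _ hτs h
    · exact key _ hτs t hts h

theorem isRegulated_of_mem_stepSpan {a b : ℝ} {σ : ℝ → ℝ} (hσ : σ ∈ stepSpan) :
    IsRegulated a b σ := by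
  refine stepSpan_induction (p := fun σ => IsRegulated a b σ) (fun c => Monotone.isRegulated ?_)
    (fun c => Monotone.isRegulated ?_) (isRegulated_const 0) (fun _ _ _ _ h h' => h.add h')
    (fun r _ _ h => h.smul r) hσ
  · intro x y hxy
    simp only [indicator, mem_Ici]
    split_ifs <;> linarith
  · intro x y hxy
    simp only [indicator, mem_Ioi]
    split_ifs <;> linarith

end StepFunctions

noncomputable section

/-! ### Partitions -/

namespace IntervalPartition

variable {a b c : ℝ}

theorem pt_mono (κ : IntervalPartition a b) {i j : ℕ} (hij : i ≤ j) (hj : j ≤ κ.n) :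
    κ.pt i ≤ κ.pt j := by
  induction j, hij using Nat.le_induction with
  | base => exact le_rfl
  | succ j hij ih => exact (ih (by omega)).trans (κ.pt_lt j (by omega)).le

theorem pt_strictMono (κ : IntervalPartition a b) {i j : ℕ} (hij : i < j) (hj : j ≤ κ.n) :
    κ.pt i < κ.pt j :=
  (κ.pt_lt i (by omega)).trans_le (κ.pt_mono hij hj)

theorem pt_mem_Icc (κ : IntervalPartition a b) {i : ℕ} (hi : i ≤ κ.n) : κ.pt i ∈ Icc a b :=
  ⟨by have := κ.pt_mono (Nat.zero_le i) hi; rwa [κ.pt_zero] at this,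
    by have := κ.pt_mono hi le_rfl; rwa [κ.pt_last] at this⟩

theorem left_mem_points (κ : IntervalPartition a b) : a ∈ κ.points := ⟨0, Nat.zero_le _, κ.pt_zero⟩

theorem right_mem_points (κ : IntervalPartition a b) : b ∈ κ.points := ⟨κ.n, le_rfl, κ.pt_last⟩

/-- The partition of a degenerate interval. -/
def single (a : ℝ) : IntervalPartition a a where
  n := 0
  pt _ := a
  pt_zero := rfl
  pt_last := rfl
  pt_lt i hi := absurd hi (Nat.not_lt_zero i)

/-- A partition of `[a,b]` extended by one more point to a partition of `[a,c]`. -/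
def snoc (κ : IntervalPartition a b) (hbc : b < c) : IntervalPartition a c where
  n := κ.n + 1
  pt i := if i ≤ κ.n then κ.pt i else c
  pt_zero := by simp [κ.pt_zero]
  pt_last := by simp
  pt_lt i hi := by
    rcases eq_or_lt_of_le (Nat.lt_succ_iff.1 hi) with rfl | h
    · simpa [κ.pt_last] using hbc
    · simpa [h.le, Nat.succ_le_of_lt h] using κ.pt_lt i h

theorem sum_snoc (κ : IntervalPartition a b) (hbc : b < c) (w : ℝ → ℝ → ℝ) :
    ∑ i ∈ Finset.range (κ.snoc hbc).n, w ((κ.snoc hbc).pt i) ((κ.snoc hbc).pt (i + 1)) =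
      ∑ i ∈ Finset.range κ.n, w (κ.pt i) (κ.pt (i + 1)) + w b c := by
  rw [show (κ.snoc hbc).n = κ.n + 1 from rfl, Finset.sum_range_succ]
  congr 1
  · refine Finset.sum_congr rfl fun i hi => ?_
    have := Finset.mem_range.1 hi
    simp [snoc, this.le, Nat.succ_le_of_lt this]
  · simp [snoc, κ.pt_last]

theorem points_subset_snoc (κ : IntervalPartition a b) (hbc : b < c) :
    κ.points ⊆ (κ.snoc hbc).points := by
  rintro x ⟨i, hi, rfl⟩
  exact ⟨i, Nat.le_succ_of_le hi, by simp [snoc, hi]⟩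

end IntervalPartition

/-! ### Bounded `p`-variation and controls -/

section Controls

variable {a b p q : ℝ} {f g h F G : ℝ → ℝ}

theorem add_rpow_le_two_rpow_mul {x y : ℝ} (hx : 0 ≤ x) (hy : 0 ≤ y) (hp : 0 ≤ p) :
    (x + y) ^ p ≤ 2 ^ p * (x ^ p + y ^ p) := by
  wlog hxy : x ≤ y generalizing x y
  · rw [add_comm x, add_comm (x ^ p)]
    exact this hy hx (le_of_not_ge hxy)
  calc (x + y) ^ p ≤ (2 * y) ^ p := Real.rpow_le_rpow (by positivity) (by linarith) hp
    _ = 2 ^ p * y ^ p := Real.mul_rpow (by norm_num) hy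
    _ ≤ _ := by
        gcongr
        exact le_add_of_nonneg_left (by positivity)

/-- `F` controls the `p`-variation of `f` on `[a,b]`. -/
def IsControl (a b p : ℝ) (f F : ℝ → ℝ) : Prop :=
  MonotoneOn F (Icc a b) ∧
    ∀ s ∈ Icc a b, ∀ t ∈ Icc a b, s ≤ t → |f t - f s| ^ p ≤ F t - F s

theorem IsControl.boundedPVariation (hF : IsControl a b p f F) : BoundedPVariation a b p f := by
  refine ⟨F b - F a, fun κ => ?_⟩
  calc κ.pVariationSum p f
      ≤ ∑ i ∈ Finset.range κ.n, (F (κ.pt (i + 1)) - F (κ.pt i)) := by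
        refine Finset.sum_le_sum fun i hi => ?_
        have hi := Finset.mem_range.1 hi
        exact hF.2 _ (κ.pt_mem_Icc hi.le) _ (κ.pt_mem_Icc hi) (κ.pt_lt i hi).le
    _ = F b - F a := by
        rw [Finset.sum_range_sub (fun i => F (κ.pt i)), κ.pt_zero, κ.pt_last]

/-- The control is the supremum of the `p`-variation sums over partitions of `[a,t]`. Appending one
point to a partition of `[a,s]` shows that it grows by at least `|f t - f s| ^ p`, and appending `b`
shows that it is finite. -/
theorem BoundedPVariation.exists_control (hp : 0 < p) (hf : BoundedPVariation a b p f) :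
    ∃ F, IsControl a b p f F := by
  obtain ⟨K, hK⟩ := hf
  set S : ℝ → Set ℝ := fun t => range fun κ : IntervalPartition a t => κ.pVariationSum p f with hS
  have hbdd : ∀ t ≤ b, BddAbove (S t) := by
    intro t ht
    refine ⟨K, ?_⟩
    rintro _ ⟨κ, rfl⟩
    rcases eq_or_lt_of_le ht with rfl | h
    · exact hK κ
    · refine le_trans ?_ (hK (κ.snoc h))
      have := κ.sum_snoc h fun s t => |f t - f s| ^ p
      unfold IntervalPartition.pVariationSum
      rw [this]
      exact le_add_of_nonneg_right (by positivity)
  have key : ∀ s ∈ Icc a b, ∀ t ∈ Icc a b, s ≤ t →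
      |f t - f s| ^ p ≤ sSup (S t) - sSup (S s) := by
    intro s hs t ht hst
    rcases eq_or_lt_of_le hst with rfl | h
    · simp [Real.zero_rpow hp.ne']
    rw [le_sub_iff_add_le, add_comm, ← le_sub_iff_add_le]
    have hne : (S s).Nonempty := by
      rcases eq_or_lt_of_le hs.1 with rfl | has
      · exact ⟨_, IntervalPartition.single a, rfl⟩
      · exact ⟨_, (IntervalPartition.single a).snoc has, rfl⟩
    refine csSup_le hne ?_
    rintro _ ⟨κ, rfl⟩
    rw [le_sub_iff_add_le]
    refine le_csSup (hbdd t ht.2) ⟨κ.snoc h, ?_⟩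
    exact κ.sum_snoc h fun s t => |f t - f s| ^ p
  refine ⟨fun t => sSup (S t), fun s hs t ht hst => ?_, key⟩
  have := key s hs t ht hst
  have h0 : 0 ≤ |f t - f s| ^ p := by positivity
  linarith

theorem IsControl.isRegulated (hp : 0 < p) (hF : IsControl a b p f F) : IsRegulated a b f := by
  have hG := hF.1.isRegulated
  have key : ∀ (l : Filter ℝ) [l.NeBot], (∃ L, Tendsto F l (𝓝 L)) → Icc a b ∈ l →
      ∃ L, Tendsto f l (𝓝 L) := by
    rintro l _ ⟨L, hL⟩ hl
    rw [← cauchy_map_iff_exists_tendsto]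
    refine (cauchy_map_iff).2 ⟨inferInstance, ?_⟩
    rw [Metric.uniformity_eq_comap_nhds_zero, tendsto_comap_iff]
    have h1 := (hL.comp tendsto_fst : Tendsto _ (l ×ˢ l) _)
    have h2 := (hL.comp tendsto_snd : Tendsto _ (l ×ˢ l) _)
    have h3 := ((h2.sub h1).abs).rpow_const (p := 1 / p) (Or.inr (by positivity))
    simp only [sub_self, abs_zero] at h3
    rw [Real.zero_rpow (by positivity)] at h3
    refine squeeze_zero' (Eventually.of_forall fun _ => dist_nonneg) ?_ h3
    filter_upwards [prod_mem_prod hl hl] with x hx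
    have H : ∀ s ∈ Icc a b, ∀ t ∈ Icc a b, s ≤ t → |f t - f s| ≤ |F t - F s| ^ (1 / p) := by
      intro s hs t ht hst
      have := hF.2 s hs t ht hst
      rw [one_div, Real.le_rpow_inv_iff_of_pos (abs_nonneg _) (abs_nonneg _) hp]
      exact this.trans (le_abs_self _)
    rw [Function.comp, Real.dist_eq]
    rcases le_total x.1 x.2 with h | h
    · rw [abs_sub_comm]; exact H _ hx.1 _ hx.2 h
    · have := H _ hx.2 _ hx.1 h
      rwa [abs_sub_comm (F x.1)] at this
  exact ⟨fun t ht => key _ (hG.1 t ht) (Icc_mem_nhdsLT_of_mem ht),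
    fun t ht => key _ (hG.2 t ht) (Icc_mem_nhdsGT_of_mem ht)⟩

theorem BoundedPVariation.isRegulated (hp : 0 < p) (hf : BoundedPVariation a b p f) :
    IsRegulated a b f := by
  obtain ⟨F, hF⟩ := hf.exists_control hp
  exact hF.isRegulated hp

/-- Bounded `p`-variation passes to larger exponents. -/
theorem BoundedPVariation.mono (hp : 0 < p) (hpq : p ≤ q) (hf : BoundedPVariation a b p f) :
    BoundedPVariation a b q f := by
  obtain ⟨F, hF⟩ := hf.exists_control hp
  obtain ⟨M, hM0, hM⟩ := (hF.isRegulated hp).exists_bound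
  -- The excess power `q - p` of an increment is absorbed into a constant by the uniform bound `2 *
  -- M` for increments.
  refine IsControl.boundedPVariation (F := fun t => (2 * M + 1) ^ (q - p) * F t) ⟨?_, ?_⟩
  · exact fun s hs t ht hst => mul_le_mul_of_nonneg_left (hF.1 hs ht hst) (by positivity)
  · intro s hs t ht hst
    rw [← mul_sub]
    have hle : |f t - f s| ≤ 2 * M + 1 := by
      have := abs_sub (f t) (f s); have := hM t ht; have := hM s hs; linarith
    calc |f t - f s| ^ q = |f t - f s| ^ (q - p) * |f t - f s| ^ p := by
          rw [← Real.rpow_add_of_nonneg (abs_nonneg _) (sub_nonneg.2 hpq) hp.le, sub_add_cancel]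
      _ ≤ (2 * M + 1) ^ (q - p) * (F t - F s) :=
          mul_le_mul (Real.rpow_le_rpow (abs_nonneg _) hle (sub_nonneg.2 hpq))
            (hF.2 s hs t ht hst) (by positivity) (by positivity)

theorem BoundedPVariation.of_dominated (hp : 1 ≤ p) (hg : BoundedPVariation a b p g)
    (hh : BoundedPVariation a b p h) {C : ℝ} (hC : 0 ≤ C)
    (H : ∀ s ∈ Icc a b, ∀ t ∈ Icc a b, s ≤ t → |f t - f s| ≤ C * (|g t - g s| + |h t - h s|)) :
    BoundedPVariation a b p f := by
  have hp0 : 0 < p := by linarith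
  obtain ⟨G, hG⟩ := hg.exists_control hp0
  obtain ⟨K, hK⟩ := hh.exists_control hp0
  refine IsControl.boundedPVariation (F := fun t => C ^ p * (2 ^ p * (G t + K t))) ⟨?_, ?_⟩
  · intro s hs t ht hst
    have := hG.1 hs ht hst
    have := hK.1 hs ht hst
    dsimp only
    gcongr
  · intro s hs t ht hst
    have h1 := hG.2 s hs t ht hst
    have h2 := hK.2 s hs t ht hst
    have h3 := add_rpow_le_two_rpow_mul (abs_nonneg (g t - g s)) (abs_nonneg (h t - h s)) hp0.le
    calc |f t - f s| ^ p ≤ (C * (|g t - g s| + |h t - h s|)) ^ p :=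
          Real.rpow_le_rpow (abs_nonneg _) (H s hs t ht hst) hp0.le
      _ = C ^ p * (|g t - g s| + |h t - h s|) ^ p := by
          rw [Real.mul_rpow hC (by positivity)]
      _ ≤ C ^ p * (2 ^ p * ((G t - G s) + (K t - K s))) := by
          gcongr
          refine h3.trans ?_
          gcongr
      _ = _ := by ring

theorem MonotoneOn.isControl_one (hF : MonotoneOn F (Icc a b)) : IsControl a b 1 F F :=
  ⟨hF, fun s hs t ht hst => by
    rw [Real.rpow_one, abs_of_nonneg (sub_nonneg.2 (hF hs ht hst))]⟩

theorem MemDualW.isRegulated (hf : MemDualW a b p f) : IsRegulated a b f := by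
  rcases hf with ⟨_, h⟩ | ⟨_, q, hq, _, h⟩
  exacts [h, h.isRegulated hq]

/-- An exponent below `1` may be raised to `1`, since `1/p + 1 > 1` in any case; from here on the
exponent of the dual class is at least `1`. -/
theorem MemDualW.exists_one_le (hp : 1 < p) (hf : MemDualW a b p f) :
    ∃ q, 1 ≤ q ∧ 1 < 1 / p + 1 / q ∧ BoundedPVariation a b q f := by
  rcases hf with ⟨h, _⟩ | ⟨_, q, hq, hpq, h⟩
  · exact absurd h hp.ne'
  · rcases le_total q 1 with h1 | h1
    · refine ⟨1, le_rfl, ?_, h.mono hq h1⟩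
      have : 0 < 1 / p := by positivity
      simpa using this
    · exact ⟨q, h1, hpq, h⟩

/-- The larger of the two exponents serves both functions and still satisfies `1/p + 1/q > 1`.
Products and Doléans exponentials stay in the dual class for this reason. -/
theorem MemDualW.of_dominated (hg : MemDualW a b p g) (hh : MemDualW a b p h) {C : ℝ} (hC : 0 ≤ C)
    (H : ∀ s ∈ Icc a b, ∀ t ∈ Icc a b, s ≤ t → |f t - f s| ≤ C * (|g t - g s| + |h t - h s|)) :
    MemDualW a b p f := by
  have hg0 := hg
  rcases hg with ⟨h1, hg⟩ | ⟨hp, -⟩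
  · exact Or.inl ⟨h1, hg.of_dominated hh.isRegulated H⟩
  · obtain ⟨q, hq, hpq, hg⟩ := hg0.exists_one_le hp
    obtain ⟨r, hr, hpr, hh⟩ := hh.exists_one_le hp
    refine Or.inr ⟨hp, max q r, by positivity, ?_,
      BoundedPVariation.of_dominated (hq.trans (le_max_left _ _)) (hg.mono (by linarith)
        (le_max_left _ _)) (hh.mono (by linarith) (le_max_right _ _)) hC H⟩
    rcases max_choice q r with e | e <;> rw [e] <;> assumption

theorem MonotoneOn.memDualW (hp : 1 ≤ p) (hF : MonotoneOn F (Icc a b)) : MemDualW a b p F := by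
  rcases eq_or_lt_of_le hp with h | h
  · exact Or.inl ⟨h.symm, hF.isRegulated⟩
  · refine Or.inr ⟨h, 1, one_pos, ?_, hF.isControl_one.boundedPVariation⟩
    have : 0 < 1 / p := by positivity
    simpa using this

theorem MemDualW.mul (hg : MemDualW a b p g) (hh : MemDualW a b p h) :
    MemDualW a b p (fun x => g x * h x) := by
  obtain ⟨M, hM0, hM⟩ := hg.isRegulated.exists_bound
  obtain ⟨K, hK0, hK⟩ := hh.isRegulated.exists_bound
  refine hg.of_dominated hh (add_nonneg hM0 hK0) fun s hs t ht _ => ?_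
  calc |g t * h t - g s * h s| = |g t * (h t - h s) + h s * (g t - g s)| := by congr 1; ring
    _ ≤ |g t| * |h t - h s| + |h s| * |g t - g s| := by
        rw [← abs_mul, ← abs_mul]; exact abs_add_le _ _
    _ ≤ (M + K) * |h t - h s| + (M + K) * |g t - g s| := by
        have := hM t ht; have := hK s hs
        gcongr <;> linarith
    _ = _ := by ring

theorem MemDualW.neg (hg : MemDualW a b p g) : MemDualW a b p (fun x => -g x) :=
  hg.of_dominated hg (C := 1) zero_le_one fun s _ t _ _ => by
    rw [show -g t - -g s = -(g t - g s) by ring, abs_neg]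
    linarith [abs_nonneg (g t - g s)]

/-- For `1 ≤ p < 2`, functions of bounded `p`-variation belong to the dual class. -/
theorem BoundedPVariation.memDualW (hp : 1 ≤ p) (hp2 : p < 2) (hf : BoundedPVariation a b p f) :
    MemDualW a b p f := by
  rcases eq_or_lt_of_le hp with h | h
  · exact Or.inl ⟨h.symm, hf.isRegulated (by linarith)⟩
  · refine Or.inr ⟨h, p, by linarith, ?_, hf⟩
    have : 1 / 2 < 1 / p := one_div_lt_one_div_of_lt (by linarith) hp2
    linarith

end Controls

end

noncomputable section

/-! ### Jumps of monotone functions -/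

section Jumps

variable {a b p q : ℝ} {f g h F G φ : ℝ → ℝ}

/-- All jumps of `f`, the left ones indexed by `Sum.inl`, the right ones by `Sum.inr`. -/
def jumps (f : ℝ → ℝ) : ℝ ⊕ ℝ → ℝ := Sum.elim (leftJump f) (rightJump f)

/-- The indices of the jumps that belong to `[s,t]`: left jumps on `(s,t]`, right jumps on
`[s,t)`. -/
def jumpSet (s t : ℝ) : Set (ℝ ⊕ ℝ) := Sum.elim (Ioc s t) (Ico s t)

@[simp] theorem jumps_inl (f : ℝ → ℝ) (x : ℝ) : jumps f (Sum.inl x) = leftJump f x := rfl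

@[simp] theorem jumps_inr (f : ℝ → ℝ) (x : ℝ) : jumps f (Sum.inr x) = rightJump f x := rfl

@[simp] theorem inl_mem_jumpSet {s t x : ℝ} : Sum.inl x ∈ jumpSet s t ↔ x ∈ Ioc s t := Iff.rfl

@[simp] theorem inr_mem_jumpSet {s t x : ℝ} : Sum.inr x ∈ jumpSet s t ↔ x ∈ Ico s t := Iff.rfl

theorem jumpSet_mono {s t s' t' : ℝ} (hs : s' ≤ s) (ht : t ≤ t') : jumpSet s t ⊆ jumpSet s' t' := by
  rintro (x | x) hx
  exacts [⟨hs.trans_lt hx.1, hx.2.trans ht⟩, ⟨hs.trans hx.1, hx.2.trans_le ht⟩]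

theorem rightJump_le_of_le {t : ℝ} (hf : IsRegulated a b f) (ht : t ∈ Ico a b) {c : ℝ}
    (h : ∀ s ∈ Ioc t b, f s - f t ≤ c) : rightJump f t ≤ c := by
  have h1 := (hf.tendsto_right ht).sub (tendsto_const_nhds (x := f t))
  rw [add_sub_cancel_left] at h1
  refine le_of_tendsto h1 ?_
  filter_upwards [Ioo_mem_nhdsGT ht.2] with s hs using h s ⟨hs.1, hs.2.le⟩

theorem MonotoneOn.leftJump_nonneg (hF : MonotoneOn F (Icc a b)) {t : ℝ} (ht : t ∈ Ioc a b) :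
    0 ≤ leftJump F t := by
  have h1 := (tendsto_const_nhds (x := F t)).sub (hF.isRegulated.tendsto_left ht)
  rw [sub_sub_cancel] at h1
  refine ge_of_tendsto h1 ?_
  filter_upwards [Ioo_mem_nhdsLT ht.1] with s hs
  exact sub_nonneg.2 (hF ⟨hs.1.le, hs.2.le.trans ht.2⟩ ⟨ht.1.le, ht.2⟩ hs.2.le)

theorem MonotoneOn.rightJump_nonneg (hF : MonotoneOn F (Icc a b)) {t : ℝ} (ht : t ∈ Ico a b) :
    0 ≤ rightJump F t := by
  have h1 := (hF.isRegulated.tendsto_right ht).sub (tendsto_const_nhds (x := F t))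
  rw [add_sub_cancel_left] at h1
  refine ge_of_tendsto h1 ?_
  filter_upwards [Ioo_mem_nhdsGT ht.2] with s hs
  exact sub_nonneg.2 (hF ⟨ht.1, ht.2.le⟩ ⟨ht.1.trans hs.1.le, hs.2.le⟩ hs.1.le)

theorem MonotoneOn.jumps_nonneg (hF : MonotoneOn F (Icc a b)) {i : ℝ ⊕ ℝ} (hi : i ∈ jumpSet a b) :
    0 ≤ jumps F i := by
  rcases i with x | x
  exacts [hF.leftJump_nonneg hi, hF.rightJump_nonneg hi]

/-- The jumps of a monotone function on `[s,t]` add up to at most its increment. -/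
theorem MonotoneOn.sum_jumps_le (hF : MonotoneOn F (Icc a b)) (T : Finset (ℝ ⊕ ℝ)) :
    ∀ s t, a ≤ s → s ≤ t → t ≤ b → (T : Set (ℝ ⊕ ℝ)) ⊆ jumpSet s t →
      ∑ i ∈ T, jumps F i ≤ F t - F s := by
  classical
  -- The jumps are removed from right to left. In the lexicographic order the left jump at a point
  -- precedes the right jump at the same point.
  induction T using Finset.induction_on_max_value
    (fun i : ℝ ⊕ ℝ => (Sum.elim (fun x => toLex (x, false)) (fun x => toLex (x, true)) i :
      ℝ ×ₗ Bool)) with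
  | empty =>
    intro s t hs hst ht _
    simpa using hF ⟨hs, hst.trans ht⟩ ⟨hs.trans hst, ht⟩ hst
  | insert i T hi hmax ih =>
    intro s t hs hst ht hT
    rw [Finset.sum_insert hi]
    rw [Finset.coe_insert, insert_subset_iff] at hT
    obtain ⟨hit, hT⟩ := hT
    rcases i with c | c
    · have hc : c ∈ Ioc s t := hit
      have hcab : c ∈ Ioc a b := ⟨hs.trans_lt hc.1, hc.2.trans ht⟩
      -- When the last jump is the left jump at `c`, the others occur strictly before `c`, hence in
      -- `[s,z]` for `z` close to `c` from the left. The induction hypothesis on `[s,z]` then passes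
      -- to the limit and leaves room for `leftJump F c`.
      have hlt : ∀ᶠ z in 𝓝[<] c, ∀ x ∈ T, x ∈ jumpSet s z := by
        rw [Finset.eventually_all]
        rintro (x | x) hx
        · have h1 := hmax _ hx
          have h2 : x < c := by
            simp only [Sum.elim_inl, Prod.Lex.toLex_le_toLex] at h1
            rcases h1 with h1 | h1
            · exact h1
            · exact absurd (h1.1 ▸ hx) hi
          filter_upwards [Ioo_mem_nhdsLT h2] with z hz using ⟨(hT hx).1, hz.1.le⟩
        · have h1 := hmax _ hx
          have h2 : x < c := by
            simp only [Sum.elim_inl, Sum.elim_inr, Prod.Lex.toLex_le_toLex] at h1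
            rcases h1 with h1 | h1
            · exact h1
            · exact absurd h1.2 (by decide)
          filter_upwards [Ioo_mem_nhdsLT h2] with z hz using ⟨(hT hx).1, hz.1⟩
      have h3 : ∑ i ∈ T, jumps F i ≤ F c - leftJump F c - F s := by
        refine ge_of_tendsto ((hF.isRegulated.tendsto_left hcab).sub_const (F s)) ?_
        filter_upwards [hlt, Ioo_mem_nhdsLT hc.1] with z hz hz'
        exact ih s z hs hz'.1.le (hz'.2.le.trans hcab.2) hz
      have h4 : F c ≤ F t := hF ⟨hcab.1.le, hcab.2⟩ ⟨hs.trans hst, ht⟩ hc.2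
      simp only [jumps_inl]
      linarith
    · have hc : c ∈ Ico s t := hit
      -- When the last jump is the right jump at `c`, the others belong to `[s,c]`.
      have h3 := ih s c hs hc.1 (hc.2.le.trans ht) fun x hx => by
        have h1 := hmax _ hx
        rcases x with x | x
        · simp only [Sum.elim_inl, Sum.elim_inr, Prod.Lex.toLex_le_toLex] at h1
          exact ⟨(hT hx).1, h1.elim le_of_lt fun h => h.1.le⟩
        · simp only [Sum.elim_inr, Prod.Lex.toLex_le_toLex] at h1
          rcases h1 with h1 | h1
          · exact ⟨(hT hx).1, h1⟩
          · exact absurd (h1.1 ▸ hx) hi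
      have h4 : rightJump F c ≤ F t - F c := by
        refine rightJump_le_of_le (a := a) (b := t) (hF.isRegulated.mono le_rfl ht)
          ⟨hs.trans hc.1, hc.2⟩ fun z hz => ?_
        have := hF ⟨hs.trans (hc.1.trans hz.1.le), hz.2.trans ht⟩ ⟨hs.trans hst, ht⟩ hz.2
        linarith
      simp only [jumps_inr]
      linarith

theorem IsControl.leftJump_le (hp : 0 < p) (hF : IsControl a b p f F) {t : ℝ} (ht : t ∈ Ioc a b) :
    |leftJump f t| ^ p ≤ leftJump F t := by
  have h1 := (tendsto_const_nhds (x := f t)).sub ((hF.isRegulated hp).tendsto_left ht)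
  have h2 := (tendsto_const_nhds (x := F t)).sub (hF.1.isRegulated.tendsto_left ht)
  rw [sub_sub_cancel] at h1 h2
  refine le_of_tendsto_of_tendsto (h1.abs.rpow_const (Or.inr hp.le)) h2 ?_
  filter_upwards [Ioo_mem_nhdsLT ht.1] with s hs
  exact hF.2 s ⟨hs.1.le, hs.2.le.trans ht.2⟩ t ⟨ht.1.le, ht.2⟩ hs.2.le

theorem IsControl.rightJump_le (hp : 0 < p) (hF : IsControl a b p f F) {t : ℝ}
    (ht : t ∈ Ico a b) : |rightJump f t| ^ p ≤ rightJump F t := by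
  have h1 := ((hF.isRegulated hp).tendsto_right ht).sub (tendsto_const_nhds (x := f t))
  have h2 := (hF.1.isRegulated.tendsto_right ht).sub (tendsto_const_nhds (x := F t))
  rw [add_sub_cancel_left] at h1 h2
  refine le_of_tendsto_of_tendsto (h1.abs.rpow_const (Or.inr hp.le)) h2 ?_
  filter_upwards [Ioo_mem_nhdsGT ht.2] with s hs
  exact hF.2 t ⟨ht.1, ht.2.le⟩ s ⟨ht.1.trans hs.1.le, hs.2.le⟩ hs.1.le

theorem IsRegulated.abs_leftJump_le (hf : IsRegulated a b f) {t : ℝ} (ht : t ∈ Ioc a b) {η : ℝ}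
    (h : ∀ s ∈ Icc a b, |f s| ≤ η) : |leftJump f t| ≤ 2 * η := by
  have h1 := ((tendsto_const_nhds (x := f t)).sub (hf.tendsto_left ht)).abs
  rw [sub_sub_cancel] at h1
  refine le_of_tendsto h1 ?_
  filter_upwards [Ioo_mem_nhdsLT ht.1] with s hs
  have := abs_sub (f t) (f s)
  have := h t ⟨ht.1.le, ht.2⟩
  have := h s ⟨hs.1.le, hs.2.le.trans ht.2⟩
  linarith

end Jumps

/-! ### Bounds for sums of Riemann–Stieltjes type -/

section Pairing

variable {a b p q : ℝ} {f g h F G φ ψ : ℝ → ℝ}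

/-- `C` bounds all sums `∑ φ(yᵢ)(h(xᵢ₊₁) - h(xᵢ))` and the sums of the products of a left jump of
`φ` and a right jump of `h`. -/
structure PairingBound (a b : ℝ) (φ h : ℝ → ℝ) (C : ℝ) : Prop where
  sum_le : ∀ (n : ℕ) (x y : ℕ → ℝ), Monotone x → Monotone y → (∀ i, x i ∈ Icc a b) →
    (∀ i, y i ∈ Icc a b) → |∑ i ∈ Finset.range n, φ (y i) * (h (x (i + 1)) - h (x i))| ≤ C
  jump_le : ∀ T : Finset ℝ, (T : Set ℝ) ⊆ Ioo a b →
    ∑ x ∈ T, |leftJump φ x * rightJump h x| ≤ C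

/-- Bookkeeping for the deletion of one node from a Riemann–Stieltjes sum: the terms `k` and `k + 1`
merge into one and the later terms are shifted. -/
theorem sum_range_sub_of_merge {A A' : ℕ → ℝ} {k n : ℕ} (hk : k ≤ n) (h1 : ∀ i < k, A' i = A i)
    (h2 : ∀ i, k < i → A' i = A (i + 1)) :
    ∑ i ∈ Finset.range (n + 2), A i =
      ∑ i ∈ Finset.range (n + 1), A' i + (A k + A (k + 1) - A' k) := by
  obtain ⟨m, rfl⟩ := Nat.exists_eq_add_of_le hk
  rw [show k + m + 2 = k + (m + 1 + 1) by ring, show k + m + 1 = k + (m + 1) by ring,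
    Finset.sum_range_add A k, Finset.sum_range_add A' k,
    Finset.sum_range_succ' (fun x => A (k + x)), Finset.sum_range_succ' (fun x => A (k + (x + 1))),
    Finset.sum_range_succ' (fun x => A' (k + x)),
    Finset.sum_congr rfl fun i hi => h1 i (Finset.mem_range.1 hi),
    Finset.sum_congr rfl fun i _ => h2 (k + (i + 1)) (by omega)]
  simp only [add_zero, zero_add, ← add_assoc]
  ring

theorem sum_sub_le_of_monotoneOn (hF : MonotoneOn F (Icc a b)) {x : ℕ → ℝ}
    (hxm : ∀ i, x i ∈ Icc a b) (k n : ℕ) :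
    ∑ i ∈ Finset.range n, (F (x (i + k + 1)) - F (x (i + k))) ≤ F b - F a := by
  have := Finset.sum_range_sub (fun i => F (x (i + k))) n
  simp only [add_right_comm _ 1 k] at this
  rw [this]
  have hab : a ≤ b := (hxm 0).1.trans (hxm 0).2
  have h1 := hF (hxm (n + k)) (right_mem_Icc.2 hab) (hxm _).2
  have h2 := hF (left_mem_Icc.2 hab) (hxm (0 + k)) (hxm _).1
  linarith

/-- The Love–Young inequality for sums. -/
theorem abs_sum_sub_le_of_controls (hF : MonotoneOn F (Icc a b)) (hG : MonotoneOn G (Icc a b))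
    {D θ : ℝ} (hD : ∀ s ∈ Icc a b, ∀ t ∈ Icc a b, s ≤ t → ∀ s' ∈ Icc a b, ∀ t' ∈ Icc a b,
      s' ≤ t' → ∀ c, F t - F s ≤ c → G t' - G s' ≤ c →
      |φ t - φ s| * |h t' - h s'| ≤ D * c ^ θ) (n : ℕ) :
    ∀ x y : ℕ → ℝ, Monotone x → Monotone y → (∀ i, x i ∈ Icc a b) → (∀ i, y i ∈ Icc a b) →
      |∑ i ∈ Finset.range (n + 1), φ (y i) * (h (x (i + 1)) - h (x i)) -
          φ (y 0) * (h (x (n + 1)) - h (x 0))| ≤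
        ∑ k ∈ Finset.range n, D * ((F b - F a + (G b - G a)) / (k + 1)) ^ θ := by
  set V := F b - F a + (G b - G a)
  induction n with
  | zero => intro x y _ _ _ _; simp
  | succ n ih =>
    intro x y hx hy hxm hym
    -- Pigeonhole: `n + 1` nodes share a total variation of at most `V`, so at one of them it is at
    -- most `V / (n + 1)`. Deleting this node changes the sum by the product of the increment of `φ`
    -- over `[y k, y (k+1)]` and that of `h` over `[x (k+1), x (k+2)]`.
    obtain ⟨k, hk, hkV⟩ : ∃ k ∈ Finset.range (n + 1),
        (F (y (k + 0 + 1)) - F (y (k + 0))) + (G (x (k + 1 + 1)) - G (x (k + 1))) ≤ V / (n + 1) := by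
      refine Finset.exists_le_of_sum_le (by simp) ?_
      rw [Finset.sum_add_distrib, Finset.sum_const, Finset.card_range, nsmul_eq_mul]
      have h1 := sum_sub_le_of_monotoneOn hF hym 0 (n + 1)
      have h2 := sum_sub_le_of_monotoneOn hG hxm 1 (n + 1)
      have h3 : ((n + 1 : ℕ) : ℝ) * (V / (n + 1)) = V := by push_cast; field_simp
      rw [h3]
      exact add_le_add h1 h2
    have hkn : k ≤ n := Nat.lt_succ_iff.1 (Finset.mem_range.1 hk)
    rw [add_zero] at hkV
    have hFk := sub_nonneg.2 (hF (hym k) (hym (k + 1)) (hy (Nat.le_succ k)))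
    have hGk := sub_nonneg.2 (hG (hxm (k + 1)) (hxm (k + 1 + 1)) (hx (Nat.le_succ (k + 1))))
    -- The enumeration that skips the index `k + 1`.
    set r : ℕ → ℕ := fun i => if i ≤ k then i else i + 1 with hr
    have hrm : Monotone r := by
      intro i j hij
      simp only [hr]
      split_ifs <;> omega
    have ih' := ih (x ∘ r) (y ∘ r) (hx.comp hrm) (hy.comp hrm) (fun i => hxm _) (fun i => hym _)
    have hr0 : r 0 = 0 := by simp [hr]
    have hrn : r (n + 1) = n + 1 + 1 := by simp [hr]; omega
    simp only [Function.comp, hr0, hrn] at ih'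
    have hmerge := sum_range_sub_of_merge
      (A := fun i => φ (y i) * (h (x (i + 1)) - h (x i)))
      (A' := fun i => φ (y (r i)) * (h (x (r (i + 1))) - h (x (r i)))) hkn
      (fun i hi => by
        have e1 : r i = i := by simp [hr, hi.le]
        have e2 : r (i + 1) = i + 1 := by simp [hr, Nat.succ_le_of_lt hi]
        simp only [e1, e2])
      (fun i hi => by
        have e1 : r i = i + 1 := by simp [hr, hi]
        have e2 : r (i + 1) = i + 1 + 1 := by simp [hr]; omega
        simp only [e1, e2])
    have e1 : r k = k := by simp [hr]
    have e2 : r (k + 1) = k + 1 + 1 := by simp [hr]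
    simp only [e1, e2] at hmerge
    rw [Finset.sum_range_succ (fun k : ℕ => D * (V / (k + 1)) ^ θ)]
    rw [show n + 1 + 1 = n + 2 from rfl] at ih' ⊢
    rw [hmerge]
    have hDk := hD _ (hym k) _ (hym (k + 1)) (hy (Nat.le_succ k)) _ (hxm (k + 1)) _
      (hxm (k + 1 + 1)) (hx (Nat.le_succ (k + 1))) (V / (n + 1)) (by linarith) (by linarith)
    rw [← abs_mul] at hDk
    refine le_trans (le_of_eq ?_) ((abs_add_le _ _).trans (add_le_add ih' hDk))
    congr 1
    ring

/-- Interpolation: the part `x ^ α` is estimated by the uniform bound `η`, the part `x ^ (1 - α)` by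
the control. Some of the Young exponent is traded for a factor which is small when `x` is uniformly
small. -/
theorem mul_le_rpow_of_rpow_le {x y c η α : ℝ} (hx : 0 ≤ x) (hy : 0 ≤ y) (hp : 0 < p) (hq : 0 < q)
    (hα : 0 ≤ α) (hα1 : α ≤ 1) (hxη : x ≤ η) (hxc : x ^ q ≤ c) (hyc : y ^ p ≤ c) :
    x * y ≤ η ^ α * c ^ (1 / p + (1 - α) / q) := by
  have hc : 0 ≤ c := (Real.rpow_nonneg hx q).trans hxc
  have h1 : x ≤ c ^ q⁻¹ := (Real.le_rpow_inv_iff_of_pos hx hc hq).2 hxc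
  have h2 : y ≤ c ^ p⁻¹ := (Real.le_rpow_inv_iff_of_pos hy hc hp).2 hyc
  have h3 : x = x ^ α * x ^ (1 - α) := by
    rw [← Real.rpow_add_of_nonneg hx hα (sub_nonneg.2 hα1)]; simp
  have h4 : c ^ (1 / p + (1 - α) / q) = (c ^ q⁻¹) ^ (1 - α) * c ^ p⁻¹ := by
    rw [← Real.rpow_mul hc, ← Real.rpow_add_of_nonneg hc
      (mul_nonneg (inv_nonneg.2 hq.le) (sub_nonneg.2 hα1)) (inv_nonneg.2 hp.le)]
    congr 1; field_simp; ring
  have hη := hx.trans hxη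
  have hα2 := sub_nonneg.2 hα1
  rw [h4, ← mul_assoc]
  nth_rewrite 1 [h3]
  gcongr

/-- The case `p = 1`: supremum norm times total variation. The factor `2` is due to the left jumps
of `ψ`, which are bounded by `2 * η` only. -/
theorem PairingBound.of_sup_le (hab : a ≤ b) (hψ : IsRegulated a b ψ) {η : ℝ}
    (hη : ∀ t ∈ Icc a b, |ψ t| ≤ η) (hG : IsControl a b 1 h G) :
    PairingBound a b ψ h (2 * η * (G b - G a)) := by
  have hη0 : 0 ≤ η := (abs_nonneg _).trans (hη a (left_mem_Icc.2 hab))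
  have hGab := sub_nonneg.2 (hG.1 (left_mem_Icc.2 hab) (right_mem_Icc.2 hab) hab)
  refine ⟨fun n x y hx hy hxm hym => ?_, fun T hT => ?_⟩
  · calc |∑ i ∈ Finset.range n, ψ (y i) * (h (x (i + 1)) - h (x i))|
        ≤ ∑ i ∈ Finset.range n, η * (G (x (i + 0 + 1)) - G (x (i + 0))) := by
          refine (Finset.abs_sum_le_sum_abs _ _).trans (Finset.sum_le_sum fun i _ => ?_)
          rw [abs_mul]
          have := hG.2 _ (hxm i) _ (hxm (i + 1)) (hx (Nat.le_succ i))
          rw [Real.rpow_one] at this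
          exact mul_le_mul (hη _ (hym i)) this (abs_nonneg _) hη0
      _ ≤ η * (G b - G a) := by
          rw [← Finset.mul_sum]
          exact mul_le_mul_of_nonneg_left (sum_sub_le_of_monotoneOn hG.1 hxm 0 n) hη0
      _ ≤ _ := by nlinarith
  · calc ∑ x ∈ T, |leftJump ψ x * rightJump h x| ≤ ∑ x ∈ T, 2 * η * rightJump G x := by
          refine Finset.sum_le_sum fun x hx => ?_
          have hx := hT hx
          rw [abs_mul]
          have := hG.rightJump_le one_pos ⟨hx.1.le, hx.2⟩
          rw [Real.rpow_one] at this
          exact mul_le_mul (hψ.abs_leftJump_le ⟨hx.1, hx.2.le⟩ hη) this (abs_nonneg _)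
            (by positivity)
      _ ≤ 2 * η * (G b - G a) := by
          rw [← Finset.mul_sum]
          refine mul_le_mul_of_nonneg_left ?_ (by positivity)
          have := hG.1.sum_jumps_le (T.map ⟨Sum.inr, Sum.inr_injective⟩) a b le_rfl hab le_rfl
            (by
              intro i hi
              obtain ⟨x, hx, rfl⟩ := Finset.mem_map.1 (Finset.mem_coe.1 hi)
              exact ⟨(hT hx).1.le, (hT hx).2⟩)
          simpa using this

/-- Deleting the nodes one by one leaves `ψ (y 0)` times a single increment of `h`, which gives `η *
(2 * H)`; the deletions cost a multiple of the convergent series of `k ^ (-θ)`. The extra `1` beside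
the series pays for the jump products, where `Σ c ^ θ ≤ V ^ (θ - 1) * Σ c`. For `α > 0` the bound
tends to `0` with `η` while `V` stays fixed. -/
theorem PairingBound.of_controls (hab : a ≤ b) (hp : 1 ≤ p) (hq : 1 ≤ q) {α : ℝ} (hα : 0 ≤ α)
    (hα1 : α ≤ 1) (hθ : 1 < 1 / p + (1 - α) / q) {η H V : ℝ} (hη : ∀ t ∈ Icc a b, |ψ t| ≤ η)
    (hH : ∀ t ∈ Icc a b, |h t| ≤ H) (hF : IsControl a b q ψ F) (hG : IsControl a b p h G)
    (hV : F b - F a + (G b - G a) ≤ V) :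
    PairingBound a b ψ h (η * (2 * H) + (2 * η) ^ α * (V ^ (1 / p + (1 - α) / q) *
      (1 + ∑' k : ℕ, 1 / ((k + 1 : ℕ) : ℝ) ^ (1 / p + (1 - α) / q)))) := by
  have hp0 : 0 < p := by linarith
  have hq0 : 0 < q := by linarith
  set θ := 1 / p + (1 - α) / q with hθd
  have hη0 : 0 ≤ η := (abs_nonneg _).trans (hη a (left_mem_Icc.2 hab))
  have hH0 : 0 ≤ H := (abs_nonneg _).trans (hH a (left_mem_Icc.2 hab))
  have hFab := sub_nonneg.2 (hF.1 (left_mem_Icc.2 hab) (right_mem_Icc.2 hab) hab)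
  have hGab := sub_nonneg.2 (hG.1 (left_mem_Icc.2 hab) (right_mem_Icc.2 hab) hab)
  have hV0 : 0 ≤ V := by linarith
  have hsum : Summable fun k : ℕ => 1 / ((k + 1 : ℕ) : ℝ) ^ θ :=
    (summable_nat_add_iff 1).2 (Real.summable_one_div_nat_rpow.2 hθ)
  set Z := ∑' k : ℕ, 1 / ((k + 1 : ℕ) : ℝ) ^ θ with hZ
  have hZ0 : 0 ≤ Z := tsum_nonneg fun k => by positivity
  have hD : ∀ s ∈ Icc a b, ∀ t ∈ Icc a b, s ≤ t → ∀ s' ∈ Icc a b, ∀ t' ∈ Icc a b,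
      s' ≤ t' → ∀ c, F t - F s ≤ c → G t' - G s' ≤ c →
      |ψ t - ψ s| * |h t' - h s'| ≤ (2 * η) ^ α * c ^ θ := by
    intro s hs t ht hst s' hs' t' ht' hst' c h1 h2
    refine mul_le_rpow_of_rpow_le (abs_nonneg _) (abs_nonneg _) hp0 hq0 hα hα1 ?_
      ((hF.2 s hs t ht hst).trans h1) ((hG.2 s' hs' t' ht' hst').trans h2)
    have := abs_sub (ψ t) (ψ s); have := hη t ht; have := hη s hs; linarith
  refine ⟨fun n x y hx hy hxm hym => ?_, fun T hT => ?_⟩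
  · rcases n with _ | n
    · simp only [Finset.range_zero, Finset.sum_empty, abs_zero]
      positivity
    have h1 := abs_sum_sub_le_of_controls hF.1 hG.1 hD n x y hx hy hxm hym
    have h2 : ∑ k ∈ Finset.range n, (2 * η) ^ α * ((F b - F a + (G b - G a)) / (k + 1)) ^ θ ≤
        (2 * η) ^ α * (V ^ θ * Z) := by
      rw [← Finset.mul_sum]
      refine mul_le_mul_of_nonneg_left ?_ (by positivity)
      calc ∑ k ∈ Finset.range n, ((F b - F a + (G b - G a)) / (k + 1)) ^ θ
          ≤ ∑ k ∈ Finset.range n, V ^ θ * (1 / ((k + 1 : ℕ) : ℝ) ^ θ) := by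
            refine Finset.sum_le_sum fun k _ => ?_
            rw [Real.div_rpow (by positivity) (by positivity), mul_one_div]
            push_cast
            gcongr
        _ ≤ V ^ θ * Z := by
            rw [← Finset.mul_sum]
            exact mul_le_mul_of_nonneg_left
              (hsum.sum_le_tsum _ fun k _ => by positivity) (by positivity)
    have h3 : |ψ (y 0) * (h (x (n + 1)) - h (x 0))| ≤ η * (2 * H) := by
      rw [abs_mul]
      refine mul_le_mul (hη _ (hym 0)) ?_ (abs_nonneg _) hη0
      have := abs_sub (h (x (n + 1))) (h (x 0))
      have := hH _ (hxm (n + 1)); have := hH _ (hxm 0); linarith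
    have h4 := abs_sub_abs_le_abs_sub (∑ i ∈ Finset.range (n + 1), ψ (y i) *
      (h (x (i + 1)) - h (x i))) (ψ (y 0) * (h (x (n + 1)) - h (x 0)))
    have h5 : 0 ≤ (2 * η) ^ α * V ^ θ := by positivity
    rw [mul_add, mul_one, mul_add]
    linarith
  · calc ∑ x ∈ T, |leftJump ψ x * rightJump h x|
        ≤ ∑ x ∈ T, (2 * η) ^ α * (V ^ (θ - 1) * (leftJump F x + rightJump G x)) := by
          refine Finset.sum_le_sum fun x hx => ?_
          have hx := hT hx
          have hxl : x ∈ Ioc a b := ⟨hx.1, hx.2.le⟩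
          have hxr : x ∈ Ico a b := ⟨hx.1.le, hx.2⟩
          have g1 := hF.1.leftJump_nonneg hxl
          have g2 := hG.1.rightJump_nonneg hxr
          have g3 : leftJump F x ≤ F b - F a := by
            have := hF.1.sum_jumps_le {Sum.inl x} a b le_rfl hab le_rfl (by simpa using hxl)
            simpa using this
          have g4 : rightJump G x ≤ G b - G a := by
            have := hG.1.sum_jumps_le {Sum.inr x} a b le_rfl hab le_rfl (by simpa using hxr)
            simpa using this
          rw [abs_mul]
          refine (mul_le_rpow_of_rpow_le (abs_nonneg _) (abs_nonneg _) hp0 hq0 hα hα1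
            ((hF.isRegulated hq0).abs_leftJump_le hxl hη)
            ((hF.leftJump_le hq0 hxl).trans (le_add_of_nonneg_right g2))
            ((hG.rightJump_le hp0 hxr).trans (le_add_of_nonneg_left g1))).trans ?_
          refine mul_le_mul_of_nonneg_left ?_ (by positivity)
          rw [← hθd]
          have e : (leftJump F x + rightJump G x) ^ θ =
              (leftJump F x + rightJump G x) ^ (θ - 1) * (leftJump F x + rightJump G x) := by
            nth_rewrite 3 [← Real.rpow_one (leftJump F x + rightJump G x)]
            rw [← Real.rpow_add_of_nonneg (by positivity) (by linarith) zero_le_one,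
              sub_add_cancel]
          rw [e]
          have : 0 ≤ θ - 1 := by linarith
          gcongr
          linarith
      _ ≤ (2 * η) ^ α * (V ^ (θ - 1) * V) := by
          rw [← Finset.mul_sum, ← Finset.mul_sum, Finset.sum_add_distrib]
          have h1 := hG.1.sum_jumps_le (T.map ⟨Sum.inr, Sum.inr_injective⟩) a b le_rfl hab le_rfl
            (by
              intro i hi
              obtain ⟨x, hx, rfl⟩ := Finset.mem_map.1 (Finset.mem_coe.1 hi)
              exact ⟨(hT hx).1.le, (hT hx).2⟩)
          have h2 := hF.1.sum_jumps_le (T.map ⟨Sum.inl, Sum.inl_injective⟩) a b le_rfl hab le_rfl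
            (by
              intro i hi
              obtain ⟨x, hx, rfl⟩ := Finset.mem_map.1 (Finset.mem_coe.1 hi)
              exact ⟨(hT hx).1, (hT hx).2.le⟩)
          simp only [Finset.sum_map, Function.Embedding.coeFn_mk, jumps_inl, jumps_inr] at h1 h2
          gcongr
          linarith
      _ = (2 * η) ^ α * V ^ θ := by
          congr 1
          nth_rewrite 2 [← Real.rpow_one V]
          rw [← Real.rpow_add_of_nonneg hV0 (by linarith) zero_le_one, sub_add_cancel]
      _ ≤ _ := by
          rw [mul_add, mul_one, mul_add]
          have : 0 ≤ (2 * η) ^ α * (V ^ θ * Z) := by positivity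
          have : 0 ≤ η * (2 * H) := by positivity
          linarith

/-- Functions of the dual class are approximated by step functions, uniformly over all sums of
Riemann–Stieltjes type with respect to a function of bounded `p`-variation. -/
theorem MemDualW.exists_pairingBound (hab : a ≤ b) (hp : 1 ≤ p) (hφ : MemDualW a b p φ)
    (hh : BoundedPVariation a b p h) {ε : ℝ} (hε : 0 < ε) :
    ∃ σ ∈ stepSpan, PairingBound a b (φ - σ) h ε := by
  have hp0 : 0 < p := by linarith
  obtain ⟨G, hG⟩ := hh.exists_control hp0
  have hGab := sub_nonneg.2 (hG.1 (left_mem_Icc.2 hab) (right_mem_Icc.2 hab) hab)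
  have mono : ∀ {ψ : ℝ → ℝ} {C C' : ℝ}, PairingBound a b ψ h C → C ≤ C' → PairingBound a b ψ h C' :=
    fun h hC => ⟨fun n x y h1 h2 h3 h4 => (h.sum_le n x y h1 h2 h3 h4).trans hC,
      fun T hT => (h.jump_le T hT).trans hC⟩
  have hφr := hφ.isRegulated
  rcases eq_or_lt_of_le hp with rfl | hp1
  · set η := ε / (2 * (G b - G a + 1)) with hη
    obtain ⟨τ, σ, hσ, -, -, -, h⟩ := hφr.exists_step hab (ε := η) (by positivity)
    refine ⟨σ, hσ, mono (PairingBound.of_sup_le hab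
      (hφr.sub (isRegulated_of_mem_stepSpan hσ)) h hG) ?_⟩
    calc 2 * η * (G b - G a) ≤ 2 * η * (G b - G a + 1) := by
          have : 0 < η := by positivity
          gcongr; linarith
      _ = ε := by rw [hη]; field_simp
  · obtain ⟨q, hq, hpq, hφq⟩ := hφ.exists_one_le hp1
    have hq0 : 0 < q := by linarith
    obtain ⟨F, hF⟩ := hφq.exists_control hq0
    obtain ⟨H, hH0, hH⟩ := (hG.isRegulated hp0).exists_bound
    -- With this choice the exponent is `1 + (1/p + 1/q - 1) / 2`: half of the surplus in `1/p + 1/q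
    -- > 1` keeps the series convergent, the other half buys the small factor.
    set α := (1 - q * (1 - 1 / p)) / 2 with hα
    have e1 : (1 - α) / q = 1 / q - (1 / p + 1 / q - 1) / 2 := by rw [hα]; field_simp; ring
    have hα0 : 0 < α := by
      have : 0 < q * (1 / p + 1 / q - 1) := mul_pos hq0 (by linarith)
      have e : q * (1 / p + 1 / q - 1) = 1 - q * (1 - 1 / p) := by field_simp; ring
      rw [hα, ← e]; positivity
    have hα1 : α ≤ 1 := by
      have : 1 / p ≤ 1 := by rw [div_le_one hp0]; exact hp
      have : 0 ≤ q * (1 - 1 / p) := mul_nonneg hq0.le (by linarith)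
      rw [hα]; linarith
    have hθ : 1 < 1 / p + (1 - α) / q := by rw [e1]; linarith
    -- This bound for the total control of `φ - σ` and `h` does not depend on the accuracy `η` of
    -- the approximation, so `η` may be chosen afterwards.
    set V := 2 ^ q * (2 * (F b - F a)) + (G b - G a) with hV
    set K := V ^ (1 / p + (1 - α) / q) *
      (1 + ∑' k : ℕ, 1 / ((k + 1 : ℕ) : ℝ) ^ (1 / p + (1 - α) / q)) with hK
    have hlim : Tendsto (fun η : ℝ => η * (2 * H) + (2 * η) ^ α * K) (𝓝[>] 0) (𝓝 0) := by
      have h1 : Tendsto (fun η : ℝ => η) (𝓝[>] 0) (𝓝 0) := nhdsWithin_le_nhds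
      have h2 := (h1.mul_const (2 * H)).add
        (((h1.const_mul 2).rpow_const (p := α) (Or.inr hα0.le)).mul_const K)
      simpa [Real.zero_rpow hα0.ne'] using h2
    obtain ⟨η, hηε, hη⟩ := ((hlim.eventually (gt_mem_nhds hε)).and self_mem_nhdsWithin).exists
    obtain ⟨τ, σ, hσ, hτ, hτm, hστ, hφσ⟩ := hφr.exists_step hab hη
    have ha := left_mem_Icc.2 hab
    have hb := right_mem_Icc.2 hab
    have hctrl : IsControl a b q (φ - σ) (fun t => 2 ^ q * (F t + F (τ t))) := by
      refine ⟨fun s hs t ht hst => ?_, fun s hs t ht hst => ?_⟩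
      · have := hF.1 hs ht hst
        have := hF.1 (hτm hs) (hτm ht) (hτ hs ht hst)
        dsimp only
        gcongr
      · have h1 := hF.2 s hs t ht hst
        have h2 := hF.2 _ (hτm hs) _ (hτm ht) (hτ hs ht hst)
        simp only [Pi.sub_apply]
        rw [hστ hs, hστ ht, Function.comp, Function.comp]
        calc |φ t - φ (τ t) - (φ s - φ (τ s))| ^ q
            ≤ (|φ t - φ s| + |φ (τ t) - φ (τ s)|) ^ q := by
              refine Real.rpow_le_rpow (abs_nonneg _) ?_ hq0.le
              rw [show φ t - φ (τ t) - (φ s - φ (τ s)) =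
                (φ t - φ s) - (φ (τ t) - φ (τ s)) by ring]
              exact abs_sub _ _
          _ ≤ 2 ^ q * (|φ t - φ s| ^ q + |φ (τ t) - φ (τ s)| ^ q) :=
              add_rpow_le_two_rpow_mul (abs_nonneg _) (abs_nonneg _) hq0.le
          _ ≤ 2 ^ q * ((F t - F s) + (F (τ t) - F (τ s))) := by gcongr
          _ = _ := by ring
    refine ⟨σ, hσ, mono (PairingBound.of_controls hab hp hq hα0.le hα1 hθ hφσ hH hctrl hG
      (V := V) ?_) hηε.le⟩
    have h1 := hF.1 (hτm hb) hb (hτm hb).2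
    have h2 := hF.1 ha (hτm ha) (hτm ha).1
    have h3 : 2 ^ q * (F b + F (τ b)) - 2 ^ q * (F a + F (τ a)) ≤ 2 ^ q * (2 * (F b - F a)) := by
      rw [← mul_sub]; gcongr; linarith
    linarith

end Pairing

end

noncomputable section

/-! ### Sums over traces of partitions -/

namespace IntervalPartition

variable {a b u v : ℝ} (κ : IntervalPartition a b)

/-- Sum of an interval function over the trace of a partition on `[u,v]`. -/
def traceSum (u v : ℝ) (w : ℝ → ℝ → ℝ) : ℝ :=
  ∑ i ∈ Finset.range κ.n, w (κ.trace u v i) (κ.trace u v (i + 1))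

variable {κ}

theorem trace_zero (hu : a ≤ u) (huv : u ≤ v) : κ.trace u v 0 = u := by
  simp [trace, κ.pt_zero, hu, hu.trans huv]

theorem trace_last (huv : u ≤ v) (hv : v ≤ b) : κ.trace u v κ.n = v := by
  simp [trace, κ.pt_last, hv, huv]

theorem trace_mono {i j : ℕ} (hij : i ≤ j) (hj : j ≤ κ.n) :
    κ.trace u v i ≤ κ.trace u v j :=
  max_le_max (min_le_min (κ.pt_mono hij hj) le_rfl) le_rfl

theorem trace_mem (huv : u ≤ v) (i : ℕ) : κ.trace u v i ∈ Icc u v :=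
  ⟨le_max_right _ _, max_le (min_le_right _ _) huv⟩

theorem trace_max {c : ℝ} (huc : u ≤ c) (i : ℕ) :
    κ.trace c v i = max (κ.trace u v i) c := by
  simp [trace, max_assoc, huc]

theorem trace_succ_sub_le (i : ℕ) (hi : i < κ.n) :
    κ.trace u v (i + 1) - κ.trace u v i ≤ κ.pt (i + 1) - κ.pt i := by
  have h := κ.pt_lt i hi
  unfold trace
  rcases max_cases (min (κ.pt (i + 1)) v) u with h1 | h1 <;>
  rcases max_cases (min (κ.pt i) v) u with h2 | h2 <;>
  rcases min_cases (κ.pt (i + 1)) v with h3 | h3 <;>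
  rcases min_cases (κ.pt i) v with h4 | h4 <;> linarith [h1.1, h2.1, h3.1, h4.1]

theorem not_mem_points_of_trace (huv : u ≤ v) {c : ℝ} {i : ℕ} (hi : i < κ.n)
    (h1 : κ.trace u v i < c) (h2 : c < κ.trace u v (i + 1)) : c ∉ κ.points := by
  rintro ⟨k, hk, rfl⟩
  have hv : κ.pt k < v := h2.trans_le (trace_mem huv _).2
  have hu : u < κ.pt k := (trace_mem huv i).1.trans_lt h1
  have h3 : κ.pt i < κ.pt k := by
    have := (le_max_left _ _).trans_lt h1
    rcases min_lt_iff.1 this with h | h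
    · exact h
    · exact absurd h (not_lt.2 hv.le)
  have h4 : κ.pt k < κ.pt (i + 1) := by
    rcases lt_max_iff.1 h2 with h | h
    · exact (lt_min_iff.1 h).1
    · exact absurd h (not_lt.2 hu.le)
  have h5 : i < k := by
    by_contra h; exact absurd (κ.pt_mono (not_lt.1 h) hi.le) (not_le.2 h3)
  exact absurd (κ.pt_mono (Nat.succ_le_of_lt h5) hk) (not_le.2 h4)

theorem traceSum_sub (hu : a ≤ u) (huv : u ≤ v) (hv : v ≤ b) (h : ℝ → ℝ) :
    κ.traceSum u v (fun s t => h t - h s) = h v - h u := by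
  unfold traceSum
  rw [Finset.sum_range_sub (fun i => h (κ.trace u v i)), trace_last huv hv, trace_zero hu huv]

theorem traceSum_add (w w' : ℝ → ℝ → ℝ) :
    κ.traceSum u v (fun s t => w s t + w' s t) = κ.traceSum u v w + κ.traceSum u v w' :=
  Finset.sum_add_distrib

theorem traceSum_neg (w : ℝ → ℝ → ℝ) :
    κ.traceSum u v (fun s t => -w s t) = -κ.traceSum u v w :=
  Finset.sum_neg_distrib _

theorem traceSum_minus (w w' : ℝ → ℝ → ℝ) :
    κ.traceSum u v (fun s t => w s t - w' s t) = κ.traceSum u v w - κ.traceSum u v w' :=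
  Finset.sum_sub_distrib _ _

theorem traceSum_mul (r : ℝ) (w : ℝ → ℝ → ℝ) :
    κ.traceSum u v (fun s t => r * w s t) = r * κ.traceSum u v w :=
  (Finset.mul_sum _ _ _).symm

theorem traceSum_congr (huv : u ≤ v) {w w' : ℝ → ℝ → ℝ}
    (h : ∀ s t, u ≤ s → s ≤ t → t ≤ v → w s t = w' s t) :
    κ.traceSum u v w = κ.traceSum u v w' :=
  Finset.sum_congr rfl fun i hi => h _ _ (trace_mem huv i).1
    (trace_mono (Nat.le_succ i) (Finset.mem_range.1 hi)) (trace_mem huv (i + 1)).2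

theorem traceSum_le (huv : u ≤ v) {w w' : ℝ → ℝ → ℝ}
    (h : ∀ s t, u ≤ s → s ≤ t → t ≤ v → w s t ≤ w' s t) :
    κ.traceSum u v w ≤ κ.traceSum u v w' :=
  Finset.sum_le_sum fun i hi => h _ _ (trace_mem huv i).1
    (trace_mono (Nat.le_succ i) (Finset.mem_range.1 hi)) (trace_mem huv (i + 1)).2

theorem traceSum_nonneg (huv : u ≤ v) {w : ℝ → ℝ → ℝ}
    (h : ∀ s t, u ≤ s → s ≤ t → t ≤ v → 0 ≤ w s t) : 0 ≤ κ.traceSum u v w :=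
  Finset.sum_nonneg fun i hi => h _ _ (trace_mem huv i).1
    (trace_mono (Nat.le_succ i) (Finset.mem_range.1 hi)) (trace_mem huv (i + 1)).2

theorem abs_traceSum_le (w : ℝ → ℝ → ℝ) :
    |κ.traceSum u v w| ≤ κ.traceSum u v fun s t => |w s t| :=
  Finset.abs_sum_le_sum_abs _ _

theorem traceSum_finset_sum {ι : Type*} (D : Finset ι) (w : ι → ℝ → ℝ → ℝ) :
    κ.traceSum u v (fun s t => ∑ d ∈ D, w d s t) = ∑ d ∈ D, κ.traceSum u v (w d) :=
  Finset.sum_comm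

theorem traceSum_mul_sq_le (w w' : ℝ → ℝ → ℝ) :
    (κ.traceSum u v fun s t => w s t * w' s t) ^ 2 ≤
      (κ.traceSum u v fun s t => w s t ^ 2) * κ.traceSum u v fun s t => w' s t ^ 2 :=
  Finset.sum_mul_sq_le_sq_mul_sq _ _ _

/-- Cutting the trace at `c` keeps the part `[c,t]` of an interval with `s < c < t`, whereas the
weight, evaluated at `s`, is zero there. The difference is the single correction term. -/
theorem traceSum_Ici {c : ℝ} (huc : u ≤ c) {w : ℝ → ℝ → ℝ} (hw : ∀ t, w t t = 0) :
    κ.traceSum u v (fun s t => (Ici c).indicator (fun _ => 1) s * w s t) =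
      κ.traceSum c v w - κ.traceSum u v fun s t => if s < c ∧ c < t then w c t else 0 := by
  rw [eq_sub_iff_add_eq, ← traceSum_add]
  refine Finset.sum_congr rfl fun i hi => ?_
  rw [trace_max huc, trace_max huc]
  have hst : κ.trace u v i ≤ κ.trace u v (i + 1) :=
    trace_mono (Nat.le_succ i) (Finset.mem_range.1 hi)
  set s := κ.trace u v i
  set t := κ.trace u v (i + 1)
  rcases le_or_gt c s with h | h
  · simp [indicator, h, not_lt.2 h, h.trans hst]
  · rcases lt_or_ge c t with h' | h'
    · simp [indicator, h, not_le.2 h, h', h.le, h'.le]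
    · simp [indicator, not_le.2 h, not_lt.2 h', h.le, h', hw]

/-- As for the closed half-line, except that an interval which starts at `c` has weight zero too and
therefore belongs to the correction. -/
theorem traceSum_Ioi {c : ℝ} (huc : u ≤ c) {w : ℝ → ℝ → ℝ} (hw : ∀ t, w t t = 0) :
    κ.traceSum u v (fun s t => (Ioi c).indicator (fun _ => 1) s * w s t) =
      κ.traceSum c v w - κ.traceSum u v fun s t => if s ≤ c ∧ c < t then w c t else 0 := by
  rw [eq_sub_iff_add_eq, ← traceSum_add]
  refine Finset.sum_congr rfl fun i hi => ?_
  rw [trace_max huc, trace_max huc]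
  have hst : κ.trace u v i ≤ κ.trace u v (i + 1) :=
    trace_mono (Nat.le_succ i) (Finset.mem_range.1 hi)
  set s := κ.trace u v i
  set t := κ.trace u v (i + 1)
  rcases lt_or_ge c s with h | h
  · simp [indicator, h, not_le.2 h, h.le, h.le.trans hst]
  · rcases lt_or_ge c t with h' | h'
    · simp [indicator, h, not_lt.2 h, h', h'.le]
    · simp [indicator, not_lt.2 h, not_lt.2 h', h, h', hw]

theorem traceSum_Ici_of_ge (huv : u ≤ v) {c : ℝ} (hc : c ≤ u) {w : ℝ → ℝ → ℝ} :
    κ.traceSum u v (fun s t => (Ici c).indicator (fun _ => 1) s * w s t) = κ.traceSum u v w :=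
  traceSum_congr huv fun s t hs _ _ => by
    rw [indicator_of_mem (show s ∈ Ici c from hc.trans hs), one_mul]

theorem traceSum_Ioi_of_gt (huv : u ≤ v) {c : ℝ} (hc : c < u) {w : ℝ → ℝ → ℝ} :
    κ.traceSum u v (fun s t => (Ioi c).indicator (fun _ => 1) s * w s t) = κ.traceSum u v w :=
  traceSum_congr huv fun s t hs _ _ => by
    rw [indicator_of_mem (show s ∈ Ioi c from hc.trans_le hs), one_mul]

theorem traceSum_Ici_of_le (huv : u ≤ v) {c : ℝ} (hc : v ≤ c) {w : ℝ → ℝ → ℝ}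
    (hw : ∀ t, w t t = 0) :
    κ.traceSum u v (fun s t => (Ici c).indicator (fun _ => 1) s * w s t) = 0 := by
  refine (traceSum_congr (w' := fun _ _ => 0) huv fun s t _ hst ht => ?_).trans
    Finset.sum_const_zero
  rcases lt_or_ge s c with h | h
  · rw [indicator_of_notMem (show s ∉ Ici c from not_le.2 h), zero_mul]
  · rw [show s = t by linarith, hw, mul_zero]

theorem traceSum_Ioi_of_le (huv : u ≤ v) {c : ℝ} (hc : v ≤ c) {w : ℝ → ℝ → ℝ} :
    κ.traceSum u v (fun s t => (Ioi c).indicator (fun _ => 1) s * w s t) = 0 := by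
  refine (traceSum_congr (w' := fun _ _ => 0) huv fun s t _ hst ht => ?_).trans
    Finset.sum_const_zero
  rw [indicator_of_notMem (show s ∉ Ioi c from not_lt.2 (by linarith : s ≤ c)), zero_mul]

/-- At most one interval of a partition contains a given point in its half-open version. -/
theorem traceSum_ite_le {P : ℝ → ℝ → Prop} [∀ s t, Decidable (P s t)]
    (hP : ∀ i j, i < j → j < κ.n → P (κ.trace u v i) (κ.trace u v (i + 1)) →
      ¬P (κ.trace u v j) (κ.trace u v (j + 1))) {w : ℝ → ℝ → ℝ} {ε : ℝ} (hε : 0 ≤ ε)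
    (hw : ∀ i < κ.n, P (κ.trace u v i) (κ.trace u v (i + 1)) →
      w (κ.trace u v i) (κ.trace u v (i + 1)) ≤ ε) :
    (κ.traceSum u v fun s t => if P s t then w s t else 0) ≤ ε := by
  unfold traceSum
  rw [← Finset.sum_filter]
  set S := (Finset.range κ.n).filter fun i => P (κ.trace u v i) (κ.trace u v (i + 1))
  have hS : S.card ≤ 1 := by
    refine Finset.card_le_one.2 fun i hi j hj => ?_
    obtain ⟨hi1, hi2⟩ := Finset.mem_filter.1 hi
    obtain ⟨hj1, hj2⟩ := Finset.mem_filter.1 hj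
    rcases lt_trichotomy i j with h | h | h
    · exact absurd hj2 (hP i j h (Finset.mem_range.1 hj1) hi2)
    · exact h
    · exact absurd hi2 (hP j i h (Finset.mem_range.1 hi1) hj2)
  calc ∑ i ∈ S, w (κ.trace u v i) (κ.trace u v (i + 1)) ≤ S.card • ε :=
        Finset.sum_le_card_nsmul _ _ _ fun i hi =>
          hw i (Finset.mem_range.1 (Finset.mem_filter.1 hi).1) (Finset.mem_filter.1 hi).2
    _ ≤ ε := by
        rw [nsmul_eq_mul]
        have : (S.card : ℝ) ≤ 1 := by exact_mod_cast hS
        nlinarith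

theorem traceSum_ite_right_le {c : ℝ} {w : ℝ → ℝ → ℝ} {ε : ℝ} (hε : 0 ≤ ε)
    (hw : ∀ i < κ.n, κ.trace u v i ≤ c → c < κ.trace u v (i + 1) →
      w (κ.trace u v i) (κ.trace u v (i + 1)) ≤ ε) :
    (κ.traceSum u v fun s t => if s ≤ c ∧ c < t then w s t else 0) ≤ ε :=
  traceSum_ite_le (P := fun s t => s ≤ c ∧ c < t)
    (fun _ _ hij hj h h' => absurd (h.2.trans_le (trace_mono hij hj.le)) (not_lt.2 h'.1)) hε
    fun i hi h => hw i hi h.1 h.2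

theorem traceSum_ite_left_le {c : ℝ} {w : ℝ → ℝ → ℝ} {ε : ℝ} (hε : 0 ≤ ε)
    (hw : ∀ i < κ.n, κ.trace u v i < c → c ≤ κ.trace u v (i + 1) →
      w (κ.trace u v i) (κ.trace u v (i + 1)) ≤ ε) :
    (κ.traceSum u v fun s t => if s < c ∧ c ≤ t then w s t else 0) ≤ ε :=
  traceSum_ite_le (P := fun s t => s < c ∧ c ≤ t)
    (fun _ _ hij hj h h' => absurd (h.2.trans (trace_mono hij hj.le)) (not_le.2 h'.1)) hε
    fun i hi h => hw i hi h.1 h.2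

end IntervalPartition

/-! ### Limits of trace sums along a nested sequence of partitions -/

section NestedPartitions

open IntervalPartition

variable {a b u v : ℝ} (lam : NestedPartitions a b)

theorem NestedPartitions.points_mono {m m' : ℕ} (h : m ≤ m') :
    (lam.part m).points ⊆ (lam.part m').points :=
  monotone_nat_of_le_succ (f := fun m => (lam.part m).points) lam.nested h

theorem NestedPartitions.eventually_mem {c : ℝ} (hc : c ∈ lam.allPoints) :
    ∀ᶠ m in atTop, c ∈ (lam.part m).points := by
  obtain ⟨m, hm⟩ := mem_iUnion.1 hc
  filter_upwards [eventually_ge_atTop m] with m' hm' using lam.points_mono hm' hm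

/-- By compactness and density, from some stage on there is a partition point within `δ / 2` of
every point of `[a,b]`. In a gap longer than `δ` the midpoint would have none. -/
theorem NestedPartitions.eventually_mesh_le {δ : ℝ} (hδ : 0 < δ) :
    ∀ᶠ m in atTop, ∀ i < (lam.part m).n, (lam.part m).pt (i + 1) - (lam.part m).pt i ≤ δ := by
  obtain ⟨T, hT, hcov⟩ := (isCompact_Icc (a := a) (b := b)).elim_nhds_subcover
    (fun c => Metric.ball c (δ / 4)) fun c _ => Metric.ball_mem_nhds c (by positivity)
  have h1 : ∀ᶠ m in atTop, ∀ c ∈ T, ∃ p ∈ (lam.part m).points, dist c p < δ / 4 := by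
    rw [Finset.eventually_all]
    intro c hc
    obtain ⟨p, hp, hcp⟩ := Metric.mem_closure_iff.1 (lam.dense (hT c hc)) (δ / 4) (by positivity)
    filter_upwards [lam.eventually_mem hp] with m hm using ⟨p, hm, hcp⟩
  filter_upwards [h1] with m hm i hi
  by_contra hlt
  push Not at hlt
  set κ := lam.part m
  have hz : (κ.pt i + κ.pt (i + 1)) / 2 ∈ Icc a b := by
    have := κ.pt_mem_Icc hi.le
    have := κ.pt_mem_Icc (Nat.succ_le_of_lt hi)
    constructor <;> linarith [this.1, this.2, (κ.pt_mem_Icc hi.le).1, (κ.pt_mem_Icc hi.le).2]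
  obtain ⟨c, hc, hzc⟩ := mem_iUnion₂.1 (hcov hz)
  obtain ⟨_, ⟨k, hk, rfl⟩, hcp⟩ := hm c hc
  rw [Metric.mem_ball, Real.dist_eq, abs_lt] at hzc
  rw [Real.dist_eq, abs_lt] at hcp
  have h3 : κ.pt i < κ.pt k := by linarith [hzc.1, hzc.2, hcp.1, hcp.2]
  have h4 : κ.pt k < κ.pt (i + 1) := by linarith [hzc.1, hzc.2, hcp.1, hcp.2]
  have h5 : i < k := by
    by_contra h; exact absurd (κ.pt_mono (not_lt.1 h) hi.le) (not_le.2 h3)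
  exact absurd (κ.pt_mono (Nat.succ_le_of_lt h5) hk) (not_le.2 h4)

/-- The form in which accessibility enters the limits below: an accessible point is eventually a
partition point, and then it is interior to no interval of the trace. -/
theorem NestedPartitions.eventually_trace (huv : u ≤ v) (c : ℝ) {δ : ℝ} (hδ : 0 < δ) :
    ∀ᶠ m in atTop, ∀ i < (lam.part m).n,
      (lam.part m).trace u v (i + 1) - (lam.part m).trace u v i ≤ δ ∧
      ((lam.part m).trace u v i < c → c < (lam.part m).trace u v (i + 1) → c ∉ lam.allPoints) := by
  have h : ∀ᶠ m in atTop, c ∈ lam.allPoints → c ∈ (lam.part m).points := by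
    by_cases hc : c ∈ lam.allPoints
    · exact (lam.eventually_mem hc).mono fun _ h _ => h
    · exact Eventually.of_forall fun _ h => absurd h hc
  filter_upwards [lam.eventually_mesh_le hδ, h] with m hm hm' i hi
  exact ⟨(trace_succ_sub_le i hi).trans (hm i hi), fun h1 h2 hc =>
    not_mem_points_of_trace huv hi h1 h2 (hm' hc)⟩

/-- The terms of the intervals which contain a given point on their left or inside are negligible,
if the interval function vanishes in the limit. -/
theorem tendsto_traceSum_ite_right (huv : u ≤ v) {c : ℝ} {w : ℝ → ℝ → ℝ}
    (hr : c ∈ Ico u v → Tendsto (w c) (𝓝[>] c) (𝓝 0))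
    (hi : c ∈ Ioo u v → c ∉ lam.allPoints →
      Tendsto (fun x : ℝ × ℝ => w x.1 x.2) (𝓝[<] c ×ˢ 𝓝[>] c) (𝓝 0)) :
    Tendsto (fun m => (lam.part m).traceSum u v fun s t => if s ≤ c ∧ c < t then |w s t| else 0)
      atTop (𝓝 0) := by
  refine Metric.tendsto_nhds.2 fun ε hε => ?_
  have h1 : ∃ δ > 0, ∀ t, c ∈ Ico u v → c < t → t < c + δ → |w c t| ≤ ε / 2 := by
    by_cases hc : c ∈ Ico u v
    · have := (hr hc).abs.eventually (gt_mem_nhds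
        (by rw [abs_zero]; exact half_pos hε : |(0 : ℝ)| < ε / 2))
      obtain ⟨d, hd, h⟩ := (mem_nhdsGT_iff_exists_Ioo_subset).1 this
      refine ⟨d - c, sub_pos.2 hd, fun t _ h1 h2 => (h ⟨h1, by linarith⟩ : |w c t| < ε / 2).le⟩
    · exact ⟨1, one_pos, fun t h => absurd h hc⟩
  -- Besides the interval that starts at `c`, only intervals with `c` in their interior matter, and
  -- these occur in the limit only at inaccessible points.
  have h2 : ∃ δ > 0, ∀ s t, c ∈ Ioo u v → c ∉ lam.allPoints → s < c → c < t → c - δ < s →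
      t < c + δ → |w s t| ≤ ε / 2 := by
    by_cases hc : c ∈ Ioo u v ∧ c ∉ lam.allPoints
    · have := (hi hc.1 hc.2).abs.eventually (gt_mem_nhds
        (by rw [abs_zero]; exact half_pos hε : |(0 : ℝ)| < ε / 2))
      obtain ⟨S, hS, T, hT, h⟩ := mem_prod_iff.1 this
      obtain ⟨d, hd, hdS⟩ := (mem_nhdsLT_iff_exists_Ioo_subset).1 hS
      obtain ⟨e, he, heT⟩ := (mem_nhdsGT_iff_exists_Ioo_subset).1 hT
      refine ⟨min (c - d) (e - c), lt_min (sub_pos.2 hd) (sub_pos.2 he),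
        fun s t _ _ h1 h2 h3 h4 => ?_⟩
      have h5 := min_le_left (c - d) (e - c)
      have h6 := min_le_right (c - d) (e - c)
      exact (h (mk_mem_prod (hdS ⟨by linarith, h1⟩) (heT ⟨h2, by linarith⟩)) :
        |w s t| < ε / 2).le
    · exact ⟨1, one_pos, fun s t h h' => absurd ⟨h, h'⟩ hc⟩
  obtain ⟨δ₁, hδ₁, h1⟩ := h1
  obtain ⟨δ₂, hδ₂, h2⟩ := h2
  filter_upwards [lam.eventually_trace huv c (half_pos (lt_min hδ₁ hδ₂))] with m hm
  have hnn : 0 ≤ (lam.part m).traceSum u v fun s t => if s ≤ c ∧ c < t then |w s t| else 0 :=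
    traceSum_nonneg huv fun s t _ _ _ => by split_ifs <;> positivity
  rw [Real.dist_eq, sub_zero, abs_of_nonneg hnn]
  refine lt_of_le_of_lt (traceSum_ite_right_le (half_pos hε).le fun i hin hic hci => ?_)
    (half_lt_self hε)
  have hd := (hm i hin).1
  have m1 := min_le_left δ₁ δ₂
  have m2 := min_le_right δ₁ δ₂
  have m0 := lt_min hδ₁ hδ₂
  have hu := (trace_mem (κ := lam.part m) huv i).1
  have hv := (trace_mem (κ := lam.part m) huv (i + 1)).2
  rcases eq_or_lt_of_le hic with h | h
  · rw [h]
    exact h1 _ ⟨h ▸ hu, hci.trans_le hv⟩ hci (by linarith)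
  · exact h2 _ _ ⟨hu.trans_lt h, hci.trans_le hv⟩ ((hm i hin).2 h hci) h hci (by linarith)
      (by linarith)

/-- The mirror image of `tendsto_traceSum_ite_right`. Both are needed, because an interval can meet
an exceptional finite set in its interior or in either of its end points. -/
theorem tendsto_traceSum_ite_left (huv : u ≤ v) {c : ℝ} {w : ℝ → ℝ → ℝ}
    (hl : c ∈ Ioc u v → Tendsto (fun s => w s c) (𝓝[<] c) (𝓝 0))
    (hi : c ∈ Ioo u v → c ∉ lam.allPoints →
      Tendsto (fun x : ℝ × ℝ => w x.1 x.2) (𝓝[<] c ×ˢ 𝓝[>] c) (𝓝 0)) :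
    Tendsto (fun m => (lam.part m).traceSum u v fun s t => if s < c ∧ c ≤ t then |w s t| else 0)
      atTop (𝓝 0) := by
  refine Metric.tendsto_nhds.2 fun ε hε => ?_
  have h1 : ∃ δ > 0, ∀ s, c ∈ Ioc u v → s < c → c - δ < s → |w s c| ≤ ε / 2 := by
    by_cases hc : c ∈ Ioc u v
    · have := (hl hc).abs.eventually (gt_mem_nhds
        (by rw [abs_zero]; exact half_pos hε : |(0 : ℝ)| < ε / 2))
      obtain ⟨d, hd, h⟩ := (mem_nhdsLT_iff_exists_Ioo_subset).1 this
      refine ⟨c - d, sub_pos.2 hd, fun s _ h1 h2 => (h ⟨by linarith, h1⟩ : |w s c| < ε / 2).le⟩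
    · exact ⟨1, one_pos, fun t h => absurd h hc⟩
  have h2 : ∃ δ > 0, ∀ s t, c ∈ Ioo u v → c ∉ lam.allPoints → s < c → c < t → c - δ < s →
      t < c + δ → |w s t| ≤ ε / 2 := by
    by_cases hc : c ∈ Ioo u v ∧ c ∉ lam.allPoints
    · have := (hi hc.1 hc.2).abs.eventually (gt_mem_nhds
        (by rw [abs_zero]; exact half_pos hε : |(0 : ℝ)| < ε / 2))
      obtain ⟨S, hS, T, hT, h⟩ := mem_prod_iff.1 this
      obtain ⟨d, hd, hdS⟩ := (mem_nhdsLT_iff_exists_Ioo_subset).1 hS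
      obtain ⟨e, he, heT⟩ := (mem_nhdsGT_iff_exists_Ioo_subset).1 hT
      refine ⟨min (c - d) (e - c), lt_min (sub_pos.2 hd) (sub_pos.2 he),
        fun s t _ _ h1 h2 h3 h4 => ?_⟩
      have h5 := min_le_left (c - d) (e - c)
      have h6 := min_le_right (c - d) (e - c)
      exact (h (mk_mem_prod (hdS ⟨by linarith, h1⟩) (heT ⟨h2, by linarith⟩)) :
        |w s t| < ε / 2).le
    · exact ⟨1, one_pos, fun s t h h' => absurd ⟨h, h'⟩ hc⟩
  obtain ⟨δ₁, hδ₁, h1⟩ := h1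
  obtain ⟨δ₂, hδ₂, h2⟩ := h2
  filter_upwards [lam.eventually_trace huv c (half_pos (lt_min hδ₁ hδ₂))] with m hm
  have hnn : 0 ≤ (lam.part m).traceSum u v fun s t => if s < c ∧ c ≤ t then |w s t| else 0 :=
    traceSum_nonneg huv fun s t _ _ _ => by split_ifs <;> positivity
  rw [Real.dist_eq, sub_zero, abs_of_nonneg hnn]
  refine lt_of_le_of_lt (traceSum_ite_left_le (half_pos hε).le fun i hin hic hci => ?_)
    (half_lt_self hε)
  have hd := (hm i hin).1
  have m1 := min_le_left δ₁ δ₂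
  have m2 := min_le_right δ₁ δ₂
  have m0 := lt_min hδ₁ hδ₂
  have hu := (trace_mem (κ := lam.part m) huv i).1
  have hv := (trace_mem (κ := lam.part m) huv (i + 1)).2
  rcases eq_or_lt_of_le hci with h | h
  · rw [← h]
    exact h1 _ ⟨hu.trans_lt hic, h ▸ hv⟩ hic (by linarith)
  · exact h2 _ _ ⟨hu.trans_lt hic, h.trans_le hv⟩ ((hm i hin).2 hic h) hic h (by linarith)
      (by linarith)

/-- An interval function which is small compared to `W` away from finite sets, and vanishes in the
limit at every point, has asymptotically vanishing absolute sums. -/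
theorem tendsto_traceSum_abs_of_small (huv : u ≤ v) {w W : ℝ → ℝ → ℝ} (hw : ∀ t, w t t = 0)
    {K : ℝ} (hW0 : ∀ s t, u ≤ s → s ≤ t → t ≤ v → 0 ≤ W s t)
    (hW : ∀ᶠ m in atTop, (lam.part m).traceSum u v W ≤ K)
    (hsmall : ∀ ε > 0, ∃ D : Finset ℝ, ∀ s t, u ≤ s → s < t → t ≤ v → (∀ d ∈ D, d ∉ Icc s t) →
      |w s t| ≤ ε * W s t)
    (hr : ∀ c ∈ Ico u v, Tendsto (w c) (𝓝[>] c) (𝓝 0))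
    (hl : ∀ c ∈ Ioc u v, Tendsto (fun s => w s c) (𝓝[<] c) (𝓝 0))
    (hi : ∀ c ∈ Ioo u v, c ∉ lam.allPoints →
      Tendsto (fun x : ℝ × ℝ => w x.1 x.2) (𝓝[<] c ×ˢ 𝓝[>] c) (𝓝 0)) :
    Tendsto (fun m => (lam.part m).traceSum u v fun s t => |w s t|) atTop (𝓝 0) := by
  refine Metric.tendsto_nhds.2 fun ε hε => ?_
  obtain ⟨D, hD⟩ := hsmall (ε / (2 * (|K| + 1))) (by positivity)
  have hlim := tendsto_finsetSum D fun d _ =>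
    (tendsto_traceSum_ite_right lam huv (w := w) (hr d) (hi d)).add
      (tendsto_traceSum_ite_left lam huv (w := w) (hl d) (hi d))
  simp only [add_zero, Finset.sum_const_zero] at hlim
  filter_upwards [hlim.eventually (gt_mem_nhds (half_pos hε)), hW] with m hm hmW
  rw [Real.dist_eq, sub_zero, abs_of_nonneg (traceSum_nonneg huv fun s t _ _ _ => abs_nonneg _)]
  -- An interval either avoids `D`, and its term is compared with `W`, or contains some `d ∈ D`, and
  -- its term is one of the finitely many local sums. The constant before `W` makes the first
  -- contribution at most `ε / 2`.
  have h1 : ((lam.part m).traceSum u v fun s t => |w s t|) ≤ (lam.part m).traceSum u v fun s t =>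
      ε / (2 * (|K| + 1)) * W s t + ∑ d ∈ D, ((if s ≤ d ∧ d < t then |w s t| else 0) +
        if s < d ∧ d ≤ t then |w s t| else 0) := by
    refine traceSum_le huv fun s t hs hst ht => ?_
    have hnn : ∀ d ∈ D, 0 ≤ ((if s ≤ d ∧ d < t then |w s t| else 0) +
        if s < d ∧ d ≤ t then |w s t| else 0) := fun d _ => by
      split_ifs <;> positivity
    have hW0' : 0 ≤ ε / (2 * (|K| + 1)) * W s t := mul_nonneg (by positivity) (hW0 s t hs hst ht)
    rcases eq_or_lt_of_le hst with rfl | hlt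
    · rw [hw, abs_zero]
      exact add_nonneg hW0' (by simp)
    by_cases hav : ∀ d ∈ D, d ∉ Icc s t
    · exact (hD s t hs hlt ht hav).trans (le_add_of_nonneg_right (Finset.sum_nonneg hnn))
    · push Not at hav
      obtain ⟨d, hd, hds⟩ := hav
      refine le_add_of_nonneg_of_le hW0' (le_trans ?_ (Finset.single_le_sum hnn hd))
      rcases lt_or_ge d t with h | h
      · rw [if_pos ⟨hds.1, h⟩]
        exact le_add_of_nonneg_right (by split_ifs <;> positivity)
      · rw [if_pos (show s < d ∧ d ≤ t from ⟨hlt.trans_le h, hds.2⟩)]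
        exact le_add_of_nonneg_left (by split_ifs <;> positivity)
  rw [traceSum_add, traceSum_mul, traceSum_finset_sum] at h1
  simp only [traceSum_add] at h1
  have h2 : ε / (2 * (|K| + 1)) * (lam.part m).traceSum u v W ≤ ε / 2 := by
    calc _ ≤ ε / (2 * (|K| + 1)) * (|K| + 1) := by
          refine mul_le_mul_of_nonneg_left ?_ (by positivity)
          linarith [le_abs_self K]
      _ = ε / 2 := by field_simp
  linarith

theorem tendsto_traceSum_ite_right' (huv : u ≤ v) {c : ℝ} {w : ℝ → ℝ → ℝ}
    (hr : c ∈ Ico u v → Tendsto (w c) (𝓝[>] c) (𝓝 0)) :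
    Tendsto (fun m => (lam.part m).traceSum u v fun s t => if s ≤ c ∧ c < t then w c t else 0)
      atTop (𝓝 0) := by
  have h := tendsto_traceSum_ite_right lam huv (c := c) (w := fun _ t => w c t) hr fun hc _ =>
    (hr ⟨hc.1.le, hc.2⟩).comp tendsto_snd
  refine squeeze_zero_norm (fun m => ?_) h
  refine (abs_traceSum_le _).trans (le_of_eq (traceSum_congr huv fun s t _ _ _ => ?_))
  split_ifs <;> simp

/-- From some stage on no interval has `c` strictly inside, unless `c` is an inaccessible point of
`(u,v)`. A limit of `w c` at `c` is therefore required only in that case. -/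
theorem tendsto_traceSum_ite_Ioo (huv : u ≤ v) {c : ℝ} {w : ℝ → ℝ → ℝ}
    (hr : c ∈ Ioo u v → c ∉ lam.allPoints → Tendsto (w c) (𝓝[>] c) (𝓝 0)) :
    Tendsto (fun m => (lam.part m).traceSum u v fun s t => if s < c ∧ c < t then w c t else 0)
      atTop (𝓝 0) := by
  by_cases hc : c ∈ Ioo u v ∧ c ∉ lam.allPoints
  · have h := tendsto_traceSum_ite_right lam huv (c := c) (w := fun _ t => w c t)
      (fun _ => hr hc.1 hc.2) fun _ _ => (hr hc.1 hc.2).comp tendsto_snd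
    refine squeeze_zero_norm (fun m => ?_) h
    refine (abs_traceSum_le _).trans (traceSum_le huv fun s t _ _ _ => ?_)
    rcases lt_trichotomy s c with h | h | h
    · simp [h, h.le]; split_ifs <;> simp
    · simp [h]; split_ifs <;> simp
    · simp [not_lt.2 h.le]; split_ifs <;> simp
  · refine (tendsto_congr' ?_).2 tendsto_const_nhds
    filter_upwards [lam.eventually_trace huv c one_pos] with m hm
    refine Finset.sum_eq_zero fun i hi => if_neg fun h => hc ⟨?_, ?_⟩
    · exact ⟨(trace_mem huv i).1.trans_lt h.1, h.2.trans_le (trace_mem huv _).2⟩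
    · exact (hm i (Finset.mem_range.1 hi)).2 h.1 h.2

/-- Weighted sums of an asymptotically negligible interval function are negligible. -/
theorem tendsto_traceSum_mul_of_regulated (huv : u < v) {w : ℝ → ℝ → ℝ} {φ : ℝ → ℝ}
    (hφ : IsRegulated u v φ) (hw : ∀ t, w t t = 0)
    (hS : ∀ c ∈ Ico u v, Tendsto (fun m => (lam.part m).traceSum c v w) atTop (𝓝 0)) {K : ℝ}
    (hK : ∀ᶠ m in atTop, (lam.part m).traceSum u v (fun s t => |w s t|) ≤ K)
    (hr : ∀ c ∈ Ico u v, Tendsto (w c) (𝓝[>] c) (𝓝 0)) :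
    Tendsto (fun m => (lam.part m).traceSum u v fun s t => φ s * w s t) atTop (𝓝 0) := by
  -- For half-line indicators the weighted sum is an unweighted sum over `[c,v]`, up to the
  -- correction at `c`; this is why `hS` is assumed for every `c`. A general weight is then
  -- approximated uniformly, the error being paid by the bound `K` for the sums of `|w|`.
  have hstep : ∀ σ ∈ stepSpan,
      Tendsto (fun m => (lam.part m).traceSum u v fun s t => σ s * w s t) atTop (𝓝 0) := by
    intro σ hσ
    have hS0 := hS u ⟨le_rfl, huv⟩
    refine stepSpan_induction (p := fun σ => Tendsto (fun m =>
      (lam.part m).traceSum u v fun s t => σ s * w s t) atTop (𝓝 0)) (fun c => ?_) (fun c => ?_) ?_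
      (fun φ ψ _ _ h h' => ?_) (fun r φ _ h => ?_) hσ
    · rcases lt_or_ge c u with hc | hc
      · exact hS0.congr fun m => (traceSum_Ici_of_ge huv.le hc.le).symm
      rcases lt_or_ge c v with hcv | hcv
      · have := (hS c ⟨hc, hcv⟩).sub (tendsto_traceSum_ite_Ioo lam huv.le (c := c) (w := w)
          fun h _ => hr c ⟨h.1.le, h.2⟩)
        rw [sub_zero] at this
        exact this.congr fun m => (traceSum_Ici hc hw).symm
      · exact tendsto_const_nhds.congr fun m => (traceSum_Ici_of_le huv.le hcv hw).symm
    · rcases lt_or_ge c u with hc | hc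
      · exact hS0.congr fun m => (traceSum_Ioi_of_gt huv.le hc).symm
      rcases lt_or_ge c v with hcv | hcv
      · have := (hS c ⟨hc, hcv⟩).sub (tendsto_traceSum_ite_right' lam huv.le (c := c) (w := w) (hr c))
        rw [sub_zero] at this
        exact this.congr fun m => (traceSum_Ioi hc hw).symm
      · exact tendsto_const_nhds.congr fun m => (traceSum_Ioi_of_le huv.le hcv).symm
    · simp [traceSum]
    · have := h.add h'
      rw [add_zero] at this
      refine this.congr fun m => ?_
      rw [← traceSum_add]
      exact traceSum_congr huv.le fun s t _ _ _ => by simp [add_mul]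
    · have := h.const_mul r
      rw [mul_zero] at this
      refine this.congr fun m => ?_
      rw [← traceSum_mul]
      exact traceSum_congr huv.le fun s t _ _ _ => by simp [mul_assoc]
  refine Metric.tendsto_nhds.2 fun ε hε => ?_
  obtain ⟨τ, σ, hσ, -, -, -, hφσ⟩ := hφ.exists_step huv.le
    (ε := ε / (2 * (|K| + 1))) (by positivity)
  filter_upwards [(hstep σ hσ).abs.eventually (gt_mem_nhds
    (by rw [abs_zero]; exact half_pos hε : |(0 : ℝ)| < ε / 2)), hK] with m hm hmK
  rw [Real.dist_eq, sub_zero]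
  have h1 : ((lam.part m).traceSum u v fun s t => φ s * w s t) =
      ((lam.part m).traceSum u v fun s t => σ s * w s t) +
        (lam.part m).traceSum u v fun s t => (φ s - σ s) * w s t := by
    rw [← traceSum_add]
    exact traceSum_congr huv.le fun s t _ _ _ => by ring
  have h2 : |(lam.part m).traceSum u v fun s t => (φ s - σ s) * w s t| ≤ ε / 2 := by
    refine (abs_traceSum_le _).trans ?_
    calc ((lam.part m).traceSum u v fun s t => |(φ s - σ s) * w s t|)
        ≤ (lam.part m).traceSum u v fun s t => ε / (2 * (|K| + 1)) * |w s t| := by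
          refine traceSum_le huv.le fun s t hs hst ht => ?_
          rw [abs_mul]
          exact mul_le_mul_of_nonneg_right (hφσ s ⟨hs, hst.trans ht⟩) (abs_nonneg _)
      _ ≤ ε / (2 * (|K| + 1)) * (|K| + 1) := by
          rw [traceSum_mul]
          refine mul_le_mul_of_nonneg_left ?_ (by positivity)
          linarith [le_abs_self K]
      _ = ε / 2 := by field_simp
  rw [h1]
  have := abs_add_le ((lam.part m).traceSum u v fun s t => σ s * w s t)
    ((lam.part m).traceSum u v fun s t => (φ s - σ s) * w s t)
  linarith

end NestedPartitions

end

noncomputable section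

/-! ### Refinement Riemann–Stieltjes integrals -/

section RRS

variable {a b u v c J J' : ℝ} {f g h k k' φ ψ : ℝ → ℝ}

theorem exists_partition_superset (S : Finset ℝ) : ∀ v, u < v →
    ∃ κ : IntervalPartition u v, ∀ x ∈ S, x ∈ Ioo u v → x ∈ κ.points := by
  classical
  induction S using Finset.induction_on_max with
  | empty => exact fun v huv => ⟨(IntervalPartition.single u).snoc huv, by simp⟩
  | insert c S hS ih =>
    intro v huv
    by_cases hc : c ∈ Ioo u v
    · obtain ⟨κ, hκ⟩ := ih c hc.1
      refine ⟨κ.snoc hc.2, fun x hx hxv => κ.points_subset_snoc hc.2 ?_⟩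
      rcases Finset.mem_insert.1 hx with rfl | hx
      · exact κ.right_mem_points
      · exact hκ x hx ⟨hxv.1, hS x hx⟩
    · obtain ⟨κ, hκ⟩ := ih v huv
      refine ⟨κ, fun x hx hxv => ?_⟩
      rcases Finset.mem_insert.1 hx with rfl | hx
      · exact absurd hxv hc
      · exact hκ x hx hxv

theorem IntervalPartition.exists_common_refinement (huv : u < v) (κ κ' : IntervalPartition u v) :
    ∃ κ'' : IntervalPartition u v, κ.points ⊆ κ''.points ∧ κ'.points ⊆ κ''.points := by
  classical
  obtain ⟨κ'', h⟩ := exists_partition_superset (u := u)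
    ((Finset.range (κ.n + 1)).image κ.pt ∪ (Finset.range (κ'.n + 1)).image κ'.pt) v huv
  have key : ∀ x ∈ Icc u v, (x ∈ Ioo u v → x ∈ κ''.points) → x ∈ κ''.points := by
    intro x hx hx'
    rcases eq_or_lt_of_le hx.1 with rfl | h1
    · exact κ''.left_mem_points
    rcases eq_or_lt_of_le hx.2 with rfl | h2
    · exact κ''.right_mem_points
    exact hx' ⟨h1, h2⟩
  refine ⟨κ'', ?_, ?_⟩
  · rintro _ ⟨i, hi, rfl⟩
    exact key _ (κ.pt_mem_Icc hi) (h _ (Finset.mem_union_left _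
      (Finset.mem_image_of_mem _ (Finset.mem_range.2 (Nat.lt_succ_of_le hi)))))
  · rintro _ ⟨i, hi, rfl⟩
    exact key _ (κ'.pt_mem_Icc hi) (h _ (Finset.mem_union_right _
      (Finset.mem_image_of_mem _ (Finset.mem_range.2 (Nat.lt_succ_of_le hi)))))

theorem HasRRSIntegral.congr (hk : HasRRSIntegral k g u v J) (h : EqOn k k' (Icc u v)) :
    HasRRSIntegral k' g u v J := by
  intro ε hε
  obtain ⟨κ₀, hκ₀⟩ := hk ε hε
  refine ⟨κ₀, fun κ hκ y hy => ?_⟩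
  rw [← Finset.sum_congr rfl fun i hi => ?_]
  · exact hκ₀ κ hκ y hy
  · have hi := Finset.mem_range.1 hi
    rw [h ⟨(κ.pt_mem_Icc hi.le).1.trans (hy i hi).1, (hy i hi).2.trans (κ.pt_mem_Icc hi).2⟩]

theorem HasRRSIntegral.add (huv : u < v) (hk : HasRRSIntegral k g u v J)
    (hk' : HasRRSIntegral k' g u v J') : HasRRSIntegral (k + k') g u v (J + J') := by
  intro ε hε
  obtain ⟨κ₁, h₁⟩ := hk (ε / 2) (half_pos hε)
  obtain ⟨κ₂, h₂⟩ := hk' (ε / 2) (half_pos hε)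
  obtain ⟨κ₀, h10, h20⟩ := κ₁.exists_common_refinement huv κ₂
  refine ⟨κ₀, fun κ hκ y hy => ?_⟩
  have e1 := h₁ κ (h10.trans hκ) y hy
  have e2 := h₂ κ (h20.trans hκ) y hy
  simp only [Pi.add_apply, add_mul, Finset.sum_add_distrib]
  rw [add_sub_add_comm]
  exact (abs_add_le _ _).trans_lt (by linarith)

theorem HasRRSIntegral.smul (hk : HasRRSIntegral k g u v J) (r : ℝ) :
    HasRRSIntegral (r • k) g u v (r * J) := by
  intro ε hε
  obtain ⟨κ₀, h⟩ := hk (ε / (|r| + 1)) (by positivity)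
  refine ⟨κ₀, fun κ hκ y hy => ?_⟩
  have := h κ hκ y hy
  simp only [Pi.smul_apply, smul_eq_mul, mul_assoc, ← Finset.mul_sum]
  rw [← mul_sub, abs_mul]
  calc _ ≤ (|r|) * (ε / (|r| + 1)) := by gcongr
    _ < (|r| + 1) * (ε / (|r| + 1)) := by
        have : 0 < ε / (|r| + 1) := by positivity
        nlinarith
    _ = ε := by field_simp

theorem HasRRSIntegral.unique (huv : u < v) (hk : HasRRSIntegral k g u v J)
    (hk' : HasRRSIntegral k g u v J') : J = J' := by
  by_contra hne
  have hpos : 0 < |J - J'| := abs_pos.2 (sub_ne_zero.2 hne)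
  obtain ⟨κ₁, h₁⟩ := hk (|J - J'| / 2) (half_pos hpos)
  obtain ⟨κ₂, h₂⟩ := hk' (|J - J'| / 2) (half_pos hpos)
  obtain ⟨κ₀, h10, h20⟩ := κ₁.exists_common_refinement huv κ₂
  have hy : ∀ i < κ₀.n, κ₀.pt i ∈ Icc (κ₀.pt i) (κ₀.pt (i + 1)) :=
    fun i hi => ⟨le_rfl, (κ₀.pt_lt i hi).le⟩
  have e1 := h₁ κ₀ h10 κ₀.pt hy
  have e2 := h₂ κ₀ h20 κ₀.pt hy
  have := abs_sub_le J (∑ i ∈ Finset.range κ₀.n, k (κ₀.pt i) * (g (κ₀.pt (i + 1)) - g (κ₀.pt i))) J'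
  rw [abs_sub_comm] at e1
  linarith

theorem hasRRSIntegral_of_const (huv : u < v) {r : ℝ} (hk : ∀ x ∈ Icc u v, k x = r) :
    HasRRSIntegral k g u v (r * (g v - g u)) := by
  intro ε hε
  refine ⟨(IntervalPartition.single u).snoc huv, fun κ _ y hy => ?_⟩
  rw [Finset.sum_congr rfl (g := fun i => r * (g (κ.pt (i + 1)) - g (κ.pt i))) fun i hi => ?_]
  · rw [← Finset.mul_sum, Finset.sum_range_sub (fun i => g (κ.pt i)), κ.pt_last, κ.pt_zero]
    simpa using hε
  · have hi := Finset.mem_range.1 hi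
    rw [hk _ ⟨(κ.pt_mem_Icc hi.le).1.trans (hy i hi).1, (hy i hi).2.trans (κ.pt_mem_Icc hi).2⟩]

/-- As soon as the partition contains `c` and a point slightly to its right, only the term of the
interval that starts at `c` can depend on the tag. Right continuity of `g` makes the increment there
small. -/
theorem hasRRSIntegral_Ioi (hc : c ∈ Ico u v)
    (hk : ∀ x ∈ Icc u v, k x = (Ioi c).indicator (fun _ => 1) x)
    (hg : Tendsto g (𝓝[>] c) (𝓝 (g c))) : HasRRSIntegral k g u v (g v - g c) := by
  intro ε hε
  have huv : u < v := hc.1.trans_lt hc.2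
  have hg' : ∀ᶠ x in 𝓝[>] c, |g x - g c| < ε := by
    filter_upwards [hg (Metric.ball_mem_nhds (g c) hε)] with x hx
    simpa [Real.dist_eq] using hx
  obtain ⟨d, hd, hdS⟩ := (mem_nhdsGT_iff_exists_Ioo_subset).1 hg'
  have hd : c < d := hd
  obtain ⟨e, hce, hed⟩ : ∃ e, c < e ∧ e < min d v := exists_between (lt_min hd hc.2)
  obtain ⟨κ₀, hκ₀⟩ := exists_partition_superset (u := u) {c, e} v huv
  refine ⟨κ₀, fun κ hκ y hy => ?_⟩
  have hcκ : c ∈ κ.points := by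
    rcases eq_or_lt_of_le hc.1 with rfl | h
    · exact κ.left_mem_points
    · exact hκ (hκ₀ c (by simp) ⟨h, hc.2⟩)
  have heκ : e ∈ κ.points :=
    hκ (hκ₀ e (by simp) ⟨hc.1.trans_lt hce, hed.trans_le (min_le_right _ _)⟩)
  obtain ⟨j, hj, hjc⟩ := hcκ
  obtain ⟨l, hl, hle⟩ := heκ
  have hjl : j < l := by
    by_contra h
    have := κ.pt_mono (not_lt.1 h) hj
    rw [hjc, hle] at this
    exact absurd this (not_le.2 hce)
  have hjn : j < κ.n := hjl.trans_le hl
  -- The claimed value as a sum over the same partition with untagged weights; the difference to the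
  -- Riemann–Stieltjes sum is concentrated in the index `j`.
  have htel : ∑ i ∈ Finset.range κ.n, (if j ≤ i then (1 : ℝ) else 0) *
      (g (κ.pt (i + 1)) - g (κ.pt i)) = g v - g c := by
    rw [Finset.sum_congr rfl (g := fun i => g (κ.pt (max (i + 1) j)) - g (κ.pt (max i j)))
      fun i _ => ?_]
    · rw [Finset.sum_range_sub (fun i => g (κ.pt (max i j))), max_eq_left hj,
        max_eq_right (Nat.zero_le j), κ.pt_last, hjc]
    · by_cases h : j ≤ i
      · rw [if_pos h, max_eq_left h, max_eq_left (by omega), one_mul]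
      · rw [if_neg h, max_eq_right (by omega), max_eq_right (by omega), zero_mul, sub_self]
  rw [← htel, ← Finset.sum_sub_distrib, Finset.sum_eq_single j]
  · rw [if_pos le_rfl, ← sub_mul, abs_mul, hjc]
    have h1 : |k (y j) - 1| ≤ 1 := by
      rw [hk _ ⟨(κ.pt_mem_Icc hj).1.trans (hy j hjn).1, (hy j hjn).2.trans (κ.pt_mem_Icc hjn).2⟩]
      by_cases h : y j ∈ Ioi c
      · rw [indicator_of_mem h]; norm_num
      · rw [indicator_of_notMem h]; norm_num
    have h2 : |g (κ.pt (j + 1)) - g c| < ε := by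
      refine hdS ⟨?_, ?_⟩
      · rw [← hjc]; exact κ.pt_lt j hjn
      · have := κ.pt_mono (Nat.succ_le_of_lt hjl) hl
        rw [hle] at this
        exact this.trans_lt (hed.trans_le (min_le_left _ _))
    have := abs_nonneg (g (κ.pt (j + 1)) - g c)
    nlinarith
  · intro i hi hij
    have hi := Finset.mem_range.1 hi
    rw [hk _ ⟨(κ.pt_mem_Icc hi.le).1.trans (hy i hi).1, (hy i hi).2.trans (κ.pt_mem_Icc hi).2⟩]
    rcases lt_or_gt_of_ne hij with h | h
    · rw [if_neg (by omega), indicator_of_notMem, sub_self]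
      have := κ.pt_mono (Nat.succ_le_of_lt h) hj
      rw [hjc] at this
      exact not_lt.2 ((hy i hi).2.trans this)
    · rw [if_pos h.le, indicator_of_mem, sub_self]
      have := κ.pt_strictMono h hi.le
      rw [hjc] at this
      exact this.trans_le (hy i hi).1
  · intro h
    exact absurd (Finset.mem_range.2 hjn) h

theorem leftModification_self (u : ℝ) (f : ℝ → ℝ) : leftModification u f u = f u := by
  simp [leftModification]

theorem leftModification_of_gt {x : ℝ} (hx : u < x) :
    leftModification u f x = Function.leftLim f x := by
  simp [leftModification, hx.ne']

theorem rightModification_self (v : ℝ) (f : ℝ → ℝ) : rightModification v f v = f v := by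
  simp [rightModification]

theorem rightModification_of_lt {x : ℝ} (hx : x < v) :
    rightModification v f x = Function.rightLim f x := by
  simp [rightModification, hx.ne]

/-- The function of right limits is right continuous, and this is what makes half-line indicators
integrable against it. -/
theorem IsRegulated.tendsto_rightModification (hh : IsRegulated a b h) (ha : a ≤ c) (hcv : c < v)
    (hv : v ≤ b) :
    Tendsto (rightModification v h) (𝓝[>] c) (𝓝 (rightModification v h c)) := by
  rw [rightModification_of_lt hcv]
  have h1 := continuousWithinAt_rightLim_Ici (hh.tendsto_rightLim ⟨ha, hcv.trans_le hv⟩)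
  have h2 : Tendsto (Function.rightLim h) (𝓝[>] c) (𝓝 (Function.rightLim h c)) :=
    h1.mono_left (nhdsWithin_mono _ Ioi_subset_Ici_self)
  refine h2.congr' ?_
  filter_upwards [Ioo_mem_nhdsGT hcv] with x hx
  rw [rightModification_of_lt hx.2]

theorem leftModification_add (hφ : IsRegulated u v φ) (hψ : IsRegulated u v ψ) :
    EqOn (leftModification u φ + leftModification u ψ) (leftModification u (φ + ψ)) (Icc u v) := by
  intro x hx
  rcases eq_or_lt_of_le hx.1 with rfl | h
  · simp [leftModification_self]
  · simp [leftModification_of_gt h, hφ.leftLim_add hψ ⟨h, hx.2⟩]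

theorem leftModification_smul (hφ : IsRegulated u v φ) (r : ℝ) :
    EqOn (r • leftModification u φ) (leftModification u (r • φ)) (Icc u v) := by
  intro x hx
  rcases eq_or_lt_of_le hx.1 with rfl | h
  · simp [leftModification_self]
  · simp [leftModification_of_gt h, hφ.leftLim_smul r ⟨h, hx.2⟩]

theorem HasLYIntegral.unique {I I' : ℝ} (h₁ : HasLYIntegral φ h u v I)
    (h₂ : HasLYIntegral φ h u v I') : I = I' := by
  rcases h₁ with ⟨h, rfl⟩ | ⟨h, -, -, J, S, hJ, hS, rfl⟩ <;>
  rcases h₂ with ⟨h', rfl⟩ | ⟨h', -, -, J', S', hJ', hS', rfl⟩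
  · rfl
  · exact absurd h h'.ne
  · exact absurd h' h.ne
  · rw [hJ.unique h hJ', hS.unique hS']

theorem HasLYIntegral.add {I I' : ℝ} (h₁ : HasLYIntegral φ h u v I)
    (h₂ : HasLYIntegral ψ h u v I') : HasLYIntegral (φ + ψ) h u v (I + I') := by
  rcases h₁ with ⟨h, rfl⟩ | ⟨huv, hφ, hh, J, S, hJ, hS, rfl⟩ <;>
  rcases h₂ with ⟨h', rfl⟩ | ⟨h', hψ, -, J', S', hJ', hS', rfl⟩
  · exact Or.inl ⟨h, add_zero 0⟩
  · exact absurd h h'.ne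
  · exact absurd h' huv.ne
  · refine Or.inr ⟨huv, hφ.add hψ, hh, J + J', S + S',
      (hJ.add huv hJ').congr (leftModification_add hφ hψ), ?_, by simp only [Pi.add_apply]; ring⟩
    convert hS.add hS' using 2 with x
    rw [hφ.leftJump_add hψ ⟨x.2.1, x.2.2.le⟩]
    ring

theorem HasLYIntegral.smul {I : ℝ} (h₁ : HasLYIntegral φ h u v I) (r : ℝ) :
    HasLYIntegral (r • φ) h u v (r * I) := by
  rcases h₁ with ⟨h, rfl⟩ | ⟨huv, hφ, hh, J, S, hJ, hS, rfl⟩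
  · exact Or.inl ⟨h, mul_zero r⟩
  · refine Or.inr ⟨huv, hφ.smul r, hh, r * J, r * S,
      (hJ.smul r).congr (leftModification_smul hφ r), ?_,
      by simp only [Pi.smul_apply, smul_eq_mul]; ring⟩
    have e : (fun x : Ioo u v => leftJump (r • φ) x * rightJump h x) =
        fun x : Ioo u v => r * (leftJump φ x * rightJump h x) := funext fun x => by
      rw [hφ.leftJump_smul r ⟨x.2.1, x.2.2.le⟩, mul_assoc]
    rw [e]
    exact hS.mul_left r

/-! ### Left Young integrals of indicators of half-lines -/

theorem leftLim_indicator_of_lt {s : Set ℝ} {x : ℝ} (hs : Ioi c ⊆ s) (hx : c < x) :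
    Function.leftLim (s.indicator fun _ => (1 : ℝ)) x = 1 := by
  refine leftLim_eq_of_tendsto (tendsto_const_nhds.congr' ?_)
  filter_upwards [Ioo_mem_nhdsLT hx] with y hy
  rw [indicator_of_mem (hs hy.1)]

theorem leftLim_indicator_of_le {s : Set ℝ} {x : ℝ} (hs : s ⊆ Ici c) (hx : x ≤ c) :
    Function.leftLim (s.indicator fun _ => (1 : ℝ)) x = 0 := by
  refine leftLim_eq_of_tendsto (tendsto_const_nhds.congr' ?_)
  filter_upwards [self_mem_nhdsWithin] with y hy
  rw [indicator_of_notMem fun h => absurd (hs h) (not_le.2 (lt_of_lt_of_le hy hx))]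

theorem isRegulated_indicator_Ici (a b c : ℝ) :
    IsRegulated a b ((Ici c).indicator fun _ => (1 : ℝ)) :=
  isRegulated_of_mem_stepSpan (indicator_Ici_mem_stepSpan c)

theorem isRegulated_indicator_Ioi (a b c : ℝ) :
    IsRegulated a b ((Ioi c).indicator fun _ => (1 : ℝ)) :=
  isRegulated_of_mem_stepSpan (indicator_Ioi_mem_stepSpan c)

theorem hasLYIntegral_of_eq_one (huv : u < v) (hφ : IsRegulated u v φ) (hh : IsRegulated u v h)
    (h1 : ∀ x ∈ Icc u v, φ x = 1) : HasLYIntegral φ h u v (h v - h u) := by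
  have h2 : ∀ x ∈ Ioc u v, Function.leftLim φ x = 1 := fun x hx => by
    rw [hφ.leftLim_congr (g := fun _ => 1) (fun y hy => h1 y hy) hx |>.symm]
    exact leftLim_eq_of_tendsto tendsto_const_nhds
  refine Or.inr ⟨huv, hφ, hh, _, 0, hasRRSIntegral_of_const huv (r := 1) fun x hx => ?_, ?_, ?_⟩
  · rcases eq_or_lt_of_le hx.1 with rfl | h
    · rw [leftModification_self, h1 _ hx]
    · rw [leftModification_of_gt h, h2 x ⟨h, hx.2⟩]
  · convert hasSum_zero using 2 with x
    rw [leftJump, h1 _ ⟨x.2.1.le, x.2.2.le⟩, h2 _ ⟨x.2.1, x.2.2.le⟩]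
    simp
  · rw [rightModification_self, rightModification_of_lt huv, rightLim_eq_add_rightJump,
      h1 u ⟨le_rfl, huv.le⟩]
    ring

theorem hasLYIntegral_of_eq_zero (huv : u < v) (hφ : IsRegulated u v φ) (hh : IsRegulated u v h)
    (h1 : ∀ x ∈ Ico u v, φ x = 0) : HasLYIntegral φ h u v 0 := by
  have h2 : ∀ x ∈ Ioc u v, Function.leftLim φ x = 0 := fun x hx => by
    refine leftLim_eq_of_tendsto (tendsto_const_nhds.congr' ?_)
    filter_upwards [Ioo_mem_nhdsLT hx.1] with y hy
    exact (h1 y ⟨hy.1.le, hy.2.trans_le hx.2⟩).symm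
  refine Or.inr ⟨huv, hφ, hh, _, 0, hasRRSIntegral_of_const huv (r := 0) fun x hx => ?_, ?_, ?_⟩
  · rcases eq_or_lt_of_le hx.1 with rfl | h
    · rw [leftModification_self, h1 _ ⟨le_rfl, huv⟩]
    · rw [leftModification_of_gt h, h2 x ⟨h, hx.2⟩]
  · convert hasSum_zero using 2 with x
    rw [leftJump, h1 _ ⟨x.2.1.le, x.2.2⟩, h2 _ ⟨x.2.1, x.2.2.le⟩]
    simp
  · rw [h1 u ⟨le_rfl, huv⟩]
    ring

/-- For `u < c < v` the Riemann–Stieltjes part sees the left limits, that is the open half-line, and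
yields `h v - h(c+)`. The missing right jump of `h` at `c` is supplied by the left jump of the
indicator in the sum. -/
theorem hasLYIntegral_indicator_Ici (hh : IsRegulated u v h) (huv : u < v) (c : ℝ) :
    HasLYIntegral ((Ici c).indicator fun _ => 1) h u v (h (max v c) - h (max u c)) := by
  have hφ := isRegulated_indicator_Ici u v c
  rcases le_or_gt c u with hcu | hcu
  · rw [max_eq_left hcu, max_eq_left (hcu.trans huv.le)]
    exact hasLYIntegral_of_eq_one huv hφ hh fun x hx =>
      indicator_of_mem (show x ∈ Ici c from hcu.trans hx.1) _
  rcases le_or_gt v c with hcv | hcv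
  · rw [max_eq_right hcv, max_eq_right (huv.le.trans hcv), sub_self]
    exact hasLYIntegral_of_eq_zero huv hφ hh fun x hx =>
      indicator_of_notMem (show x ∉ Ici c from not_le.2 (hx.2.trans_le hcv)) _
  rw [max_eq_left hcv.le, max_eq_right hcu.le]
  refine Or.inr ⟨huv, hφ, hh, _, rightJump h c, hasRRSIntegral_Ioi ⟨hcu.le, hcv⟩ (fun x hx => ?_)
    (hh.tendsto_rightModification hcu.le hcv le_rfl), ?_, ?_⟩
  · rcases eq_or_lt_of_le hx.1 with rfl | h
    · rw [leftModification_self, indicator_of_notMem (show u ∉ Ici c from not_le.2 hcu),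
        indicator_of_notMem (show u ∉ Ioi c from not_lt.2 hcu.le)]
    · rw [leftModification_of_gt h]
      rcases le_or_gt x c with h' | h'
      · rw [leftLim_indicator_of_le subset_rfl h',
          indicator_of_notMem (show x ∉ Ioi c from not_lt.2 h')]
      · rw [leftLim_indicator_of_lt Ioi_subset_Ici_self h',
          indicator_of_mem (show x ∈ Ioi c from h')]
  · convert hasSum_single (⟨c, hcu, hcv⟩ : Ioo u v) (fun x hx => ?_) using 1
    · rw [leftJump, leftLim_indicator_of_le subset_rfl le_rfl,
        indicator_of_mem (mem_Ici.2 (le_refl c))]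
      ring
    · have hx : (x : ℝ) ≠ c := fun h => hx (Subtype.ext h)
      rw [leftJump]
      rcases lt_or_gt_of_ne hx with h' | h'
      · rw [leftLim_indicator_of_le subset_rfl h'.le,
          indicator_of_notMem (show (x : ℝ) ∉ Ici c from not_le.2 h')]
        ring
      · rw [leftLim_indicator_of_lt Ioi_subset_Ici_self h',
          indicator_of_mem (show (x : ℝ) ∈ Ici c from h'.le)]
        ring
  · rw [rightModification_self, rightModification_of_lt hcv, rightLim_eq_add_rightJump,
      indicator_of_notMem (show u ∉ Ici c from not_le.2 hcu)]
    ring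

/-- The indicator of the open half-line has no left jump, so the integral starts at the right limit
of `h` at `c`. The case distinctions present it as an increment of one function of the end point. -/
theorem hasLYIntegral_indicator_Ioi (hh : IsRegulated u v h) (huv : u < v) (c : ℝ) :
    HasLYIntegral ((Ioi c).indicator fun _ => 1) h u v
      ((if v ≤ c then 0 else h v - Function.rightLim h c) -
        if u ≤ c then 0 else h u - Function.rightLim h c) := by
  have hφ := isRegulated_indicator_Ioi u v c
  rcases lt_or_ge c u with hcu | hcu
  · rw [if_neg (not_le.2 (hcu.trans huv)), if_neg (not_le.2 hcu), sub_sub_sub_cancel_right]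
    exact hasLYIntegral_of_eq_one huv hφ hh fun x hx =>
      indicator_of_mem (show x ∈ Ioi c from hcu.trans_le hx.1) _
  rw [if_pos hcu, sub_zero]
  rcases le_or_gt v c with hcv | hcv
  · rw [if_pos hcv]
    exact hasLYIntegral_of_eq_zero huv hφ hh fun x hx =>
      indicator_of_notMem (show x ∉ Ioi c from not_lt.2 (hx.2.le.trans hcv)) _
  rw [if_neg (not_le.2 hcv)]
  refine Or.inr ⟨huv, hφ, hh, _, 0, hasRRSIntegral_Ioi ⟨hcu, hcv⟩ (fun x hx => ?_)
    (hh.tendsto_rightModification hcu hcv le_rfl), ?_, ?_⟩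
  · rcases eq_or_lt_of_le hx.1 with rfl | h
    · rw [leftModification_self]
    · rw [leftModification_of_gt h]
      rcases le_or_gt x c with h' | h'
      · rw [leftLim_indicator_of_le Ioi_subset_Ici_self h',
          indicator_of_notMem (show x ∉ Ioi c from not_lt.2 h')]
      · rw [leftLim_indicator_of_lt subset_rfl h', indicator_of_mem (show x ∈ Ioi c from h')]
  · convert hasSum_zero using 2 with x
    rw [leftJump]
    rcases le_or_gt (x : ℝ) c with h' | h'
    · rw [leftLim_indicator_of_le Ioi_subset_Ici_self h',
        indicator_of_notMem (show (x : ℝ) ∉ Ioi c from not_lt.2 h')]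
      ring
    · rw [leftLim_indicator_of_lt subset_rfl h', indicator_of_mem (show (x : ℝ) ∈ Ioi c from h')]
      ring
  · rw [rightModification_self, rightModification_of_lt hcv,
      indicator_of_notMem (show u ∉ Ioi c from not_lt.2 hcu)]
    ring

end RRS

end

noncomputable section

/-! ### Indefinite Left Young integrals as limits of Left Cauchy sums -/

section Primitive

open IntervalPartition

variable {a b u v c C C' : ℝ} {g h φ ψ I I' : ℝ → ℝ} {lam : NestedPartitions a b}

/-- `I` is an indefinite Left Young integral of `φ` with respect to `h`, and an indefinite limit of
Left Cauchy sums. -/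
structure IsYoungPrimitive (lam : NestedPartitions a b) (φ h I : ℝ → ℝ) : Prop where
  ly : ∀ u v, a ≤ u → u < v → v ≤ b → HasLYIntegral φ h u v (I v - I u)
  lc : ∀ u v, a ≤ u → u < v → v ≤ b →
    Tendsto (fun m => (lam.part m).traceSum u v fun s t => φ s * (h t - h s)) atTop
      (𝓝 (I v - I u))
  left : ∀ t ∈ Ioc a b, Tendsto I (𝓝[<] t) (𝓝 (I t - Function.leftLim φ t * leftJump h t))
  right : ∀ t ∈ Ico a b, Tendsto I (𝓝[>] t) (𝓝 (I t + φ t * rightJump h t))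

theorem IsYoungPrimitive.isRegulated (hI : IsYoungPrimitive lam φ h I) : IsRegulated a b I :=
  ⟨fun t ht => ⟨_, hI.left t ht⟩, fun t ht => ⟨_, hI.right t ht⟩⟩

theorem IsYoungPrimitive.leftJump_eq (hI : IsYoungPrimitive lam φ h I) {t : ℝ} (ht : t ∈ Ioc a b) :
    leftJump I t = Function.leftLim φ t * leftJump h t :=
  leftJump_eq_of_tendsto (hI.left t ht)

theorem IsYoungPrimitive.rightJump_eq (hI : IsYoungPrimitive lam φ h I) {t : ℝ}
    (ht : t ∈ Ico a b) : rightJump I t = φ t * rightJump h t :=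
  rightJump_eq_of_tendsto (hI.right t ht)

theorem IsYoungPrimitive.add (hφ : IsRegulated a b φ) (hψ : IsRegulated a b ψ)
    (hI : IsYoungPrimitive lam φ h I) (hI' : IsYoungPrimitive lam ψ h I') :
    IsYoungPrimitive lam (φ + ψ) h (I + I') where
  ly u v hu huv hv := by
    convert (hI.ly u v hu huv hv).add (hI'.ly u v hu huv hv) using 1
    simp only [Pi.add_apply]; ring
  lc u v hu huv hv := by
    have := (hI.lc u v hu huv hv).add (hI'.lc u v hu huv hv)
    rw [show (I + I') v - (I + I') u = I v - I u + (I' v - I' u) by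
      simp only [Pi.add_apply]; ring]
    refine this.congr fun m => ?_
    rw [← traceSum_add]
    exact traceSum_congr huv.le fun s t _ _ _ => by simp [add_mul]
  left t ht := by
    have e : (I + I') t - Function.leftLim (φ + ψ) t * leftJump h t =
        I t - Function.leftLim φ t * leftJump h t +
          (I' t - Function.leftLim ψ t * leftJump h t) := by
      rw [hφ.leftLim_add hψ ht, Pi.add_apply]; ring
    rw [e]
    exact (hI.left t ht).add (hI'.left t ht)
  right t ht := by
    have e : (I + I') t + (φ + ψ) t * rightJump h t =
        I t + φ t * rightJump h t + (I' t + ψ t * rightJump h t) := by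
      rw [Pi.add_apply, Pi.add_apply]; ring
    rw [e]
    exact (hI.right t ht).add (hI'.right t ht)

theorem IsYoungPrimitive.smul (hφ : IsRegulated a b φ) (hI : IsYoungPrimitive lam φ h I) (r : ℝ) :
    IsYoungPrimitive lam (r • φ) h (r • I) where
  ly u v hu huv hv := by
    convert (hI.ly u v hu huv hv).smul r using 1
    simp only [Pi.smul_apply, smul_eq_mul]; ring
  lc u v hu huv hv := by
    have := (hI.lc u v hu huv hv).const_mul r
    rw [show (r • I) v - (r • I) u = r * (I v - I u) by
      simp only [Pi.smul_apply, smul_eq_mul]; ring]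
    refine this.congr fun m => ?_
    rw [← traceSum_mul]
    exact traceSum_congr huv.le fun s t _ _ _ => by simp [mul_assoc]
  left t ht := by
    have e : (r • I) t - Function.leftLim (r • φ) t * leftJump h t =
        r * (I t - Function.leftLim φ t * leftJump h t) := by
      rw [hφ.leftLim_smul r ht, Pi.smul_apply, smul_eq_mul]; ring
    rw [e]
    exact (hI.left t ht).const_mul r
  right t ht := by
    have e : (r • I) t + (r • φ) t * rightJump h t = r * (I t + φ t * rightJump h t) := by
      rw [Pi.smul_apply, Pi.smul_apply, smul_eq_mul, smul_eq_mul]; ring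
    rw [e]
    exact (hI.right t ht).const_mul r

/-- Over an interval with `s < c < t` the Left Cauchy sum misses the increment from `c` to `t`. In
the limit this loss is the right jump of `h` at `c`, or nothing if `c` is a partition point; hence
the accessibility hypothesis. -/
theorem isYoungPrimitive_indicator_Ici (hh : IsRegulated a b h)
    (hacc : ∀ t ∈ Ioo a b, rightJump h t ≠ 0 → t ∈ lam.allPoints) (c : ℝ) :
    IsYoungPrimitive lam ((Ici c).indicator fun _ => 1) h (fun t => h (max t c)) where
  ly u v hu huv hv := hasLYIntegral_indicator_Ici (hh.mono hu hv) huv c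
  lc u v hu huv hv := by
    rcases le_or_gt c u with hc | hc
    · rw [max_eq_left hc, max_eq_left (hc.trans huv.le)]
      refine tendsto_const_nhds.congr fun m => ?_
      rw [traceSum_Ici_of_ge huv.le hc, traceSum_sub hu huv.le hv]
    rcases le_or_gt v c with hcv | hcv
    · rw [max_eq_right hcv, max_eq_right (huv.le.trans hcv), sub_self]
      exact tendsto_const_nhds.congr fun m =>
        (traceSum_Ici_of_le huv.le hcv (w := fun s t => h t - h s) fun t => sub_self _).symm
    rw [max_eq_left hcv.le, max_eq_right hc.le]
    have h1 := tendsto_traceSum_ite_Ioo lam huv.le (c := c) (w := fun s t => h t - h s)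
      fun hc' hca => by
        have hcab : c ∈ Ico a b := ⟨hu.trans hc.le, hcv.trans_le hv⟩
        have h0 : rightJump h c = 0 := by
          by_contra h0
          exact hca (hacc c ⟨hu.trans_lt hc, hcab.2⟩ h0)
        have := (hh.tendsto_right hcab).sub_const (h c)
        simpa [h0] using this
    have h2 := (tendsto_const_nhds (x := h v - h c)).sub h1
    rw [sub_zero] at h2
    refine h2.congr fun m => ?_
    rw [traceSum_Ici hc.le (w := fun s t => h t - h s) (fun t => sub_self _), traceSum_sub (hu.trans hc.le) hcv.le hv]
  left t ht := by
    rcases le_or_gt t c with h' | h'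
    · rw [leftLim_indicator_of_le subset_rfl h', zero_mul, sub_zero]
      refine tendsto_const_nhds.congr' ?_
      filter_upwards [self_mem_nhdsWithin] with s hs
      rw [max_eq_right h', max_eq_right ((le_of_lt hs).trans h')]
    · rw [leftLim_indicator_of_lt Ioi_subset_Ici_self h', one_mul, max_eq_left h'.le]
      refine (hh.tendsto_left ht).congr' ?_
      filter_upwards [Ioo_mem_nhdsLT h'] with s hs
      rw [max_eq_left hs.1.le]
  right t ht := by
    rcases lt_or_ge t c with h' | h'
    · rw [indicator_of_notMem (show t ∉ Ici c from not_le.2 h'), zero_mul, add_zero]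
      refine tendsto_const_nhds.congr' ?_
      filter_upwards [Ioo_mem_nhdsGT h'] with s hs
      rw [max_eq_right h'.le, max_eq_right hs.2.le]
    · rw [indicator_of_mem (show t ∈ Ici c from h'), one_mul, max_eq_left h']
      refine (hh.tendsto_right ht).congr' ?_
      filter_upwards [self_mem_nhdsWithin] with s hs
      rw [max_eq_left (h'.trans (le_of_lt hs))]

/-- No accessibility is needed: what the Cauchy sum misses is counted from the right limit at `c`
and always tends to zero. -/
theorem isYoungPrimitive_indicator_Ioi (hh : IsRegulated a b h) (c : ℝ) :
    IsYoungPrimitive lam ((Ioi c).indicator fun _ => 1) h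
      (fun t => if t ≤ c then 0 else h t - Function.rightLim h c) where
  ly u v hu huv hv := hasLYIntegral_indicator_Ioi (hh.mono hu hv) huv c
  lc u v hu huv hv := by
    rcases lt_or_ge c u with hc | hc
    · rw [if_neg (not_le.2 (hc.trans huv)), if_neg (not_le.2 hc), sub_sub_sub_cancel_right]
      refine tendsto_const_nhds.congr fun m => ?_
      rw [traceSum_Ioi_of_gt huv.le hc, traceSum_sub hu huv.le hv]
    rw [if_pos hc, sub_zero]
    rcases le_or_gt v c with hcv | hcv
    · rw [if_pos hcv]
      exact tendsto_const_nhds.congr fun m => (traceSum_Ioi_of_le huv.le hcv).symm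
    rw [if_neg (not_le.2 hcv)]
    -- The integrator matters only to the right of `c`; replacing its values up to `c` by the right
    -- limit makes it right continuous there.
    set h' : ℝ → ℝ := fun t => if t ≤ c then Function.rightLim h c else h t with hh'
    have e1 : ∀ t, c < t → h' t = h t := fun t ht => by simp [hh', not_le.2 ht]
    have e2 : h' c = Function.rightLim h c := by simp [hh']
    have h1 := tendsto_traceSum_ite_right' lam huv.le (c := c) (w := fun s t => h' t - h' s)
      fun hc' => by
        have h3 := (hh.tendsto_rightLim ⟨hu.trans hc, hcv.trans_le hv⟩).sub_const
          (Function.rightLim h c)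
        rw [sub_self] at h3
        refine h3.congr' ?_
        filter_upwards [self_mem_nhdsWithin] with t ht
        rw [e1 t ht, e2]
    have h2 := (tendsto_const_nhds (x := h' v - h' c)).sub h1
    rw [sub_zero, e1 v hcv, e2] at h2
    refine h2.congr fun m => ?_
    rw [← e1 v hcv, ← e2, ← traceSum_sub (κ := lam.part m) (hu.trans hc) hcv.le hv h',
      ← traceSum_Ioi hc (w := fun s t => h' t - h' s) (fun t => sub_self _)]
    refine traceSum_congr huv.le fun s t hs hst _ => ?_
    by_cases hsc : c < s
    · rw [e1 s hsc, e1 t (hsc.trans_le hst)]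
    · rw [indicator_of_notMem (show s ∉ Ioi c from hsc), zero_mul, zero_mul]
  left t ht := by
    rcases le_or_gt t c with h' | h'
    · rw [leftLim_indicator_of_le Ioi_subset_Ici_self h', zero_mul, sub_zero]
      refine tendsto_const_nhds.congr' ?_
      filter_upwards [self_mem_nhdsWithin] with s hs
      rw [if_pos h', if_pos ((le_of_lt hs).trans h')]
    · rw [leftLim_indicator_of_lt subset_rfl h', one_mul, if_neg (not_le.2 h'), sub_right_comm]
      refine ((hh.tendsto_left ht).sub_const _).congr' ?_
      filter_upwards [Ioo_mem_nhdsLT h'] with s hs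
      rw [if_neg (not_le.2 hs.1)]
  right t ht := by
    rcases lt_trichotomy t c with h' | rfl | h'
    · rw [indicator_of_notMem (show t ∉ Ioi c from not_lt.2 h'.le), zero_mul, add_zero]
      refine tendsto_const_nhds.congr' ?_
      filter_upwards [Ioo_mem_nhdsGT h'] with s hs
      rw [if_pos h'.le, if_pos hs.2.le]
    · rw [indicator_of_notMem (show t ∉ Ioi t from lt_irrefl t), zero_mul, add_zero, if_pos le_rfl]
      have h3 := (hh.tendsto_rightLim ht).sub_const (Function.rightLim h t)
      rw [sub_self] at h3
      refine h3.congr' ?_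
      filter_upwards [self_mem_nhdsWithin] with s hs
      rw [if_neg (not_le.2 hs)]
    · rw [indicator_of_mem (show t ∈ Ioi c from h'), one_mul, if_neg (not_le.2 h'),
        sub_add_eq_add_sub]
      refine ((hh.tendsto_right ht).sub_const _).congr' ?_
      filter_upwards [self_mem_nhdsWithin] with s hs
      rw [if_neg (not_le.2 (h'.trans hs))]

theorem exists_isYoungPrimitive_of_mem_stepSpan (hh : IsRegulated a b h)
    (hacc : ∀ t ∈ Ioo a b, rightJump h t ≠ 0 → t ∈ lam.allPoints) {σ : ℝ → ℝ}
    (hσ : σ ∈ stepSpan) : ∃ I, IsYoungPrimitive lam σ h I := by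
  refine stepSpan_induction (p := fun σ => ∃ I, IsYoungPrimitive lam σ h I)
    (fun c => ⟨_, isYoungPrimitive_indicator_Ici hh hacc c⟩)
    (fun c => ⟨_, isYoungPrimitive_indicator_Ioi hh c⟩) ?_ ?_ ?_ hσ
  · have := (isYoungPrimitive_indicator_Ici hh hacc 0).smul (isRegulated_indicator_Ici a b 0) 0
    rw [zero_smul] at this
    exact ⟨_, this⟩
  · rintro φ ψ hφ hψ ⟨I, hI⟩ ⟨I', hI'⟩
    exact ⟨_, hI.add (isRegulated_of_mem_stepSpan hφ) (isRegulated_of_mem_stepSpan hψ) hI'⟩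
  · rintro r φ hφ ⟨I, hI⟩
    exact ⟨_, hI.smul (isRegulated_of_mem_stepSpan hφ) r⟩

/-! ### Passage to the limit -/

/-- The bound is applied to sums with a single term, over an interval that shrinks to a point. -/
theorem PairingBound.tendsto_jump_le (hP : PairingBound a b ψ h C) {l : Filter ℝ} [l.NeBot]
    {s t s' : ℝ → ℝ} {L L' : ℝ} (hs : ∀ᶠ x in l, s x ∈ Icc a b ∧ t x ∈ Icc a b ∧
      s' x ∈ Icc a b ∧ s x ≤ t x) (hL : Tendsto (fun x => ψ (s' x)) l (𝓝 L))
    (hL' : Tendsto (fun x => h (t x) - h (s x)) l (𝓝 L')) : |L * L'| ≤ C := by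
  refine le_of_tendsto (hL.mul hL').abs ?_
  filter_upwards [hs] with x hx
  have := hP.sum_le 1 (fun i => if i = 0 then s x else t x) (fun _ => s' x)
    (by
      intro i j hij
      by_cases hi : i = 0 <;> by_cases hj : j = 0
      · simp [hi, hj]
      · simp [hi, hj, hx.2.2.2]
      · omega
      · simp [hi, hj])
    (fun _ _ _ => le_rfl) (fun i => by split_ifs <;> tauto) (fun _ => hx.2.2.1)
  simpa using this

theorem PairingBound.rightJump_le (hP : PairingBound a b ψ h C) (hh : IsRegulated a b h) {t : ℝ}
    (ht : t ∈ Ico a b) : |ψ t * rightJump h t| ≤ C := by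
  have h1 := (hh.tendsto_right ht).sub_const (h t)
  rw [add_sub_cancel_left] at h1
  refine hP.tendsto_jump_le (s := fun _ => t) (s' := fun _ => t) ?_ tendsto_const_nhds h1
  filter_upwards [Ioo_mem_nhdsGT ht.2] with x hx
  exact ⟨⟨ht.1, ht.2.le⟩, ⟨ht.1.trans hx.1.le, hx.2.le⟩, ⟨ht.1, ht.2.le⟩, hx.1.le⟩

theorem PairingBound.leftJump_le (hP : PairingBound a b ψ h C) (hψ : IsRegulated a b ψ)
    (hh : IsRegulated a b h) {t : ℝ} (ht : t ∈ Ioc a b) :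
    |Function.leftLim ψ t * leftJump h t| ≤ C := by
  have h1 := (tendsto_const_nhds (x := h t)).sub (hh.tendsto_left ht)
  rw [sub_sub_cancel] at h1
  refine hP.tendsto_jump_le (t := fun _ => t) (s' := fun x => x) ?_ (hψ.tendsto_leftLim ht) h1
  filter_upwards [Ioo_mem_nhdsLT ht.1] with x hx
  exact ⟨⟨hx.1.le, hx.2.le.trans ht.2⟩, ⟨ht.1.le, ht.2⟩, ⟨hx.1.le, hx.2.le.trans ht.2⟩, hx.2.le⟩

theorem PairingBound.sub (hφ : IsRegulated a b φ) (hψ : IsRegulated a b ψ)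
    (h₁ : PairingBound a b φ h C) (h₂ : PairingBound a b ψ h C') :
    PairingBound a b (φ - ψ) h (C + C') where
  sum_le n x y hx hy hxm hym := by
    simp only [Pi.sub_apply, sub_mul, Finset.sum_sub_distrib]
    exact (abs_sub _ _).trans (add_le_add (h₁.sum_le n x y hx hy hxm hym)
      (h₂.sum_le n x y hx hy hxm hym))
  jump_le T hT := by
    refine le_trans (Finset.sum_le_sum fun x hx => ?_) ((Finset.sum_add_distrib).trans_le
      (add_le_add (h₁.jump_le T hT) (h₂.jump_le T hT)))
    rw [hφ.leftJump_sub hψ ⟨(hT hx).1, (hT hx).2.le⟩, sub_mul]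
    exact abs_sub _ _

theorem PairingBound.traceSum_le (hP : PairingBound a b ψ h C) (κ : IntervalPartition a b)
    (hu : a ≤ u) (huv : u ≤ v) (hv : v ≤ b) :
    |κ.traceSum u v fun s t => ψ s * (h t - h s)| ≤ C := by
  -- The values of a partition beyond its last index are arbitrary, so the sequence is frozen there
  -- in order to be monotone on all of `ℕ`.
  have hm : Monotone fun i => κ.trace u v (min i κ.n) := fun i j hij =>
    trace_mono (min_le_min hij le_rfl) (min_le_right _ _)
  have hmem : ∀ i, κ.trace u v (min i κ.n) ∈ Icc a b := fun i =>
    ⟨hu.trans (trace_mem huv _).1, (trace_mem huv _).2.trans hv⟩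
  have := hP.sum_le κ.n _ _ hm hm hmem hmem
  convert this using 2
  refine Finset.sum_congr rfl fun i hi => ?_
  have hi := Finset.mem_range.1 hi
  simp only [min_eq_left hi.le, min_eq_left (Nat.succ_le_of_lt hi)]

theorem IsRegulated.tendsto_max_sub (hψ : IsRegulated u v ψ) {y : ℝ} (hy : y ∈ Icc u v) :
    Tendsto (fun δ => ψ (max (y - δ) u)) (𝓝[>] 0) (𝓝 (leftModification u ψ y)) := by
  rcases eq_or_lt_of_le hy.1 with rfl | h
  · rw [leftModification_self]
    refine tendsto_const_nhds.congr' ?_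
    filter_upwards [self_mem_nhdsWithin] with δ hδ
    rw [max_eq_right (sub_le_self _ (le_of_lt hδ))]
  · rw [leftModification_of_gt h]
    refine (hψ.tendsto_leftLim ⟨h, hy.2⟩).comp (tendsto_nhdsWithin_iff.2 ⟨?_, ?_⟩)
    · have : Tendsto (fun δ : ℝ => max (y - δ) u) (𝓝 0) (𝓝 (max (y - 0) u)) := by
        apply Continuous.tendsto; fun_prop
      rw [sub_zero, max_eq_left h.le] at this
      exact this.mono_left nhdsWithin_le_nhds
    · filter_upwards [self_mem_nhdsWithin] with δ hδ
      exact max_lt (sub_lt_self _ hδ) h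

theorem IsRegulated.tendsto_min_add (hh : IsRegulated u v h) {x : ℝ} (hx : x ∈ Icc u v) :
    Tendsto (fun δ => h (min (x + δ) v)) (𝓝[>] 0) (𝓝 (rightModification v h x)) := by
  rcases eq_or_lt_of_le hx.2 with rfl | h'
  · rw [rightModification_self]
    refine tendsto_const_nhds.congr' ?_
    filter_upwards [self_mem_nhdsWithin] with δ hδ
    rw [min_eq_right (le_add_of_nonneg_right (le_of_lt hδ))]
  · rw [rightModification_of_lt h']
    refine (hh.tendsto_rightLim ⟨hx.1, h'⟩).comp (tendsto_nhdsWithin_iff.2 ⟨?_, ?_⟩)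
    · have : Tendsto (fun δ : ℝ => min (x + δ) v) (𝓝 0) (𝓝 (min (x + 0) v)) := by
        apply Continuous.tendsto; fun_prop
      rw [add_zero, min_eq_left h'.le] at this
      exact this.mono_left nhdsWithin_le_nhds
    · filter_upwards [self_mem_nhdsWithin] with δ hδ
      exact lt_min (lt_add_of_pos_right _ hδ) h'

/-- Sums with the one-sided modifications are limits, as `δ ↓ 0`, of ordinary sums whose nodes are
moved to the right and whose tags are moved to the left by `δ`. A bound for all ordinary sums, with
tags not tied to the partition intervals, is exactly what passes to this limit. -/
theorem PairingBound.modified_sum_le (hP : PairingBound a b ψ h C) (hψ : IsRegulated a b ψ)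
    (hh : IsRegulated a b h) (hu : a ≤ u) (huv : u < v) (hv : v ≤ b) (κ : IntervalPartition u v)
    {y : ℕ → ℝ} (hy : ∀ i < κ.n, y i ∈ Icc (κ.pt i) (κ.pt (i + 1))) :
    |∑ i ∈ Finset.range κ.n, leftModification u ψ (y i) *
      (rightModification v h (κ.pt (i + 1)) - rightModification v h (κ.pt i))| ≤ C := by
  have hn : 0 < κ.n := by
    by_contra hn
    have h1 := κ.pt_zero
    have h2 := κ.pt_last
    rw [show κ.n = 0 by omega, h1] at h2
    exact huv.ne h2
  have hyuv : ∀ i < κ.n, y i ∈ Icc u v := fun i hi =>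
    ⟨(κ.pt_mem_Icc hi.le).1.trans (hy i hi).1, (hy i hi).2.trans (κ.pt_mem_Icc hi).2⟩
  have hψ' := hψ.mono hu hv
  have hh' := hh.mono hu hv
  have hlim : Tendsto (fun δ : ℝ => ∑ i ∈ Finset.range κ.n, ψ (max (y i - δ) u) *
      (h (min (κ.pt (i + 1) + δ) v) - h (min (κ.pt i + δ) v))) (𝓝[>] 0)
      (𝓝 (∑ i ∈ Finset.range κ.n, leftModification u ψ (y i) *
        (rightModification v h (κ.pt (i + 1)) - rightModification v h (κ.pt i)))) := by
    refine tendsto_finsetSum (Finset.range κ.n) fun i hi => ?_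
    have hi := Finset.mem_range.1 hi
    exact (hψ'.tendsto_max_sub (hyuv i hi)).mul
      ((hh'.tendsto_min_add (κ.pt_mem_Icc hi)).sub (hh'.tendsto_min_add (κ.pt_mem_Icc hi.le)))
  refine le_of_tendsto hlim.abs ?_
  filter_upwards [self_mem_nhdsWithin] with δ hδ
  have hδ : 0 < δ := hδ
  have := hP.sum_le κ.n (fun i => min (κ.pt (min i κ.n) + δ) v)
    (fun i => max (y (min i (κ.n - 1)) - δ) u) ?_ ?_ ?_ ?_
  · refine le_of_eq_of_le (congrArg abs (Finset.sum_congr rfl fun i hi => ?_)) this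
    have hi := Finset.mem_range.1 hi
    simp only [min_eq_left hi.le, min_eq_left (Nat.succ_le_of_lt hi),
      min_eq_left (Nat.le_sub_one_of_lt hi)]
  · intro i j hij
    exact min_le_min (by
      have := κ.pt_mono (min_le_min hij (le_refl κ.n)) (min_le_right _ _); linarith) le_rfl
  · have hy' : Monotone fun i => y (min i (κ.n - 1)) := by
      refine monotone_nat_of_le_succ fun i => ?_
      rcases lt_or_ge (i + 1) κ.n with h' | h'
      · rw [min_eq_left (show i ≤ κ.n - 1 by omega), min_eq_left (show i + 1 ≤ κ.n - 1 by omega)]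
        exact (hy i (by omega)).2.trans (hy (i + 1) h').1
      · rw [min_eq_right (show κ.n - 1 ≤ i by omega), min_eq_right (show κ.n - 1 ≤ i + 1 by omega)]
    intro i j hij
    exact max_le_max (by have := hy' hij; dsimp only at this; linarith) le_rfl
  · intro i
    have h1 := κ.pt_mem_Icc (min_le_right i κ.n)
    exact ⟨le_min (by linarith [h1.1]) (hu.trans huv.le), (min_le_right _ _).trans hv⟩
  · intro i
    have h1 := hyuv (min i (κ.n - 1)) (lt_of_le_of_lt (min_le_right _ _) (by omega))
    exact ⟨hu.trans (le_max_right _ _), max_le (by linarith [h1.2]) (huv.le.trans hv)⟩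

theorem PairingBound.rrs_le (hP : PairingBound a b ψ h C) (hψ : IsRegulated a b ψ)
    (hh : IsRegulated a b h) (hu : a ≤ u) (huv : u < v) (hv : v ≤ b) {J : ℝ}
    (hJ : HasRRSIntegral (leftModification u ψ) (rightModification v h) u v J) : |J| ≤ C := by
  refine le_of_forall_pos_lt_add fun ε hε => ?_
  obtain ⟨κ, hκ⟩ := hJ ε hε
  have hy : ∀ i < κ.n, κ.pt i ∈ Icc (κ.pt i) (κ.pt (i + 1)) :=
    fun i hi => ⟨le_rfl, (κ.pt_lt i hi).le⟩
  have h1 := hκ κ subset_rfl κ.pt hy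
  have h2 := hP.modified_sum_le hψ hh hu huv hv κ hy
  have := abs_sub_abs_le_abs_sub J (∑ i ∈ Finset.range κ.n, leftModification u ψ (κ.pt i) *
    (rightModification v h (κ.pt (i + 1)) - rightModification v h (κ.pt i)))
  rw [abs_sub_comm] at h1
  linarith

/-- The Left Young integral over a fixed interval, as a limit along step functions. -/
theorem exists_hasLYIntegral_of_pairingBound (hφ : IsRegulated a b φ) (hh : IsRegulated a b h)
    (hu : a ≤ u) (huv : u < v) (hv : v ≤ b) {σ : ℕ → ℝ → ℝ} {L : ℕ → ℝ}
    (hσ : ∀ n, IsRegulated a b (σ n)) (hL : ∀ n, HasLYIntegral (σ n) h u v (L n))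
    (hP : ∀ n : ℕ, PairingBound a b (φ - σ n) h (1 / ((n : ℝ) + 1))) :
    ∃ M, HasLYIntegral φ h u v M ∧ ∀ n : ℕ, |M - L n| ≤ 3 * (1 / ((n : ℝ) + 1)) := by
  have hdata : ∀ n, ∃ J S : ℝ,
      HasRRSIntegral (leftModification u (σ n)) (rightModification v h) u v J ∧
      HasSum (fun x : Ioo u v => leftJump (σ n) x * rightJump h x) S ∧
      L n = J + σ n u * rightJump h u + S := by
    intro n
    rcases hL n with ⟨h, -⟩ | ⟨-, -, -, h⟩
    · exact absurd h huv.ne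
    · exact h
  choose J S hJ hS hLn using hdata
  have hlim : Tendsto (fun n : ℕ => 1 / ((n : ℝ) + 1)) atTop (𝓝 0) :=
    tendsto_one_div_add_atTop_nhds_zero_nat
  -- The difference of two approximants is the difference of their errors, so the Riemann–Stieltjes
  -- integrals form a Cauchy sequence.
  have hJJ : ∀ n m, |J n - J m| ≤ 1 / ((m : ℝ) + 1) + 1 / ((n : ℝ) + 1) := by
    intro n m
    have h1 := (hP m).sub (hφ.sub (hσ m)) (hφ.sub (hσ n)) (hP n)
    rw [sub_sub_sub_cancel_left] at h1
    refine h1.rrs_le ((hσ n).sub (hσ m)) hh hu huv hv ?_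
    have h2 := (hJ n).add huv ((hJ m).smul (-1))
    rw [neg_one_mul, ← sub_eq_add_neg] at h2
    refine h2.congr fun x hx => ?_
    rw [sub_eq_add_neg (σ n), ← leftModification_add ((hσ n).mono hu hv)
      (((hσ m).smul (-1)).mono hu hv |>.congr fun x _ => by simp) hx, Pi.add_apply, Pi.add_apply,
      leftModification_smul ((hσ m).mono hu hv) (-1) hx, neg_one_smul]
  have hcauchy : CauchySeq J := by
    refine cauchySeq_of_le_tendsto_0' (fun n : ℕ => 1 / ((n : ℝ) + 1) + 1 / ((n : ℝ) + 1))
      (fun n m hnm => ?_) (by simpa using hlim.add hlim)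
    rw [Real.dist_eq]
    refine (hJJ n m).trans (add_le_add ?_ le_rfl)
    exact Nat.one_div_le_one_div hnm
  obtain ⟨J₀, hJ₀⟩ := cauchySeq_tendsto_of_complete hcauchy
  have hJn : ∀ n, |J₀ - J n| ≤ 1 / ((n : ℝ) + 1) := by
    intro n
    have h1 := ((hJ₀.sub_const (J n)).abs)
    have h2 : Tendsto (fun m : ℕ => 1 / ((n : ℝ) + 1) + 1 / ((m : ℝ) + 1)) atTop
        (𝓝 (1 / ((n : ℝ) + 1))) := by simpa using hlim.const_add (1 / ((n : ℝ) + 1))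
    exact le_of_tendsto_of_tendsto' h1 h2 fun m => hJJ m n
  have hRRS : HasRRSIntegral (leftModification u φ) (rightModification v h) u v J₀ := by
    intro ε hε
    obtain ⟨n, hn⟩ := exists_nat_one_div_lt (K := ℝ) (ε := ε / 3) (by positivity)
    obtain ⟨κ₀, hκ₀⟩ := hJ n (ε / 3) (by positivity)
    refine ⟨κ₀, fun κ hκ y hy => ?_⟩
    have h1 := hκ₀ κ hκ y hy
    have h2 := (hP n).modified_sum_le (hφ.sub (hσ n)) hh hu huv hv κ hy
    have h3 := hJn n
    have h4 : ∑ i ∈ Finset.range κ.n, leftModification u φ (y i) *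
        (rightModification v h (κ.pt (i + 1)) - rightModification v h (κ.pt i)) =
        ∑ i ∈ Finset.range κ.n, leftModification u (φ - σ n) (y i) *
          (rightModification v h (κ.pt (i + 1)) - rightModification v h (κ.pt i)) +
        ∑ i ∈ Finset.range κ.n, leftModification u (σ n) (y i) *
          (rightModification v h (κ.pt (i + 1)) - rightModification v h (κ.pt i)) := by
      rw [← Finset.sum_add_distrib]
      refine Finset.sum_congr rfl fun i hi => ?_
      have hi := Finset.mem_range.1 hi
      rw [← add_mul]
      congr 1
      have := leftModification_add (hφ.sub (hσ n) |>.mono hu hv) ((hσ n).mono hu hv)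
        ⟨(κ.pt_mem_Icc hi.le).1.trans (hy i hi).1, (hy i hi).2.trans (κ.pt_mem_Icc hi).2⟩
      rw [sub_add_cancel] at this
      exact this.symm
    rw [h4]
    set A := ∑ i ∈ Finset.range κ.n, leftModification u (φ - σ n) (y i) *
          (rightModification v h (κ.pt (i + 1)) - rightModification v h (κ.pt i))
    set B := ∑ i ∈ Finset.range κ.n, leftModification u (σ n) (y i) *
          (rightModification v h (κ.pt (i + 1)) - rightModification v h (κ.pt i))
    have h5 : A + B - J₀ = A + (B - J n) - (J₀ - J n) := by ring
    rw [h5]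
    have := abs_sub (A + (B - J n)) (J₀ - J n)
    have := abs_add_le A (B - J n)
    linarith
  have hjd : ∀ n, ∀ x : Ioo u v, leftJump φ x * rightJump h x =
      leftJump (φ - σ n) x * rightJump h x + leftJump (σ n) x * rightJump h x := by
    intro n x
    rw [hφ.leftJump_sub (hσ n) ⟨hu.trans_lt x.2.1, x.2.2.le.trans hv⟩]
    ring
  have hbd : ∀ n, ∀ T : Finset (Ioo u v), ∑ x ∈ T, |leftJump (φ - σ n) x * rightJump h x| ≤
      1 / ((n : ℝ) + 1) := by
    intro n T
    have := (hP n).jump_le (T.map ⟨Subtype.val, Subtype.val_injective⟩) (by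
      intro x hx
      obtain ⟨y, _, rfl⟩ := Finset.mem_map.1 (Finset.mem_coe.1 hx)
      exact ⟨hu.trans_lt y.2.1, y.2.2.trans_le hv⟩)
    simpa using this
  have hsumd : ∀ n, Summable fun x : Ioo u v => |leftJump (φ - σ n) x * rightJump h x| :=
    fun n => summable_of_sum_le (fun _ => abs_nonneg _) (hbd n)
  have hsum : Summable fun x : Ioo u v => leftJump φ x * rightJump h x := by
    rw [funext (hjd 0)]
    exact (hsumd 0).of_abs.add (hS 0).summable
  obtain ⟨S₀, hS₀⟩ := hsum
  have hSn : ∀ n, |S₀ - S n| ≤ 1 / ((n : ℝ) + 1) := by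
    intro n
    have h1 : HasSum (fun x : Ioo u v => leftJump (φ - σ n) x * rightJump h x) (S₀ - S n) := by
      have e : (fun x : Ioo u v => leftJump (φ - σ n) x * rightJump h x) = fun x : Ioo u v =>
          leftJump φ x * rightJump h x - leftJump (σ n) x * rightJump h x :=
        funext fun x => by rw [hjd n x]; ring
      rw [e]
      exact hS₀.sub (hS n)
    rw [← h1.tsum_eq]
    have h2 : ‖∑' x : Ioo u v, leftJump (φ - σ n) x * rightJump h x‖ ≤ _ :=
      norm_tsum_le_tsum_norm (f := fun x : Ioo u v => leftJump (φ - σ n) x * rightJump h x) (hsumd n)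
    exact h2.trans ((hsumd n).tsum_le_of_sum_le (hbd n))
  -- The Riemann–Stieltjes part, the jump at `u` and the jump sum are each within `1 / (n + 1)` of
  -- their approximants; hence the factor `3`.
  refine ⟨J₀ + φ u * rightJump h u + S₀,
    Or.inr ⟨huv, hφ.mono hu hv, hh.mono hu hv, J₀, S₀, hRRS, hS₀, rfl⟩, fun n => ?_⟩
  rw [hLn n, show J₀ + φ u * rightJump h u + S₀ - (J n + σ n u * rightJump h u + S n) =
    (J₀ - J n) + (φ - σ n) u * rightJump h u + (S₀ - S n) by simp only [Pi.sub_apply]; ring]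
  have h1 := (hP n).rightJump_le hh ⟨hu, huv.trans_le hv⟩
  refine (abs_add_le _ _).trans ((add_le_add (abs_add_le _ _) le_rfl).trans ?_)
  have := hJn n
  have := hSn n
  linarith

/-- Existence of indefinite Left Young integrals, when the right jumps of the integrator are
accessible. -/
theorem exists_isYoungPrimitive (hφ : IsRegulated a b φ) (hh : IsRegulated a b h)
    (hacc : ∀ t ∈ Ioo a b, rightJump h t ≠ 0 → t ∈ lam.allPoints)
    (happ : ∀ ε > 0, ∃ σ ∈ stepSpan, PairingBound a b (φ - σ) h ε) :
    ∃ I, IsYoungPrimitive lam φ h I := by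
  choose σ hσ hP using fun n : ℕ => happ (1 / ((n : ℝ) + 1)) Nat.one_div_pos_of_nat
  have hσr : ∀ n, IsRegulated a b (σ n) := fun n => isRegulated_of_mem_stepSpan (hσ n)
  choose I hI using fun n => exists_isYoungPrimitive_of_mem_stepSpan hh hacc (hσ n)
  have hex : ∀ u v, a ≤ u → u < v → v ≤ b → ∃ M, HasLYIntegral φ h u v M ∧
      ∀ n : ℕ, |M - (I n v - I n u)| ≤ 3 * (1 / ((n : ℝ) + 1)) := fun u v hu huv hv =>
    exists_hasLYIntegral_of_pairingBound hφ hh hu huv hv hσr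
      (fun n => (hI n).ly u v hu huv hv) hP
  have hlim : Tendsto (fun n : ℕ => 3 * (1 / ((n : ℝ) + 1))) atTop (𝓝 0) := by
    simpa using (tendsto_one_div_add_atTop_nhds_zero_nat (𝕜 := ℝ)).const_mul 3
  have htend : ∀ {M : ℝ} {K : ℕ → ℝ}, (∀ n : ℕ, |M - K n| ≤ 3 * (1 / ((n : ℝ) + 1))) →
      Tendsto K atTop (𝓝 M) := by
    intro M K hMK
    rw [tendsto_iff_dist_tendsto_zero]
    refine squeeze_zero (fun _ => dist_nonneg) (fun n => ?_) hlim
    rw [dist_comm]; exact hMK n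
  have hex' : ∀ t, ∃ M, t ∈ Icc a b → (∀ n : ℕ, |M - (I n t - I n a)| ≤ 3 * (1 / ((n : ℝ) + 1))) := by
    intro t
    by_cases ht : t ∈ Ioc a b
    · obtain ⟨M, -, hM⟩ := hex a t le_rfl ht.1 ht.2
      exact ⟨M, fun _ => hM⟩
    · refine ⟨0, fun ht' n => ?_⟩
      rw [show t = a by
        by_contra hne
        exact ht ⟨lt_of_le_of_ne ht'.1 (Ne.symm hne), ht'.2⟩]
      simp only [sub_self, abs_zero]
      positivity
  choose K hK using hex'
  -- Additivity over adjacent intervals is inherited from the step functions, since the integrals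
  -- over `[a,u]`, `[a,v]` and `[u,v]` are all limits of theirs.
  have hKuv : ∀ u v, a ≤ u → u < v → v ≤ b → HasLYIntegral φ h u v (K v - K u) ∧
      ∀ n : ℕ, |(K v - K u) - (I n v - I n u)| ≤ 3 * (1 / ((n : ℝ) + 1)) := by
    intro u v hu huv hv
    obtain ⟨M, hM, hMn⟩ := hex u v hu huv hv
    have h1 := (htend (hK v ⟨hu.trans huv.le, hv⟩)).sub (htend (hK u ⟨hu, huv.le.trans hv⟩))
    simp only [sub_sub_sub_cancel_right] at h1
    rw [tendsto_nhds_unique h1 (htend hMn)]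
    exact ⟨hM, hMn⟩
  -- In each of the three limits the error is at most four times `1 / (n + 1)`: three from the
  -- primitive, one from the sum or the jump. The factor `5` leaves a strict margin.
  have hlim5 : Tendsto (fun n : ℕ => 5 * (1 / ((n : ℝ) + 1))) atTop (𝓝 0) := by
    simpa using (tendsto_one_div_add_atTop_nhds_zero_nat (𝕜 := ℝ)).const_mul 5
  refine ⟨K, fun u v hu huv hv => (hKuv u v hu huv hv).1, fun u v hu huv hv => ?_,
    fun t ht => ?_, fun t ht => ?_⟩
  · refine Metric.tendsto_nhds.2 fun ε hε => ?_
    obtain ⟨n, hn⟩ := (hlim5.eventually (gt_mem_nhds (half_pos hε))).exists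
    filter_upwards [Metric.tendsto_nhds.1 ((hI n).lc u v hu huv hv) (ε / 2) (half_pos hε)]
      with m hm
    rw [Real.dist_eq] at hm ⊢
    have h1 := (hP n).traceSum_le (lam.part m) hu huv.le hv
    have h2 := (hKuv u v hu huv hv).2 n
    have h3 : ((lam.part m).traceSum u v fun s t => φ s * (h t - h s)) =
        ((lam.part m).traceSum u v fun s t => (φ - σ n) s * (h t - h s)) +
        (lam.part m).traceSum u v fun s t => σ n s * (h t - h s) := by
      rw [← traceSum_add]
      exact traceSum_congr huv.le fun s t _ _ _ => by simp only [Pi.sub_apply]; ring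
    rw [h3]
    set A := (lam.part m).traceSum u v fun s t => (φ - σ n) s * (h t - h s)
    set B := (lam.part m).traceSum u v fun s t => σ n s * (h t - h s)
    rw [show A + B - (K v - K u) = A + (B - (I n v - I n u)) - ((K v - K u) - (I n v - I n u)) by
      ring]
    have h4 := abs_sub (A + (B - (I n v - I n u))) ((K v - K u) - (I n v - I n u))
    have h5 := abs_add_le A (B - (I n v - I n u))
    have h6 : 0 < 1 / ((n : ℝ) + 1) := Nat.one_div_pos_of_nat
    linarith
  · refine Metric.tendsto_nhds.2 fun ε hε => ?_
    obtain ⟨n, hn⟩ := (hlim5.eventually (gt_mem_nhds (half_pos hε))).exists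
    filter_upwards [Metric.tendsto_nhds.1 ((hI n).left t ht) (ε / 2) (half_pos hε),
      Ioo_mem_nhdsLT ht.1] with s hs hst
    rw [Real.dist_eq] at hs ⊢
    have h1 := (hP n).leftJump_le (hφ.sub (hσr n)) hh ht
    rw [hφ.leftLim_sub (hσr n) ht] at h1
    have h2 := (hKuv s t hst.1.le hst.2 ht.2).2 n
    rw [show K s - (K t - Function.leftLim φ t * leftJump h t) =
      (I n s - (I n t - Function.leftLim (σ n) t * leftJump h t)) +
      (Function.leftLim φ t - Function.leftLim (σ n) t) * leftJump h t -
      ((K t - K s) - (I n t - I n s)) by ring]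
    refine (abs_sub _ _).trans_lt ?_
    have := abs_add_le (I n s - (I n t - Function.leftLim (σ n) t * leftJump h t))
      ((Function.leftLim φ t - Function.leftLim (σ n) t) * leftJump h t)
    have h6 : 0 < 1 / ((n : ℝ) + 1) := Nat.one_div_pos_of_nat
    linarith
  · refine Metric.tendsto_nhds.2 fun ε hε => ?_
    obtain ⟨n, hn⟩ := (hlim5.eventually (gt_mem_nhds (half_pos hε))).exists
    filter_upwards [Metric.tendsto_nhds.1 ((hI n).right t ht) (ε / 2) (half_pos hε),
      Ioo_mem_nhdsGT ht.2] with s hs hst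
    rw [Real.dist_eq] at hs ⊢
    have h1 := (hP n).rightJump_le hh ht
    rw [Pi.sub_apply] at h1
    have h2 := (hKuv t s ht.1 hst.1 hst.2.le).2 n
    rw [show K s - (K t + φ t * rightJump h t) =
      (I n s - (I n t + σ n t * rightJump h t)) - (φ t - σ n t) * rightJump h t +
      ((K s - K t) - (I n s - I n t)) by ring]
    refine (abs_add_le _ _).trans_lt ?_
    have := abs_sub (I n s - (I n t + σ n t * rightJump h t)) ((φ t - σ n t) * rightJump h t)
    have h6 : 0 < 1 / ((n : ℝ) + 1) := Nat.one_div_pos_of_nat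
    linarith

end Primitive

end

noncomputable section

/-! ### Sums and products over jumps -/

section JumpSums

variable {a b s t r c : ℝ} {α β : ℝ ⊕ ℝ → ℝ}

/-- The sum of `α` over the jump indices of `[s,t]`. -/
def jumpSum (α : ℝ ⊕ ℝ → ℝ) (s t : ℝ) : ℝ := ∑' i, (jumpSet s t).indicator α i

/-- The product of `1 + α` over the jump indices of `[s,t]`. -/
def jumpProd (α : ℝ ⊕ ℝ → ℝ) (s t : ℝ) : ℝ := ∏' i, (1 + (jumpSet s t).indicator α i)

theorem jumpSet_disjoint (r s t : ℝ) : Disjoint (jumpSet r s) (jumpSet s t) := by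
  rw [Set.disjoint_left]
  rintro (x | x) h1 h2
  exacts [h1.2.not_gt h2.1, h1.2.not_ge h2.1]

/-- Left jumps are taken on `(s,t]` and right jumps on `[s,t)`, so the two jumps at a common end
point are shared out between the adjacent intervals. -/
theorem jumpSet_union (hrs : r ≤ s) (hst : s ≤ t) : jumpSet r s ∪ jumpSet s t = jumpSet r t := by
  ext (x | x)
  · exact Set.ext_iff.1 (Ioc_union_Ioc_eq_Ioc hrs hst) x
  · exact Set.ext_iff.1 (Ico_union_Ico_eq_Ico hrs hst) x

theorem jumpSet_self (t : ℝ) : jumpSet t t = ∅ := by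
  ext (x | x)
  · simp
  · simp

theorem jumpSum_self (α : ℝ ⊕ ℝ → ℝ) (t : ℝ) : jumpSum α t t = 0 := by
  simp [jumpSum, jumpSet_self]

theorem jumpProd_self (α : ℝ ⊕ ℝ → ℝ) (t : ℝ) : jumpProd α t t = 1 := by
  simp [jumpProd, jumpSet_self]

theorem Summable.jumpSet_mono (hα : Summable ((jumpSet a b).indicator α)) (hs : a ≤ s)
    (ht : t ≤ b) : Summable ((jumpSet s t).indicator α) := by
  have := hα.indicator (jumpSet s t)
  rwa [indicator_indicator, inter_eq_left.2 (_root_.jumpSet_mono hs ht)] at this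

theorem indicator_jumpSet_abs :
    (jumpSet s t).indicator (fun i => |α i|) = fun i => |(jumpSet s t).indicator α i| := by
  ext i
  by_cases h : i ∈ jumpSet s t <;> simp [h]

theorem Summable.jumpSet_abs (hα : Summable ((jumpSet a b).indicator α)) :
    Summable ((jumpSet a b).indicator fun i => |α i|) := by
  rw [indicator_jumpSet_abs]
  exact hα.abs

theorem summable_jumpSet_of_abs_le (hβ : Summable ((jumpSet a b).indicator β)) {K : ℝ}
    (h : ∀ i ∈ jumpSet a b, |α i| ≤ K * β i) : Summable ((jumpSet a b).indicator α) := by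
  refine (hβ.mul_left K).of_norm_bounded fun i => ?_
  by_cases hi : i ∈ jumpSet a b
  · simpa [hi] using h i hi
  · simp [hi]

theorem jumpSum_le_jumpSum (hα : Summable ((jumpSet s t).indicator α))
    (hβ : Summable ((jumpSet s t).indicator β)) (h : ∀ i ∈ jumpSet s t, α i ≤ β i) :
    jumpSum α s t ≤ jumpSum β s t := by
  refine hα.tsum_le_tsum (fun i => ?_) hβ
  by_cases hi : i ∈ jumpSet s t
  · simpa [hi] using h i hi
  · simp [hi]

theorem jumpSum_nonneg (h : ∀ i ∈ jumpSet s t, 0 ≤ α i) : 0 ≤ jumpSum α s t :=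
  tsum_nonneg fun i => indicator_nonneg h i

theorem abs_jumpSum_le (hα : Summable ((jumpSet s t).indicator α)) :
    |jumpSum α s t| ≤ jumpSum (fun i => |α i|) s t := by
  rw [jumpSum, jumpSum, indicator_jumpSet_abs]
  exact norm_tsum_le_tsum_norm hα.norm

theorem jumpSum_const_mul (K : ℝ) (α : ℝ ⊕ ℝ → ℝ) (s t : ℝ) :
    jumpSum (fun i => K * α i) s t = K * jumpSum α s t := by
  rw [jumpSum, jumpSum, ← tsum_mul_left]
  exact tsum_congr fun i => indicator_const_mul _ _ _ _

theorem jumpSum_add (hα : Summable ((jumpSet s t).indicator α))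
    (hβ : Summable ((jumpSet s t).indicator β)) :
    jumpSum (fun i => α i + β i) s t = jumpSum α s t + jumpSum β s t := by
  rw [jumpSum, jumpSum, jumpSum, ← hα.tsum_add hβ]
  exact tsum_congr fun i => congrFun (indicator_add _ _ _) i

theorem jumpSum_add_jumpSum (hα : Summable ((jumpSet a b).indicator α)) (hr : a ≤ r) (hrs : r ≤ s)
    (hst : s ≤ t) (ht : t ≤ b) : jumpSum α r s + jumpSum α s t = jumpSum α r t := by
  rw [jumpSum, jumpSum, ← (hα.jumpSet_mono hr (hst.trans ht)).tsum_add
    (hα.jumpSet_mono (hr.trans hrs) ht), jumpSum, ← jumpSet_union hrs hst,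
    indicator_union_of_disjoint (jumpSet_disjoint r s t)]

theorem jumpSum_sub_jumpSum (hα : Summable ((jumpSet a b).indicator α)) (hs : a ≤ s)
    (hst : s ≤ t) (ht : t ≤ b) : jumpSum α a t - jumpSum α a s = jumpSum α s t := by
  rw [← jumpSum_add_jumpSum hα le_rfl hs hst ht, add_sub_cancel_left]

theorem multipliable_one_add_indicator (hα : Summable ((jumpSet s t).indicator α)) :
    Multipliable fun i => 1 + (jumpSet s t).indicator α i :=
  multipliable_one_add_of_summable hα.norm

theorem jumpProd_mul_jumpProd (hα : Summable ((jumpSet a b).indicator α)) (hr : a ≤ r)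
    (hrs : r ≤ s) (hst : s ≤ t) (ht : t ≤ b) :
    jumpProd α r s * jumpProd α s t = jumpProd α r t := by
  rw [jumpProd, jumpProd, jumpProd,
    ← (multipliable_one_add_indicator (hα.jumpSet_mono hr (hst.trans ht))).tprod_mul
      (multipliable_one_add_indicator (hα.jumpSet_mono (hr.trans hrs) ht))]
  refine tprod_congr fun i => ?_
  rw [← jumpSet_union hrs hst]
  by_cases h1 : i ∈ jumpSet r s
  · simp [h1, Set.disjoint_left.1 (jumpSet_disjoint r s t) h1]
  · by_cases h2 : i ∈ jumpSet s t <;> simp [h1, h2]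

/-- For a fixed index, membership stabilises as the interval shrinks to `c`. This is the pointwise
limit in the dominated convergence below. -/
theorem eventually_mem_jumpSet_right (c : ℝ) (i : ℝ ⊕ ℝ) :
    ∀ᶠ t in 𝓝[>] c, (i ∈ jumpSet c t ↔ i = Sum.inr c) := by
  rcases i with x | x
  · rcases le_or_gt x c with h | h
    · exact Eventually.of_forall fun t => by simp [h]
    · filter_upwards [Ioo_mem_nhdsGT h] with t ht
      simp [ht.2]
  · rcases lt_trichotomy x c with h | rfl | h
    · exact Eventually.of_forall fun t => by simp [h.ne, h]
    · filter_upwards [self_mem_nhdsWithin] with t ht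
      simpa using ht
    · filter_upwards [Ioo_mem_nhdsGT h] with t ht
      simp [h.ne', ht.2.le]

theorem eventually_mem_jumpSet_left (c : ℝ) (i : ℝ ⊕ ℝ) :
    ∀ᶠ s in 𝓝[<] c, (i ∈ jumpSet s c ↔ i = Sum.inl c) := by
  rcases i with x | x
  · rcases lt_trichotomy x c with h | rfl | h
    · filter_upwards [Ioo_mem_nhdsLT h] with t ht
      simp [h.ne, ht.1.le]
    · filter_upwards [self_mem_nhdsWithin] with t ht
      simpa using ht
    · exact Eventually.of_forall fun t => by simp [h.ne', h]
  · rcases lt_or_ge x c with h | h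
    · filter_upwards [Ioo_mem_nhdsLT h] with t ht
      simp [ht.1]
    · exact Eventually.of_forall fun t => by simp [h]

theorem eventually_mem_jumpSet_both (c : ℝ) (i : ℝ ⊕ ℝ) :
    ∀ᶠ x : ℝ × ℝ in 𝓝[<] c ×ˢ 𝓝[>] c,
      (i ∈ jumpSet x.1 x.2 ↔ i = Sum.inl c ∨ i = Sum.inr c) := by
  filter_upwards [(eventually_mem_jumpSet_left c i).prod_mk (eventually_mem_jumpSet_right c i),
    (eventually_mem_nhdsWithin (a := c) (s := Iio c)).prod_mk
      (eventually_mem_nhdsWithin (a := c) (s := Ioi c))] with x hx hx'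
  rw [← jumpSet_union (le_of_lt hx'.1) (le_of_lt hx'.2), mem_union, hx.1, hx.2]

section Limits

variable {X : Type*} {l : Filter X} {u v : X → ℝ} {T : Finset (ℝ ⊕ ℝ)}

theorem tendsto_indicator_jumpSet (i : ℝ ⊕ ℝ) (hT : ∀ᶠ x in l, (i ∈ jumpSet (u x) (v x) ↔ i ∈ T)) :
    Tendsto (fun x => (jumpSet (u x) (v x)).indicator α i) l
      (𝓝 ((T : Set (ℝ ⊕ ℝ)).indicator α i)) := by
  refine tendsto_const_nhds.congr' ?_
  filter_upwards [hT] with x hx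
  by_cases h : i ∈ T
  · simp [hx.2 h, h]
  · simp [mt hx.1 h, h]

theorem abs_indicator_jumpSet_le (hs : a ≤ s) (ht : t ≤ b) (i : ℝ ⊕ ℝ) :
    ‖(jumpSet s t).indicator α i‖ ≤ |(jumpSet a b).indicator α i| := by
  by_cases h : i ∈ jumpSet s t
  · simp [h, jumpSet_mono hs ht h]
  · simp [h]

/-- Dominated convergence over the jump indices: the terms stabilise to those of `T` and are
dominated by the summable family over `[a,b]`. -/
theorem tendsto_jumpSum (hα : Summable ((jumpSet a b).indicator α))
    (huv : ∀ᶠ x in l, a ≤ u x ∧ v x ≤ b)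
    (hT : ∀ i, ∀ᶠ x in l, (i ∈ jumpSet (u x) (v x) ↔ i ∈ T)) :
    Tendsto (fun x => jumpSum α (u x) (v x)) l (𝓝 (∑ i ∈ T, α i)) := by
  rw [show ∑ i ∈ T, α i = ∑' i, (T : Set (ℝ ⊕ ℝ)).indicator α i by
    rw [tsum_eq_sum (s := T) fun i hi => by simp [hi]]
    exact Finset.sum_congr rfl fun i hi => by simp [hi]]
  exact tendsto_tsum_of_dominated_convergence hα.abs
    (fun i => tendsto_indicator_jumpSet i (hT i))
    (huv.mono fun x hx i => abs_indicator_jumpSet_le hx.1 hx.2 i)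

theorem tendsto_jumpProd (hα : Summable ((jumpSet a b).indicator α))
    (huv : ∀ᶠ x in l, a ≤ u x ∧ v x ≤ b)
    (hT : ∀ i, ∀ᶠ x in l, (i ∈ jumpSet (u x) (v x) ↔ i ∈ T)) :
    Tendsto (fun x => jumpProd α (u x) (v x)) l (𝓝 (∏ i ∈ T, (1 + α i))) := by
  rw [show ∏ i ∈ T, (1 + α i) = ∏' i, (1 + (T : Set (ℝ ⊕ ℝ)).indicator α i) by
    rw [tprod_eq_prod (s := T) fun i hi => by simp [hi]]
    exact Finset.prod_congr rfl fun i hi => by simp [hi]]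
  exact tendsto_tprod_one_add_of_dominated_convergence hα.abs
    (fun i => tendsto_indicator_jumpSet i (hT i))
    (huv.mono fun x hx i => abs_indicator_jumpSet_le hx.1 hx.2 i)

end Limits

theorem eventually_mem_Icc_right (hc : c ∈ Ico a b) : ∀ᶠ t in 𝓝[>] c, a ≤ c ∧ t ≤ b := by
  filter_upwards [Ioo_mem_nhdsGT hc.2] with t ht using ⟨hc.1, ht.2.le⟩

theorem eventually_mem_Icc_left (hc : c ∈ Ioc a b) : ∀ᶠ s in 𝓝[<] c, a ≤ s ∧ c ≤ b := by
  filter_upwards [Ioo_mem_nhdsLT hc.1] with s hs using ⟨hs.1.le, hc.2⟩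

theorem eventually_mem_Icc_both (hc : c ∈ Ioo a b) :
    ∀ᶠ x : ℝ × ℝ in 𝓝[<] c ×ˢ 𝓝[>] c, a ≤ x.1 ∧ x.2 ≤ b :=
  ((eventually_mem_Icc_left ⟨hc.1, hc.2.le⟩).prod_mk
    (eventually_mem_Icc_right ⟨hc.1.le, hc.2⟩)).mono fun _ hx => ⟨hx.1.1, hx.2.2⟩

theorem tendsto_jumpSum_right (hα : Summable ((jumpSet a b).indicator α)) (hc : c ∈ Ico a b) :
    Tendsto (jumpSum α c) (𝓝[>] c) (𝓝 (α (Sum.inr c))) := by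
  simpa using tendsto_jumpSum (T := {Sum.inr c}) hα (eventually_mem_Icc_right hc)
    fun i => by simpa using eventually_mem_jumpSet_right c i

theorem tendsto_jumpSum_left (hα : Summable ((jumpSet a b).indicator α)) (hc : c ∈ Ioc a b) :
    Tendsto (fun s => jumpSum α s c) (𝓝[<] c) (𝓝 (α (Sum.inl c))) := by
  simpa using tendsto_jumpSum (T := {Sum.inl c}) hα (eventually_mem_Icc_left hc)
    fun i => by simpa using eventually_mem_jumpSet_left c i

theorem tendsto_jumpSum_both (hα : Summable ((jumpSet a b).indicator α)) (hc : c ∈ Ioo a b) :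
    Tendsto (fun x : ℝ × ℝ => jumpSum α x.1 x.2) (𝓝[<] c ×ˢ 𝓝[>] c)
      (𝓝 (α (Sum.inl c) + α (Sum.inr c))) := by
  classical
  have := tendsto_jumpSum (T := {Sum.inl c, Sum.inr c}) hα (eventually_mem_Icc_both hc)
    fun i => by simpa using eventually_mem_jumpSet_both c i
  rwa [Finset.sum_pair Sum.inl_ne_inr] at this

theorem tendsto_jumpProd_right (hα : Summable ((jumpSet a b).indicator α)) (hc : c ∈ Ico a b) :
    Tendsto (jumpProd α c) (𝓝[>] c) (𝓝 (1 + α (Sum.inr c))) := by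
  simpa using tendsto_jumpProd (T := {Sum.inr c}) hα (eventually_mem_Icc_right hc)
    fun i => by simpa using eventually_mem_jumpSet_right c i

theorem tendsto_jumpProd_left (hα : Summable ((jumpSet a b).indicator α)) (hc : c ∈ Ioc a b) :
    Tendsto (fun s => jumpProd α s c) (𝓝[<] c) (𝓝 (1 + α (Sum.inl c))) := by
  simpa using tendsto_jumpProd (T := {Sum.inl c}) hα (eventually_mem_Icc_left hc)
    fun i => by simpa using eventually_mem_jumpSet_left c i

theorem tendsto_jumpProd_both (hα : Summable ((jumpSet a b).indicator α)) (hc : c ∈ Ioo a b) :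
    Tendsto (fun x : ℝ × ℝ => jumpProd α x.1 x.2) (𝓝[<] c ×ˢ 𝓝[>] c)
      (𝓝 ((1 + α (Sum.inl c)) * (1 + α (Sum.inr c)))) := by
  classical
  have := tendsto_jumpProd (T := {Sum.inl c, Sum.inr c}) hα (eventually_mem_Icc_both hc)
    fun i => by simpa using eventually_mem_jumpSet_both c i
  rwa [Finset.prod_pair Sum.inl_ne_inr] at this

theorem MonotoneOn.summable_jumps {F : ℝ → ℝ} (hab : a ≤ b) (hF : MonotoneOn F (Icc a b)) :
    Summable ((jumpSet a b).indicator (jumps F)) := by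
  classical
  refine summable_of_sum_le (c := F b - F a) (fun i => indicator_nonneg
    (fun i hi => hF.jumps_nonneg hi) i) fun T => ?_
  have := hF.sum_jumps_le (T.filter (· ∈ jumpSet a b)) a b le_rfl hab le_rfl
    fun i hi => (Finset.mem_filter.1 hi).2
  refine le_of_eq_of_le ?_ this
  rw [Finset.sum_filter]
  rfl

theorem MonotoneOn.jumpSum_jumps_le {F : ℝ → ℝ} (hF : MonotoneOn F (Icc a b)) (hs : a ≤ s)
    (hst : s ≤ t) (ht : t ≤ b) : jumpSum (jumps F) s t ≤ F t - F s := by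
  classical
  have hF' : MonotoneOn F (Icc s t) := hF.mono (Icc_subset_Icc hs ht)
  refine (hF'.summable_jumps hst).tsum_le_of_sum_le fun T => ?_
  refine le_of_eq_of_le ?_ (hF.sum_jumps_le (T.filter (· ∈ jumpSet s t)) s t hs hst ht
    fun i hi => (Finset.mem_filter.1 hi).2)
  rw [Finset.sum_filter]
  rfl

end JumpSums

end

noncomputable section

/-! ### Brackets -/

section BracketLemmas

variable {a b : ℝ} {lam : NestedPartitions a b} {f f₁ f₂ f₁' f₂' g h φ B B' G : ℝ → ℝ} {s t c p : ℝ}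

open IntervalPartition

theorem IsRegulated.tendsto_sub_right (hf : IsRegulated a b f) (hc : c ∈ Ico a b) :
    Tendsto (fun t => f t - f c) (𝓝[>] c) (𝓝 (rightJump f c)) := by
  simpa using (hf.tendsto_right hc).sub_const (f c)

theorem IsRegulated.tendsto_sub_left (hf : IsRegulated a b f) (hc : c ∈ Ioc a b) :
    Tendsto (fun s => f c - f s) (𝓝[<] c) (𝓝 (leftJump f c)) := by
  simpa using (hf.tendsto_left hc).const_sub (f c)

theorem IsRegulated.tendsto_sub_both (hf : IsRegulated a b f) (hc : c ∈ Ioo a b) :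
    Tendsto (fun x : ℝ × ℝ => f x.2 - f x.1) (𝓝[<] c ×ˢ 𝓝[>] c)
      (𝓝 (leftJump f c + rightJump f c)) := by
  have := ((hf.tendsto_sub_left ⟨hc.1, hc.2.le⟩).comp tendsto_fst).add
    ((hf.tendsto_sub_right ⟨hc.1.le, hc.2⟩).comp (tendsto_snd (f := 𝓝[<] c) (g := 𝓝[>] c)))
  refine this.congr fun x => ?_
  simp only [Function.comp]
  ring

theorem tendsto_traceSum_of_abs {u v : ℝ} {w : ℝ → ℝ → ℝ}
    (h : Tendsto (fun m => (lam.part m).traceSum u v fun s t => |w s t|) atTop (𝓝 0)) :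
    Tendsto (fun m => (lam.part m).traceSum u v w) atTop (𝓝 0) :=
  squeeze_zero_norm (fun _ => abs_traceSum_le _) h

theorem IsBracket.tendsto (hB : IsBracket lam f₁ f₂ B) (hs : a ≤ s) (hst : s < t) (ht : t ≤ b) :
    Tendsto (fun m => (lam.part m).traceSum s t fun s t => (f₁ t - f₁ s) * (f₂ t - f₂ s)) atTop
      (𝓝 (B t - B s)) :=
  hB.2.2.2.2.1 s t hs hst ht

theorem IsBracket.eqOn (hB : IsBracket lam f₁ f₂ B) (hB' : IsBracket lam f₁ f₂ B') :
    EqOn B B' (Icc a b) := by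
  intro t ht
  rcases eq_or_lt_of_le ht.1 with rfl | h
  · rw [hB.2.2.2.1, hB'.2.2.2.1]
  · have := tendsto_nhds_unique (hB.tendsto le_rfl h ht.2) (hB'.tendsto le_rfl h ht.2)
    rwa [hB.2.2.2.1, hB'.2.2.2.1, sub_zero, sub_zero] at this

theorem HasQuadraticCovariation.isBracket (h : HasQuadraticCovariation lam f₁ f₂) :
    IsBracket lam f₁ f₂ (bracket lam f₁ f₂) := by
  rw [bracket, dif_pos (show ∃ B, IsBracket lam f₁ f₂ B from h)]
  exact h.choose_spec

theorem IsBracket.eqOn_bracket (hB : IsBracket lam f₁ f₂ B) :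
    EqOn (bracket lam f₁ f₂) B (Icc a b) :=
  (HasQuadraticCovariation.isBracket ⟨B, hB⟩).eqOn hB

theorem IsBracket.congr (hB : IsBracket lam f₁ f₂ B) (h₁ : EqOn f₁ f₁' (Icc a b))
    (h₂ : EqOn f₂ f₂' (Icc a b)) (hab : a ≤ b) (h : EqOn B B' (Icc a b)) :
    IsBracket lam f₁' f₂' B' := by
  obtain ⟨r₁, r₂, r, h0, hlim, hl, hr⟩ := hB
  refine ⟨r₁.congr h₁, r₂.congr h₂, r.congr h, by rw [← h (left_mem_Icc.2 hab), h0],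
    fun s t hs hst ht => ?_, fun t ht => ?_, fun s hs => ?_⟩
  · rw [← h ⟨hs, hst.le.trans ht⟩, ← h ⟨hs.trans hst.le, ht⟩]
    refine (hlim s t hs hst ht).congr fun m => ?_
    refine traceSum_congr hst.le (w := fun s t => (f₁ t - f₁ s) * (f₂ t - f₂ s))
      (w' := fun s t => (f₁' t - f₁' s) * (f₂' t - f₂' s)) fun x y hx hxy hy => ?_
    have hx' : x ∈ Icc a b := ⟨hs.trans hx, hxy.trans (hy.trans ht)⟩
    have hy' : y ∈ Icc a b := ⟨hx'.1.trans hxy, hy.trans ht⟩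
    rw [h₁ hx', h₁ hy', h₂ hx', h₂ hy']
  · rw [r.leftJump_congr h ht, r₁.leftJump_congr h₁ ht, r₂.leftJump_congr h₂ ht, hl t ht]
  · rw [r.rightJump_congr h hs, r₁.rightJump_congr h₁ hs, r₂.rightJump_congr h₂ hs, hr s hs]

theorem IsBracket.symm (hB : IsBracket lam f₁ f₂ B) : IsBracket lam f₂ f₁ B := by
  obtain ⟨r₁, r₂, r, h0, hlim, hl, hr⟩ := hB
  refine ⟨r₂, r₁, r, h0, fun s t hs hst ht => ?_, fun t ht => ?_, fun s hs => ?_⟩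
  · refine (hlim s t hs hst ht).congr fun m => Finset.sum_congr rfl fun i _ => mul_comm _ _
  · rw [hl t ht, mul_comm]
  · rw [hr s hs, mul_comm]

theorem IsBracket.add_left (hB : IsBracket lam f₁ f B) (hB' : IsBracket lam f₂ f B') :
    IsBracket lam (f₁ + f₂) f (B + B') := by
  obtain ⟨r₁, r₂, r, h0, hlim, hl, hr⟩ := hB
  obtain ⟨r₁', -, r', h0', hlim', hl', hr'⟩ := hB'
  refine ⟨r₁.add r₁', r₂, r.add r', by simp [h0, h0'], fun s t hs hst ht => ?_, fun t ht => ?_,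
    fun s hs => ?_⟩
  · have := (hlim s t hs hst ht).add (hlim' s t hs hst ht)
    have e : (B + B') t - (B + B') s = B t - B s + (B' t - B' s) := by
      simp only [Pi.add_apply]; ring
    rw [e]
    refine this.congr fun m => ?_
    simp only [covariationSum, ← Finset.sum_add_distrib, Pi.add_apply]
    exact Finset.sum_congr rfl fun i _ => by ring
  · rw [r.leftJump_add r' ht, r₁.leftJump_add r₁' ht, hl t ht, hl' t ht, add_mul]
  · rw [r.rightJump_add r' hs, r₁.rightJump_add r₁' hs, hr s hs, hr' s hs, add_mul]

theorem IsBracket.add_right (hB : IsBracket lam f f₁ B) (hB' : IsBracket lam f f₂ B') :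
    IsBracket lam f (f₁ + f₂) (B + B') :=
  (hB.symm.add_left hB'.symm).symm

theorem IsBracket.add_self (h₁ : IsBracket lam f₁ f₁ B) (h₁₂ : IsBracket lam f₁ f₂ B')
    (h₂ : IsBracket lam f₂ f₂ G) : IsBracket lam (f₁ + f₂) (f₁ + f₂) (B + B' + (B' + G)) :=
  (h₁.add_right h₁₂).add_left (h₁₂.symm.add_right h₂)

theorem isBracket_const_left (r : ℝ) (hf : IsRegulated a b f) : IsBracket lam (fun _ => r) f 0 := by
  have h0 : ∀ t, leftJump (fun _ : ℝ => r) t = 0 := fun t => by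
    simpa using leftJump_eq_of_tendsto (f := fun _ : ℝ => r) (t := t) (j := 0) (by simp)
  have h0' : ∀ t, rightJump (fun _ : ℝ => r) t = 0 := fun t => by
    simpa using rightJump_eq_of_tendsto (f := fun _ : ℝ => r) (t := t) (j := 0) (by simp)
  have h1 : ∀ t, leftJump (0 : ℝ → ℝ) t = 0 := fun t => by
    simpa using leftJump_eq_of_tendsto (f := (0 : ℝ → ℝ)) (t := t) (j := 0)
      (by simp [Pi.zero_def])
  have h1' : ∀ t, rightJump (0 : ℝ → ℝ) t = 0 := fun t => by
    simpa using rightJump_eq_of_tendsto (f := (0 : ℝ → ℝ)) (t := t) (j := 0)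
      (by simp [Pi.zero_def])
  refine ⟨isRegulated_const r, hf, isRegulated_const 0, rfl, fun s t _ _ _ => ?_,
    fun t _ => by rw [h0, h1, zero_mul], fun t _ => by rw [h0', h1', zero_mul]⟩
  simp [covariationSum]

theorem IsBracket.monotoneOn (hB : IsBracket lam f f B) : MonotoneOn B (Icc a b) := by
  intro s hs t ht hst
  rcases eq_or_lt_of_le hst with rfl | h
  · exact le_rfl
  · refine sub_nonneg.1 (ge_of_tendsto' (hB.tendsto hs.1 h ht.2) fun m => ?_)
    exact traceSum_nonneg hst fun _ _ _ _ _ => mul_self_nonneg _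

theorem IsBracket.jumps_eq (hB : IsBracket lam f₁ f₂ B) {i : ℝ ⊕ ℝ} (hi : i ∈ jumpSet a b) :
    jumps B i = jumps f₁ i * jumps f₂ i := by
  rcases i with x | x
  exacts [hB.2.2.2.2.2.1 x hi, hB.2.2.2.2.2.2 x hi]

/-- The products of increments of `φ` and `h` are small compared to the increments of the
nondecreasing function `G` away from finite sets. -/
def CrossSmall (a b : ℝ) (φ h G : ℝ → ℝ) : Prop :=
  MonotoneOn G (Icc a b) ∧
  (∃ C, ∀ s t, a ≤ s → s ≤ t → t ≤ b → |φ t - φ s| * |h t - h s| ≤ C * (G t - G s)) ∧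
  ∀ ε > 0, ∃ D : Finset ℝ, ∀ s t, a ≤ s → s ≤ t → t ≤ b → (∀ d ∈ D, d ∉ Icc s t) →
    |φ t - φ s| * |h t - h s| ≤ ε * (G t - G s)

/-- For `p = 1`, small oscillation of `φ` multiplies the variation of `h`. For `p > 1`, the product
of the increments is at most the power `1/p + 1/q` of the increment of the joint control `F + G`.
This power exceeds `1`, so a factor remains which is small wherever the control oscillates little.
-/
theorem MemDualW.exists_crossSmall (hp : 1 ≤ p) (hφ : MemDualW a b p φ)
    (hh : BoundedPVariation a b p h) : ∃ G, CrossSmall a b φ h G := by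
  have hp0 : 0 < p := by linarith
  obtain ⟨G, hG⟩ := hh.exists_control hp0
  rcases eq_or_lt_of_le hp with rfl | hp1
  · have hG2 : ∀ s t, a ≤ s → s ≤ t → t ≤ b → |h t - h s| ≤ G t - G s := fun s t hs hst ht => by
      simpa using hG.2 s ⟨hs, hst.trans ht⟩ t ⟨hs.trans hst, ht⟩ hst
    refine ⟨G, hG.1, ?_, fun ε hε => ?_⟩
    · obtain ⟨M, hM0, hM⟩ := hφ.isRegulated.exists_bound
      refine ⟨2 * M, fun s t hs hst ht => mul_le_mul ?_ (hG2 s t hs hst ht) (abs_nonneg _)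
        (by positivity)⟩
      have := abs_sub (φ t) (φ s)
      linarith [hM s ⟨hs, hst.trans ht⟩, hM t ⟨hs.trans hst, ht⟩]
    · obtain ⟨D, hD⟩ := hφ.isRegulated.exists_finset_osc hε
      exact ⟨D, fun s t hs hst ht hd => mul_le_mul (hD s t hs hst ht hd) (hG2 s t hs hst ht)
        (abs_nonneg _) hε.le⟩
  obtain ⟨q, hq, hpq, hφq⟩ := hφ.exists_one_le hp1
  have hq0 : 0 < q := by linarith
  obtain ⟨F, hF⟩ := hφq.exists_control hq0
  have hW : MonotoneOn (F + G) (Icc a b) := hF.1.add hG.1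
  set θ := 1 / p + 1 / q with hθ
  have key : ∀ s t, a ≤ s → s ≤ t → t ≤ b → ∀ η, (F + G) t - (F + G) s ≤ η →
      |φ t - φ s| * |h t - h s| ≤ η ^ (θ - 1) * ((F + G) t - (F + G) s) := by
    intro s t hs hst ht η hη
    have ms : s ∈ Icc a b := ⟨hs, hst.trans ht⟩
    have mt : t ∈ Icc a b := ⟨hs.trans hst, ht⟩
    have h0 := sub_nonneg.2 (hW ms mt hst)
    have e : (F + G) t - (F + G) s = F t - F s + (G t - G s) := by simp only [Pi.add_apply]; ring
    have h1 := mul_le_rpow_of_rpow_le (c := (F + G) t - (F + G) s) (abs_nonneg (φ t - φ s))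
      (abs_nonneg (h t - h s)) hp0 hq0 le_rfl zero_le_one le_rfl
      ((hF.2 s ms t mt hst).trans (by rw [e]; linarith [hG.1 ms mt hst]))
      ((hG.2 s ms t mt hst).trans (by rw [e]; linarith [hF.1 ms mt hst]))
    rw [Real.rpow_zero, one_mul, sub_zero, ← hθ] at h1
    refine h1.trans ?_
    calc ((F + G) t - (F + G) s) ^ θ
        = ((F + G) t - (F + G) s) ^ (θ - 1) * ((F + G) t - (F + G) s) := by
          nth_rewrite 3 [← Real.rpow_one ((F + G) t - (F + G) s)]
          rw [← Real.rpow_add_of_nonneg h0 (by linarith) zero_le_one, sub_add_cancel]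
      _ ≤ η ^ (θ - 1) * ((F + G) t - (F + G) s) :=
          mul_le_mul_of_nonneg_right (Real.rpow_le_rpow h0 hη (by linarith)) h0
  refine ⟨F + G, hW, ⟨((F + G) b - (F + G) a) ^ (θ - 1), fun s t hs hst ht =>
    key s t hs hst ht _ ?_⟩, fun ε hε => ?_⟩
  · have ms : s ∈ Icc a b := ⟨hs, hst.trans ht⟩
    have mt : t ∈ Icc a b := ⟨hs.trans hst, ht⟩
    have hab := hs.trans (hst.trans ht)
    linarith [hW (left_mem_Icc.2 hab) ms hs, hW mt (right_mem_Icc.2 hab) ht]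
  -- The oscillation bound is chosen so that its power `θ - 1` equals `ε`.
  · obtain ⟨D, hD⟩ := hW.isRegulated.exists_finset_osc (Real.rpow_pos_of_pos hε (θ - 1)⁻¹)
    refine ⟨D, fun s t hs hst ht hd => ?_⟩
    have := key s t hs hst ht _ ((le_abs_self _).trans (hD s t hs hst ht hd))
    rwa [← Real.rpow_mul hε.le, inv_mul_cancel₀ (by linarith), Real.rpow_one] at this

theorem abs_jumps_mul_le (hφ : IsRegulated a b φ) (hh : IsRegulated a b h) (hG : IsRegulated a b G)
    (hs : a ≤ s) (ht : t ≤ b) {C : ℝ}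
    (H : ∀ x y, s ≤ x → x ≤ y → y ≤ t → |φ y - φ x| * |h y - h x| ≤ C * (G y - G x))
    {i : ℝ ⊕ ℝ} (hi : i ∈ jumpSet s t) : |jumps φ i * jumps h i| ≤ C * jumps G i := by
  rcases i with c | c
  · have hc : c ∈ Ioc s t := hi
    have hc' : c ∈ Ioc a b := ⟨hs.trans_lt hc.1, hc.2.trans ht⟩
    refine le_of_tendsto_of_tendsto
      ((hφ.tendsto_sub_left hc').mul (hh.tendsto_sub_left hc')).abs
      ((hG.tendsto_sub_left hc').const_mul C) ?_
    filter_upwards [Ioo_mem_nhdsLT hc.1] with x hx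
    rw [abs_mul]
    exact H x c hx.1.le hx.2.le hc.2
  · have hc : c ∈ Ico s t := hi
    have hc' : c ∈ Ico a b := ⟨hs.trans hc.1, hc.2.trans_le ht⟩
    refine le_of_tendsto_of_tendsto
      ((hφ.tendsto_sub_right hc').mul (hh.tendsto_sub_right hc')).abs
      ((hG.tendsto_sub_right hc').const_mul C) ?_
    filter_upwards [Ioo_mem_nhdsGT hc.2] with x hx
    rw [abs_mul]
    exact H c x hc.1 hx.1.le hx.2.le

theorem tendsto_jumpSum_from_right {α : ℝ ⊕ ℝ → ℝ} (hα : Summable ((jumpSet a b).indicator α))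
    (hc : c ∈ Ico a b) :
    Tendsto (jumpSum α a) (𝓝[>] c) (𝓝 (jumpSum α a c + α (Sum.inr c))) := by
  refine ((tendsto_jumpSum_right hα hc).const_add (jumpSum α a c)).congr' ?_
  filter_upwards [Ioo_mem_nhdsGT hc.2] with t ht
  exact jumpSum_add_jumpSum hα le_rfl hc.1 ht.1.le ht.2.le

theorem tendsto_jumpSum_from_left {α : ℝ ⊕ ℝ → ℝ} (hα : Summable ((jumpSet a b).indicator α))
    (hc : c ∈ Ioc a b) :
    Tendsto (jumpSum α a) (𝓝[<] c) (𝓝 (jumpSum α a c - α (Sum.inl c))) := by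
  refine ((tendsto_jumpSum_left hα hc).const_sub (jumpSum α a c)).congr' ?_
  filter_upwards [Ioo_mem_nhdsLT hc.1] with s hs
  rw [← jumpSum_add_jumpSum hα le_rfl hs.1.le hs.2.le hc.2, add_sub_cancel_right]

theorem isRegulated_jumpSum {α : ℝ ⊕ ℝ → ℝ} (hα : Summable ((jumpSet a b).indicator α)) :
    IsRegulated a b (jumpSum α a) :=
  ⟨fun _ ht => ⟨_, tendsto_jumpSum_from_left hα ht⟩,
    fun _ ht => ⟨_, tendsto_jumpSum_from_right hα ht⟩⟩

/-- If the products of increments of `φ` and `h` are small and the right jumps are accessible, then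
the bracket of `φ` and `h` is the sum of the products of their jumps. -/
theorem CrossSmall.isBracket (hab : a ≤ b) (hφ : IsRegulated a b φ) (hh : IsRegulated a b h)
    (hG : CrossSmall a b φ h G)
    (hacc : ∀ t ∈ Ioo a b, rightJump φ t ≠ 0 ∨ rightJump h t ≠ 0 → t ∈ lam.allPoints) :
    IsBracket lam φ h (jumpSum (fun i => jumps φ i * jumps h i) a) := by
  obtain ⟨hG, ⟨C, hC⟩, hsm⟩ := hG
  set α : ℝ ⊕ ℝ → ℝ := fun i => jumps φ i * jumps h i with hαd
  have hα : Summable ((jumpSet a b).indicator α) :=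
    summable_jumpSet_of_abs_le (hG.summable_jumps hab) fun i hi =>
      abs_jumps_mul_le hφ hh hG.isRegulated le_rfl le_rfl hC hi
  refine ⟨hφ, hh, isRegulated_jumpSum hα, jumpSum_self _ _, fun u v hu huv hv => ?_,
    fun t ht => leftJump_eq_of_tendsto (tendsto_jumpSum_from_left hα ht),
    fun t ht => rightJump_eq_of_tendsto (tendsto_jumpSum_from_right hα ht)⟩
  have hr : ∀ c ∈ Ico a b, Tendsto (fun t => (φ t - φ c) * (h t - h c) - jumpSum α c t) (𝓝[>] c)
      (𝓝 0) := fun c hc => by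
    simpa [hαd] using ((hφ.tendsto_sub_right hc).mul (hh.tendsto_sub_right hc)).sub
      (tendsto_jumpSum_right hα hc)
  have hl : ∀ c ∈ Ioc a b, Tendsto (fun s => (φ c - φ s) * (h c - h s) - jumpSum α s c) (𝓝[<] c)
      (𝓝 0) := fun c hc => by
    simpa [hαd] using ((hφ.tendsto_sub_left hc).mul (hh.tendsto_sub_left hc)).sub
      (tendsto_jumpSum_left hα hc)
  -- Away from a finite set, the product of the increments and the jump sum are both small compared
  -- to the increment of `G`. At a point they have the same one-sided limits, and also the same
  -- two-sided limit when both right jumps vanish, which holds at inaccessible points.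
  have := tendsto_traceSum_of_abs (tendsto_traceSum_abs_of_small lam huv.le
    (w := fun s t => (φ t - φ s) * (h t - h s) - jumpSum α s t) (W := fun s t => G t - G s)
    (fun t => by simp [jumpSum_self])
    (fun s t hs hst ht => sub_nonneg.2 (hG ⟨hu.trans hs, hst.trans (ht.trans hv)⟩
      ⟨hu.trans (hs.trans hst), ht.trans hv⟩ hst))
    (Eventually.of_forall fun m => (traceSum_sub hu huv.le hv G).le)
    (fun ε hε => by
      obtain ⟨D, hD⟩ := hsm (ε / 2) (half_pos hε)
      refine ⟨D, fun s t hs hst ht hd => ?_⟩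
      have hs' := hu.trans hs
      have ht' := ht.trans hv
      have h1 := hD s t hs' hst.le ht' hd
      have h2 : |jumpSum α s t| ≤ ε / 2 * (G t - G s) := by
        refine (abs_jumpSum_le (hα.jumpSet_mono hs' ht')).trans ((jumpSum_le_jumpSum
          (hα.jumpSet_abs.jumpSet_mono hs' ht') (β := fun i => ε / 2 * jumps G i) ?_
          fun i hi => abs_jumps_mul_le hφ hh hG.isRegulated hs' ht' (fun x y hx hxy hy =>
            hD x y (hs'.trans hx) hxy (hy.trans ht') fun d hdD hdI =>
              hd d hdD ⟨hx.trans hdI.1, hdI.2.trans hy⟩) hi).trans ?_)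
        · refine summable_jumpSet_of_abs_le (K := ε / 2)
            ((hG.summable_jumps hab).jumpSet_mono hs' ht') fun i hi => ?_
          rw [abs_of_nonneg (mul_nonneg (half_pos hε).le
            (hG.jumps_nonneg (jumpSet_mono hs' ht' hi)))]
        · rw [jumpSum_const_mul]
          exact mul_le_mul_of_nonneg_left (hG.jumpSum_jumps_le hs' hst.le ht') (half_pos hε).le
      refine (abs_sub _ _).trans ?_
      rw [abs_mul]
      linarith)
    (fun c hc => hr c ⟨hu.trans hc.1, hc.2.trans_le hv⟩)
    (fun c hc => hl c ⟨hu.trans_lt hc.1, hc.2.trans hv⟩)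
    fun c hc hcl => by
      have hc' : c ∈ Ioo a b := ⟨hu.trans_lt hc.1, hc.2.trans_le hv⟩
      have h0 : rightJump φ c = 0 ∧ rightJump h c = 0 := by
        by_contra h0
        exact hcl (hacc c hc' (not_and_or.1 h0))
      simpa [hαd, h0.1, h0.2] using ((hφ.tendsto_sub_both hc').mul (hh.tendsto_sub_both hc')).sub
        (tendsto_jumpSum_both hα hc'))
  have h2 := this.add_const (jumpSum α a v - jumpSum α a u)
  rw [zero_add] at h2
  refine h2.congr fun m => ?_
  rw [← traceSum_sub hu huv.le hv (jumpSum α a) (κ := lam.part m), ← traceSum_add]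
  refine traceSum_congr huv.le (w' := fun s t => (φ t - φ s) * (h t - h s)) fun s t hs hst ht => ?_
  rw [jumpSum_sub_jumpSum hα (hu.trans hs) hst (ht.trans hv), sub_add_cancel]

/-- A function with an accessible decomposition has the quadratic variation. -/
theorem hasQuadraticVariation_of_mem_dualPairsPlus (hab : a ≤ b) (hp1 : 1 ≤ p) (hp2 : p < 2)
    (hgh : (g, h) ∈ dualPairsPlus lam p f) : HasQuadraticVariation lam f := by
  obtain ⟨⟨hg, hh, ⟨Bg, hBg⟩, hgd, hhp, -, -, C, hC⟩, hacc⟩ := hgh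
  -- The bracket is assembled as `[g] + 2[g,h] + [h]`, the last two being jump sums. Since `p < 2`,
  -- the function `h` lies in its own dual class, and this gives `[h]`.
  obtain ⟨G, hG⟩ := hgd.exists_crossSmall hp1 hhp
  obtain ⟨G', hG'⟩ := (hhp.memDualW hp1 hp2).exists_crossSmall hp1 hhp
  have h1 := hG.isBracket hab hg hh hacc
  have h2 := hG'.isBracket (lam := lam) hab hh hh fun t ht h => hacc t ht (Or.inr (or_self_iff.1 h))
  have h3 := hBg.add_self h1 h2
  have h4 := (isBracket_const_left (lam := lam) C (isRegulated_const C)).add_self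
    (isBracket_const_left C h3.1) h3
  exact ⟨_, h4.congr (fun t ht => by simp [hC t ht, add_assoc])
    (fun t ht => by simp [hC t ht, add_assoc]) hab fun t _ => rfl⟩

end BracketLemmas

end

noncomputable section

/-! ### Elementary estimates -/

section Estimates

theorem abs_exp_sub_one_sub_sub_le {x : ℝ} (hx : |x| ≤ 1) :
    |Real.exp x - 1 - x - x ^ 2 / 2| ≤ |x| ^ 3 / 4 := by
  have h := Real.exp_bound hx (n := 3) (by norm_num)
  norm_num [Finset.sum_range_succ, Nat.factorial] at h
  have e : Real.exp x - 1 - x - x ^ 2 / 2 = Real.exp x - (1 + x + x ^ 2 / 2) := by ring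
  rw [e]
  have := pow_nonneg (abs_nonneg x) 3
  linarith

theorem abs_exp_sub_one_le_mul_exp (x : ℝ) : |Real.exp x - 1| ≤ |x| * Real.exp |x| := by
  rcases le_total 0 x with h | h
  · rw [abs_of_nonneg h, abs_of_nonneg (sub_nonneg.2 (Real.one_le_exp h))]
    have h1 := Real.add_one_le_exp (-x)
    have h2 : Real.exp (-x) * Real.exp x = 1 := by rw [← Real.exp_add]; simp
    nlinarith [Real.exp_pos x]
  · rw [abs_of_nonpos (sub_nonpos.2 (Real.exp_le_one_iff.2 h))]
    have h1 := Real.add_one_le_exp x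
    have h2 := Real.one_le_exp (abs_nonneg x)
    have h3 := neg_le_abs x
    nlinarith [abs_nonneg x]

/-- The expansion `(1 + x) e^{-x} = 1 - x²/2 + O(|x|³)`. To second order the product over small
jumps contributes minus half the sum of their squares, and this completes the continuous part of the
bracket in the exponent to the whole bracket. -/
theorem abs_jumpFactor_sub_one_add_le {x : ℝ} (hx : |x| ≤ 1) :
    |jumpFactor x - 1 + x ^ 2 / 2| ≤ |x| ^ 3 := by
  have h := abs_exp_sub_one_sub_sub_le (x := -x) (by rwa [abs_neg])
  rw [abs_neg] at h
  have e : jumpFactor x - 1 + x ^ 2 / 2 =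
      (1 + x) * (Real.exp (-x) - 1 - -x - (-x) ^ 2 / 2) + x ^ 3 / 2 := by
    rw [jumpFactor]; ring
  rw [e]
  have h1 : |1 + x| ≤ 2 := (abs_add_le _ _).trans (by rw [abs_one]; linarith)
  have h2 := mul_le_mul h1 h (abs_nonneg _) zero_le_two
  rw [← abs_mul] at h2
  have h3 : |x ^ 3 / 2| = |x| ^ 3 / 2 := by rw [abs_div, abs_pow, abs_two]
  refine (abs_add_le _ _).trans ?_
  rw [h3]
  linarith

theorem abs_jumpFactor_sub_one_le_of_le_one {x : ℝ} (hx : |x| ≤ 1) :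
    |jumpFactor x - 1| ≤ 2 * x ^ 2 := by
  have h := abs_jumpFactor_sub_one_add_le hx
  have h1 : |x| ^ 3 ≤ x ^ 2 := by
    rw [← sq_abs, pow_succ]
    exact mul_le_of_le_one_right (by positivity) hx
  have h2 := abs_sub (jumpFactor x - 1 + x ^ 2 / 2) (x ^ 2 / 2)
  rw [add_sub_cancel_right, abs_of_nonneg (show 0 ≤ x ^ 2 / 2 by positivity)] at h2
  linarith [sq_nonneg x]

/-- For `|x| > 1` a constant suffices, because then `x ^ 2 ≥ 1`. -/
theorem abs_jumpFactor_sub_one_le {x M : ℝ} (hx : |x| ≤ M) :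
    |jumpFactor x - 1| ≤ (2 + (1 + M) * Real.exp M) * x ^ 2 := by
  have hM : 0 ≤ M := (abs_nonneg x).trans hx
  have h0 : 0 ≤ (1 + M) * Real.exp M := by positivity
  rcases le_or_gt |x| 1 with h | h
  · have := abs_jumpFactor_sub_one_le_of_le_one h
    nlinarith [sq_nonneg x]
  · have h1 : |jumpFactor x| ≤ (1 + M) * Real.exp M := by
      rw [jumpFactor, abs_mul, Real.abs_exp]
      refine mul_le_mul ((abs_add_le _ _).trans (by rw [abs_one]; linarith))
        (Real.exp_le_exp.2 ((neg_le_abs x).trans hx)) (Real.exp_pos _).le (by positivity)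
    have h2 : 1 ≤ x ^ 2 := by rw [← sq_abs]; nlinarith
    have h3 := abs_sub (jumpFactor x) 1
    rw [abs_one] at h3
    nlinarith

theorem abs_prod_one_add_sub_one_le {ι : Type*} (T : Finset ι) (α : ι → ℝ) :
    |∏ i ∈ T, (1 + α i) - 1| ≤ Real.exp (∑ i ∈ T, |α i|) - 1 :=
  Finset.norm_prod_one_add_sub_one_le T α

/-- Products are compared with the exponential of the absolute sum, whose remainder majorises that
of the product at first order. -/
theorem abs_prod_one_add_sub_one_sub_le {ι : Type*} (T : Finset ι) (α : ι → ℝ) :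
    |∏ i ∈ T, (1 + α i) - 1 - ∑ i ∈ T, α i| ≤
      Real.exp (∑ i ∈ T, |α i|) - 1 - ∑ i ∈ T, |α i| := by
  classical
  induction T using Finset.induction_on with
  | empty => simp
  | insert i T hi ih =>
    rw [Finset.prod_insert hi, Finset.sum_insert hi, Finset.sum_insert hi]
    have h1 := abs_prod_one_add_sub_one_le T α
    set P := ∏ i ∈ T, (1 + α i)
    set S := ∑ i ∈ T, |α i|
    set Z := ∑ i ∈ T, α i
    have e : (1 + α i) * P - 1 - (α i + Z) = (P - 1 - Z) + α i * (P - 1) := by ring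
    rw [e]
    refine (abs_add_le _ _).trans ?_
    rw [abs_mul]
    have h2 := mul_le_mul_of_nonneg_left h1 (abs_nonneg (α i))
    have h3 : Real.exp S * (|α i| + 1) ≤ Real.exp (|α i| + S) := by
      rw [add_comm (|α i|) S, Real.exp_add]
      exact mul_le_mul_of_nonneg_left (Real.add_one_le_exp _) (Real.exp_pos _).le
    linarith

/-- The second-order expansion of one factor of the Doléans exponential in terms of numbers: `d`
stands for the increment of `f`, `q` and `sq` for the continuous and the jump part of the increment
of the bracket, `P` for the jump product, and `σ`, `S` for the sum and the absolute sum of its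
deviations from `1`. -/
theorem abs_exp_mul_sub_le {d q sq σ S P ε : ℝ} (hq : 0 ≤ q) (hsq : 0 ≤ sq) (hε : 0 < ε)
    (hε1 : ε ≤ 1 / 8) (hd : |d| ≤ ε) (hβ : q + sq ≤ ε) (hS0 : 0 ≤ S) (hS : S ≤ 2 * sq)
    (hP1 : |P - 1| ≤ Real.exp S - 1) (hP2 : |P - 1 - σ| ≤ Real.exp S - 1 - S)
    (hσ : |σ + sq / 2| ≤ ε * sq) :
    |Real.exp (d - 1 / 2 * q) * P - 1 - d - 1 / 2 * (d ^ 2 - (q + sq))| ≤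
      24 * ε * (d ^ 2 + (q + sq)) := by
  have hS1 : |S| ≤ 1 := by rw [abs_of_nonneg hS0]; linarith
  have e1 := Real.abs_exp_sub_one_sub_id_le hS1
  have e2 := Real.abs_exp_sub_one_le hS1
  rw [abs_of_nonneg hS0] at e2
  have hP1' : |P - 1| ≤ 4 * (q + sq) := by
    have := le_abs_self (Real.exp S - 1)
    linarith
  have hP2' : |P - 1 - σ| ≤ 4 * ε * (q + sq) := by
    have := le_abs_self (Real.exp S - 1 - S)
    have h1 : S ^ 2 ≤ (2 * sq) ^ 2 := pow_le_pow_left₀ hS0 hS 2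
    nlinarith
  set x := d - 1 / 2 * q with hx
  have hxa : |x| ≤ 2 * ε := by
    have := abs_sub d (1 / 2 * q)
    rw [abs_of_nonneg (show 0 ≤ 1 / 2 * q by positivity)] at this
    linarith
  have hx1 : |x| ≤ 1 := by linarith
  have r3 := abs_exp_sub_one_sub_sub_le hx1
  have r1 := Real.abs_exp_sub_one_le hx1
  have hx2 : x ^ 2 ≤ 2 * d ^ 2 + (q + sq) := by
    have : q ^ 2 ≤ q := by nlinarith
    rw [hx]
    nlinarith [sq_nonneg (d + 1 / 2 * q)]
  have hx3 : |x| ^ 3 ≤ 2 * ε * (2 * d ^ 2 + (q + sq)) := by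
    rw [pow_succ, sq_abs, mul_comm]
    exact mul_le_mul hxa hx2 (sq_nonneg x) (by positivity)
  have hxd : |1 / 2 * (x ^ 2 - d ^ 2)| ≤ ε * (q + sq) := by
    have e : 1 / 2 * (x ^ 2 - d ^ 2) = 1 / 4 * q * (1 / 2 * q - 2 * d) := by rw [hx]; ring
    rw [e, abs_mul, abs_of_nonneg (show 0 ≤ 1 / 4 * q by positivity)]
    have h1 : |1 / 2 * q - 2 * d| ≤ 3 * ε := by
      have := abs_sub (1 / 2 * q) (2 * d)
      rw [abs_of_nonneg (show 0 ≤ 1 / 2 * q by positivity), abs_mul, abs_two] at this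
      linarith
    have := mul_le_mul_of_nonneg_left h1 (show 0 ≤ 1 / 4 * q by positivity)
    nlinarith
  have hcross : |(Real.exp x - 1) * (P - 1)| ≤ 16 * ε * (q + sq) := by
    rw [abs_mul]
    calc |Real.exp x - 1| * |P - 1| ≤ (4 * ε) * (4 * (q + sq)) :=
          mul_le_mul (by linarith) hP1' (abs_nonneg _) (by positivity)
      _ = 16 * ε * (q + sq) := by ring
  have hσ' : |σ + sq / 2| ≤ ε * (q + sq) := hσ.trans (by nlinarith)
  -- The five errors are: the jump factors at second order, the replacement of `x²` by `d²`, the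
  -- exponential at third order, the product beyond first order, and the cross term. Their bounds
  -- add up to less than the constant `24`.
  have e : Real.exp x * P - 1 - d - 1 / 2 * (d ^ 2 - (q + sq)) =
      (σ + sq / 2) + 1 / 2 * (x ^ 2 - d ^ 2) + (Real.exp x - 1 - x - x ^ 2 / 2) + (P - 1 - σ) +
        (Real.exp x - 1) * (P - 1) := by rw [hx]; ring
  rw [e]
  refine (abs_add_le _ _).trans ((add_le_add_left ((abs_add_le _ _).trans (add_le_add_left
    ((abs_add_le _ _).trans (add_le_add_left (abs_add_le _ _) _)) _)) _).trans ?_)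
  have : 0 ≤ ε * d ^ 2 := by positivity
  have : 0 ≤ ε * (q + sq) := by positivity
  nlinarith

end Estimates

/-! ### Infinite products over jumps compared with exponentials -/

section JumpProdEstimates

variable {s t : ℝ} {α : ℝ ⊕ ℝ → ℝ}

theorem abs_jumpProd_sub_one_le (hα : Summable ((jumpSet s t).indicator α)) :
    |jumpProd α s t - 1| ≤ Real.exp (jumpSum (fun i => |α i|) s t) - 1 := by
  have h2 : HasSum (fun i => |(jumpSet s t).indicator α i|) (jumpSum (fun i => |α i|) s t) := by
    rw [jumpSum, indicator_jumpSet_abs]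
    exact hα.abs.hasSum
  exact le_of_tendsto_of_tendsto'
    ((multipliable_one_add_indicator hα).hasProd.sub_const (1 : ℝ)).abs
    (((Real.continuous_exp.tendsto _).comp h2).sub_const 1)
    fun T => abs_prod_one_add_sub_one_le T _

theorem abs_jumpProd_sub_one_sub_le (hα : Summable ((jumpSet s t).indicator α)) :
    |jumpProd α s t - 1 - jumpSum α s t| ≤
      Real.exp (jumpSum (fun i => |α i|) s t) - 1 - jumpSum (fun i => |α i|) s t := by
  have h2 : HasSum (fun i => |(jumpSet s t).indicator α i|) (jumpSum (fun i => |α i|) s t) := by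
    rw [jumpSum, indicator_jumpSet_abs]
    exact hα.abs.hasSum
  exact le_of_tendsto_of_tendsto'
    (((multipliable_one_add_indicator hα).hasProd.sub_const (1 : ℝ)).sub hα.hasSum).abs
    ((((Real.continuous_exp.tendsto _).comp h2).sub_const 1).sub h2)
    fun T => abs_prod_one_add_sub_one_sub_le T _

end JumpProdEstimates

end

noncomputable section

/-! ### The two-parameter Doléans exponential -/

/-- The Doléans exponential of `f` over `[s,t]`, where `B` is the bracket function of `f`. -/
def doleans (f B : ℝ → ℝ) (s t : ℝ) : ℝ :=
  Real.exp (f t - f s - 1 / 2 * (B t - B s - jumpSum (fun i => jumps f i ^ 2) s t)) *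
    jumpProd (fun i => jumpFactor (jumps f i) - 1) s t

section Doleans

variable {a b : ℝ} {lam : NestedPartitions a b} {f B φ : ℝ → ℝ} {r s t c u v : ℝ}

open IntervalPartition

/-- The squared jumps of `f` are the jumps of its bracket function, which is nondecreasing. -/
theorem IsBracket.summable_sq (hab : a ≤ b) (hB : IsBracket lam f f B) :
    Summable ((jumpSet a b).indicator fun i => jumps f i ^ 2) := by
  rw [indicator_congr (g := jumps B) fun i hi => by rw [hB.jumps_eq hi, sq]]
  exact hB.monotoneOn.summable_jumps hab

theorem IsBracket.jumpSum_sq_le (hB : IsBracket lam f f B) (hs : a ≤ s) (hst : s ≤ t) (ht : t ≤ b) :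
    jumpSum (fun i => jumps f i ^ 2) s t ≤ B t - B s := by
  rw [jumpSum, indicator_congr (g := jumps B) fun i hi => by
    rw [hB.jumps_eq (jumpSet_mono hs ht hi), sq]]
  exact hB.monotoneOn.jumpSum_jumps_le hs hst ht

theorem IsBracket.sq_jumps_le (hB : IsBracket lam f f B) (hs : a ≤ s) (hst : s ≤ t) (ht : t ≤ b)
    {i : ℝ ⊕ ℝ} (hi : i ∈ jumpSet s t) : jumps f i ^ 2 ≤ B t - B s := by
  have := hB.monotoneOn.sum_jumps_le {i} s t hs hst ht (by simpa using hi)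
  rwa [Finset.sum_singleton, hB.jumps_eq (jumpSet_mono hs ht hi), ← sq] at this

theorem IsBracket.exists_jumpFactor_bound (hab : a ≤ b) (hB : IsBracket lam f f B) :
    ∃ K, 0 ≤ K ∧ ∀ i ∈ jumpSet a b, |jumpFactor (jumps f i) - 1| ≤ K * jumps f i ^ 2 := by
  have h0 := sub_nonneg.2 (hB.monotoneOn (left_mem_Icc.2 hab) (right_mem_Icc.2 hab) hab)
  refine ⟨_, ?_, fun i hi => abs_jumpFactor_sub_one_le (M := B b - B a + 1) ?_⟩
  · have : 0 ≤ 1 + (B b - B a + 1) := by linarith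
    positivity
  · have := hB.sq_jumps_le le_rfl hab le_rfl hi
    rw [← sq_abs] at this
    nlinarith [sq_nonneg (|jumps f i| - 1)]

theorem IsBracket.summable_jumpFactor (hab : a ≤ b) (hB : IsBracket lam f f B) :
    Summable ((jumpSet a b).indicator fun i => jumpFactor (jumps f i) - 1) := by
  obtain ⟨K, -, hK⟩ := hB.exists_jumpFactor_bound hab
  exact summable_jumpSet_of_abs_le (hB.summable_sq hab) hK

theorem doleans_self (f B : ℝ → ℝ) (t : ℝ) : doleans f B t t = 1 := by
  simp [doleans, jumpSum_self, jumpProd_self]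

/-- The flow property, on which existence and uniqueness both rest: increments and jump sums are
additive, jump products multiplicative over adjacent intervals. -/
theorem IsBracket.doleans_mul_doleans (hab : a ≤ b) (hB : IsBracket lam f f B) (hr : a ≤ r)
    (hrs : r ≤ s) (hst : s ≤ t) (ht : t ≤ b) :
    doleans f B r s * doleans f B s t = doleans f B r t := by
  rw [doleans, doleans, mul_mul_mul_comm, ← Real.exp_add,
    jumpProd_mul_jumpProd (hB.summable_jumpFactor hab) hr hrs hst ht, doleans,
    ← jumpSum_add_jumpSum (hB.summable_sq hab) hr hrs hst ht]
  congr 2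
  ring

theorem exp_mul_one_add_jumpFactor (x : ℝ) : Real.exp x * (1 + (jumpFactor x - 1)) = 1 + x := by
  have : Real.exp x * Real.exp (-x) = 1 := by rw [← Real.exp_add]; simp
  rw [jumpFactor]
  linear_combination (1 + x) * this

/-- The continuous part of the bracket contributes nothing in the limit, since the jump of `B` is
the square of the jump of `f`. The exponential `e^{Δf}` then cancels the factor `e^{-Δf}` of the
product. -/
theorem IsBracket.tendsto_doleans_right (hB : IsBracket lam f f B) (hc : c ∈ Ico a b) :
    Tendsto (doleans f B c) (𝓝[>] c) (𝓝 (1 + rightJump f c)) := by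
  have hab := hc.1.trans hc.2.le
  have h1 := ((hB.1.tendsto_sub_right hc).sub ((((hB.2.2.1.tendsto_sub_right hc).sub
    (tendsto_jumpSum_right (hB.summable_sq hab) hc))).const_mul (1 / 2)))
  have h2 := ((Real.continuous_exp.tendsto _).comp h1).mul
    (tendsto_jumpProd_right (hB.summable_jumpFactor hab) hc)
  rw [hB.2.2.2.2.2.2 c hc, jumps_inr, ← sq, sub_self, mul_zero, sub_zero,
    exp_mul_one_add_jumpFactor] at h2
  exact h2

theorem IsBracket.tendsto_doleans_left (hB : IsBracket lam f f B) (hc : c ∈ Ioc a b) :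
    Tendsto (fun s => doleans f B s c) (𝓝[<] c) (𝓝 (1 + leftJump f c)) := by
  have hab := hc.1.le.trans hc.2
  have h1 := ((hB.1.tendsto_sub_left hc).sub ((((hB.2.2.1.tendsto_sub_left hc).sub
    (tendsto_jumpSum_left (hB.summable_sq hab) hc))).const_mul (1 / 2)))
  have h2 := ((Real.continuous_exp.tendsto _).comp h1).mul
    (tendsto_jumpProd_left (hB.summable_jumpFactor hab) hc)
  rw [hB.2.2.2.2.2.1 c hc, jumps_inl, ← sq, sub_self, mul_zero, sub_zero,
    exp_mul_one_add_jumpFactor] at h2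
  exact h2

theorem IsBracket.tendsto_doleans_both (hB : IsBracket lam f f B) (hc : c ∈ Ioo a b) :
    Tendsto (fun x : ℝ × ℝ => doleans f B x.1 x.2) (𝓝[<] c ×ˢ 𝓝[>] c)
      (𝓝 ((1 + leftJump f c) * (1 + rightJump f c))) := by
  have hab := (hc.1.trans hc.2).le
  have h1 := ((hB.1.tendsto_sub_both hc).sub ((((hB.2.2.1.tendsto_sub_both hc).sub
    (tendsto_jumpSum_both (hB.summable_sq hab) hc))).const_mul (1 / 2)))
  have h2 := ((Real.continuous_exp.tendsto _).comp h1).mul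
    (tendsto_jumpProd_both (hB.summable_jumpFactor hab) hc)
  rw [hB.2.2.2.2.2.1 c ⟨hc.1, hc.2.le⟩, hB.2.2.2.2.2.2 c ⟨hc.1.le, hc.2⟩, jumps_inl, jumps_inr,
    ← sq, ← sq, sub_self, mul_zero, sub_zero, Real.exp_add, mul_mul_mul_comm,
    exp_mul_one_add_jumpFactor, exp_mul_one_add_jumpFactor] at h2
  exact h2

/-- A first-order bound by the increments of `f` and of its nondecreasing bracket function; through
it Doléans exponentials inherit membership in the dual class. -/
theorem IsBracket.exists_abs_doleans_sub_one_le (hab : a ≤ b) (hB : IsBracket lam f f B) :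
    ∃ C, 0 ≤ C ∧ ∀ s t, a ≤ s → s ≤ t → t ≤ b →
      |doleans f B s t - 1| ≤ C * (|f t - f s| + |B t - B s|) := by
  obtain ⟨K, hK0, hK⟩ := hB.exists_jumpFactor_bound hab
  obtain ⟨M, hM0, hM⟩ := hB.1.exists_bound
  have hV := sub_nonneg.2 (hB.monotoneOn (left_mem_Icc.2 hab) (right_mem_Icc.2 hab) hab)
  set V := B b - B a
  set Y := Real.exp (2 * M + V) * Real.exp (K * V) with hY
  have hY0 : 0 ≤ Y := by positivity
  refine ⟨Y + Real.exp (K * V) * K, by positivity, fun s t hs hst ht => ?_⟩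
  have ms : s ∈ Icc a b := ⟨hs, hst.trans ht⟩
  have mt : t ∈ Icc a b := ⟨hs.trans hst, ht⟩
  have hΔ := sub_nonneg.2 (hB.monotoneOn ms mt hst)
  have hΔV : B t - B s ≤ V := by
    have h1 := hB.monotoneOn (left_mem_Icc.2 hab) ms hs
    have h2 := hB.monotoneOn mt (right_mem_Icc.2 hab) ht
    simp only [V]
    linarith
  have hq0 : 0 ≤ jumpSum (fun i => jumps f i ^ 2) s t := jumpSum_nonneg fun i _ => sq_nonneg _
  have hq := hB.jumpSum_sq_le hs hst ht
  set q := jumpSum (fun i => jumps f i ^ 2) s t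
  have hP := abs_jumpProd_sub_one_le ((hB.summable_jumpFactor hab).jumpSet_mono hs ht)
  have hS : jumpSum (fun i => |jumpFactor (jumps f i) - 1|) s t ≤ K * (B t - B s) := by
    refine (jumpSum_le_jumpSum ((hB.summable_jumpFactor hab).jumpSet_abs.jumpSet_mono hs ht)
      (β := fun i => K * jumps f i ^ 2) ?_ fun i hi => hK i (jumpSet_mono hs ht hi)).trans ?_
    · exact summable_jumpSet_of_abs_le (K := K) ((hB.summable_sq hab).jumpSet_mono hs ht)
        fun i _ => (abs_of_nonneg (by positivity)).le
    · rw [jumpSum_const_mul]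
      exact mul_le_mul_of_nonneg_left hq hK0
  rw [doleans]
  set P := jumpProd (fun i => jumpFactor (jumps f i) - 1) s t
  have hKΔ : 0 ≤ K * (B t - B s) := by positivity
  have hP1 : |P - 1| ≤ Real.exp (K * V) * K * (B t - B s) := by
    have h1 := hP.trans (sub_le_sub_right (Real.exp_le_exp.2 hS) 1)
    have h2 := (le_abs_self _).trans (abs_exp_sub_one_le_mul_exp (K * (B t - B s)))
    rw [abs_of_nonneg hKΔ] at h2
    have h3 : Real.exp (K * (B t - B s)) ≤ Real.exp (K * V) :=
      Real.exp_le_exp.2 (mul_le_mul_of_nonneg_left hΔV hK0)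
    have h4 := mul_le_mul_of_nonneg_left h3 hKΔ
    linarith
  have hP2 : |P| ≤ Real.exp (K * V) := by
    have h1 := hP.trans (sub_le_sub_right (Real.exp_le_exp.2
      (hS.trans (mul_le_mul_of_nonneg_left hΔV hK0))) 1)
    have h2 := abs_add_le (P - 1) 1
    rw [sub_add_cancel, abs_one] at h2
    linarith
  set x := f t - f s - 1 / 2 * (B t - B s - q) with hx
  have hxa : |x| ≤ |f t - f s| + (B t - B s) := by
    have h1 := abs_sub (f t - f s) (1 / 2 * (B t - B s - q))
    rw [abs_of_nonneg (show 0 ≤ 1 / 2 * (B t - B s - q) by linarith)] at h1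
    linarith
  have hxM : |x| ≤ 2 * M + V := by
    have h1 := abs_sub (f t) (f s)
    linarith [hM s ms, hM t mt]
  have hexp : |Real.exp x - 1| * |P| ≤ (|f t - f s| + (B t - B s)) * Y := by
    rw [hY, ← mul_assoc]
    refine mul_le_mul ((abs_exp_sub_one_le_mul_exp x).trans ?_) hP2 (abs_nonneg _) (by positivity)
    exact mul_le_mul hxa (Real.exp_le_exp.2 hxM) (Real.exp_pos _).le (by positivity)
  have e : Real.exp x * P - 1 = (Real.exp x - 1) * P + (P - 1) := by ring
  rw [e, abs_of_nonneg hΔ]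
  refine (abs_add_le _ _).trans ?_
  rw [abs_mul]
  have : 0 ≤ Real.exp (K * V) * K * |f t - f s| := by positivity
  linarith

/-- The remainder `ℰ(s,t) - 1 - (f(t) - f(s))`. -/
def doleansRem (f B : ℝ → ℝ) (s t : ℝ) : ℝ := doleans f B s t - 1 - (f t - f s)

theorem doleansRem_self (f B : ℝ → ℝ) (t : ℝ) : doleansRem f B t t = 0 := by
  simp [doleansRem, doleans_self]

/-- The heart of the matter. Where `f` and `B` oscillate little, all jumps are small too, and the
exponential and the product can be expanded to second order. The main term is half of `(f t - f s) ^
2 - (B t - B s)`, whose sums vanish by the definition of the bracket. -/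
theorem IsBracket.exists_doleansRem_small (hab : a ≤ b) (hB : IsBracket lam f f B) {ε : ℝ}
    (hε : 0 < ε) : ∃ D : Finset ℝ, ∀ s t, a ≤ s → s ≤ t → t ≤ b → (∀ d ∈ D, d ∉ Icc s t) →
      |doleansRem f B s t - 1 / 2 * ((f t - f s) ^ 2 - (B t - B s))| ≤
        ε * ((f t - f s) ^ 2 + (B t - B s)) := by
  classical
  -- The bounds `1 / 8` and `24` are those of `abs_exp_mul_sub_le`.
  set η := min (1 / 8) (ε / 24) with hη
  have hη0 : 0 < η := by positivity
  have hη1 : η ≤ 1 / 8 := min_le_left _ _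
  have hη2 : 24 * η ≤ ε := by linarith [min_le_right (1 / 8) (ε / 24)]
  obtain ⟨D, hD⟩ := hB.1.exists_finset_osc hη0
  -- The increments of `B` bound the squares of the jumps of `f`, so an oscillation of at most `η ^
  -- 2` makes all jumps at most `η`.
  obtain ⟨D', hD'⟩ := hB.2.2.1.exists_finset_osc (pow_pos hη0 2)
  refine ⟨D ∪ D', fun s t hs hst ht hd => ?_⟩
  have hf := hD s t hs hst ht fun d h => hd d (Finset.mem_union_left _ h)
  have hBs := (le_abs_self _).trans (hD' s t hs hst ht fun d h => hd d (Finset.mem_union_right _ h))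
  have hBη : B t - B s ≤ η := hBs.trans (by nlinarith)
  have hsum := (hB.summable_jumpFactor hab).jumpSet_mono hs ht
  have hsq := (hB.summable_sq hab).jumpSet_mono hs ht
  have hj : ∀ i ∈ jumpSet s t, |jumps f i| ≤ η := fun i hi =>
    abs_le_of_sq_le_sq ((hB.sq_jumps_le hs hst ht hi).trans hBs) hη0.le
  have hq0 : 0 ≤ jumpSum (fun i => jumps f i ^ 2) s t := jumpSum_nonneg fun i _ => sq_nonneg _
  have hq := hB.jumpSum_sq_le hs hst ht
  have hS : jumpSum (fun i => |jumpFactor (jumps f i) - 1|) s t ≤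
      2 * jumpSum (fun i => jumps f i ^ 2) s t := by
    rw [← jumpSum_const_mul]
    refine jumpSum_le_jumpSum hsum.jumpSet_abs ?_ fun i hi =>
      abs_jumpFactor_sub_one_le_of_le_one ((hj i hi).trans (by linarith))
    exact summable_jumpSet_of_abs_le (K := 2) hsq fun i _ => (abs_of_nonneg (by positivity)).le
  have hσ : |jumpSum (fun i => jumpFactor (jumps f i) - 1) s t +
      jumpSum (fun i => jumps f i ^ 2) s t / 2| ≤ η * jumpSum (fun i => jumps f i ^ 2) s t := by
    have hsq2 : Summable ((jumpSet s t).indicator fun i => 1 / 2 * jumps f i ^ 2) :=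
      summable_jumpSet_of_abs_le (K := 1 / 2) hsq fun i _ => (abs_of_nonneg (by positivity)).le
    have e := jumpSum_add hsum hsq2
    rw [jumpSum_const_mul] at e
    have e2 : jumpSum (fun i => jumpFactor (jumps f i) - 1) s t +
        jumpSum (fun i => jumps f i ^ 2) s t / 2 =
        jumpSum (fun i => jumpFactor (jumps f i) - 1 + 1 / 2 * jumps f i ^ 2) s t := by
      rw [e]; ring
    have hs3 : Summable ((jumpSet s t).indicator fun i =>
        jumpFactor (jumps f i) - 1 + 1 / 2 * jumps f i ^ 2) := by
      have := hsum.add hsq2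
      rwa [← indicator_add] at this
    rw [e2, ← jumpSum_const_mul]
    refine (abs_jumpSum_le hs3).trans (jumpSum_le_jumpSum hs3.jumpSet_abs ?_ fun i hi => ?_)
    · exact summable_jumpSet_of_abs_le (K := η) hsq fun i _ => (abs_of_nonneg (by positivity)).le
    · have h1 := abs_jumpFactor_sub_one_add_le ((hj i hi).trans (by linarith))
      have h2 : |jumps f i| ^ 3 ≤ η * jumps f i ^ 2 := by
        rw [pow_succ, sq_abs, mul_comm]
        exact mul_le_mul_of_nonneg_right (hj i hi) (sq_nonneg _)
      rw [show jumpFactor (jumps f i) - 1 + 1 / 2 * jumps f i ^ 2 =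
        jumpFactor (jumps f i) - 1 + jumps f i ^ 2 / 2 by ring]
      exact h1.trans h2
  have key := abs_exp_mul_sub_le (d := f t - f s) (sub_nonneg.2 hq) hq0 hη0 hη1 hf
    (by rwa [sub_add_cancel]) (jumpSum_nonneg fun i _ => abs_nonneg _) hS
    (abs_jumpProd_sub_one_le hsum) (abs_jumpProd_sub_one_sub_le hsum) hσ
  rw [sub_add_cancel] at key
  have h0 : 0 ≤ (f t - f s) ^ 2 + (B t - B s) := by nlinarith [sq_nonneg (f t - f s)]
  exact key.trans (mul_le_mul_of_nonneg_right hη2 h0)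

theorem IsBracket.tendsto_traceSum_sq_add (hB : IsBracket lam f f B) (hu : a ≤ u) (huv : u < v)
    (hv : v ≤ b) :
    Tendsto (fun m => (lam.part m).traceSum u v fun s t => (f t - f s) ^ 2 + (B t - B s)) atTop
      (𝓝 (B v - B u + (B v - B u))) := by
  refine ((hB.tendsto hu huv hv).add_const (B v - B u)).congr fun m => ?_
  rw [traceSum_add, traceSum_sub hu huv.le hv B]
  simp only [sq]

theorem IsBracket.tendsto_traceSum_sq_sub (hB : IsBracket lam f f B) (hu : a ≤ u) (huv : u < v)
    (hv : v ≤ b) :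
    Tendsto (fun m => (lam.part m).traceSum u v fun s t => (f t - f s) ^ 2 - (B t - B s)) atTop
      (𝓝 0) := by
  have := (hB.tendsto hu huv hv).sub_const (B v - B u)
  rw [sub_self] at this
  refine this.congr fun m => ?_
  rw [traceSum_minus, traceSum_sub hu huv.le hv B]
  simp only [sq]

theorem IsBracket.tendsto_sq_sub_right (hB : IsBracket lam f f B) (hc : c ∈ Ico a b) :
    Tendsto (fun t => (f t - f c) ^ 2 - (B t - B c)) (𝓝[>] c) (𝓝 0) := by
  have := ((hB.1.tendsto_sub_right hc).pow 2).sub (hB.2.2.1.tendsto_sub_right hc)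
  rwa [hB.2.2.2.2.2.2 c hc, ← sq, sub_self] at this

theorem IsBracket.tendsto_sq_sub_left (hB : IsBracket lam f f B) (hc : c ∈ Ioc a b) :
    Tendsto (fun s => (f c - f s) ^ 2 - (B c - B s)) (𝓝[<] c) (𝓝 0) := by
  have := ((hB.1.tendsto_sub_left hc).pow 2).sub (hB.2.2.1.tendsto_sub_left hc)
  rwa [hB.2.2.2.2.2.1 c hc, ← sq, sub_self] at this

theorem IsBracket.tendsto_sq_sub_both (hB : IsBracket lam f f B) (hc : c ∈ Ioo a b)
    (h0 : rightJump f c = 0) :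
    Tendsto (fun x : ℝ × ℝ => (f x.2 - f x.1) ^ 2 - (B x.2 - B x.1)) (𝓝[<] c ×ˢ 𝓝[>] c) (𝓝 0) := by
  have := ((hB.1.tendsto_sub_both hc).pow 2).sub (hB.2.2.1.tendsto_sub_both hc)
  rwa [hB.2.2.2.2.2.2 c ⟨hc.1.le, hc.2⟩, hB.2.2.2.2.2.1 c ⟨hc.1, hc.2.le⟩, h0, mul_zero, add_zero,
    add_zero, ← sq, sub_self] at this

theorem IsBracket.tendsto_doleansRem_right (hB : IsBracket lam f f B) (hc : c ∈ Ico a b) :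
    Tendsto (doleansRem f B c) (𝓝[>] c) (𝓝 0) := by
  have := ((hB.tendsto_doleans_right hc).sub_const 1).sub (hB.1.tendsto_sub_right hc)
  rw [add_sub_cancel_left, sub_self] at this
  exact this

theorem IsBracket.tendsto_doleansRem_left (hB : IsBracket lam f f B) (hc : c ∈ Ioc a b) :
    Tendsto (fun s => doleansRem f B s c) (𝓝[<] c) (𝓝 0) := by
  simpa [doleansRem] using ((hB.tendsto_doleans_left hc).sub_const 1).sub (hB.1.tendsto_sub_left hc)

/-- Across an interior point the limit of the remainder is the product of the left and the right
jump, so one of them has to vanish. -/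
theorem IsBracket.tendsto_doleansRem_both (hB : IsBracket lam f f B) (hc : c ∈ Ioo a b)
    (h0 : rightJump f c = 0) :
    Tendsto (fun x : ℝ × ℝ => doleansRem f B x.1 x.2) (𝓝[<] c ×ˢ 𝓝[>] c) (𝓝 0) := by
  simpa [doleansRem, h0] using ((hB.tendsto_doleans_both hc).sub_const 1).sub (hB.1.tendsto_sub_both hc)

theorem IsBracket.tendsto_traceSum_abs_doleansRem_sub (hB : IsBracket lam f f B)
    (hacc : ∀ t ∈ Ioo a b, rightJump f t ≠ 0 → t ∈ lam.allPoints) (hu : a ≤ u) (huv : u < v) (hv : v ≤ b) :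
    Tendsto (fun m => (lam.part m).traceSum u v fun s t =>
      |doleansRem f B s t - 1 / 2 * ((f t - f s) ^ 2 - (B t - B s))|) atTop (𝓝 0) := by
  refine tendsto_traceSum_abs_of_small lam huv.le
    (w := fun s t => doleansRem f B s t - 1 / 2 * ((f t - f s) ^ 2 - (B t - B s)))
    (W := fun s t => (f t - f s) ^ 2 + (B t - B s)) (K := B v - B u + (B v - B u) + 1)
    (fun t => by simp [doleansRem_self]) (fun s t hs hst ht => ?_)
    ((hB.tendsto_traceSum_sq_add hu huv hv).eventually (ge_mem_nhds (by linarith)))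
    (fun ε hε => ?_) (fun c hc => ?_) (fun c hc => ?_) fun c hc hcl => ?_
  · exact add_nonneg (sq_nonneg _) (sub_nonneg.2 (hB.monotoneOn ⟨hu.trans hs, hst.trans (ht.trans hv)⟩
      ⟨hu.trans (hs.trans hst), ht.trans hv⟩ hst))
  · obtain ⟨D, hD⟩ := hB.exists_doleansRem_small (hu.trans (huv.le.trans hv)) hε
    exact ⟨D, fun s t hs hst ht hd => hD s t (hu.trans hs) hst.le (ht.trans hv) hd⟩
  · have hc' : c ∈ Ico a b := ⟨hu.trans hc.1, hc.2.trans_le hv⟩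
    have := (hB.tendsto_doleansRem_right hc').sub
      ((hB.tendsto_sq_sub_right hc').const_mul (1 / 2))
    rwa [mul_zero, sub_zero] at this
  · have hc' : c ∈ Ioc a b := ⟨hu.trans_lt hc.1, hc.2.trans hv⟩
    have := (hB.tendsto_doleansRem_left hc').sub
      ((hB.tendsto_sq_sub_left hc').const_mul (1 / 2))
    rwa [mul_zero, sub_zero] at this
  · have hc' : c ∈ Ioo a b := ⟨hu.trans_lt hc.1, hc.2.trans_le hv⟩
    have h0 : rightJump f c = 0 := by
      by_contra h0
      exact hcl (hacc c hc' h0)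
    have := (hB.tendsto_doleansRem_both hc' h0).sub
      ((hB.tendsto_sq_sub_both hc' h0).const_mul (1 / 2))
    rwa [mul_zero, sub_zero] at this

theorem IsBracket.tendsto_traceSum_doleansRem (hB : IsBracket lam f f B)
    (hacc : ∀ t ∈ Ioo a b, rightJump f t ≠ 0 → t ∈ lam.allPoints) (hu : a ≤ u) (huv : u < v) (hv : v ≤ b) :
    Tendsto (fun m => (lam.part m).traceSum u v (doleansRem f B)) atTop (𝓝 0) := by
  have := (tendsto_traceSum_of_abs (hB.tendsto_traceSum_abs_doleansRem_sub hacc hu huv hv)).add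
    ((hB.tendsto_traceSum_sq_sub hu huv hv).const_mul (1 / 2))
  rw [mul_zero, add_zero] at this
  refine this.congr fun m => ?_
  rw [← traceSum_mul, ← traceSum_add]
  exact traceSum_congr huv.le fun s t _ _ _ => sub_add_cancel _ _

/-- Each `|R|` is at most its error at second order plus `(δf)² + δB`, and the sums of the latter
converge. -/
theorem IsBracket.eventually_traceSum_abs_doleansRem_le (hB : IsBracket lam f f B)
    (hacc : ∀ t ∈ Ioo a b, rightJump f t ≠ 0 → t ∈ lam.allPoints) (hu : a ≤ u) (huv : u < v) (hv : v ≤ b) :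
    ∃ K, ∀ᶠ m in atTop, (lam.part m).traceSum u v (fun s t => |doleansRem f B s t|) ≤ K := by
  have h1 := (hB.tendsto_traceSum_abs_doleansRem_sub hacc hu huv hv).add
    (hB.tendsto_traceSum_sq_add hu huv hv)
  refine ⟨_, (h1.eventually (ge_mem_nhds (lt_add_one _))).mono fun m hm => le_trans ?_ hm⟩
  rw [← traceSum_add]
  refine traceSum_le huv.le fun s t hs hst ht => ?_
  have h0 := sub_nonneg.2 (hB.monotoneOn ⟨hu.trans hs, hst.trans (ht.trans hv)⟩
      ⟨hu.trans (hs.trans hst), ht.trans hv⟩ hst)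
  have h2 := abs_add_le (doleansRem f B s t - 1 / 2 * ((f t - f s) ^ 2 - (B t - B s)))
    (1 / 2 * ((f t - f s) ^ 2 - (B t - B s)))
  rw [sub_add_cancel] at h2
  refine h2.trans (add_le_add_right ?_ _)
  rw [abs_le]
  constructor <;> nlinarith [sq_nonneg (f t - f s)]

theorem IsBracket.tendsto_traceSum_mul_doleansRem (hB : IsBracket lam f f B)
    (hacc : ∀ t ∈ Ioo a b, rightJump f t ≠ 0 → t ∈ lam.allPoints) (hφ : IsRegulated a b φ) (hu : a ≤ u)
    (huv : u < v) (hv : v ≤ b) :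
    Tendsto (fun m => (lam.part m).traceSum u v fun s t => φ s * doleansRem f B s t) atTop
      (𝓝 0) := by
  obtain ⟨K, hK⟩ := hB.eventually_traceSum_abs_doleansRem_le hacc hu huv hv
  exact tendsto_traceSum_mul_of_regulated lam huv (hφ.mono hu hv) (doleansRem_self f B)
    (fun c hc => hB.tendsto_traceSum_doleansRem hacc (hu.trans hc.1) hc.2 hv) hK
    fun c hc => hB.tendsto_doleansRem_right ⟨hu.trans hc.1, hc.2.trans_le hv⟩

theorem IsBracket.tendsto_traceSum_doleansRem_sq (hB : IsBracket lam f f B)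
    (hacc : ∀ t ∈ Ioo a b, rightJump f t ≠ 0 → t ∈ lam.allPoints) (hu : a ≤ u) (huv : u < v) (hv : v ≤ b) :
    Tendsto (fun m => (lam.part m).traceSum u v fun s t => doleansRem f B s t ^ 2) atTop
      (𝓝 0) := by
  classical
  have hab := hu.trans (huv.le.trans hv)
  have h0 : ∀ s t, u ≤ s → s ≤ t → t ≤ v → 0 ≤ B t - B s := fun s t hs hst ht =>
    sub_nonneg.2 (hB.monotoneOn ⟨hu.trans hs, hst.trans (ht.trans hv)⟩
      ⟨hu.trans (hs.trans hst), ht.trans hv⟩ hst)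
  refine tendsto_traceSum_of_abs (tendsto_traceSum_abs_of_small lam huv.le
    (w := fun s t => doleansRem f B s t ^ 2)
    (W := fun s t => (f t - f s) ^ 2 + (B t - B s)) (K := B v - B u + (B v - B u) + 1)
    (fun t => by simp [doleansRem_self])
    (fun s t hs hst ht => add_nonneg (sq_nonneg _) (h0 s t hs hst ht))
    ((hB.tendsto_traceSum_sq_add hu huv hv).eventually (ge_mem_nhds (by linarith)))
    (fun ε hε => ?_) (fun c hc => ?_) (fun c hc => ?_) fun c hc hcl => ?_)
  · obtain ⟨D, hD⟩ := hB.exists_doleansRem_small hab one_pos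
    -- With `W = (δf)² + δB` at most `2 * η` and `|R| ≤ 2 * W`, the square of `R` is at most `4 * W
    -- * W ≤ 8 * η * W`.
    set η := min 1 (ε / 8) with hη
    have hη0 : 0 < η := by positivity
    have hη1 : η ≤ 1 := min_le_left _ _
    have hη2 : 8 * η ≤ ε := by linarith [min_le_right 1 (ε / 8)]
    obtain ⟨D₁, hD₁⟩ := hB.1.exists_finset_osc hη0
    obtain ⟨D₂, hD₂⟩ := hB.2.2.1.exists_finset_osc hη0
    refine ⟨D ∪ D₁ ∪ D₂, fun s t hs hst ht hd => ?_⟩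
    have h1 := hD s t (hu.trans hs) hst.le (ht.trans hv) fun d h => hd d (by simp [h])
    have h2 := hD₁ s t (hu.trans hs) hst.le (ht.trans hv) fun d h => hd d (by simp [h])
    have h3 := (le_abs_self _).trans
      (hD₂ s t (hu.trans hs) hst.le (ht.trans hv) fun d h => hd d (by simp [h]))
    have hB0 := h0 s t hs hst.le ht
    have hW : (f t - f s) ^ 2 + (B t - B s) ≤ 2 * η := by
      have : (f t - f s) ^ 2 ≤ η ^ 2 := by
        rw [← sq_abs]
        exact pow_le_pow_left₀ (abs_nonneg _) h2 2
      nlinarith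
    have hR : |doleansRem f B s t| ≤ 2 * ((f t - f s) ^ 2 + (B t - B s)) := by
      rw [abs_le] at h1 ⊢
      constructor <;> nlinarith [sq_nonneg (f t - f s)]
    have hW0 : 0 ≤ (f t - f s) ^ 2 + (B t - B s) := add_nonneg (sq_nonneg _) hB0
    rw [abs_of_nonneg (sq_nonneg _), ← sq_abs]
    calc |doleansRem f B s t| ^ 2 ≤ (2 * ((f t - f s) ^ 2 + (B t - B s))) ^ 2 :=
          pow_le_pow_left₀ (abs_nonneg _) hR 2
      _ = 4 * ((f t - f s) ^ 2 + (B t - B s)) * ((f t - f s) ^ 2 + (B t - B s)) := by ring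
      _ ≤ ε * ((f t - f s) ^ 2 + (B t - B s)) :=
          mul_le_mul_of_nonneg_right (by linarith) hW0
  · simpa using (hB.tendsto_doleansRem_right ⟨hu.trans hc.1, hc.2.trans_le hv⟩).pow 2
  · simpa using (hB.tendsto_doleansRem_left ⟨hu.trans_lt hc.1, hc.2.trans hv⟩).pow 2
  · have hc' : c ∈ Ioo a b := ⟨hu.trans_lt hc.1, hc.2.trans_le hv⟩
    have h0 : rightJump f c = 0 := by
      by_contra h0
      exact hcl (hacc c hc' h0)
    simpa using (hB.tendsto_doleansRem_both hc' h0).pow 2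

end Doleans

end

noncomputable section

/-! ### Identification of the Doléans exponentials -/

section Identification

variable {a b : ℝ} {lam : NestedPartitions a b} {f B : ℝ → ℝ} {s t u v : ℝ} {α : ℝ ⊕ ℝ → ℝ}

theorem Summable.subtype_inl (hα : Summable ((jumpSet s t).indicator α)) :
    Summable fun x : Ioc s t => α (Sum.inl x) := by
  refine (hα.comp_injective (i := fun x : Ioc s t => (Sum.inl (x : ℝ) : ℝ ⊕ ℝ))
    (Sum.inl_injective.comp Subtype.val_injective)).congr fun x => ?_
  exact indicator_of_mem (s := jumpSet s t) (show Sum.inl (x : ℝ) ∈ jumpSet s t from x.2) α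

theorem Summable.subtype_inr (hα : Summable ((jumpSet s t).indicator α)) :
    Summable fun x : Ico s t => α (Sum.inr x) := by
  refine (hα.comp_injective (i := fun x : Ico s t => (Sum.inr (x : ℝ) : ℝ ⊕ ℝ))
    (Sum.inr_injective.comp Subtype.val_injective)).congr fun x => ?_
  exact indicator_of_mem (s := jumpSet s t) (show Sum.inr (x : ℝ) ∈ jumpSet s t from x.2) α

theorem jumpSum_eq_tsum (hα : Summable ((jumpSet s t).indicator α)) :
    jumpSum α s t = ∑' x : Ioc s t, α (Sum.inl x) + ∑' x : Ico s t, α (Sum.inr x) := by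
  rw [jumpSum, Summable.tsum_sum (hα.comp_injective Sum.inl_injective)
    (hα.comp_injective Sum.inr_injective), tsum_subtype (Ioc s t) (fun x => α (Sum.inl x)),
    tsum_subtype (Ico s t) (fun x => α (Sum.inr x))]
  rfl

theorem IsBracket.finite_jumps (hab : a ≤ b) (hB : IsBracket lam f f B) {δ : ℝ} (hδ : 0 < δ) :
    {i | i ∈ jumpSet a b ∧ δ < |jumps f i|}.Finite := by
  have h := (hB.summable_sq hab).tendsto_cofinite_zero.eventually (gt_mem_nhds (pow_pos hδ 2))
  refine (eventually_cofinite.1 h).subset fun i hi => ?_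
  simp only [mem_ofPred_eq, indicator_of_mem hi.1, not_lt]
  rw [← sq_abs (jumps f i)]
  exact pow_le_pow_left₀ hδ.le hi.2.le 2

/-- Only finitely many jumps exceed `δ`, so the two finite products are one infinite product over
the jump indices with almost all factors `1`. In this form dominated convergence applies as `δ ↓ 0`.
-/
theorem IsBracket.truncatedJumpProduct_eq (hB : IsBracket lam f f B) (hu : a ≤ u) (huv : u ≤ v)
    (hv : v ≤ b) {δ : ℝ} (hδ : 0 < δ) :
    truncatedJumpProduct f u v δ = ∏' i, (1 + {i | i ∈ jumpSet u v ∧ δ < |jumps f i|}.indicator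
      (fun i => jumpFactor (jumps f i) - 1) i) := by
  set S := {i | i ∈ jumpSet u v ∧ δ < |jumps f i|} with hS
  have hfin : S.Finite := (hB.finite_jumps (hu.trans (huv.trans hv)) hδ).subset fun i hi =>
    ⟨jumpSet_mono hu hv hi.1, hi.2⟩
  set F : ℝ ⊕ ℝ → ℝ := fun i => 1 + S.indicator (fun i => jumpFactor (jumps f i) - 1) i with hF
  have hF1 : ∀ i, F i = S.mulIndicator (fun i => jumpFactor (jumps f i)) i := fun i => by
    by_cases hi : i ∈ S <;> simp [hF, hi]
  have hsupp : (Function.mulSupport F).Finite := hfin.subset fun i hi => by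
    by_contra hiS
    exact hi (by simp [hF, hiS])
  have hl : (Function.mulSupport (F ∘ Sum.inl)).Finite :=
    hsupp.preimage Sum.inl_injective.injOn
  have hr : (Function.mulSupport (F ∘ Sum.inr)).Finite :=
    hsupp.preimage Sum.inr_injective.injOn
  rw [Multipliable.tprod_sum (multipliable_of_hasFiniteMulSupport hl)
    (multipliable_of_hasFiniteMulSupport hr), truncatedJumpProduct, finprod_mem_def,
    finprod_mem_def]
  congr 1
  · refine Eq.trans ?_ (tprod_eq_finprod hl).symm
    refine finprod_congr fun x => Eq.trans ?_ (hF1 (Sum.inl x)).symm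
    by_cases hx : x ∈ Ioc u v ∧ δ < |leftJump f x|
    · rw [mulIndicator_of_mem (by exact hx), mulIndicator_of_mem (by exact hx)]; rfl
    · rw [mulIndicator_of_notMem (by exact hx), mulIndicator_of_notMem (by exact hx)]
  · refine Eq.trans ?_ (tprod_eq_finprod hr).symm
    refine finprod_congr fun x => Eq.trans ?_ (hF1 (Sum.inr x)).symm
    by_cases hx : x ∈ Ico u v ∧ δ < |rightJump f x|
    · rw [mulIndicator_of_mem (by exact hx), mulIndicator_of_mem (by exact hx)]; rfl
    · rw [mulIndicator_of_notMem (by exact hx), mulIndicator_of_notMem (by exact hx)]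

theorem IsBracket.tendsto_truncatedJumpProduct (hB : IsBracket lam f f B) (hu : a ≤ u)
    (huv : u ≤ v) (hv : v ≤ b) :
    Tendsto (truncatedJumpProduct f u v) (𝓝[>] 0)
      (𝓝 (jumpProd (fun i => jumpFactor (jumps f i) - 1) u v)) := by
  have hsum := (hB.summable_jumpFactor (hu.trans (huv.trans hv))).jumpSet_mono hu hv
  have := tendsto_tprod_one_add_of_dominated_convergence (𝓕 := 𝓝[>] (0 : ℝ))
    (f := fun δ => {i | i ∈ jumpSet u v ∧ δ < |jumps f i|}.indicator
      (fun i => jumpFactor (jumps f i) - 1)) hsum.norm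
    (g := (jumpSet u v).indicator fun i => jumpFactor (jumps f i) - 1) (fun i => ?_)
    (Eventually.of_forall fun δ i => ?_)
  · refine this.congr' ?_
    filter_upwards [self_mem_nhdsWithin] with δ hδ
    exact (hB.truncatedJumpProduct_eq hu huv hv hδ).symm
  · refine tendsto_const_nhds.congr' ?_
    by_cases h0 : jumps f i = 0
    · exact Eventually.of_forall fun δ => by
        by_cases h1 : i ∈ jumpSet u v <;> by_cases h2 : δ < |jumps f i| <;>
          simp [indicator, h0, jumpFactor]
    · filter_upwards [Ioo_mem_nhdsGT (abs_pos.2 h0)] with δ hδ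
      by_cases h1 : i ∈ jumpSet u v <;> simp [indicator, h1, hδ.2]
  · by_cases h1 : i ∈ jumpSet u v <;> by_cases h2 : δ < |jumps f i| <;>
      simp [indicator, h1, h2]

theorem IsBracket.jumpProduct_eq (hB : IsBracket lam f f B) (hu : a ≤ u) (huv : u ≤ v)
    (hv : v ≤ b) : jumpProduct f u v = jumpProd (fun i => jumpFactor (jumps f i) - 1) u v :=
  (hB.tendsto_truncatedJumpProduct hu huv hv).limUnder_eq

theorem IsBracket.doleansDefined (hab : a ≤ b) (hB : IsBracket lam f f B) :
    DoleansDefined lam f :=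
  ⟨⟨B, hB⟩, (hB.summable_sq hab).subtype_inl, (hB.summable_sq hab).subtype_inr,
    (hB.summable_jumpFactor hab).jumpSet_abs.subtype_inl,
    (hB.summable_jumpFactor hab).jumpSet_abs.subtype_inr, fun u v hu huv hv => by
      rw [hB.jumpProduct_eq hu huv.le hv]
      exact hB.tendsto_truncatedJumpProduct hu huv.le hv⟩

theorem IsBracket.bracketCont_eq (hB : IsBracket lam f f B) (ht : t ∈ Icc a b) :
    bracketCont lam f t = B t - jumpSum (fun i => jumps f i ^ 2) a t := by
  rw [bracketCont, hB.eqOn_bracket ht, jumpSum_eq_tsum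
    ((hB.summable_sq (ht.1.trans ht.2)).jumpSet_mono le_rfl ht.2), ← sub_sub]
  rfl

theorem IsBracket.doleansForward_eq (hB : IsBracket lam f f B) (ht : t ∈ Icc a b) :
    doleansForward lam f t = doleans f B a t := by
  rw [doleansForward]
  split_ifs with h
  · rw [h, doleans_self]
  · rw [hB.jumpProduct_eq le_rfl ht.1 ht.2, hB.bracketCont_eq ht, doleans, hB.2.2.2.1, sub_zero]

theorem IsBracket.doleansBackward_eq (hB : IsBracket lam f f B) (ht : t ∈ Icc a b) :
    doleansBackward lam f t = doleans f B t b := by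
  have hab := ht.1.trans ht.2
  rw [doleansBackward]
  split_ifs with h
  · rw [h, doleans_self]
  · rw [hB.jumpProduct_eq ht.1 ht.2 le_rfl, hB.bracketCont_eq ht,
      hB.bracketCont_eq (right_mem_Icc.2 hab), doleans,
      ← jumpSum_add_jumpSum (hB.summable_sq hab) le_rfl ht.1 ht.2 le_rfl]
    congr 2
    ring

end Identification

end

noncomputable section

/-! ### The forward equation: existence -/

section CauchySchwarz

variable {a b : ℝ} {lam : NestedPartitions a b} {u v : ℝ}

open IntervalPartition

/-- The Cauchy–Schwarz inequality for the sums, one factor tending to zero and the other staying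
bounded. -/
theorem tendsto_traceSum_abs_mul {w w' : ℝ → ℝ → ℝ}
    (hw : Tendsto (fun m => (lam.part m).traceSum u v fun s t => w s t ^ 2) atTop (𝓝 0)) {K : ℝ}
    (hw' : ∀ᶠ m in atTop, (lam.part m).traceSum u v (fun s t => w' s t ^ 2) ≤ K) :
    Tendsto (fun m => (lam.part m).traceSum u v fun s t => |w s t * w' s t|) atTop (𝓝 0) := by
  have h1 : Tendsto (fun m => Real.sqrt (((lam.part m).traceSum u v fun s t => w s t ^ 2) * |K|))
      atTop (𝓝 0) := by
    have := (Real.continuous_sqrt.tendsto _).comp (hw.mul_const |K|)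
    rwa [zero_mul, Real.sqrt_zero] at this
  refine squeeze_zero' (Eventually.of_forall fun m => Finset.sum_nonneg fun i _ => abs_nonneg _)
    (hw'.mono fun m hm => Real.le_sqrt_of_sq_le ?_) h1
  have h2 := (lam.part m).traceSum_mul_sq_le (u := u) (v := v) (fun s t => |w s t|)
    fun s t => |w' s t|
  simp only [sq_abs, ← abs_mul] at h2
  refine h2.trans (mul_le_mul_of_nonneg_left (hm.trans (le_abs_self K)) ?_)
  exact Finset.sum_nonneg fun i _ => sq_nonneg _

theorem tendsto_traceSum_of_abs_le (huv : u ≤ v) {w w' : ℝ → ℝ → ℝ} {M : ℝ}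
    (h : Tendsto (fun m => (lam.part m).traceSum u v fun s t => |w s t|) atTop (𝓝 0))
    (hle : ∀ s t, u ≤ s → s ≤ t → t ≤ v → |w' s t| ≤ M * |w s t|) :
    Tendsto (fun m => (lam.part m).traceSum u v w') atTop (𝓝 0) := by
  have h1 := h.const_mul M
  rw [mul_zero] at h1
  refine squeeze_zero_norm (fun m => (abs_traceSum_le _).trans ?_) h1
  rw [← traceSum_mul]
  exact traceSum_le huv hle

end CauchySchwarz

/-! ### Functions that evolve by the Doléans exponential: class, jumps, brackets -/

section Forward

variable {a b p : ℝ} {lam : NestedPartitions a b} {f g h B φ I ψ E : ℝ → ℝ} {s t c u v : ℝ}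

open IntervalPartition

/-- A monotone integrator has bounded `1`-variation, and the dual class for `p = 1` consists of all
regulated functions. -/
theorem exists_isYoungPrimitive_of_monotoneOn (hab : a ≤ b) (hφ : IsRegulated a b φ)
    (hB : MonotoneOn B (Icc a b))
    (hacc : ∀ t ∈ Ioo a b, rightJump B t ≠ 0 → t ∈ lam.allPoints) :
    ∃ I, IsYoungPrimitive lam φ B I :=
  exists_isYoungPrimitive hφ hB.isRegulated hacc fun _ hε =>
    MemDualW.exists_pairingBound hab le_rfl (Or.inl ⟨rfl, hφ⟩) hB.isControl_one.boundedPVariation hε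

theorem exists_isYoungPrimitive_of_memDualW (hab : a ≤ b) (hp : 1 ≤ p) (hφ : MemDualW a b p φ)
    (hh : BoundedPVariation a b p h)
    (hacc : ∀ t ∈ Ioo a b, rightJump h t ≠ 0 → t ∈ lam.allPoints) :
    ∃ I, IsYoungPrimitive lam φ h I :=
  exists_isYoungPrimitive hφ.isRegulated (hh.isRegulated (by linarith)) hacc fun _ hε =>
    hφ.exists_pairingBound hab hp hh hε

theorem IsYoungPrimitive.hasLYIntegral (hI : IsYoungPrimitive lam φ h I) (ht : t ∈ Icc a b) :
    HasLYIntegral φ h a t (I t - I a) := by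
  rcases eq_or_lt_of_le ht.1 with rfl | h
  · exact Or.inl ⟨rfl, sub_self _⟩
  · exact hI.ly a t le_rfl h ht.2

theorem IsRegulated.sub_const (hf : IsRegulated a b f) (r : ℝ) :
    IsRegulated a b fun t => f t - r :=
  hf.sub (isRegulated_const r)

theorem IsRegulated.leftJump_sub_const (hf : IsRegulated a b f) (r : ℝ) (ht : t ∈ Ioc a b) :
    leftJump (fun t => f t - r) t = leftJump f t := by
  refine leftJump_eq_of_tendsto ?_
  have := (hf.tendsto_left ht).sub_const r
  rwa [sub_right_comm] at this

theorem IsRegulated.rightJump_sub_const (hf : IsRegulated a b f) (r : ℝ) (ht : t ∈ Ico a b) :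
    rightJump (fun t => f t - r) t = rightJump f t := by
  refine rightJump_eq_of_tendsto ?_
  have := (hf.tendsto_right ht).sub_const r
  rwa [add_sub_right_comm] at this

theorem IsBracket.rightJump_accessible (hB : IsBracket lam f f B)
    (hacc : ∀ t ∈ Ioo a b, rightJump f t ≠ 0 → t ∈ lam.allPoints) :
    ∀ t ∈ Ioo a b, rightJump B t ≠ 0 → t ∈ lam.allPoints := fun t ht h =>
  hacc t ht fun h0 => h (by rw [hB.2.2.2.2.2.2 t ⟨ht.1.le, ht.2⟩, h0, zero_mul])

theorem IsBracket.eventually_traceSum_sq_le (hB : IsBracket lam f f B) (hu : a ≤ u) (huv : u < v)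
    (hv : v ≤ b) :
    ∀ᶠ m in atTop, (lam.part m).traceSum u v (fun s t => (f t - f s) ^ 2) ≤ B v - B u + 1 := by
  refine ((hB.tendsto hu huv hv).eventually (ge_mem_nhds (lt_add_one _))).mono fun m hm => ?_
  simpa only [sq] using hm

/-- Weighted sums of squared increments converge to the Left Young integral with respect to the
bracket function. -/
theorem IsBracket.tendsto_traceSum_mul_sq (hB : IsBracket lam f f B) (hφ : IsRegulated a b φ)
    (hI : IsYoungPrimitive lam φ B I) (hu : a ≤ u) (huv : u < v) (hv : v ≤ b) :
    Tendsto (fun m => (lam.part m).traceSum u v fun s t => φ s * (f t - f s) ^ 2) atTop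
      (𝓝 (I v - I u)) := by
  -- The squares may be replaced by increments of `B`, because the differences have vanishing sums
  -- on every subinterval; what remains are Left Cauchy sums with respect to `B`.
  have h1 := tendsto_traceSum_mul_of_regulated lam huv (hφ.mono hu hv)
    (w := fun s t => (f t - f s) ^ 2 - (B t - B s)) (fun t => by simp)
    (fun c hc => hB.tendsto_traceSum_sq_sub (hu.trans hc.1) hc.2 hv)
    (K := B v - B u + (B v - B u) + 1) ?_
    (fun c hc => hB.tendsto_sq_sub_right ⟨hu.trans hc.1, hc.2.trans_le hv⟩)
  · have h2 := h1.add (hI.lc u v hu huv hv)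
    rw [zero_add] at h2
    refine h2.congr fun m => ?_
    rw [← traceSum_add]
    exact traceSum_congr huv.le fun s t _ _ _ => by ring
  · refine ((hB.tendsto_traceSum_sq_add hu huv hv).eventually
      (ge_mem_nhds (lt_add_one _))).mono fun m hm => le_trans ?_ hm
    refine traceSum_le huv.le fun s t hs hst ht => ?_
    have h0 := sub_nonneg.2 (hB.monotoneOn ⟨hu.trans hs, hst.trans (ht.trans hv)⟩
      ⟨hu.trans (hs.trans hst), ht.trans hv⟩ hst)
    rw [abs_le]
    constructor <;> nlinarith [sq_nonneg (f t - f s)]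

theorem IsBracket.exists_abs_doleans_le (hab : a ≤ b) (hB : IsBracket lam f f B) :
    ∃ M, 0 ≤ M ∧ ∀ s t, a ≤ s → s ≤ t → t ≤ b → |doleans f B s t| ≤ M := by
  obtain ⟨C, hC0, hC⟩ := hB.exists_abs_doleans_sub_one_le hab
  obtain ⟨M, hM0, hM⟩ := hB.1.exists_bound
  obtain ⟨N, hN0, hN⟩ := hB.2.2.1.exists_bound
  refine ⟨C * (2 * M + 2 * N) + 1, by positivity, fun s t hs hst ht => ?_⟩
  have ms : s ∈ Icc a b := ⟨hs, hst.trans ht⟩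
  have mt : t ∈ Icc a b := ⟨hs.trans hst, ht⟩
  have h1 := hC s t hs hst ht
  have h2 : |f t - f s| + |B t - B s| ≤ 2 * M + 2 * N := by
    linarith [abs_sub (f t) (f s), abs_sub (B t) (B s), hM s ms, hM t mt, hN s ms, hN t mt]
  have h3 := mul_le_mul_of_nonneg_left h2 hC0
  have h4 := abs_add_le (doleans f B s t - 1) 1
  rw [sub_add_cancel, abs_one] at h4
  linarith

/-- `E` evolves by the two-parameter Doléans exponential of `f`. -/
def EvolvesBy (a b : ℝ) (f B E : ℝ → ℝ) : Prop :=
  ∀ s t, a ≤ s → s ≤ t → t ≤ b → E t = E s * doleans f B s t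

theorem EvolvesBy.memDualW (hab : a ≤ b) (hp : 1 ≤ p) (hE : EvolvesBy a b f B E)
    (hB : IsBracket lam f f B) (hf : MemDualW a b p f) : MemDualW a b p E := by
  obtain ⟨C, hC0, hC⟩ := hB.exists_abs_doleans_sub_one_le hab
  obtain ⟨M, hM0, hM⟩ := hB.exists_abs_doleans_le hab
  refine hf.of_dominated (hB.monotoneOn.memDualW hp) (C := |E a| * M * C) (by positivity)
    fun s hs t ht hst => ?_
  rw [hE s t hs.1 hst ht.2, show E s * doleans f B s t - E s = E s * (doleans f B s t - 1) by ring,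
    abs_mul, mul_assoc]
  refine mul_le_mul ?_ (hC s t hs.1 hst ht.2) (abs_nonneg _) (by positivity)
  rw [hE a s le_rfl hs.1 hs.2, abs_mul]
  exact mul_le_mul_of_nonneg_left (hM a s le_rfl hs.1 hs.2) (abs_nonneg _)

theorem EvolvesBy.rightJump_eq (hE : EvolvesBy a b f B E) (hB : IsBracket lam f f B)
    (hc : c ∈ Ico a b) : rightJump E c = E c * rightJump f c := by
  refine rightJump_eq_of_tendsto ?_
  have h1 := (hB.tendsto_doleans_right hc).const_mul (E c)
  rw [mul_add, mul_one] at h1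
  refine h1.congr' ?_
  filter_upwards [Ioo_mem_nhdsGT hc.2] with t ht
  exact (hE c t hc.1 ht.1.le ht.2.le).symm

theorem EvolvesBy.leftJump_eq (hE : EvolvesBy a b f B E) (hB : IsBracket lam f f B)
    (hEr : IsRegulated a b E) (hc : c ∈ Ioc a b) :
    leftJump E c = Function.leftLim E c * leftJump f c := by
  have h1 := (hEr.tendsto_leftLim hc).mul (hB.tendsto_doleans_left hc)
  have h2 : Tendsto (fun s => E s * doleans f B s c) (𝓝[<] c) (𝓝 (E c)) := by
    refine tendsto_const_nhds.congr' ?_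
    filter_upwards [Ioo_mem_nhdsLT hc.1] with s hs
    exact hE s c hs.1.le hs.2.le hc.2
  have h3 := tendsto_nhds_unique h1 h2
  rw [leftJump]
  linarith

theorem EvolvesBy.sub_eq (hE : EvolvesBy a b f B E) (hs : a ≤ s) (hst : s ≤ t) (ht : t ≤ b) :
    E t - E s = E s * (f t - f s + doleansRem f B s t) := by
  rw [hE s t hs hst ht, doleansRem]
  ring

theorem IsBracket.tendsto_traceSum_mul_incr_rem (hB : IsBracket lam f f B)
    (hacc : ∀ t ∈ Ioo a b, rightJump f t ≠ 0 → t ∈ lam.allPoints) (hφ : IsRegulated a b φ)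
    (hu : a ≤ u) (huv : u < v) (hv : v ≤ b) :
    Tendsto (fun m => (lam.part m).traceSum u v fun s t =>
      φ s * (doleansRem f B s t * (f t - f s))) atTop (𝓝 0) := by
  obtain ⟨M, -, hM⟩ := hφ.exists_bound
  refine tendsto_traceSum_of_abs_le huv.le (tendsto_traceSum_abs_mul
    (hB.tendsto_traceSum_doleansRem_sq hacc hu huv hv) (hB.eventually_traceSum_sq_le hu huv hv))
    (M := M) fun s t hs hst ht => ?_
  rw [abs_mul]
  exact mul_le_mul_of_nonneg_right (hM s ⟨hu.trans hs, hst.trans (ht.trans hv)⟩) (abs_nonneg _)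

theorem IsBracket.tendsto_traceSum_mul_rem_sq (hB : IsBracket lam f f B)
    (hacc : ∀ t ∈ Ioo a b, rightJump f t ≠ 0 → t ∈ lam.allPoints) (hφ : IsRegulated a b φ)
    (hu : a ≤ u) (huv : u < v) (hv : v ≤ b) :
    Tendsto (fun m => (lam.part m).traceSum u v fun s t =>
      φ s * doleansRem f B s t ^ 2) atTop (𝓝 0) := by
  obtain ⟨M, -, hM⟩ := hφ.exists_bound
  have h1 := hB.tendsto_traceSum_doleansRem_sq hacc hu huv hv
  refine tendsto_traceSum_of_abs_le huv.le (w := fun s t => doleansRem f B s t ^ 2)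
    (by simpa only [abs_pow, sq_abs] using h1) (M := M) fun s t hs hst ht => ?_
  rw [abs_mul]
  exact mul_le_mul_of_nonneg_right (hM s ⟨hu.trans hs, hst.trans (ht.trans hv)⟩) (abs_nonneg _)

/-- With `δE = E(s)(δf + R)`, the square of `δE` is `E(s)²` times `(δf)² + 2Rδf + R²`, and only the
first term survives in the limit. -/
theorem EvolvesBy.isBracket_self (hE : EvolvesBy a b f B E) (hB : IsBracket lam f f B)
    (hacc : ∀ t ∈ Ioo a b, rightJump f t ≠ 0 → t ∈ lam.allPoints)
    (hEr : IsRegulated a b E)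
    (hI : IsYoungPrimitive lam (fun x => E x ^ 2) B I) :
    IsBracket lam E E fun t => I t - I a := by
  have hE2 : IsRegulated a b fun x => E x ^ 2 := by
    simpa only [sq] using hEr.mul hEr
  refine ⟨hEr, hEr, hI.isRegulated.sub_const _, sub_self _, fun u v hu huv hv => ?_, fun t ht => ?_,
    fun t ht => ?_⟩
  · rw [sub_sub_sub_cancel_right]
    have := ((hB.tendsto_traceSum_mul_sq hE2 hI hu huv hv).add
      ((hB.tendsto_traceSum_mul_incr_rem hacc hE2 hu huv hv).const_mul 2)).add
      (hB.tendsto_traceSum_mul_rem_sq hacc hE2 hu huv hv)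
    rw [mul_zero, add_zero, add_zero] at this
    refine this.congr fun m => ?_
    rw [← traceSum_mul, ← traceSum_add, ← traceSum_add]
    refine traceSum_congr huv.le (w' := fun s t => (E t - E s) *
      (E t - E s)) fun s t hs hst ht => ?_
    rw [hE.sub_eq (hu.trans hs) hst (ht.trans hv)]
    ring
  · rw [hI.isRegulated.leftJump_sub_const _ ht, hI.leftJump_eq ht, hE.leftJump_eq hB hEr ht,
      hB.2.2.2.2.2.1 t ht, show Function.leftLim (fun x => E x ^ 2) t =
        Function.leftLim E t * Function.leftLim E t by
          simpa only [sq] using hEr.leftLim_mul hEr ht]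
    ring
  · rw [hI.isRegulated.rightJump_sub_const _ ht, hI.rightJump_eq ht, hE.rightJump_eq hB ht,
      hB.2.2.2.2.2.2 t ht]
    ring

theorem EvolvesBy.isBracket (hE : EvolvesBy a b f B E) (hB : IsBracket lam f f B)
    (hacc : ∀ t ∈ Ioo a b, rightJump f t ≠ 0 → t ∈ lam.allPoints)
    (hEr : IsRegulated a b E)
    (hI : IsYoungPrimitive lam E B I) :
    IsBracket lam f E fun t => I t - I a := by
  refine ⟨hB.1, hEr, hI.isRegulated.sub_const _, sub_self _, fun u v hu huv hv => ?_, fun t ht => ?_,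
    fun t ht => ?_⟩
  · rw [sub_sub_sub_cancel_right]
    have := (hB.tendsto_traceSum_mul_sq hEr hI hu huv hv).add
      (hB.tendsto_traceSum_mul_incr_rem hacc hEr hu huv hv)
    rw [add_zero] at this
    refine this.congr fun m => ?_
    rw [← traceSum_add]
    refine traceSum_congr huv.le (w' := fun s t => (f t - f s) *
      (E t - E s)) fun s t hs hst ht => ?_
    rw [hE.sub_eq (hu.trans hs) hst (ht.trans hv)]
    ring
  · rw [hI.isRegulated.leftJump_sub_const _ ht, hI.leftJump_eq ht, hE.leftJump_eq hB hEr ht,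
      hB.2.2.2.2.2.1 t ht]
    ring
  · rw [hI.isRegulated.rightJump_sub_const _ ht, hI.rightJump_eq ht, hE.rightJump_eq hB ht,
      hB.2.2.2.2.2.2 t ht]
    ring

end Forward

end

noncomputable section

/-! ### The forward Doléans exponential solves the equation -/

section ForwardExistence

variable {a b p : ℝ} {lam : NestedPartitions a b} {f g h B φ I X ψ E : ℝ → ℝ} {s t c u v y : ℝ}

open IntervalPartition

theorem IsYoungPrimitive.sub_const (hI : IsYoungPrimitive lam φ h I) (r : ℝ) :
    IsYoungPrimitive lam φ h fun t => I t - r where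
  ly u v hu huv hv := by
    rw [sub_sub_sub_cancel_right]
    exact hI.ly u v hu huv hv
  lc u v hu huv hv := by
    rw [sub_sub_sub_cancel_right]
    exact hI.lc u v hu huv hv
  left t ht := by
    rw [sub_right_comm]
    exact (hI.left t ht).sub_const r
  right t ht := by
    rw [sub_add_eq_add_sub]
    exact (hI.right t ht).sub_const r

theorem IsYoungPrimitive.congr (hI : IsYoungPrimitive lam φ h I) (hX : EqOn I X (Icc a b)) :
    IsYoungPrimitive lam φ h X where
  ly u v hu huv hv := by
    rw [← hX ⟨hu, huv.le.trans hv⟩, ← hX ⟨hu.trans huv.le, hv⟩]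
    exact hI.ly u v hu huv hv
  lc u v hu huv hv := by
    rw [← hX ⟨hu, huv.le.trans hv⟩, ← hX ⟨hu.trans huv.le, hv⟩]
    exact hI.lc u v hu huv hv
  left t ht := by
    rw [← hX ⟨ht.1.le, ht.2⟩]
    exact (hI.left t ht).congr' (eventuallyEq_nhdsLT hX ht)
  right t ht := by
    rw [← hX ⟨ht.1, ht.2.le⟩]
    exact (hI.right t ht).congr' (eventuallyEq_nhdsGT hX ht)

section DualPairs

theorem sub_eq_of_mem_dualPairs (hgh : (g, h) ∈ dualPairs lam p f) (hs : s ∈ Icc a b)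
    (ht : t ∈ Icc a b) : f t - f s = g t - g s + (h t - h s) := by
  obtain ⟨-, -, -, -, -, -, -, C, hC⟩ := hgh
  rw [hC s hs, hC t ht]
  ring

theorem memDualW_of_mem_dualPairs (hp1 : 1 ≤ p) (hp2 : p < 2) (hgh : (g, h) ∈ dualPairs lam p f) :
    MemDualW a b p f :=
  hgh.2.2.2.1.of_dominated (hgh.2.2.2.2.1.memDualW hp1 hp2) zero_le_one fun s hs t ht _ => by
    rw [sub_eq_of_mem_dualPairs hgh hs ht, one_mul]
    exact abs_add_le _ _

theorem rightJump_of_mem_dualPairs (hgh : (g, h) ∈ dualPairs lam p f) (ht : t ∈ Ico a b) :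
    rightJump f t = rightJump g t + rightJump h t := by
  refine rightJump_eq_of_tendsto ?_
  have h1 := ((hgh.1.tendsto_sub_right ht).add (hgh.2.1.tendsto_sub_right ht)).const_add (f t)
  refine h1.congr' ?_
  filter_upwards [Ioo_mem_nhdsGT ht.2] with s hs
  rw [← sub_eq_of_mem_dualPairs hgh ⟨ht.1, ht.2.le⟩ ⟨ht.1.trans hs.1.le, hs.2.le⟩,
    add_sub_cancel]

theorem leftJump_of_mem_dualPairs (hgh : (g, h) ∈ dualPairs lam p f) (ht : t ∈ Ioc a b) :
    leftJump f t = leftJump g t + leftJump h t := by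
  refine leftJump_eq_of_tendsto ?_
  have h1 := ((hgh.1.tendsto_sub_left ht).add (hgh.2.1.tendsto_sub_left ht)).const_sub (f t)
  refine h1.congr' ?_
  filter_upwards [Ioo_mem_nhdsLT ht.1] with s hs
  rw [← sub_eq_of_mem_dualPairs hgh ⟨hs.1.le, hs.2.le.trans ht.2⟩ ⟨ht.1.le, ht.2⟩, sub_sub_cancel]

theorem accessible_of_mem_dualPairsPlus (hgh : (g, h) ∈ dualPairsPlus lam p f) :
    ∀ t ∈ Ioo a b, rightJump f t ≠ 0 → t ∈ lam.allPoints := fun t ht h0 => by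
  refine hgh.2 t ht ?_
  by_contra hcon
  rw [not_or, not_not, not_not] at hcon
  exact h0 (by rw [rightJump_of_mem_dualPairs hgh.1 ⟨ht.1.le, ht.2⟩, hcon.1, hcon.2, add_zero])

end DualPairs

theorem EvolvesBy.exists_bracket_self (hab : a ≤ b) (hE : EvolvesBy a b f B E)
    (hB : IsBracket lam f f B) (hacc : ∀ t ∈ Ioo a b, rightJump f t ≠ 0 → t ∈ lam.allPoints)
    (hEr : IsRegulated a b E) :
    ∃ X, IsBracket lam E E X ∧ IsYoungPrimitive lam (fun x => E x ^ 2) B X := by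
  have hE2 : IsRegulated a b fun x => E x ^ 2 := by
    simpa only [sq] using hEr.mul hEr
  obtain ⟨I, hI⟩ := exists_isYoungPrimitive_of_monotoneOn hab hE2 hB.monotoneOn
    (hB.rightJump_accessible hacc)
  exact ⟨_, hE.isBracket_self hB hacc hEr hI, hI.sub_const _⟩

theorem EvolvesBy.exists_bracket (hab : a ≤ b) (hE : EvolvesBy a b f B E)
    (hB : IsBracket lam f f B) (hacc : ∀ t ∈ Ioo a b, rightJump f t ≠ 0 → t ∈ lam.allPoints)
    (hEr : IsRegulated a b E) :
    ∃ X, IsBracket lam f E X ∧ IsYoungPrimitive lam E B X := by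
  obtain ⟨I, hI⟩ := exists_isYoungPrimitive_of_monotoneOn hab hEr hB.monotoneOn
    (hB.rightJump_accessible hacc)
  exact ⟨_, hE.isBracket hB hacc hEr hI, hI.sub_const _⟩

/-- The `g`-part of `δf` cancels term by term, leaving `ψ(s)E(s)(δh + R)`. The sums with `δh`
converge to the Left Young integral and those with `R` to zero. -/
theorem EvolvesBy.exists_substitution (hab : a ≤ b) (hp : 1 ≤ p) (hE : EvolvesBy a b f B E)
    (hB : IsBracket lam f f B) (hgh : (g, h) ∈ dualPairsPlus lam p f) (hEd : MemDualW a b p E)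
    (hψ : MemDualW a b p ψ) :
    ∃ I, IsYoungPrimitive lam (fun x => ψ x * E x) h I ∧ ∀ u v, a ≤ u → u < v → v ≤ b →
      Tendsto (fun m => (lam.part m).traceSum u v fun s t =>
        ψ s * (E t - E s) - ψ s * E s * (g t - g s)) atTop (𝓝 (I v - I u)) := by
  have hφ := hψ.mul hEd
  obtain ⟨I, hI⟩ := exists_isYoungPrimitive_of_memDualW (lam := lam) hab hp hφ hgh.1.2.2.2.2.1
    fun t ht h0 => hgh.2 t ht (Or.inr h0)
  refine ⟨I, hI, fun u v hu huv hv => ?_⟩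
  have h1 := (hI.lc u v hu huv hv).add (hB.tendsto_traceSum_mul_doleansRem
    (accessible_of_mem_dualPairsPlus hgh) hφ.isRegulated hu huv hv)
  rw [add_zero] at h1
  refine h1.congr fun m => ?_
  rw [← traceSum_add]
  refine traceSum_congr huv.le fun s t hs hst ht => ?_
  rw [hE.sub_eq (hu.trans hs) hst (ht.trans hv), sub_eq_of_mem_dualPairs hgh.1
    ⟨hu.trans hs, hst.trans (ht.trans hv)⟩ ⟨hu.trans (hs.trans hst), ht.trans hv⟩]
  ring

theorem IsBracket.evolvesBy_doleansForward (hB : IsBracket lam f f B) :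
    EvolvesBy a b f B (doleansForward lam f) := fun s t hs hst ht => by
  rw [hB.doleansForward_eq ⟨hs.trans hst, ht⟩, hB.doleansForward_eq ⟨hs, hst.trans ht⟩,
    hB.doleans_mul_doleans (hs.trans (hst.trans ht)) le_rfl hs hst ht]

theorem isForwardSolution_doleansForward (hab : a ≤ b) (hp1 : 1 ≤ p) (hp2 : p < 2)
    {g₀ h₀ : ℝ → ℝ} (hgh₀ : (g₀, h₀) ∈ dualPairsPlus lam p f) :
    IsForwardSolution lam p f (doleansForward lam f) := by
  have hB := (hasQuadraticVariation_of_mem_dualPairsPlus hab hp1 hp2 hgh₀).isBracket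
  have hE := hB.evolvesBy_doleansForward
  set E := doleansForward lam f
  have hEd := hE.memDualW hab hp1 hB (memDualW_of_mem_dualPairs hp1 hp2 hgh₀.1)
  have hEr := hEd.isRegulated
  have hacc := accessible_of_mem_dualPairsPlus hgh₀
  obtain ⟨X, hX, hXI⟩ := hE.exists_bracket_self hab hB hacc hEr
  obtain ⟨Y, hY, hYI⟩ := hE.exists_bracket hab hB hacc hEr
  refine ⟨hEd, ⟨X, hX⟩, if_pos rfl, fun g h hgh ψ hψ => ?_, fun k l => ?_, fun y hy => ?_⟩
  · obtain ⟨I, hI, hlim⟩ := hE.exists_substitution hab hp1 hB hgh hEd hψ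
    have hφr := (hψ.mul hEd).isRegulated
    refine ⟨fun t => I t - I a, ⟨fun k => ?_, hI.isRegulated.sub_const _, sub_self _,
      fun u v hu huv hv => ?_, fun v hv => ?_, fun u hu => ?_⟩, fun y hy => ?_⟩
    · fin_cases k
      · exact ⟨hEr, fun t ht _ => hψ.isRegulated.1 t ht⟩
      · exact ⟨hgh.1.1, fun t ht _ => (hψ.mul hEd).neg.isRegulated.1 t ht⟩
    · rw [sub_sub_sub_cancel_right]
      refine (hlim u v hu huv hv).congr fun m => ?_
      rw [Fin.sum_univ_two]
      simp only [leftCauchySum, traceSum, Matrix.cons_val_zero, Matrix.cons_val_one,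
        ← Finset.sum_add_distrib]
      exact Finset.sum_congr rfl fun i _ => by ring
    · rw [hI.isRegulated.leftJump_sub_const _ hv, hI.leftJump_eq hv, Fin.sum_univ_two]
      simp only [Matrix.cons_val_zero, Matrix.cons_val_one]
      rw [hE.leftJump_eq hB hEr hv, leftJump_of_mem_dualPairs hgh.1 hv,
        hψ.isRegulated.leftLim_mul hEr hv, leftLim_eq_of_tendsto (f := fun x => -(ψ x * E x))
          (hφr.tendsto_leftLim hv).neg, hψ.isRegulated.leftLim_mul hEr hv]
      ring
    · rw [hI.isRegulated.rightJump_sub_const _ hu, hI.rightJump_eq hu, Fin.sum_univ_two]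
      simp only [Matrix.cons_val_zero, Matrix.cons_val_one]
      rw [hE.rightJump_eq hB hu, rightJump_of_mem_dualPairs hgh.1 hu]
      ring
    · rw [sub_sub_sub_cancel_right]
      exact hI.hasLYIntegral hy
  · fin_cases k <;> fin_cases l
    · exact ⟨X, hX⟩
    · exact ⟨Y, hY.symm⟩
    · exact ⟨Y, hY⟩
    · exact ⟨_, hB⟩
  · rw [hX.eqOn_bracket hy, hY.eqOn_bracket hy, hY.symm.eqOn_bracket hy]
    have h1 := hXI.hasLYIntegral hy
    have h2 := hYI.hasLYIntegral hy
    rw [hX.2.2.2.1, sub_zero] at h1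
    rw [hY.2.2.2.1, sub_zero] at h2
    refine ⟨h1, h2, h2, ?_⟩
    rcases eq_or_lt_of_le hy.1 with rfl | hay
    · exact Or.inl ⟨rfl, hB.2.2.2.1⟩
    · have := hasLYIntegral_of_eq_one hay (isRegulated_const 1)
        (hB.2.2.1.mono le_rfl hy.2) fun x _ => rfl
      rwa [hB.2.2.2.1, sub_zero] at this

end ForwardExistence

/-! ### Uniqueness for the forward equation -/

section ForwardUniqueness

variable {a b p : ℝ} {lam : NestedPartitions a b} {f g h B F X Y φ : ℝ → ℝ} {s t c u v y : ℝ}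

open IntervalPartition

theorem IsRegulated.comp_min (hf : IsRegulated a b f) (y : ℝ) :
    IsRegulated a b fun s => f (min s y) := by
  refine ⟨fun t ht => ?_, fun t ht => ?_⟩
  · rcases le_or_gt t y with h | h
    · obtain ⟨l, hl⟩ := hf.1 t ht
      refine ⟨l, hl.congr' ?_⟩
      filter_upwards [self_mem_nhdsWithin] with s hs
      rw [min_eq_left (le_of_lt (lt_of_lt_of_le hs h))]
    · refine ⟨f y, tendsto_const_nhds.congr' ?_⟩
      filter_upwards [Ioo_mem_nhdsLT h] with s hs
      rw [min_eq_right hs.1.le]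
  · rcases lt_or_ge t y with h | h
    · obtain ⟨l, hl⟩ := hf.2 t ht
      refine ⟨l, hl.congr' ?_⟩
      filter_upwards [Ioo_mem_nhdsGT h] with s hs
      rw [min_eq_left hs.2.le]
    · refine ⟨f y, tendsto_const_nhds.congr' ?_⟩
      filter_upwards [self_mem_nhdsWithin] with s hs
      rw [min_eq_right (h.trans (le_of_lt hs))]

theorem min_mem_Icc (hs : s ∈ Icc a b) (hy : y ∈ Icc a b) : min s y ∈ Icc a b :=
  ⟨le_min hs.1 hy.1, (min_le_left _ _).trans hs.2⟩

theorem MemDualW.comp_min (hf : MemDualW a b p f) (hy : y ∈ Icc a b) :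
    MemDualW a b p fun s => f (min s y) := by
  rcases hf with ⟨h1, hf⟩ | ⟨h1, q, hq, hpq, hf⟩
  · exact Or.inl ⟨h1, hf.comp_min y⟩
  · refine Or.inr ⟨h1, q, hq, hpq, ?_⟩
    obtain ⟨G, hG⟩ := hf.exists_control hq
    exact IsControl.boundedPVariation (F := fun s => G (min s y))
      ⟨fun s hs t ht hst => hG.1 (min_mem_Icc hs hy) (min_mem_Icc ht hy) (min_le_min_right y hst),
        fun s hs t ht hst => hG.2 _ (min_mem_Icc hs hy) _ (min_mem_Icc ht hy)
          (min_le_min_right y hst)⟩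

/-- This is the test function of the uniqueness proof. It is stopped at `y`, so that it is defined
and of the dual class on the whole interval; by the flow property its increments are bounded by
those of `f` and `B`, both stopped. -/
theorem IsBracket.memDualW_doleans_min (hab : a ≤ b) (hp : 1 ≤ p) (hB : IsBracket lam f f B)
    (hf : MemDualW a b p f) (hy : y ∈ Icc a b) :
    MemDualW a b p fun s => doleans f B (min s y) y := by
  obtain ⟨C, hC0, hC⟩ := hB.exists_abs_doleans_sub_one_le hab
  obtain ⟨M, hM0, hM⟩ := hB.exists_abs_doleans_le hab
  refine (hf.comp_min hy).of_dominated ((hB.monotoneOn.memDualW hp).comp_min hy) (C := M * C)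
    (by positivity) fun s hs t ht hst => ?_
  have h1 := min_mem_Icc hs hy
  have h2 := min_mem_Icc ht hy
  have h3 : min s y ≤ min t y := min_le_min_right y hst
  have h4 : min t y ≤ y := min_le_right t y
  rw [← hB.doleans_mul_doleans hab h1.1 h3 h4 hy.2, show doleans f B (min t y) y -
    doleans f B (min s y) (min t y) * doleans f B (min t y) y =
      -(doleans f B (min t y) y * (doleans f B (min s y) (min t y) - 1)) by ring, abs_neg, abs_mul,
    mul_assoc]
  exact mul_le_mul (hM _ _ h2.1 h4 hy.2) (hC _ _ h1.1 h3 h2.2) (abs_nonneg _) hM0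

/-- Under the bracket equations, the increments of `F` are asymptotically `F Δf`. -/
theorem tendsto_traceSum_sub_mul_sq (hB : IsBracket lam f f B) (hX : IsBracket lam F F X)
    (hXI : IsYoungPrimitive lam (fun x => F x ^ 2) B X) (hY : IsBracket lam f F Y)
    (hYI : IsYoungPrimitive lam F B Y) (hu : a ≤ u) (huv : u < v) (hv : v ≤ b) :
    Tendsto (fun m => (lam.part m).traceSum u v fun s t =>
      (F t - F s - F s * (f t - f s)) ^ 2) atTop (𝓝 0) := by
  have hF := hX.1
  have hF2 : IsRegulated a b fun x => F x ^ 2 := by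
    simpa only [sq] using hF.mul hF
  obtain ⟨M, hM0, hM⟩ := hF.exists_bound
  have h1 := tendsto_traceSum_mul_of_regulated lam huv (hF.mono hu hv)
    (w := fun s t => (f t - f s) * (F t - F s) - F s * (f t - f s) ^ 2) (fun t => by simp)
    (fun c hc => ?_) (K := (1 + M) * (B v - B u + 1) + (X v - X u + 1)) ?_ (fun c hc => ?_)
  -- Expansion of the square as `(δF)² - F²(δf)² - 2F(δf δF - F(δf)²)`. The first two terms cancel
  -- in the limit by the equation for `[F]`, the last vanishes by the equation for `[f,F]`.
  · have h2 := ((hX.tendsto hu huv hv).sub (hB.tendsto_traceSum_mul_sq hF2 hXI hu huv hv)).sub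
      (h1.const_mul 2)
    rw [sub_self, mul_zero, sub_zero] at h2
    refine h2.congr fun m => ?_
    rw [← traceSum_minus, ← traceSum_mul, ← traceSum_minus]
    exact traceSum_congr huv.le fun s t _ _ _ => by ring
  · have h3 := (hY.tendsto (hu.trans hc.1) hc.2 hv).sub
      (hB.tendsto_traceSum_mul_sq hF hYI (hu.trans hc.1) hc.2 hv)
    rw [sub_self] at h3
    refine h3.congr fun m => ?_
    rw [← traceSum_minus]
  · filter_upwards [hB.eventually_traceSum_sq_le hu huv hv, hX.eventually_traceSum_sq_le hu huv hv]
      with m h4 h5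
    refine le_trans ?_ (add_le_add (mul_le_mul_of_nonneg_left h4
      (show 0 ≤ 1 + M by positivity)) h5)
    rw [← traceSum_mul, ← traceSum_add]
    refine traceSum_le huv.le fun s t hs hst ht => ?_
    have h6 := hM s ⟨hu.trans hs, hst.trans (ht.trans hv)⟩
    refine (abs_sub _ _).trans ?_
    rw [abs_mul, abs_mul, abs_of_nonneg (sq_nonneg (f t - f s))]
    have h7 := mul_le_mul_of_nonneg_right h6 (sq_nonneg (f t - f s))
    nlinarith [sq_nonneg (|f t - f s| - |F t - F s|), sq_abs (f t - f s), sq_abs (F t - F s),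
      sq_nonneg (f t - f s), sq_nonneg (F t - F s)]
  · have hc' : c ∈ Ico a b := ⟨hu.trans hc.1, hc.2.trans_le hv⟩
    have h3 := ((hB.1.tendsto_sub_right hc').mul (hF.tendsto_sub_right hc')).sub
      (((hB.1.tendsto_sub_right hc').pow 2).const_mul (F c))
    have h4 := hYI.rightJump_eq hc'
    rw [hY.2.2.2.2.2.2 c hc', hB.2.2.2.2.2.2 c hc'] at h4
    rwa [h4, ← sq, sub_self] at h3

/-- A function which satisfies the forward substitution rule for one decomposition and the bracket
equations is the forward Doléans exponential. -/
theorem eq_doleans_of_substitution (hab : a ≤ b) (hp1 : 1 ≤ p) (hp2 : p < 2)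
    (hgh : (g, h) ∈ dualPairsPlus lam p f) (hB : IsBracket lam f f B) (hFd : MemDualW a b p F)
    (hFa : F a = 1) (hX : IsBracket lam F F X)
    (hXI : IsYoungPrimitive lam (fun x => F x ^ 2) B X) (hY : IsBracket lam f F Y)
    (hYI : IsYoungPrimitive lam F B Y)
    (hsub : ∀ ψ, MemDualW a b p ψ → ∀ y ∈ Ioc a b, ∃ L,
      Tendsto (fun m => (lam.part m).traceSum a y fun s t =>
        ψ s * (F t - F s) - ψ s * F s * (g t - g s)) atTop (𝓝 L) ∧
      HasLYIntegral (fun x => ψ x * F x) h a y L) (hy : y ∈ Icc a b) :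
    F y = doleans f B a y := by
  rcases eq_or_lt_of_le hy.1 with rfl | hay
  · rw [hFa, doleans_self]
  have hacc := accessible_of_mem_dualPairsPlus hgh
  have hHd := hB.memDualW_doleans_min hab hp1 (memDualW_of_mem_dualPairs hp1 hp2 hgh.1) hy
  obtain ⟨H, hH⟩ : ∃ H : ℝ → ℝ, H = fun s => doleans f B (min s y) y := ⟨_, rfl⟩
  rw [← hH] at hHd
  have hHle : ∀ s ≤ y, H s = doleans f B s y := fun s hs => by rw [hH]; simp only [min_eq_left hs]
  have hHF := hHd.mul hFd
  obtain ⟨I, hI⟩ := exists_isYoungPrimitive_of_memDualW (lam := lam) hab hp1 hHF hgh.1.2.2.2.2.1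
    fun t ht h0 => hgh.2 t ht (Or.inr h0)
  -- The Left Young integral in the substitution rule is also a limit of Left Cauchy sums, so the
  -- sums of `H(s)(δF - F(s)δg - F(s)δh)` tend to zero.
  obtain ⟨L, hL, hLY⟩ := hsub H hHd y ⟨hay, hy.2⟩
  rw [hLY.unique (hI.ly a y le_rfl hay hy.2)] at hL
  have h1 := hL.sub (hI.lc a y le_rfl hay hy.2)
  rw [sub_self] at h1
  obtain ⟨M, hM0, hM⟩ := hHd.isRegulated.exists_bound
  obtain ⟨N, hN0, hN⟩ := hFd.isRegulated.exists_bound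
  have hstep : ∀ s t, a ≤ s → s ≤ t → t ≤ y → H s = doleans f B s t * H t :=
    fun s t hs hst ht => by
      rw [hHle s (hst.trans ht), hHle t ht, hB.doleans_mul_doleans hab hs hst ht hy.2]
  -- By the flow property `δH = -H(t)(δf + R)`, so the squared increments of `H` have bounded sums;
  -- this is the bounded factor in the Cauchy–Schwarz estimates.
  have hΔH : ∀ s t, a ≤ s → s ≤ t → t ≤ y →
      (H t - H s) ^ 2 ≤ 2 * M ^ 2 * ((f t - f s) ^ 2 + doleansRem f B s t ^ 2) := by
    intro s t hs hst ht
    rw [hstep s t hs hst ht, show H t - doleans f B s t * H t =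
      -(H t * (f t - f s + doleansRem f B s t)) by rw [doleansRem]; ring, neg_sq, mul_pow]
    have h2 : H t ^ 2 ≤ M ^ 2 := by
      rw [← sq_abs]
      exact pow_le_pow_left₀ (abs_nonneg _) (hM t ⟨hs.trans hst, ht.trans hy.2⟩) 2
    have h3 : (f t - f s + doleansRem f B s t) ^ 2 ≤
        2 * ((f t - f s) ^ 2 + doleansRem f B s t ^ 2) := by
      nlinarith [sq_nonneg (f t - f s - doleansRem f B s t)]
    have h4 := mul_le_mul h2 h3 (sq_nonneg _) (sq_nonneg M)
    linarith
  have hR2 := hB.tendsto_traceSum_doleansRem_sq hacc le_rfl hay hy.2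
  obtain ⟨K, hK⟩ : ∃ K, ∀ᶠ m in atTop,
      (lam.part m).traceSum a y (fun s t => (H t - H s) ^ 2) ≤ K := by
    refine ⟨2 * M ^ 2 * (B y - B a + 1 + 1), ?_⟩
    filter_upwards [hB.eventually_traceSum_sq_le le_rfl hay hy.2,
      hR2.eventually (ge_mem_nhds one_pos)] with m h2 h3
    refine le_trans ?_ (mul_le_mul_of_nonneg_left (add_le_add h2 h3) (by positivity))
    rw [← traceSum_add, ← traceSum_mul]
    exact traceSum_le hay.le hΔH
  have h2 := tendsto_traceSum_of_abs
    (tendsto_traceSum_abs_mul (tendsto_traceSum_sub_mul_sq hB hX hXI hY hYI le_rfl hay hy.2) hK)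
  have h3 := hB.tendsto_traceSum_mul_doleansRem hacc hHF.isRegulated le_rfl hay hy.2
  have h4 := tendsto_traceSum_of_abs_le hay.le (tendsto_traceSum_abs_mul hR2 hK) (M := N)
    (w' := fun s t => F s * (doleansRem f B s t * (H t - H s))) fun s t hs hst ht => by
      rw [abs_mul]
      exact mul_le_mul_of_nonneg_right (hN s ⟨hs, hst.trans (ht.trans hy.2)⟩) (abs_nonneg _)
  have h5 := ((h1.add h2).sub h3).sub h4
  simp only [add_zero, sub_zero] at h5
  -- Integration by parts at the level of sums: the increment of `FH` is `HδF + FδH + δFδH`, where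
  -- `FδH = -HFδf - HFR - F(δf + R)δH`. Every group on the right tends to zero, while the left side
  -- does not depend on the partition.
  have h6 : ∀ m, F y * H y - F a * H a =
      (((lam.part m).traceSum a y fun s t => H s * (F t - F s) - H s * F s * (g t - g s)) -
        ((lam.part m).traceSum a y fun s t => H s * F s * (h t - h s)) +
        ((lam.part m).traceSum a y fun s t => (F t - F s - F s * (f t - f s)) * (H t - H s)) -
        (lam.part m).traceSum a y fun s t => H s * F s * doleansRem f B s t) -
        (lam.part m).traceSum a y fun s t => F s * (doleansRem f B s t * (H t - H s)) := by
    intro m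
    rw [← traceSum_minus, ← traceSum_add, ← traceSum_minus, ← traceSum_minus,
      ← traceSum_sub le_rfl hay.le hy.2 (fun s => F s * H s) (κ := lam.part m)]
    refine traceSum_congr hay.le fun s t hs hst ht => ?_
    have e := sub_eq_of_mem_dualPairs hgh.1 (s := s) (t := t) ⟨hs, hst.trans (ht.trans hy.2)⟩
      ⟨hs.trans hst, ht.trans hy.2⟩
    have e2 := hstep s t hs hst ht
    have e3 : doleansRem f B s t = doleans f B s t - 1 - (f t - f s) := rfl
    linear_combination (-(H s * F s)) * e + (-F s) * e2 + (F s * H t) * e3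
  have h7 := tendsto_nhds_unique (tendsto_const_nhds.congr h6) h5
  rw [hHle y le_rfl, doleans_self, hHle a hay.le, hFa] at h7
  linarith

/-- Uniqueness of the Left Young integral identifies the brackets of `F` with primitives obtained
independently; the latter are also limits of Cauchy sums, and in this form the bracket equations are
used. -/
theorem IsForwardSolution.eqOn_doleansForward (hab : a ≤ b) (hp1 : 1 ≤ p) (hp2 : p < 2)
    (hgh : (g, h) ∈ dualPairsPlus lam p f) (hF : IsForwardSolution lam p f F) :
    EqOn F (doleansForward lam f) (Icc a b) := by
  intro y hy
  have hB := (hasQuadraticVariation_of_mem_dualPairsPlus hab hp1 hp2 hgh).isBracket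
  have hacc := hB.rightJump_accessible (accessible_of_mem_dualPairsPlus hgh)
  have hFr := hF.mem_dual.isRegulated
  have hF2 : IsRegulated a b fun x => F x ^ 2 := by
    simpa only [sq] using hFr.mul hFr
  obtain ⟨I, hI⟩ := exists_isYoungPrimitive_of_monotoneOn (lam := lam) hab hF2 hB.monotoneOn hacc
  obtain ⟨J, hJ⟩ := exists_isYoungPrimitive_of_monotoneOn (lam := lam) hab hFr hB.monotoneOn hacc
  rw [hB.doleansForward_eq hy]
  refine eq_doleans_of_substitution hab hp1 hp2 hgh hB hF.mem_dual hF.initial hF.mem_Q.isBracket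
    ((hI.sub_const (I a)).congr fun t ht => (hI.hasLYIntegral ht).unique (hF.bracket_eq t ht).1)
    (HasQuadraticCovariation.isBracket (hF.vector_qv 1 0))
    ((hJ.sub_const (J a)).congr fun t ht => (hJ.hasLYIntegral ht).unique (hF.bracket_eq t ht).2.1)
    (fun ψ hψ z hz => ?_) hy
  obtain ⟨Φ, hΦ, hLY⟩ := hF.substitution g h hgh ψ hψ
  refine ⟨Φ z - Φ a, ?_, hLY z ⟨hz.1.le, hz.2⟩⟩
  refine (hΦ.2.2.2.1 a z le_rfl hz.1 hz.2).congr fun m => ?_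
  rw [Fin.sum_univ_two]
  simp only [leftCauchySum, traceSum, Matrix.cons_val_zero, Matrix.cons_val_one,
    ← Finset.sum_add_distrib]
  exact Finset.sum_congr rfl fun i _ => by ring

end ForwardUniqueness

end

noncomputable section

/-! ### Reversal of the interval -/

section Reversal

variable {a b a' b' p r r' u v u' v' s t : ℝ} {f f₁ f₂ g h k φ B X : ℝ → ℝ}

/-- The function `s ↦ r - f(-s)`. -/
def reverse (r : ℝ) (f : ℝ → ℝ) (s : ℝ) : ℝ := r - f (-s)

theorem reverse_sub_reverse (r : ℝ) (f : ℝ → ℝ) (s t : ℝ) :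
    reverse r f t - reverse r f s = f (-s) - f (-t) := by
  simp [reverse]

theorem reverse_zero_reverse_zero (f : ℝ → ℝ) : reverse 0 (reverse 0 f) = f := by
  ext; simp [reverse]

theorem tendsto_neg_nhdsLT_of (t : ℝ) : Tendsto (fun s : ℝ => -s) (𝓝[<] t) (𝓝[>] (-t)) :=
  tendsto_neg_nhdsLT

theorem tendsto_neg_nhdsGT_of (t : ℝ) : Tendsto (fun s : ℝ => -s) (𝓝[>] t) (𝓝[<] (-t)) :=
  tendsto_neg_nhdsGT

/-- No regularity of `f` is needed: a homeomorphism preserves the existence of limits, and where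
there is none both sides take the value of the function. -/
theorem leftLim_homeomorph_comp_neg (T : ℝ ≃ₜ ℝ) (f : ℝ → ℝ) (t : ℝ) :
    Function.leftLim (fun s => T (f (-s))) t = T (Function.rightLim f (-t)) := by
  by_cases h : ∃ l, Tendsto f (𝓝[>] (-t)) (𝓝 l)
  · obtain ⟨l, hl⟩ := h
    rw [rightLim_eq_of_tendsto hl]
    exact leftLim_eq_of_tendsto ((T.continuous.tendsto l).comp (hl.comp (tendsto_neg_nhdsLT_of t)))
  · rw [rightLim_eq_of_not_tendsto f h, leftLim_eq_of_not_tendsto]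
    rintro ⟨l, hl⟩
    refine h ⟨T.symm l, ?_⟩
    have h1 := tendsto_neg_nhdsGT_of (-t)
    rw [neg_neg] at h1
    refine ((T.symm.continuous.tendsto l).comp (hl.comp h1)).congr fun s => ?_
    simp

theorem rightLim_homeomorph_comp_neg (T : ℝ ≃ₜ ℝ) (f : ℝ → ℝ) (t : ℝ) :
    Function.rightLim (fun s => T (f (-s))) t = T (Function.leftLim f (-t)) := by
  by_cases h : ∃ l, Tendsto f (𝓝[<] (-t)) (𝓝 l)
  · obtain ⟨l, hl⟩ := h
    rw [leftLim_eq_of_tendsto hl]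
    exact rightLim_eq_of_tendsto ((T.continuous.tendsto l).comp (hl.comp (tendsto_neg_nhdsGT_of t)))
  · rw [leftLim_eq_of_not_tendsto f h, rightLim_eq_of_not_tendsto]
    rintro ⟨l, hl⟩
    refine h ⟨T.symm l, ?_⟩
    have h1 := tendsto_neg_nhdsLT_of (-t)
    rw [neg_neg] at h1
    refine ((T.symm.continuous.tendsto l).comp (hl.comp h1)).congr fun s => ?_
    simp

theorem leftLim_comp_neg (f : ℝ → ℝ) (t : ℝ) :
    Function.leftLim (fun s => f (-s)) t = Function.rightLim f (-t) :=
  leftLim_homeomorph_comp_neg (Homeomorph.refl ℝ) f t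

theorem rightLim_comp_neg (f : ℝ → ℝ) (t : ℝ) :
    Function.rightLim (fun s => f (-s)) t = Function.leftLim f (-t) :=
  rightLim_homeomorph_comp_neg (Homeomorph.refl ℝ) f t

theorem leftLim_reverse (r : ℝ) (f : ℝ → ℝ) (t : ℝ) :
    Function.leftLim (reverse r f) t = r - Function.rightLim f (-t) :=
  leftLim_homeomorph_comp_neg (Homeomorph.subLeft r) f t

theorem rightLim_reverse (r : ℝ) (f : ℝ → ℝ) (t : ℝ) :
    Function.rightLim (reverse r f) t = r - Function.leftLim f (-t) :=
  rightLim_homeomorph_comp_neg (Homeomorph.subLeft r) f t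

theorem leftJump_comp_neg (f : ℝ → ℝ) (t : ℝ) :
    leftJump (fun s => f (-s)) t = -rightJump f (-t) := by
  rw [leftJump, leftLim_comp_neg, rightJump, neg_sub]

theorem rightJump_comp_neg (f : ℝ → ℝ) (t : ℝ) :
    rightJump (fun s => f (-s)) t = -leftJump f (-t) := by
  rw [rightJump, rightLim_comp_neg, leftJump, neg_sub]

theorem leftJump_reverse (r : ℝ) (f : ℝ → ℝ) (t : ℝ) :
    leftJump (reverse r f) t = rightJump f (-t) := by
  rw [leftJump, leftLim_reverse, rightJump, reverse, sub_sub_sub_cancel_left]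

theorem rightJump_reverse (r : ℝ) (f : ℝ → ℝ) (t : ℝ) :
    rightJump (reverse r f) t = leftJump f (-t) := by
  rw [rightJump, rightLim_reverse, leftJump, reverse, sub_sub_sub_cancel_left]

theorem IsRegulated.comp_neg (hf : IsRegulated a b f) (ha : a' = -b) (hb : b' = -a) :
    IsRegulated a' b' fun s => f (-s) := by
  subst ha hb
  refine ⟨fun t ht => ?_, fun t ht => ?_⟩
  · obtain ⟨l, hl⟩ := hf.2 (-t) ⟨le_neg.2 ht.2, neg_lt.2 ht.1⟩
    exact ⟨l, hl.comp (tendsto_neg_nhdsLT_of t)⟩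
  · obtain ⟨l, hl⟩ := hf.1 (-t) ⟨lt_neg.2 ht.2, neg_le.2 ht.1⟩
    exact ⟨l, hl.comp (tendsto_neg_nhdsGT_of t)⟩

theorem IsRegulated.reverse (hf : IsRegulated a b f) (r : ℝ) (ha : a' = -b) (hb : b' = -a) :
    IsRegulated a' b' (reverse r f) :=
  (isRegulated_const r).sub (hf.comp_neg ha hb)

/-- The image of a partition under `t ↦ -t`. -/
def IntervalPartition.reflect (κ : IntervalPartition a b) (ha : a' = -b) (hb : b' = -a) :
    IntervalPartition a' b' where
  n := κ.n
  pt i := -κ.pt (κ.n - i)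
  pt_zero := by rw [Nat.sub_zero, κ.pt_last, ha]
  pt_last := by rw [Nat.sub_self, κ.pt_zero, hb]
  pt_lt i hi := by
    have := κ.pt_lt (κ.n - (i + 1)) (by omega)
    rw [show κ.n - (i + 1) + 1 = κ.n - i by omega] at this
    exact neg_lt_neg this

theorem IntervalPartition.mem_points_reflect (κ : IntervalPartition a b) (ha : a' = -b)
    (hb : b' = -a) {x : ℝ} : x ∈ (κ.reflect ha hb).points ↔ -x ∈ κ.points := by
  constructor
  · rintro ⟨i, hi, rfl⟩
    exact ⟨κ.n - i, Nat.sub_le _ _, (neg_neg _).symm⟩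
  · rintro ⟨i, hi, h⟩
    refine ⟨κ.n - i, Nat.sub_le _ _, ?_⟩
    change -κ.pt (κ.n - (κ.n - i)) = x
    rw [Nat.sub_sub_self hi, h, neg_neg]

theorem IntervalPartition.trace_reflect (κ : IntervalPartition a b) (ha : a' = -b)
    (hb : b' = -a) (huv : u ≤ v) (i : ℕ) :
    (κ.reflect ha hb).trace u v i = -κ.trace (-v) (-u) (κ.n - i) := by
  change max (min (-κ.pt (κ.n - i)) v) u = -max (min (κ.pt (κ.n - i)) (-u)) (-v)
  rw [← min_neg_neg, ← max_neg_neg, neg_neg, neg_neg, max_min_distrib_right, max_eq_left huv]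

theorem IntervalPartition.traceSum_reflect (κ : IntervalPartition a b) (ha : a' = -b)
    (hb : b' = -a) (huv : u ≤ v) (w : ℝ → ℝ → ℝ) :
    (κ.reflect ha hb).traceSum u v w = κ.traceSum (-v) (-u) fun s t => w (-t) (-s) := by
  unfold IntervalPartition.traceSum
  rw [← Finset.sum_range_reflect]
  refine Finset.sum_congr rfl fun i hi => ?_
  have hi : i < κ.n := Finset.mem_range.1 hi
  have hn : (κ.reflect ha hb).n = κ.n := rfl
  rw [κ.trace_reflect ha hb huv, κ.trace_reflect ha hb huv, hn,
    show κ.n - (κ.n - 1 - i) = i + 1 by omega, show κ.n - (κ.n - 1 - i + 1) = i by omega]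

theorem BoundedPVariation.comp_neg (hf : BoundedPVariation a b p f) (ha : a' = -b)
    (hb : b' = -a) : BoundedPVariation a' b' p fun s => f (-s) := by
  obtain ⟨K, hK⟩ := hf
  refine ⟨K, fun κ => ?_⟩
  refine le_of_eq_of_le ?_ (hK (κ.reflect (by rw [hb, neg_neg]) (by rw [ha, neg_neg])))
  unfold IntervalPartition.pVariationSum
  rw [← Finset.sum_range_reflect]
  refine Finset.sum_congr rfl fun i hi => ?_
  have hi : i < κ.n := Finset.mem_range.1 hi
  change |f (-κ.pt (κ.n - 1 - i + 1)) - f (-κ.pt (κ.n - 1 - i))| ^ p =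
    |f (-κ.pt (κ.n - (i + 1))) - f (-κ.pt (κ.n - i))| ^ p
  rw [show κ.n - 1 - i + 1 = κ.n - i by omega, show κ.n - 1 - i = κ.n - (i + 1) by omega,
    abs_sub_comm]

theorem MemDualW.comp_neg (hf : MemDualW a b p f) (ha : a' = -b) (hb : b' = -a) :
    MemDualW a' b' p fun s => f (-s) := by
  rcases hf with ⟨h1, hf⟩ | ⟨h1, q, hq, hpq, hf⟩
  · exact Or.inl ⟨h1, hf.comp_neg ha hb⟩
  · exact Or.inr ⟨h1, q, hq, hpq, hf.comp_neg ha hb⟩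

theorem HasRRSIntegral.reflect {J : ℝ} (hk : HasRRSIntegral k g u v J) (r : ℝ) (hu : u' = -v)
    (hv : v' = -u) : HasRRSIntegral (fun s => k (-s)) (_root_.reverse r g) u' v' J := by
  intro ε hε
  obtain ⟨κ₀, hκ₀⟩ := hk ε hε
  refine ⟨κ₀.reflect hu hv, fun κ hκ y hy => ?_⟩
  have hu' : u = -v' := by rw [hv, neg_neg]
  have hv' : v = -u' := by rw [hu, neg_neg]
  have h1 := hκ₀ (κ.reflect hu' hv') (fun x hx => (κ.mem_points_reflect hu' hv').2
    (hκ ((κ₀.mem_points_reflect hu hv).2 (by rwa [neg_neg])))) (fun i => -y (κ.n - 1 - i))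
    fun i hi => by
      have hi : i < κ.n := hi
      have := hy (κ.n - 1 - i) (by omega)
      rw [show κ.n - 1 - i + 1 = κ.n - i by omega, show κ.n - 1 - i = κ.n - (i + 1) by omega]
        at this
      rw [show κ.n - 1 - i = κ.n - (i + 1) by omega]
      exact ⟨neg_le_neg this.2, neg_le_neg this.1⟩
  refine lt_of_eq_of_lt (congrArg (fun z => |z - J|) ?_) h1
  rw [← Finset.sum_range_reflect]
  refine Finset.sum_congr rfl fun i hi => ?_
  have hi : i < κ.n := Finset.mem_range.1 hi
  change k (-y (κ.n - 1 - i)) * (_root_.reverse r g (κ.pt (κ.n - 1 - i + 1)) -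
      _root_.reverse r g (κ.pt (κ.n - 1 - i))) =
    k (-y (κ.n - 1 - i)) * (g (-κ.pt (κ.n - (i + 1))) - g (-κ.pt (κ.n - i)))
  rw [reverse_sub_reverse, show κ.n - 1 - i + 1 = κ.n - i by omega,
    show κ.n - 1 - i = κ.n - (i + 1) by omega]

theorem leftModification_comp_neg (hu : u = -v') (φ : ℝ → ℝ) :
    leftModification u (fun s => φ (-s)) = fun s => rightModification v' φ (-s) := by
  ext s
  by_cases h : s = u
  · rw [h, leftModification_self, show -u = v' by rw [hu, neg_neg], rightModification_self]
  · rw [leftModification, if_neg h, rightModification,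
      if_neg (fun h' => h (by rw [hu, ← h', neg_neg])), leftLim_comp_neg]

theorem rightModification_reverse (hv : v = -u') (r : ℝ) (f : ℝ → ℝ) :
    rightModification v (reverse r f) = reverse r (leftModification u' f) := by
  ext s
  by_cases h : s = v
  · rw [h, rightModification_self, reverse, reverse, show -v = u' by rw [hv, neg_neg],
      leftModification_self]
  · rw [rightModification, if_neg h, reverse, leftModification,
      if_neg (fun h' => h (by rw [hv, ← h', neg_neg])), rightLim_reverse]

theorem hasSum_Ioo_neg {α : ℝ → ℝ} {S : ℝ} :
    HasSum (fun x : Ioo u v => α x) S ↔ HasSum (fun x : Ioo (-v) (-u) => α (-x)) S := by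
  rw [← ((Equiv.neg ℝ).subtypeEquiv (p := (· ∈ Ioo (-v) (-u))) (q := (· ∈ Ioo u v))
    fun x => ⟨fun h => ⟨lt_neg.2 h.2, neg_lt.2 h.1⟩,
      fun h => ⟨neg_lt.2 h.2, lt_neg.2 h.1⟩⟩).hasSum_iff]
  rfl

/-- Reversal exchanges the Left and the Right Young integrals. -/
theorem hasRYIntegral_iff {I : ℝ} (r : ℝ) : HasRYIntegral φ h u v I ↔
    HasLYIntegral (fun s => φ (-s)) (reverse r h) (-v) (-u) I := by
  have hu : u = -(-u) := (neg_neg u).symm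
  have hv : v = -(-v) := (neg_neg v).symm
  unfold HasRYIntegral HasLYIntegral
  refine or_congr (and_congr_left' ⟨fun h => by rw [h], fun h => (neg_injective h).symm⟩) ?_
  refine and_congr neg_lt_neg_iff.symm (and_congr ⟨fun h => h.comp_neg rfl rfl, fun h => ?_⟩
    (and_congr ⟨fun h => h.reverse r rfl rfl, fun h => ?_⟩ ?_))
  · simpa using h.comp_neg hu hv
  · have := h.reverse r hu hv
    refine this.congr fun x _ => ?_
    simp [reverse]
  rw [leftModification_comp_neg rfl, rightModification_reverse rfl]
  constructor
  -- Composition with `s ↦ -s` turns a right jump of `φ` into minus a left jump, whereas `reverse`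
  -- preserves the sign of the jumps of `h`. So the jump sum changes its sign, in accordance with
  -- the minus sign in the Right Young integral.
  · rintro ⟨J, S, hJ, hS, rfl⟩
    refine ⟨J, -S, hJ.reflect r rfl rfl, ?_, ?_⟩
    · rw [hasSum_Ioo_neg (α := fun x => rightJump φ x * leftJump h x)] at hS
      refine hS.neg.congr_fun fun x => ?_
      rw [leftJump_comp_neg, rightJump_reverse, neg_mul]
    · simp only [rightJump_reverse, neg_neg]
      ring
  · rintro ⟨J, S, hJ, hS, rfl⟩
    refine ⟨J, -S, ?_, ?_, ?_⟩
    · have := hJ.reflect r hu hv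
      have e1 : (fun s => (fun s => rightModification v φ (-s)) (-s)) = rightModification v φ := by
        ext s; simp
      have e2 : reverse r (reverse r (leftModification u h)) = leftModification u h := by
        ext s; simp [reverse]
      rwa [e1, e2] at this
    · rw [hasSum_Ioo_neg (α := fun x => rightJump φ x * leftJump h x)]
      refine hS.neg.congr_fun fun x => ?_
      rw [leftJump_comp_neg, rightJump_reverse, neg_mul, neg_neg]
    · simp only [rightJump_reverse, neg_neg]
      ring

/-- `lam'` is the image of `lam` under `t ↦ -t`. -/
structure IsReversal (lam : NestedPartitions a b) (lam' : NestedPartitions a' b') : Prop where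
  left_eq : a' = -b
  right_eq : b' = -a
  traceSum_eq : ∀ m u v, u ≤ v → ∀ w : ℝ → ℝ → ℝ, (lam'.part m).traceSum u v w =
    (lam.part m).traceSum (-v) (-u) fun s t => w (-t) (-s)
  mem_allPoints : ∀ x, x ∈ lam'.allPoints ↔ -x ∈ lam.allPoints

theorem NestedPartitions.exists_isReversal (lam : NestedPartitions a b) :
    ∃ lam' : NestedPartitions (-b) (-a), IsReversal lam lam' := by
  have hmem : ∀ x, x ∈ ⋃ m, ((lam.part m).reflect (a' := -b) (b' := -a) rfl rfl).points ↔
      -x ∈ ⋃ m, (lam.part m).points := fun x => by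
    simp only [mem_iUnion, IntervalPartition.mem_points_reflect]
  refine ⟨⟨fun m => (lam.part m).reflect rfl rfl, fun m x hx => ?_, fun x hx => ?_⟩, rfl, rfl,
    fun m u v huv w => (lam.part m).traceSum_reflect rfl rfl huv w, hmem⟩
  · rw [IntervalPartition.mem_points_reflect] at hx ⊢
    exact lam.nested m hx
  · have h1 := lam.dense (show -x ∈ Icc a b from ⟨le_neg.2 hx.2, neg_le.2 hx.1⟩)
    have h2 : (⋃ m, ((lam.part m).reflect (a' := -b) (b' := -a) rfl rfl).points) =
        (Homeomorph.neg ℝ) ⁻¹' ⋃ m, (lam.part m).points := by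
      ext x; exact hmem x
    rw [h2, ← (Homeomorph.neg ℝ).preimage_closure]
    exact h1

variable {lam : NestedPartitions a b} {lam' : NestedPartitions a' b'}

theorem IsReversal.symm (hl : IsReversal lam lam') : IsReversal lam' lam where
  left_eq := by rw [hl.right_eq, neg_neg]
  right_eq := by rw [hl.left_eq, neg_neg]
  traceSum_eq m u v huv w := by
    rw [hl.traceSum_eq m _ _ (neg_le_neg huv), neg_neg, neg_neg]
    simp only [neg_neg]
  mem_allPoints x := by rw [hl.mem_allPoints, neg_neg]

theorem IsReversal.neg_mem_Icc (hl : IsReversal lam lam') (ht : t ∈ Icc a' b') : -t ∈ Icc a b := by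
  rw [hl.left_eq, hl.right_eq] at ht
  exact ⟨le_neg.2 ht.2, neg_le.2 ht.1⟩

theorem IsReversal.neg_mem_Ioc (hl : IsReversal lam lam') (ht : t ∈ Ico a' b') : -t ∈ Ioc a b := by
  rw [hl.left_eq, hl.right_eq] at ht
  exact ⟨lt_neg.2 ht.2, neg_le.2 ht.1⟩

theorem IsReversal.neg_mem_Ico (hl : IsReversal lam lam') (ht : t ∈ Ioc a' b') : -t ∈ Ico a b := by
  rw [hl.left_eq, hl.right_eq] at ht
  exact ⟨le_neg.2 ht.2, neg_lt.2 ht.1⟩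

theorem IsReversal.neg_mem_Ioo (hl : IsReversal lam lam') (ht : t ∈ Ioo a' b') : -t ∈ Ioo a b := by
  rw [hl.left_eq, hl.right_eq] at ht
  exact ⟨lt_neg.2 ht.2, neg_lt.2 ht.1⟩

theorem IsBracket.reverse (hB : IsBracket lam f₁ f₂ B) (hl : IsReversal lam lam') (r₁ r₂ : ℝ) :
    IsBracket lam' (_root_.reverse r₁ f₁) (_root_.reverse r₂ f₂) (_root_.reverse (B b) B) := by
  refine ⟨hB.1.reverse _ hl.left_eq hl.right_eq, hB.2.1.reverse _ hl.left_eq hl.right_eq,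
    hB.2.2.1.reverse _ hl.left_eq hl.right_eq, by simp [_root_.reverse, hl.left_eq],
    fun s t hs hst ht => ?_, fun t ht => ?_, fun t ht => ?_⟩
  · rw [reverse_sub_reverse]
    refine (hB.tendsto (hl.neg_mem_Icc ⟨hs.trans hst.le, ht⟩).1 (neg_lt_neg hst)
      (hl.neg_mem_Icc ⟨hs, hst.le.trans ht⟩).2).congr fun m => ?_
    refine Eq.trans ?_ (hl.traceSum_eq m s t hst.le fun s t =>
      (_root_.reverse r₁ f₁ t - _root_.reverse r₁ f₁ s) *
        (_root_.reverse r₂ f₂ t - _root_.reverse r₂ f₂ s)).symm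
    simp only [reverse_sub_reverse, neg_neg]
  · rw [leftJump_reverse, leftJump_reverse, leftJump_reverse,
      hB.2.2.2.2.2.2 _ (hl.neg_mem_Ico ht)]
  · rw [rightJump_reverse, rightJump_reverse, rightJump_reverse,
      hB.2.2.2.2.2.1 _ (hl.neg_mem_Ioc ht)]

theorem IsBracket.neg_left (hB : IsBracket lam f₁ f₂ B) :
    IsBracket lam (fun s => -f₁ s) f₂ fun s => -B s := by
  have hn : ∀ {f : ℝ → ℝ}, IsRegulated a b f → IsRegulated a b fun s => -f s := fun hf => by
    exact ((isRegulated_const 0).sub hf).congr fun x _ => by simp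
  refine ⟨hn hB.1, hB.2.1, hn hB.2.2.1, by simp [hB.2.2.2.1], fun s t hs hst ht => ?_,
    fun t ht => ?_, fun t ht => ?_⟩
  · have := (hB.tendsto hs hst ht).neg
    rw [neg_sub, ← neg_sub_neg] at this
    refine this.congr fun m => ?_
    rw [← IntervalPartition.traceSum_neg]
    exact Finset.sum_congr rfl fun i _ => by ring
  · have h1 := hB.2.2.2.2.2.1 t ht
    simp only [leftJump] at h1 ⊢
    rw [leftLim_eq_of_tendsto (hB.2.2.1.tendsto_leftLim ht).neg,
      leftLim_eq_of_tendsto (hB.1.tendsto_leftLim ht).neg]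
    linear_combination -h1
  · have h1 := hB.2.2.2.2.2.2 t ht
    simp only [rightJump] at h1 ⊢
    rw [rightLim_eq_of_tendsto (hB.2.2.1.tendsto_rightLim ht).neg,
      rightLim_eq_of_tendsto (hB.1.tendsto_rightLim ht).neg]
    linear_combination -h1

theorem neg_reverse_zero (f : ℝ → ℝ) : (fun s => -reverse 0 f s) = fun s => f (-s) := by
  ext; simp [reverse]

/-- The integrator is reversed but the solution is only reflected, and this costs a sign in their
mutual bracket: the origin of `-G` in the backward bracket equation. -/
theorem IsBracket.reverse_comp_neg (hB : IsBracket lam f₁ f₂ B) (hl : IsReversal lam lam')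
    (r : ℝ) : IsBracket lam' (_root_.reverse r f₁) (fun s => f₂ (-s))
      fun s => -_root_.reverse (B b) B s := by
  have := (hB.reverse hl r 0).symm.neg_left.symm
  rwa [neg_reverse_zero] at this

theorem IsBracket.comp_neg (hB : IsBracket lam f₁ f₂ B) (hl : IsReversal lam lam') :
    IsBracket lam' (fun s => f₁ (-s)) (fun s => f₂ (-s)) (_root_.reverse (B b) B) := by
  have := (hB.reverse_comp_neg hl 0).neg_left
  rw [neg_reverse_zero] at this
  simpa using this

/-- The reflection of the jump indices. -/
def jumpReflect : ℝ ⊕ ℝ ≃ ℝ ⊕ ℝ :=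
  (Equiv.sumComm ℝ ℝ).trans ((Equiv.neg ℝ).sumCongr (Equiv.neg ℝ))

theorem jumps_reverse (r : ℝ) (f : ℝ → ℝ) (i : ℝ ⊕ ℝ) :
    jumps (reverse r f) i = jumps f (jumpReflect i) := by
  rcases i with x | x
  exacts [leftJump_reverse r f x, rightJump_reverse r f x]

theorem jumpReflect_mem_jumpSet (s t : ℝ) (i : ℝ ⊕ ℝ) :
    jumpReflect i ∈ jumpSet (-t) (-s) ↔ i ∈ jumpSet s t := by
  rcases i with x | x
  · exact ⟨fun h => ⟨neg_lt_neg_iff.1 h.2, neg_le_neg_iff.1 h.1⟩,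
      fun h => ⟨neg_le_neg h.2, neg_lt_neg h.1⟩⟩
  · exact ⟨fun h => ⟨neg_le_neg_iff.1 h.2, neg_lt_neg_iff.1 h.1⟩,
      fun h => ⟨neg_lt_neg h.2, neg_le_neg h.1⟩⟩

theorem indicator_jumpReflect (α : ℝ ⊕ ℝ → ℝ) (s t : ℝ) (i : ℝ ⊕ ℝ) :
    (jumpSet s t).indicator (fun i => α (jumpReflect i)) i =
      (jumpSet (-t) (-s)).indicator α (jumpReflect i) := by
  by_cases h : i ∈ jumpSet s t
  · rw [indicator_of_mem h, indicator_of_mem ((jumpReflect_mem_jumpSet s t i).2 h)]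
  · rw [indicator_of_notMem h, indicator_of_notMem (mt (jumpReflect_mem_jumpSet s t i).1 h)]

/-- Reversal keeps increments and jumps and only permutes the jump indices, so sums and products are
merely reindexed. -/
theorem doleans_reverse (r r' : ℝ) (f B : ℝ → ℝ) (s t : ℝ) :
    doleans (reverse r f) (reverse r' B) s t = doleans f B (-t) (-s) := by
  unfold doleans jumpSum jumpProd
  simp only [reverse_sub_reverse, jumps_reverse]
  rw [← jumpReflect.tsum_eq ((jumpSet (-t) (-s)).indicator fun i => jumps f i ^ 2),
    ← jumpReflect.tprod_eq fun i => 1 + (jumpSet (-t) (-s)).indicator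
      (fun i => jumpFactor (jumps f i) - 1) i]
  congr 3
  · congr 2
    exact tsum_congr fun i => indicator_jumpReflect (fun i => jumps f i ^ 2) s t i
  · ext i
    rw [indicator_jumpReflect (fun i => jumpFactor (jumps f i) - 1)]

/-- Left discontinuities become right discontinuities. The constants `g b` and `h b` restore the
normalisation at the new left end point `-b`. -/
theorem reverse_mem_dualPairsPlus (hl : IsReversal lam lam')
    (hgh : (g, h) ∈ dualPairsMinus lam p f) (r : ℝ) :
    (reverse (g b) g, reverse (h b) h) ∈ dualPairsPlus lam' p (reverse r f) := by
  obtain ⟨⟨hg, hh, ⟨Bg, hBg⟩, hgd, hhp, hga, hha, C, hC⟩, hacc⟩ := hgh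
  have ea : a' = -b := hl.left_eq
  have eb : b' = -a := hl.right_eq
  refine ⟨⟨hg.reverse _ ea eb, hh.reverse _ ea eb, ⟨_, hBg.reverse hl _ _⟩, ?_, ?_,
    by simp [reverse, ea], by simp [reverse, ea], r - C - g b - h b, fun t ht => ?_⟩,
    fun t ht ht' => ?_⟩
  · refine (hgd.comp_neg ea eb).of_dominated (hgd.comp_neg ea eb) zero_le_one
      fun s _ t _ _ => ?_
    rw [reverse_sub_reverse, abs_sub_comm]
    linarith [abs_nonneg (g (-t) - g (-s))]
  · obtain ⟨K, hK⟩ := hhp.comp_neg ea eb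
    refine ⟨K, fun κ => le_of_eq_of_le (Finset.sum_congr rfl fun i _ => ?_) (hK κ)⟩
    rw [reverse_sub_reverse, abs_sub_comm]
  · simp only [reverse]
    rw [hC _ (hl.neg_mem_Icc ht)]
    ring
  · rw [hl.mem_allPoints]
    exact hacc (-t) (hl.neg_mem_Ioo ht) (by simpa only [rightJump_reverse] using ht')

end Reversal

end

noncomputable section

/-! ### The backward equation, by reversal -/

section Backward

variable {a b a' b' p r u v s t y : ℝ} {lam : NestedPartitions a b}
  {lam' : NestedPartitions a' b'} {f g h φ B G I X : ℝ → ℝ}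

open IntervalPartition

theorem IsYoungPrimitive.hasRYIntegral
    (hI : IsYoungPrimitive lam' (fun s => φ (-s)) (reverse r h) I) (hl : IsReversal lam lam')
    (hu : a ≤ u) (huv : u ≤ v) (hv : v ≤ b) : HasRYIntegral φ h u v (I (-u) - I (-v)) := by
  rcases eq_or_lt_of_le huv with rfl | h'
  · exact Or.inl ⟨rfl, sub_self _⟩
  · exact (hasRYIntegral_iff r).2 (hI.ly (-v) (-u) (hl.left_eq ▸ neg_le_neg hv) (neg_lt_neg h')
      (hl.right_eq ▸ neg_le_neg hu))

theorem HasRYIntegral.unique {J J' : ℝ} (h₁ : HasRYIntegral φ h u v J)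
    (h₂ : HasRYIntegral φ h u v J') : J = J' :=
  ((hasRYIntegral_iff 0).1 h₁).unique ((hasRYIntegral_iff 0).1 h₂)

theorem HasRYIntegral.neg {J : ℝ} (h₁ : HasRYIntegral φ h u v J) :
    HasRYIntegral (fun x => -φ x) h u v (-J) := by
  have := ((hasRYIntegral_iff 0).1 h₁).smul (-1)
  rw [neg_one_mul, neg_one_smul] at this
  exact (hasRYIntegral_iff 0).2 this

theorem hasRYIntegral_one (huv : u ≤ v) (hh : IsRegulated u v h) :
    HasRYIntegral (fun _ => 1) h u v (h v - h u) := by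
  rcases eq_or_lt_of_le huv with rfl | h'
  · exact Or.inl ⟨rfl, sub_self _⟩
  · have := hasLYIntegral_of_eq_one (neg_lt_neg h') (isRegulated_const 1)
      (hh.reverse 0 rfl rfl) fun x _ => rfl
    rw [reverse_sub_reverse, neg_neg, neg_neg] at this
    exact (hasRYIntegral_iff 0).2 this

theorem hasQuadraticVariation_of_mem_dualPairsMinus (hab : a ≤ b) (hp1 : 1 ≤ p) (hp2 : p < 2)
    (hgh : (g, h) ∈ dualPairsMinus lam p f) : HasQuadraticVariation lam f := by
  obtain ⟨lam', hl⟩ := lam.exists_isReversal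
  obtain ⟨B, hB⟩ := hasQuadraticVariation_of_mem_dualPairsPlus (neg_le_neg hab) hp1 hp2
    (reverse_mem_dualPairsPlus hl hgh 0)
  have := hB.reverse hl.symm 0 0
  rw [reverse_zero_reverse_zero] at this
  exact ⟨_, this⟩

/-- After reflection the flow property is that of the forward equation: going from `s` to `t`
extends the interval `[-s,b]` to `[-t,b]`. -/
theorem IsBracket.evolvesBy_doleansBackward (hB : IsBracket lam f f B)
    (hl : IsReversal lam lam') (r r' : ℝ) :
    EvolvesBy a' b' (_root_.reverse r f) (_root_.reverse r' B) fun s => doleansBackward lam f (-s) := by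
  intro s t hs hst ht
  have h1 := hl.neg_mem_Icc ⟨hs, hst.trans ht⟩
  have h2 := hl.neg_mem_Icc ⟨hs.trans hst, ht⟩
  dsimp only
  rw [hB.doleansBackward_eq h1, hB.doleansBackward_eq h2, doleans_reverse, mul_comm,
    hB.doleans_mul_doleans (h1.1.trans h1.2) h2.1 (neg_le_neg hst) h1.2 le_rfl]

theorem leftJump_eq_of_evolvesBy_comp_neg (hl : IsReversal lam lam')
    (hB : IsBracket lam' (reverse r f) (reverse r f) B)
    (hG : EvolvesBy a' b' (reverse r f) B fun s => G (-s)) (ht : t ∈ Ioc a b) :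
    leftJump G t = -(G t * leftJump f t) := by
  have h1 := hG.rightJump_eq hB (hl.symm.neg_mem_Ico ht)
  rw [rightJump_comp_neg, rightJump_reverse, neg_neg] at h1
  linarith

theorem rightJump_eq_of_evolvesBy_comp_neg (hl : IsReversal lam lam')
    (hB : IsBracket lam' (reverse r f) (reverse r f) B)
    (hG : EvolvesBy a' b' (reverse r f) B fun s => G (-s))
    (hGr : IsRegulated a' b' fun s => G (-s)) (ht : t ∈ Ico a b) :
    rightJump G t = -(Function.rightLim G t * rightJump f t) := by
  have h1 := hG.leftJump_eq hB hGr (hl.symm.neg_mem_Ioc ht)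
  rw [leftJump_comp_neg, leftJump_reverse, leftLim_comp_neg, neg_neg] at h1
  linarith

theorem isBackwardSolution_doleansBackward (hab : a ≤ b) (hp1 : 1 ≤ p) (hp2 : p < 2)
    {g₀ h₀ : ℝ → ℝ} (hgh₀ : (g₀, h₀) ∈ dualPairsMinus lam p f) :
    IsBackwardSolution lam p f (doleansBackward lam f) := by
  have hB := (hasQuadraticVariation_of_mem_dualPairsMinus hab hp1 hp2 hgh₀).isBracket
  obtain ⟨lam', hl⟩ := lam.exists_isReversal
  have hab' : -b ≤ -a := neg_le_neg hab
  have ha : a = -(-a) := (neg_neg a).symm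
  have hb : b = -(-b) := (neg_neg b).symm
  have hgh₀' := reverse_mem_dualPairsPlus hl hgh₀ 0
  have hacc := accessible_of_mem_dualPairsPlus hgh₀'
  have hB' := hB.reverse hl 0 0
  have hE := hB.evolvesBy_doleansBackward hl 0 (bracket lam f f b)
  set E := doleansBackward lam f
  have hFd := hE.memDualW hab' hp1 hB' (memDualW_of_mem_dualPairs hp1 hp2 hgh₀'.1)
  have hEd : MemDualW a b p E := by simpa only [neg_neg] using hFd.comp_neg ha hb
  have hEr := hEd.isRegulated
  obtain ⟨X, hX, hXI⟩ := hE.exists_bracket_self hab' hB' hacc hFd.isRegulated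
  obtain ⟨Y, hY, hYI⟩ := hE.exists_bracket hab' hB' hacc hFd.isRegulated
  have hX' : IsBracket lam E E (reverse (X (-a)) X) := by simpa only [neg_neg] using hX.comp_neg hl.symm
  have hY' : IsBracket lam f E fun s => -reverse (Y (-a)) Y s := by
    simpa only [neg_neg, reverse_zero_reverse_zero] using hY.reverse_comp_neg hl.symm 0
  refine ⟨hEd, ⟨_, hX'⟩, if_pos rfl, fun g h hgh ψ hψ => ?_, fun k l => ?_, fun y hy => ?_⟩
  · have hψ' := hψ.comp_neg (a' := -b) (b' := -a) rfl rfl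
    obtain ⟨I, hI, hlim⟩ := hE.exists_substitution hab' hp1 hB'
      (reverse_mem_dualPairsPlus hl hgh 0) hFd hψ'
    have hIr := hI.isRegulated.comp_neg ha hb
    have hφ := hψ.mul hEd
    refine ⟨fun t => I (-t) - I (-a), ⟨fun k => ?_, hIr.sub_const _, sub_self _,
      fun u v hu huv hv => ?_, fun v hv => ?_, fun u hu => ?_⟩, fun y hy => ?_⟩
    · fin_cases k
      · exact ⟨hEr, fun t ht _ => hψ.isRegulated.2 t ht⟩
      · exact ⟨hgh.1.1, fun t ht _ => hφ.isRegulated.2 t ht⟩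
    · have := (hlim (-v) (-u) (neg_le_neg hv) (neg_lt_neg huv) (neg_le_neg hu)).neg
      rw [sub_sub_sub_cancel_right, ← neg_sub]
      refine this.congr fun m => ?_
      rw [← traceSum_neg]
      -- Under reflection the left end points of the forward sums become right end points, and
      -- increments of `E` change sign while those of the reversed `g` do not. The difference in the
      -- forward rule thus becomes a sum.
      refine Eq.trans ?_ (((hl.symm.traceSum_eq m u v huv.le fun s t =>
        ψ t * (E t - E s) + ψ t * E t * (g t - g s)).symm).trans ?_)
      · refine Finset.sum_congr rfl fun i _ => ?_
        simp only [reverse_sub_reverse]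
        ring
      · rw [Fin.sum_univ_two]
        simp only [rightCauchySum, traceSum, Matrix.cons_val_zero, Matrix.cons_val_one,
          ← Finset.sum_add_distrib]
    · rw [hIr.leftJump_sub_const _ hv, leftJump_comp_neg, hI.rightJump_eq (hl.symm.neg_mem_Ico hv),
        rightJump_reverse, Fin.sum_univ_two]
      simp only [Matrix.cons_val_zero, Matrix.cons_val_one, neg_neg]
      rw [leftJump_eq_of_evolvesBy_comp_neg hl hB' hE hv, leftJump_of_mem_dualPairs hgh.1 hv]
      ring
    · rw [hIr.rightJump_sub_const _ hu, rightJump_comp_neg, hI.leftJump_eq (hl.symm.neg_mem_Ioc hu),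
        leftLim_comp_neg fun s => ψ s * E s, leftJump_reverse, Fin.sum_univ_two]
      simp only [Matrix.cons_val_zero, Matrix.cons_val_one, neg_neg]
      rw [rightJump_eq_of_evolvesBy_comp_neg hl hB' hE hFd.isRegulated hu,
        rightJump_of_mem_dualPairs hgh.1 hu, rightLim_eq_of_tendsto
          ((hψ.isRegulated.tendsto_rightLim hu).mul (hEr.tendsto_rightLim hu))]
      ring
    · rw [sub_sub_sub_cancel_right, neg_sub]
      exact hI.hasRYIntegral hl hy.1 hy.2 le_rfl
  · fin_cases k <;> fin_cases l
    · exact ⟨_, hX'⟩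
    · exact ⟨_, hY'.symm⟩
    · exact ⟨_, hY'⟩
    · exact ⟨_, hB⟩
  · rw [hX'.eqOn_bracket hy, hY'.eqOn_bracket hy, hY'.symm.eqOn_bracket hy]
    have h2 := (hYI.hasRYIntegral hl le_rfl hy.1 hy.2).neg
    refine ⟨hXI.hasRYIntegral hl le_rfl hy.1 hy.2, h2, h2, ?_⟩
    have := hasRYIntegral_one hy.1 (hB.2.2.1.mono le_rfl hy.2)
    rwa [hB.2.2.2.1, sub_zero] at this

theorem IsBackwardSolution.eqOn_doleansBackward (hab : a ≤ b) (hp1 : 1 ≤ p) (hp2 : p < 2)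
    (hgh : (g, h) ∈ dualPairsMinus lam p f) (hG : IsBackwardSolution lam p f G) :
    EqOn G (doleansBackward lam f) (Icc a b) := by
  have hB := (hasQuadraticVariation_of_mem_dualPairsMinus hab hp1 hp2 hgh).isBracket
  obtain ⟨lam', hl⟩ := lam.exists_isReversal
  have hab' : -b ≤ -a := neg_le_neg hab
  have hgh' := reverse_mem_dualPairsPlus hl hgh 0
  have hB' := hB.reverse hl 0 0
  have hacc := hB'.rightJump_accessible (accessible_of_mem_dualPairsPlus hgh')
  have hFd := hG.mem_dual.comp_neg (a' := -b) (b' := -a) rfl rfl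
  have hX := hG.mem_Q.isBracket
  have hY : IsBracket lam f G (bracket lam f G) :=
    HasQuadraticCovariation.isBracket (hG.vector_qv 1 0)
  obtain ⟨J, hJ⟩ := exists_isYoungPrimitive_of_monotoneOn hab' (φ := fun s => G (-s) ^ 2)
    (by simpa only [sq] using hFd.isRegulated.mul hFd.isRegulated) hB'.monotoneOn hacc
  obtain ⟨K, hK⟩ := exists_isYoungPrimitive_of_monotoneOn hab' hFd.isRegulated hB'.monotoneOn hacc
  -- The Right Young integrals in the bracket equations are increments of primitives on the reversed
  -- interval, with the orientation reversed.
  have hXJ : ∀ t ∈ Icc a b, bracket lam G G t = J (-a) - J (-t) := fun t ht =>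
    (hG.bracket_eq t ht).1.unique
      (IsYoungPrimitive.hasRYIntegral (φ := fun s => G s ^ 2) hJ hl le_rfl ht.1 ht.2)
  have hYK : ∀ t ∈ Icc a b, bracket lam f G t = -(K (-a) - K (-t)) := fun t ht =>
    (hG.bracket_eq t ht).2.1.unique (hK.hasRYIntegral hl le_rfl ht.1 ht.2).neg
  have hbb := right_mem_Icc.2 hab
  intro y hy
  have key := eq_doleans_of_substitution hab' hp1 hp2 hgh' hB' hFd
    (by rw [neg_neg, hG.terminal]) (hX.comp_neg hl)
    ((hJ.sub_const (J (-b))).congr fun s hs => ?_) (hY.reverse_comp_neg hl 0)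
    ((hK.sub_const (K (-b))).congr fun s hs => ?_) (fun ψ hψ s hs => ?_) (hl.symm.neg_mem_Icc hy)
  · rw [neg_neg, doleans_reverse, neg_neg, neg_neg] at key
    rw [key, hB.doleansBackward_eq hy]
  · rw [reverse, hXJ b hbb, hXJ _ (hl.neg_mem_Icc hs), neg_neg]
    ring
  · rw [reverse, hYK b hbb, hYK _ (hl.neg_mem_Icc hs), neg_neg]
    ring
  · have hψ' := hψ.comp_neg (a' := a) (b' := b) (neg_neg a).symm (neg_neg b).symm
    obtain ⟨Ψ, hΨ, hRY⟩ := hG.substitution g h hgh _ hψ'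
    have hs' := hl.neg_mem_Ico hs
    have h1 := (hΨ.2.2.2.1 (-s) b hs'.1 hs'.2 le_rfl).neg
    -- The additive constant is immaterial for the integral; with `h b` the integrator is the second
    -- component of the reversed pair.
    have h2 := (hasRYIntegral_iff (h b)).1 (hRY (-s) ⟨hs'.1, hs'.2.le⟩)
    rw [neg_neg] at h2
    refine ⟨_, h1.congr fun m => ?_, by simpa only [neg_neg] using h2⟩
    rw [hl.traceSum_eq m _ _ hs.1.le, neg_neg, Fin.sum_univ_two]
    simp only [rightCauchySum, traceSum, Matrix.cons_val_zero, Matrix.cons_val_one,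
      ← Finset.sum_add_distrib, ← Finset.sum_neg_distrib, reverse_sub_reverse, neg_neg]
    exact Finset.sum_congr rfl fun i _ => by ring

end Backward

theorem mainTheorem5 (a b : ℝ) (hab : a < b) (lam : NestedPartitions a b)
    (p : ℝ) (hp1 : 1 ≤ p) (hp2 : p < 2) (f : ℝ → ℝ) (hf : IsDecomposable lam p f) :
    ((dualPairsPlus lam p f).Nonempty →
      DoleansDefined lam f ∧
      IsForwardSolution lam p f (doleansForward lam f) ∧
      ∀ F : ℝ → ℝ, IsForwardSolution lam p f F → EqOn F (doleansForward lam f) (Icc a b)) ∧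
    ((dualPairsMinus lam p f).Nonempty →
      DoleansDefined lam f ∧
      IsBackwardSolution lam p f (doleansBackward lam f) ∧
      ∀ G : ℝ → ℝ, IsBackwardSolution lam p f G → EqOn G (doleansBackward lam f) (Icc a b)) := by
  refine ⟨fun ⟨⟨g, h⟩, hgh⟩ => ?_, fun ⟨⟨g, h⟩, hgh⟩ => ?_⟩
  · exact ⟨(hasQuadraticVariation_of_mem_dualPairsPlus hab.le hp1 hp2 hgh).isBracket.doleansDefined
      hab.le, isForwardSolution_doleansForward hab.le hp1 hp2 hgh,
      fun F hF => hF.eqOn_doleansForward hab.le hp1 hp2 hgh⟩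
  · exact ⟨(hasQuadraticVariation_of_mem_dualPairsMinus hab.le hp1 hp2 hgh).isBracket.doleansDefined
      hab.le, isBackwardSolution_doleansBackward hab.le hp1 hp2 hgh,
      fun G hG => hG.eqOn_doleansBackward hab.le hp1 hp2 hgh⟩

end
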